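/- **Setting.** Let $\Lambda>0$, $h_2<h_1$, $\Delta h_1,\Delta h_2>0$, and let the cavity $\Omega_c\subset\mathbb R^2$ be an open set with Lipschitz boundary $\Gamma_c$ whose closure is contained in $R=(0,\Lambda)\times(h_2,h_1)$. Put $$\Omega^{\rm PML}=\big((0,\Lambda)\times(h_2-\Delta h_2,\,h_1+\Delta h_1)\big)\setminus\overline{\Omega_c},\qquad \Gamma_1^{\rm PML}=(0,\Lambda)\times\{h_1+\Delta h_1\},\qquad \Gamma_2^{\rm PML}=(0,\Lambda)\times\{h_2-\Delta h_2\}.$$ Let $m>3$ be real, let $\sigma_1,\sigma_2>0$, and define $\sigma:\mathbb R\to\mathbb C$ by $\sigma(t)=1$ for $h_2\le t\le h_1$, $\sigma(t)=1+(\sigma_1+{\rm i}\sigma_2)\big(\frac{t-h_1}{\Delta h_1}\big)^m$ for $t>h_1$, and $\sigma(t)=1+(\sigma_1+{\rm i}\sigma_2)\big(\frac{h_2-t}{\Delta h_2}\big)^m$ for $t<h_2$. Fix an incident angle $\theta\in(-\frac\pi2,\frac\pi2)$. For a wavenumber $\kappa>0$ put $\alpha=\kappa\sin\theta$, $\beta=\kappa\cos\theta$,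 $u^i(x)=e^{{\rm i}(\alpha x_1-\beta x_2)}$, and $$f=\tilde\Delta^2u^i-\kappa^4u^i\ \text{ for } x_2>h_1,\qquad f=0\ \text{ for } x_2\le h_1,\qquad \tilde\Delta=\frac{\partial^2}{\partial x_1^2}+\frac1\sigma\frac{\partial}{\partial x_2}\Big(\frac1\sigma\frac{\partial}{\partial x_2}\Big),\quad \sigma=\sigma(x_2).$$ Let $H^2_{\rm qp}(\Omega^{\rm PML})$ be the space of ($\alpha$-)quasi-periodic functions in $H^2(\Omega^{\rm PML})$, i.e. the closure in $H^2(\Omega^{\rm PML})$ of the smooth functions $\psi$ on $\mathbb R^2$ with $\psi(x_1+\Lambda,x_2)=e^{{\rm i}\alpha\Lambda}\psi(x_1,x_2)$. Boundary conditions "$u=g$, $\partial_\nu u=\partial_\nu g$ on $S$" mean that $u$ is an $H^2$-limit of such $\psi$ that agree with $g$ to first order on $S$. Let $H^2_{{\rm qp},0}(\Omega^{\rm PML})$ be the set of $u\in H^2_{\rm qp}(\Omega^{\rm PML})$ with $u=0$, $\partial_\nu u=0$ on $\Gamma_c$ and on $\Gamma_2^{\rm PML}$, and $H^2_{{\rm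 qp},00}(\Omega^{\rm PML})$ the set of those that satisfy $u=0$, $\partial_\nu u=0$ on $\Gamma_1^{\rm PML}$ as well. For $\mu\in(0,1)$ (the Poisson ratio) let $$a^{\rm PML}(u,v)=\int_{\Omega^{\rm PML}}\Big[\sigma\,\partial_1^2u\,\partial_1^2\bar v+\mu\,\partial_2\big(\tfrac1\sigma\partial_2u\big)\partial_1^2\bar v+\tfrac{2-2\mu}{\sigma}\,\partial_1\partial_2u\,\partial_1\partial_2\bar v+\tfrac1\sigma\,\partial_2\big(\tfrac1\sigma\partial_2u\big)\,\partial_2\big(\tfrac1\sigma\partial_2\bar v\big)+\mu\,\partial_1^2u\,\partial_2\big(\tfrac1\sigma\partial_2\bar v\big)-\kappa^4\sigma u\bar v\Big]{\rm d}x .$$ A weak solution of the PML problem with wavenumber $\kappa$ is a function $u\in H^2_{{\rm qp},0}(\Omega^{\rm PML})$ with $u=u^i$, $\partial_\nu u=\partial_\nu u^i$ on $\Gamma_1^{\rm PML}$ and $$a^{\rm PML}(u,v)=\int_{\Omega^{\rm PML}}\sigma f\,\bar v\,{\rm d}x\qquad\text{for all } v\in H^2_{{\rm qp},00}(\Omega^{\rm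 PML}).$$ **Theorem.** For any $\mu\in(0,1)$, if $m>3$ and $$1+\sigma_1>\sqrt{\frac{3+\mu}{1-\mu}}\;\sigma_2,$$ then there is a closed discrete set $E\subset\mathbb R$, $E\subset(0,\infty)$, such that for every $\kappa>0$ with $\kappa\notin E$ the PML problem with wavenumber $\kappa$ has exactly one weak solution. -/

import Mathlib

open MeasureTheory Filter Topology
open scoped ContDiff ENNReal ComplexConjugate

noncomputable section

namespace BiharmonicPML

/-- The boundary of `U ⊆ ℝ²` is Lipschitz: near each boundary point, after a rotation of the
coordinates, `U` is the region lying on one side of the graph of a Lipschitz function. -/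
def HasLipschitzBoundary (U : Set (ℝ × ℝ)) : Prop :=
  ∀ p ∈ frontier U, ∃ (φ : ℝ) (γ : ℝ → ℝ), (∃ K, LipschitzWith K γ) ∧
    ∀ᶠ x : ℝ × ℝ in 𝓝 p,
      (x ∈ U ↔ -Real.sin φ * x.1 + Real.cos φ * x.2 < γ (Real.cos φ * x.1 + Real.sin φ * x.2))

/-! ### The Sobolev space `H²(D)` -/

/-- `g` is the weak derivative of `u` on the open set `D` in the direction `e`. -/
def IsWeakDeriv (D : Set (ℝ × ℝ)) (e : ℝ × ℝ) (u g : ℝ × ℝ → ℂ) : Prop :=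
  ∀ φ : ℝ × ℝ → ℂ, ContDiff ℝ ∞ φ → HasCompactSupport φ → tsupport φ ⊆ D →
    ∫ x in D, u x * fderiv ℝ φ x e = -∫ x in D, g x * φ x

/-- The Sobolev space `H²(D)` of an open set `D ⊆ ℝ²`: an `L²` function together with its
(uniquely determined) weak derivatives up to order two, all of them in `L²(D)`. -/
@[ext]
structure H2 (D : Set (ℝ × ℝ)) where
  /-- the function -/
  val : Lp ℂ 2 (volume.restrict D)
  /-- `∂u/∂x₁` -/
  d1 : Lp ℂ 2 (volume.restrict D)
  /-- `∂u/∂x₂` -/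
  d2 : Lp ℂ 2 (volume.restrict D)
  /-- `∂²u/∂x₁²` -/
  d11 : Lp ℂ 2 (volume.restrict D)
  /-- `∂²u/∂x₁∂x₂` -/
  d12 : Lp ℂ 2 (volume.restrict D)
  /-- `∂²u/∂x₂²` -/
  d22 : Lp ℂ 2 (volume.restrict D)
  weak_d1 : IsWeakDeriv D (1, 0) val d1
  weak_d2 : IsWeakDeriv D (0, 1) val d2
  weak_d11 : IsWeakDeriv D (1, 0) d1 d11
  weak_d12 : IsWeakDeriv D (0, 1) d1 d12
  weak_d22 : IsWeakDeriv D (0, 1) d2 d22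

/-- The classical directional derivative, as a function. -/
def pd (e : ℝ × ℝ) (ψ : ℝ × ℝ → ℂ) : ℝ × ℝ → ℂ := fun x => fderiv ℝ ψ x e

/-- The distance in `H²(D)` between a smooth function `ψ` and an element `u`, as the sum of the
`L²(D)` distances of the function and of its derivatives up to order two. -/
def H2.distSmooth {D : Set (ℝ × ℝ)} (ψ : ℝ × ℝ → ℂ) (u : H2 D) : ℝ≥0∞ :=
  eLpNorm (fun x => ψ x - u.val x) 2 (volume.restrict D)
  + eLpNorm (fun x => pd (1, 0) ψ x - u.d1 x) 2 (volume.restrict D)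
  + eLpNorm (fun x => pd (0, 1) ψ x - u.d2 x) 2 (volume.restrict D)
  + eLpNorm (fun x => pd (1, 0) (pd (1, 0) ψ) x - u.d11 x) 2 (volume.restrict D)
  + eLpNorm (fun x => pd (0, 1) (pd (1, 0) ψ) x - u.d12 x) 2 (volume.restrict D)
  + eLpNorm (fun x => pd (0, 1) (pd (0, 1) ψ) x - u.d22 x) 2 (volume.restrict D)

/-- `ψ(x) e^{-iαx₁}` is periodic in `x₁` with period `Λ`. -/
def QuasiPeriodic (Λ α : ℝ) (ψ : ℝ × ℝ → ℂ) : Prop :=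
  ∀ x : ℝ × ℝ, ψ (x.1 + Λ, x.2) = Complex.exp (Complex.I * (α * Λ : ℝ)) * ψ x

/-- The quasi-periodic space `H²_qp(D)`: the closure in `H²(D)` of the smooth quasi-periodic
functions. -/
def H2qp (D : Set (ℝ × ℝ)) (Λ α : ℝ) : Set (H2 D) :=
  {u | ∃ ψ : ℕ → ℝ × ℝ → ℂ, (∀ n, ContDiff ℝ ∞ (ψ n) ∧ QuasiPeriodic Λ α (ψ n)) ∧
    Tendsto (fun n => u.distSmooth (ψ n)) atTop (𝓝 0)}

/-- The boundary condition `u = g`, `∂_ν u = ∂_ν g` on `S`, for a quasi-periodic `u ∈ H²(D)`, a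
smooth `g` and a part `S` of the boundary of `D`: `u` is the limit in `H²(D)` of smooth
quasi-periodic functions that agree with `g` on `S` together with their first derivatives.
(Tangential derivatives agree as soon as the functions agree on `S`, so that only the normal one is
an additional condition.) -/
def HasCauchyData {D : Set (ℝ × ℝ)} (Λ α : ℝ) (u : H2 D) (S : Set (ℝ × ℝ))
    (g : ℝ × ℝ → ℂ) : Prop :=
  ∃ ψ : ℕ → ℝ × ℝ → ℂ, (∀ n, ContDiff ℝ ∞ (ψ n) ∧ QuasiPeriodic Λ α (ψ n) ∧
      ∀ x ∈ S, ψ n x = g x ∧ fderiv ℝ (ψ n) x = fderiv ℝ g x) ∧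
    Tendsto (fun n => u.distSmooth (ψ n)) atTop (𝓝 0)

/-! ### The truncated problem -/

/-- The data of the truncated problem, except for the wavenumber. -/
structure Setup where
  /-- the period -/
  Λ : ℝ
  /-- height of the upper interface -/
  h₁ : ℝ
  /-- height of the lower interface -/
  h₂ : ℝ
  /-- thickness of the upper layer -/
  Δh₁ : ℝ
  /-- thickness of the lower layer -/
  Δh₂ : ℝ
  /-- the cavity in the unit cell -/
  cavity : Set (ℝ × ℝ)
  /-- the incident angle -/
  θ : ℝ
  /-- the Poisson ratio -/
  μ : ℝ
  /-- real strength of the stretching -/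
  σ₁ : ℝ
  /-- imaginary strength of the stretching -/
  σ₂ : ℝ
  /-- order of the stretching -/
  m : ℝ

namespace Setup

variable (P : Setup)

/-- The rectangle `R` between the two interfaces. -/
def rect : Set (ℝ × ℝ) := Set.Ioo 0 P.Λ ×ˢ Set.Ioo P.h₂ P.h₁

/-- The computational domain: the rectangle `R` extended by the two layers, without the closed
cavity. -/
def domain : Set (ℝ × ℝ) :=
  (Set.Ioo 0 P.Λ ×ˢ Set.Ioo (P.h₂ - P.Δh₂) (P.h₁ + P.Δh₁)) \ closure P.cavity

/-- The boundary of the cavity. -/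
def Γc : Set (ℝ × ℝ) := frontier P.cavity

/-- The outer boundary of the upper layer. -/
def Γ₁ : Set (ℝ × ℝ) := Set.Ioo 0 P.Λ ×ˢ {P.h₁ + P.Δh₁}

/-- The outer boundary of the lower layer. -/
def Γ₂ : Set (ℝ × ℝ) := Set.Ioo 0 P.Λ ×ˢ {P.h₂ - P.Δh₂}

/-- The complex stretching `σ`. -/
def σ (t : ℝ) : ℂ :=
  if P.h₁ < t then
    1 + P.σ₁ * (((t - P.h₁) / P.Δh₁) ^ P.m : ℝ) +
      Complex.I * P.σ₂ * (((t - P.h₁) / P.Δh₁) ^ P.m : ℝ)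
  else if t < P.h₂ then
    1 + P.σ₁ * (((P.h₂ - t) / P.Δh₂) ^ P.m : ℝ) +
      Complex.I * P.σ₂ * (((P.h₂ - t) / P.Δh₂) ^ P.m : ℝ)
  else 1

/-- `α = κ sin θ` -/
def α (κ : ℝ) : ℝ := κ * Real.sin P.θ

/-- `β = κ cos θ` -/
def β (κ : ℝ) : ℝ := κ * Real.cos P.θ

/-- The incident plane wave `e^{i(αx₁ - βx₂)}`. -/
def uinc (κ : ℝ) (x : ℝ × ℝ) : ℂ :=
  Complex.exp (Complex.I * (P.α κ * x.1 - P.β κ * x.2 : ℝ))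

/-- The stretched derivative `(1/σ) ∂/∂x₂`. -/
def stretchedD2 (g : ℝ × ℝ → ℂ) (x : ℝ × ℝ) : ℂ :=
  (P.σ x.2)⁻¹ * deriv (fun t => g (x.1, t)) x.2

/-- The Laplacian in the stretched coordinates,
`∂²/∂x₁² + (1/σ) ∂/∂x₂ ((1/σ) ∂/∂x₂)`. -/
def stretchedLaplacian (g : ℝ × ℝ → ℂ) (x : ℝ × ℝ) : ℂ :=
  deriv (deriv (fun s => g (s, x.2))) x.1 + P.stretchedD2 (P.stretchedD2 g) x

/-- The source term: the stretched biharmonic wave operator applied to the incident wave in the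
upper layer, and zero elsewhere. -/
def source (κ : ℝ) (x : ℝ × ℝ) : ℂ :=
  if P.h₁ < x.2 then
    P.stretchedLaplacian (P.stretchedLaplacian (P.uinc κ)) x - κ ^ 4 * P.uinc κ x
  else 0

/-- The derivative `∂/∂x₂ ((1/σ) w)` at a point of height `t`, by the product rule, where `w` and
`dw` are the values of a function and of its (weak) derivative in the direction `x₂`. -/
def D2InvSigma (t : ℝ) (w dw : ℂ) : ℂ :=
  (P.σ t)⁻¹ * dw + deriv (fun s => (P.σ s)⁻¹) t * w

/-- The sesquilinear form of the truncated problem. -/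
def form (κ : ℝ) (u v : H2 P.domain) : ℂ :=
  ∫ x in P.domain,
    (P.σ x.2 * u.d11 x * conj (v.d11 x)
      + P.μ * P.D2InvSigma x.2 (u.d2 x) (u.d22 x) * conj (v.d11 x)
      + (2 - 2 * P.μ) / P.σ x.2 * conj (v.d12 x) * u.d12 x
      + 1 / P.σ x.2 * P.D2InvSigma x.2 (u.d2 x) (u.d22 x)
          * P.D2InvSigma x.2 (conj (v.d2 x)) (conj (v.d22 x))
      + P.μ * u.d11 x * P.D2InvSigma x.2 (conj (v.d2 x)) (conj (v.d22 x))
      - κ ^ 4 * P.σ x.2 * u.val x * conj (v.val x))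

/-- Quasi-periodic `H²` functions that are clamped on the cavity. -/
def H2qpΓc (κ : ℝ) : Set (H2 P.domain) :=
  {u | u ∈ H2qp P.domain P.Λ (P.α κ) ∧ HasCauchyData P.Λ (P.α κ) u P.Γc 0}

/-- Quasi-periodic `H²` functions that are clamped on the cavity and on the lower outer boundary. -/
def H2qp0 (κ : ℝ) : Set (H2 P.domain) :=
  {u | u ∈ P.H2qpΓc κ ∧ HasCauchyData P.Λ (P.α κ) u P.Γ₂ 0}

/-- Quasi-periodic `H²` functions that are clamped on the cavity and on both outer boundaries. -/
def H2qp00 (κ : ℝ) : Set (H2 P.domain) :=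
  {u | u ∈ P.H2qpΓc κ ∧ HasCauchyData P.Λ (P.α κ) u P.Γ₂ 0 ∧ HasCauchyData P.Λ (P.α κ) u P.Γ₁ 0}

/-- `u` is a weak solution of the truncated problem with wavenumber `κ`. -/
def IsWeakSolution (κ : ℝ) (u : H2 P.domain) : Prop :=
  u ∈ P.H2qp0 κ ∧ HasCauchyData P.Λ (P.α κ) u P.Γ₁ (P.uinc κ) ∧
    ∀ v ∈ P.H2qp00 κ,
      P.form κ u v = ∫ x in P.domain, P.σ x.2 * P.source κ x * conj (v.val x)

end Setup

end BiharmonicPML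

end

/-! ### Compact operators and polynomial operator pencils -/

/-! Multiplication by exp(-iαx₁) turns α-quasi-periodic functions into periodic ones and ∂₁ into ∂₁
+ iα. Thus all wavenumbers share one Hilbert space `V₀`: the closure of the jets (function and
derivatives up to order two, in L²) of smooth periodic functions clamped on the cavity and on both
outer boundaries. Once the incident wave is lifted by a cutoff, the PML problem at κ is the equation
`opB κ w = rhs κ` in `V₀` (`isWeakSolution_iff`). Since α = κ sin θ, the operator `opB κ` is a
polynomial of degree four in κ, and it makes sense for complex κ.

Fredholm structure. The condition on σ₁, σ₂ is what a completed square needs for the real part of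
the principal part to be coercive in the second derivatives (`principal_part_ge`). The components of
order zero and one are compact on `V₀`: clamped functions extend by zero into the cavity, so a
Poincaré inequality on small boxes gives Rellich's theorem directly (`isCompactOperator_component`).
Hence `opB κ` = C + Σ κʲ Kⱼ with C invertible and all Kⱼ compact (`exists_pencil`). If such a pencil
is injective at one point κ₀, it is singular at only finitely many points of each disc: expand about
κ₀ and pass to the companion operator, whose fourth power is compact, so that the singular points
correspond to eigenvalues bounded away from zero (`finite_singular_of_injective`). Wherever the
pencil is injective it is invertible. The exceptional set is therefore locally finite, and it
remains to find one κ₀.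

Injectivity at one point. The point is sought off the real axis, κ₀ = k(1 + iδ) with δ small and k
large. The form is tested with Hψ, where H is a smooth approximation of conj((3δ + i)/σ): this
removes the factor σ and rotates the form by 3δ + i. The terms with the Poisson ratio are a null
Lagrangian and cancel up to derivatives of the coefficients (`mainForm_eq`). In the real part of the
rest, the rotation gives 3δ to the second derivatives, while 3δ - 4δ = -δ in front of κ₀⁴ makes the
term of order zero positive. The imaginary part of α contributes cross terms of the same order in δ.
The resulting quadratic form is affine in |sin θ|: it is positive definite at 0, and at 1 it is a
sum of squares up to terms that integrate to lower order (`firstOrder_ge`). As |sin θ| < 1, it is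
coercive after integration. In the layers the argument of σ lies between 0 and π/6, which only helps
(`stretch_rotation_bounds`).

The errors are of three kinds: terms quadratic in δ, the approximation error of H, and terms in
which a derivative falls on a coefficient and which are a factor 1/k smaller in the k-weighted norm.
They are absorbed by choosing δ, then the accuracy of H, then k (`core_estimate`,
`exists_multiplier`). -/

namespace IsCompactOperator

/-- The eigenvalues of a compact operator that are bounded away from zero are finite in number. -/
theorem finite_hasEigenvalue {X : Type*} [NormedAddCommGroup X] [NormedSpace ℂ X]
    {T : X →L[ℂ] X} (hT : IsCompactOperator T) {ε : ℝ} (hε : 0 < ε) :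
    {l : ℂ | ε ≤ ‖l‖ ∧ Module.End.HasEigenvalue (T : Module.End ℂ X) l}.Finite := by
  by_contra hinf
  have hinf : Set.Infinite _ := hinf
  let l : ℕ → ℂ := fun n => (Set.Infinite.natEmbedding _ hinf n : ℂ)
  have hl_inj : Function.Injective l := fun a b h =>
    (Set.Infinite.natEmbedding _ hinf).injective (Subtype.ext h)
  have hl (n : ℕ) : ε ≤ ‖l n‖ ∧ Module.End.HasEigenvalue (T : Module.End ℂ X) (l n) :=
    (Set.Infinite.natEmbedding _ hinf n).2
  choose e he using fun n => (hl n).2.exists_hasEigenvector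
  have hli : LinearIndependent ℂ e :=
    Module.End.eigenvectors_linearIndependent' (T : Module.End ℂ X) l hl_inj e he
  -- Riesz's argument: infinitely many such eigenvalues give a strictly increasing chain of
  -- invariant subspaces `Y n`, along which T maps a bounded sequence to one whose members keep
  -- mutual distance at least ε.
  let Y : ℕ → Submodule ℂ X := fun n => Submodule.span ℂ (e '' Set.Iio n)
  have hYfin (n : ℕ) : FiniteDimensional ℂ (Y n) :=
    FiniteDimensional.span_of_finite ℂ ((Set.finite_Iio n).image e)
  have hYmono : Monotone Y := fun a b hab =>
    Submodule.span_mono (Set.image_mono (Set.Iio_subset_Iio hab))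
  have hTe (n : ℕ) : T (e n) = l n • e n := (he n).apply_eq_smul
  have hYT (n : ℕ) : ∀ y ∈ Y n, T y ∈ Y n := by
    intro y hy
    refine Submodule.span_induction ?_ ?_ ?_ ?_ hy
    · rintro _ ⟨i, hi, rfl⟩
      rw [hTe]
      exact Submodule.smul_mem _ _ (Submodule.subset_span ⟨i, hi, rfl⟩)
    · simp
    · intro a b _ _ ha hb
      rw [map_add]
      exact add_mem ha hb
    · intro c a _ ha
      rw [map_smul]
      exact Submodule.smul_mem _ _ ha
  -- T minus its n-th eigenvalue kills the last eigenvector, so it lowers `Y (n + 1)` into `Y n`.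
  have hYT' (n : ℕ) : ∀ y ∈ Y (n + 1), T y - l n • y ∈ Y n := by
    intro y hy
    refine Submodule.span_induction ?_ ?_ ?_ ?_ hy
    · rintro _ ⟨i, hi, rfl⟩
      rw [hTe, ← sub_smul]
      rcases Nat.lt_succ_iff_lt_or_eq.mp hi with h | h
      · exact Submodule.smul_mem _ _ (Submodule.subset_span ⟨i, h, rfl⟩)
      · simp [h]
    · simp
    · intro a b _ _ ha hb
      have : T (a + b) - l n • (a + b) = (T a - l n • a) + (T b - l n • b) := by
        rw [map_add, smul_add]; abel
      rw [this]
      exact add_mem ha hb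
    · intro c a _ ha
      have : T (c • a) - l n • c • a = c • (T a - l n • a) := by
        rw [map_smul, smul_sub, smul_comm]
      rw [this]
      exact Submodule.smul_mem _ _ ha
  have hR : ∀ n, ∃ x ∈ Y (n + 1), ‖x‖ ≤ 3 ∧ ∀ y ∈ Y n, 1 ≤ ‖x - y‖ := by
    intro n
    have h₁ : IsClosed ((Y n).comap (Y (n + 1)).subtype : Set (Y (n + 1))) :=
      (Y n).closed_of_finiteDimensional.preimage continuous_subtype_val
    have h₂ : ∃ x : Y (n + 1), x ∉ (Y n).comap (Y (n + 1)).subtype := by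
      refine ⟨⟨e n, Submodule.subset_span ⟨n, Nat.lt_succ_self n, rfl⟩⟩, ?_⟩
      simpa [Y] using hli.notMem_span_image (s := Set.Iio n) (x := n) (by simp)
    obtain ⟨x, hx, hxy⟩ := riesz_lemma_of_norm_lt (𝕜 := ℂ) (c := 2) (R := 3)
      (by norm_num) (by norm_num) h₁ h₂
    exact ⟨x, x.2, hx, fun y hy => hxy ⟨y, hYmono n.le_succ hy⟩ hy⟩
  choose x hxY hx3 hxd using hR
  have hsep : ∀ m n, m < n → ε ≤ ‖T (x n) - T (x m)‖ := by
    intro m n hmn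
    have hl0 : l n ≠ 0 := fun h => by have := (hl n).1; rw [h, norm_zero] at this; linarith
    have hy : T (x n) - l n • x n - T (x m) ∈ Y n :=
      sub_mem (hYT' n _ (hxY n)) (hYmono (Nat.succ_le_of_lt hmn) (hYT _ _ (hxY m)))
    have h1 := hxd n _ (Submodule.smul_mem _ (-(l n)⁻¹) hy)
    -- The difference is `l n` times the difference of `x n` and an element of `Y n`, and the latter
    -- has norm at least 1 by the choice of `x n`.
    have h2 : T (x n) - T (x m)
        = l n • (x n - (-(l n)⁻¹) • (T (x n) - l n • x n - T (x m))) := by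
      rw [smul_sub, neg_smul, smul_neg, smul_inv_smul₀ hl0]; abel
    rw [h2, norm_smul]
    nlinarith [(hl n).1, norm_nonneg (l n)]
  obtain ⟨K, hK, hK'⟩ := hT.image_closedBall_subset_compact 3
  obtain ⟨y, -, φ, hφ, hφy⟩ := hK.tendsto_subseq (fun n => hK' ⟨x n, by simp [hx3], rfl⟩)
  have hc := hφy.cauchySeq
  rw [Metric.cauchySeq_iff'] at hc
  obtain ⟨N, hN⟩ := hc ε hε
  have h1 := hN (N + 1) N.le_succ
  rw [dist_eq_norm] at h1
  exact absurd (hsep (φ N) (φ (N + 1)) (hφ N.lt_succ_self)) (not_le.mpr h1)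

/-- An injective compact perturbation of an invertible operator is invertible. -/
theorem isUnit_add_of_injective {X : Type*} [NormedAddCommGroup X] [NormedSpace ℂ X]
    [CompleteSpace X] {A K : X →L[ℂ] X} (hA : IsUnit A) (hK : IsCompactOperator K)
    (hinj : ∀ x, A x + K x = 0 → x = 0) : IsUnit (A + K) := by
  obtain ⟨u, rfl⟩ := hA
  have hT : IsCompactOperator (((u⁻¹ : (X →L[ℂ] X)ˣ) : X →L[ℂ] X) * K : X →L[ℂ] X) :=
    hK.clm_comp ((u⁻¹ : (X →L[ℂ] X)ˣ) : X →L[ℂ] X)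
  -- The factorisation A + K = -A(-1 - A⁻¹K) reduces the claim to the Fredholm alternative for the
  -- compact operator A⁻¹K at -1.
  have hfac : (u : X →L[ℂ] X) + K
      = -(u * (algebraMap ℂ (X →L[ℂ] X) (-1) - ((u⁻¹ : (X →L[ℂ] X)ˣ) : X →L[ℂ] X) * K)) := by
    rw [mul_sub, ← mul_assoc, Units.mul_inv, map_neg, map_one, one_mul, mul_neg, mul_one]
    abel
  rcases hT.hasEigenvalue_or_mem_resolventSet (μ := -1) (by norm_num) with h | h
  · obtain ⟨x, hx⟩ := h.exists_hasEigenvector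
    have h1 : ((u⁻¹ : (X →L[ℂ] X)ˣ) : X →L[ℂ] X) (K x) = (-1 : ℂ) • x := hx.apply_eq_smul
    have h2 := congrArg (u : X →L[ℂ] X) h1
    rw [← mul_apply_eq_comp, Units.mul_inv] at h2
    refine absurd (hinj x ?_) hx.2
    have h3 : K x = (u : X →L[ℂ] X) ((-1 : ℂ) • x) := h2
    rw [h3, map_smul]; simp
  · rw [hfac]
    exact (u.isUnit.mul h).neg

/-- The adjoint of a compact operator between Hilbert spaces is compact. -/
theorem adjoint {H K : Type*} [NormedAddCommGroup H] [InnerProductSpace ℂ H] [CompleteSpace H]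
    [NormedAddCommGroup K] [InnerProductSpace ℂ K] [CompleteSpace K] {T : H →L[ℂ] K}
    (hT : IsCompactOperator T) : IsCompactOperator (ContinuousLinearMap.adjoint T) := by
  set S := ContinuousLinearMap.adjoint T with hS
  have hTS : IsCompactOperator (T ∘L S) := hT.comp_clm S
  refine (isCompactOperator_iff_isCompact_closure_image_closedBall (𝕜₁ := ℂ) (S : K →ₗ[ℂ] H)
    zero_lt_one).mpr ?_
  obtain ⟨C, hC, hC'⟩ := hTS.image_closedBall_subset_compact 1
  refine isCompact_iff_totallyBounded_isComplete.mpr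
    ⟨TotallyBounded.closure ?_, isClosed_closure.isComplete⟩
  rw [Metric.totallyBounded_iff]
  intro ε hε
  -- Since ‖Sy‖² = ⟨y, TSy⟩, a net for the image of the ball under TS yields one for its image under
  -- S. Differences of points of the unit ball have norm at most 2, so accuracy ε²/2 for TS
  -- suffices.
  obtain ⟨t, ht, htf, hcov⟩ := Metric.finite_approx_of_totallyBounded
    (hC.totallyBounded.subset hC') (ε ^ 2 / 2) (by positivity)
  have ht' : ∀ y ∈ t, ∃ z : K, z ∈ Metric.closedBall (0 : K) 1 ∧ T (S z) = y := fun y hy => ht hy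
  choose! z hz hzt using ht'
  refine ⟨(fun y => S (z y)) '' t, htf.image _, ?_⟩
  rintro _ ⟨x, hx, rfl⟩
  obtain ⟨y, hy, hxy⟩ := Set.mem_iUnion₂.mp (hcov ⟨x, hx, rfl⟩)
  refine Set.mem_iUnion₂.mpr ⟨_, ⟨y, hy, rfl⟩, ?_⟩
  rw [Metric.mem_ball, dist_eq_norm, ← hzt y hy] at hxy
  rw [Metric.mem_ball, dist_eq_norm]
  have h1 : ‖T (S (x - z y))‖ < ε ^ 2 / 2 := by simpa using hxy
  have h2 : ‖S (x - z y)‖ ^ 2 ≤ ‖T (S (x - z y))‖ * ‖x - z y‖ := by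
    rw [← inner_self_eq_norm_sq (𝕜 := ℂ)]
    conv_lhs => rw [hS, ContinuousLinearMap.adjoint_inner_right]
    exact (RCLike.re_le_norm _).trans (norm_inner_le_norm _ _)
  have h3 : ‖x - z y‖ ≤ 2 := by
    have h4 : ‖x‖ ≤ 1 := by simpa using hx
    have h5 : ‖z y‖ ≤ 1 := by simpa using hz y hy
    exact (norm_sub_le _ _).trans (by linarith)
  have h6 : ‖S (x - z y)‖ < ε := by
    nlinarith [norm_nonneg (S (x - z y)), norm_nonneg (T (S (x - z y))), norm_nonneg (x - z y)]
  simpa using h6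

end IsCompactOperator

/-- The companion operator of the pencil `1 + ζ L₁ + ζ² L₂ + ζ³ L₃ + ζ⁴ L₄`. -/
noncomputable def companion {X : Type*} [NormedAddCommGroup X] [NormedSpace ℂ X]
    (L : Fin 4 → X →L[ℂ] X) : (Fin 4 → X) →L[ℂ] (Fin 4 → X) :=
  ContinuousLinearMap.pi ![-∑ j, L j ∘L ContinuousLinearMap.proj j, ContinuousLinearMap.proj 0,
    ContinuousLinearMap.proj 1, ContinuousLinearMap.proj 2]

/-- The companion operator is the shift, which is nilpotent of order four, plus an operator built
from the compact coefficients. Powers of the sum differ from powers of the shift by compact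
operators, so the fourth power is compact although the companion operator itself need not be. -/
theorem isCompactOperator_companion_pow {X : Type*} [NormedAddCommGroup X] [NormedSpace ℂ X]
    {L : Fin 4 → X →L[ℂ] X} (hL : ∀ j, IsCompactOperator (L j)) :
    IsCompactOperator (companion L ^ 4 : (Fin 4 → X) →L[ℂ] (Fin 4 → X)) := by
  set N : (Fin 4 → X) →L[ℂ] (Fin 4 → X) := companion 0 with hN
  set K : (Fin 4 → X) →L[ℂ] (Fin 4 → X) :=
    ContinuousLinearMap.single ℂ (fun _ : Fin 4 => X) 0 ∘L
      (-∑ j, L j ∘L ContinuousLinearMap.proj j) with hK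
  have hNK : companion L = N + K := by
    ext v i
    fin_cases i <;> simp [hN, hK, companion]
  have hN4 : N ^ 4 = 0 := by
    ext v i
    fin_cases i <;> simp [hN, companion, pow_succ]
  have hKc : IsCompactOperator K := by
    have h : ∀ s : Finset (Fin 4), IsCompactOperator
        (∑ j ∈ s, L j ∘L ContinuousLinearMap.proj j : (Fin 4 → X) →L[ℂ] X) := by
      intro s
      induction s using Finset.induction_on with
      | empty => simpa using isCompactOperator_zero
      | insert a s ha ih =>
        rw [Finset.sum_insert ha]
        exact ((hL a).comp_clm _).add ih
    have h' := (h Finset.univ).neg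
    exact h'.clm_comp (ContinuousLinearMap.single ℂ (fun _ : Fin 4 => X) 0)
  have hstep : ∀ n : ℕ, IsCompactOperator (companion L ^ n - N ^ n : _ →L[ℂ] _) := by
    intro n
    induction n with
    | zero => simpa using isCompactOperator_zero
    | succ n ih =>
      have : companion L ^ (n + 1) - N ^ (n + 1)
          = companion L ^ n * K + (companion L ^ n - N ^ n) * N := by
        rw [pow_succ, pow_succ, sub_mul]
        nth_rewrite 2 [hNK]
        rw [mul_add]; abel
      rw [this]
      exact (hKc.clm_comp (companion L ^ n)).add (ih.comp_clm N)
  simpa [hN4] using hstep 4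

/-- A polynomial pencil `A₀ + ζ A₁ + ζ² A₂ + ζ³ A₃ + ζ⁴ A₄` with `A₀` invertible and the other
coefficients compact is singular at only finitely many points of each disc. -/
theorem finite_singular_pencil {X : Type*} [NormedAddCommGroup X] [NormedSpace ℂ X]
    {A₀ : X →L[ℂ] X} (hA : IsUnit A₀) {L : Fin 4 → X →L[ℂ] X}
    (hL : ∀ j, IsCompactOperator (L j)) (R : ℝ) :
    {ζ : ℂ | ‖ζ‖ ≤ R ∧ ∃ u, u ≠ 0 ∧ A₀ u + ∑ j : Fin 4, ζ ^ (j + 1 : ℕ) • L j u = 0}.Finite := by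
  obtain ⟨A, rfl⟩ := hA
  set M : Fin 4 → X →L[ℂ] X := fun j => ((A⁻¹ : (X →L[ℂ] X)ˣ) : X →L[ℂ] X) ∘L L j with hM
  have hMc : ∀ j, IsCompactOperator (M j) := fun j => (hL j).clm_comp _
  have hT := isCompactOperator_companion_pow hMc
  -- A singular ζ makes ζ⁻¹ an eigenvalue of the companion operator and ζ⁻⁴ one of its fourth power,
  -- of modulus at least (|R| + 1)⁻⁴. The shift by 1 keeps the base positive for every real R. Each
  -- eigenvalue comes from at most four ζ.
  have hfin := hT.finite_hasEigenvalue (ε := ((|R| + 1) ^ 4)⁻¹) (by positivity)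
  have hfin2 : (⋃ l ∈ {l : ℂ | ((|R| + 1) ^ 4)⁻¹ ≤ ‖l‖ ∧ Module.End.HasEigenvalue
      ((companion M ^ 4 : (Fin 4 → X) →L[ℂ] (Fin 4 → X)) : Module.End ℂ (Fin 4 → X)) l},
      {ζ : ℂ | ζ ^ 4 = l⁻¹}).Finite := by
    refine hfin.biUnion fun l _ => ?_
    refine (Polynomial.nthRoots 4 l⁻¹).toFinset.finite_toSet.subset fun ζ hζ => ?_
    simpa [Polynomial.mem_nthRoots] using hζ
  refine hfin2.subset ?_
  rintro ζ ⟨hζR, u, hu, hζ⟩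
  have hζ0 : ζ ≠ 0 := by
    rintro rfl
    have h1 : (A : X →L[ℂ] X) u = 0 := by simpa using hζ
    have h2 := congrArg ((A⁻¹ : (X →L[ℂ] X)ˣ) : X →L[ℂ] X) h1
    rw [← mul_apply_eq_comp, Units.inv_mul] at h2
    exact hu (by simpa using h2)
  have hMu : u + ∑ j : Fin 4, ζ ^ (j + 1 : ℕ) • M j u = 0 := by
    have h2 := congrArg ((A⁻¹ : (X →L[ℂ] X)ˣ) : X →L[ℂ] X) hζ
    rw [map_add, ← mul_apply_eq_comp, Units.inv_mul, map_sum] at h2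
    simpa [hM] using h2
  refine Set.mem_iUnion₂.mpr ⟨(ζ ^ 4)⁻¹, ⟨?_, ?_⟩, by simp⟩
  · rw [norm_inv, norm_pow]
    have : ‖ζ‖ ≤ |R| + 1 := hζR.trans ((le_abs_self R).trans (by linarith))
    gcongr
  -- The eigenvector is (ζ⁻³u, ζ⁻²u, ζ⁻¹u, u): the shift rows hold by construction, and the first
  -- row is the pencil equation multiplied by ζ⁻⁴.
  · set U : Fin 4 → X := fun j => (ζ ^ (3 - j : ℕ))⁻¹ • u with hU
    have hev : companion M U = ζ⁻¹ • U := by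
      rw [Fin.sum_univ_four] at hMu
      have h3 : u = -(ζ • M 0 u + ζ ^ 2 • M 1 u + ζ ^ 3 • M 2 u + ζ ^ 4 • M 3 u) := by
        have := eq_neg_of_add_eq_zero_left hMu
        simpa using this
      ext i
      fin_cases i
      · have h4 : ζ⁻¹ • (ζ ^ 3)⁻¹ • u = (ζ ^ 4)⁻¹ • u := by
          rw [smul_smul, ← mul_inv]; congr 2; ring
        simp only [companion, hU, Fin.sum_univ_four]
        simp only [ContinuousLinearMap.coe_pi', Fin.zero_eta, Pi.smul_apply]
        simp only [Matrix.cons_val_zero, neg_apply,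
          add_apply, ContinuousLinearMap.comp_apply,
          ContinuousLinearMap.proj_apply, map_smul]
        norm_num
        rw [h4]
        conv_rhs => rw [h3]
        rw [smul_neg, neg_inj.symm, neg_neg]
        simp only [smul_add, smul_smul]
        have e1 : (ζ ^ 4)⁻¹ * ζ = (ζ ^ 3)⁻¹ := by field_simp
        have e2 : (ζ ^ 4)⁻¹ * ζ ^ 2 = (ζ ^ 2)⁻¹ := by field_simp
        have e3 : (ζ ^ 4)⁻¹ * ζ ^ 3 = ζ⁻¹ := by field_simp
        have e4 : (ζ ^ 4)⁻¹ * ζ ^ 4 = 1 := by field_simp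
        rw [e1, e2, e3, e4]
        simp
      · simp [companion, hU, smul_smul]
        rw [← mul_inv]; congr 2; ring
      · simp [companion, hU, smul_smul]
        rw [← mul_inv]; congr 2; ring
      · simp [companion, hU]
    have hpow : ∀ n : ℕ, (companion M ^ n : (Fin 4 → X) →L[ℂ] (Fin 4 → X)) U = (ζ ^ n)⁻¹ • U := by
      intro n
      induction n with
      | zero => simp
      | succ n ih =>
        rw [pow_succ, mul_apply_eq_comp, hev, map_smul, ih, smul_smul, pow_succ, mul_inv,
          mul_comm]
    refine Module.End.hasEigenvalue_of_hasEigenvector (x := U) ⟨?_, fun h => hu ?_⟩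
    · exact Module.End.mem_eigenspace_iff.mpr (hpow 4)
    · simpa [hU] using congrFun h 3

/-- A polynomial pencil of degree four, equal to an invertible operator up to compact ones, that is
injective at one point is singular at only finitely many points of each disc. -/
theorem finite_singular_of_injective {X : Type*} [NormedAddCommGroup X] [NormedSpace ℂ X]
    [CompleteSpace X] {C : X →L[ℂ] X} (hC : IsUnit C) {K : Fin 5 → X →L[ℂ] X}
    (hK : ∀ j, IsCompactOperator (K j)) {κ₀ : ℂ}
    (hinj : ∀ u, C u + ∑ j : Fin 5, κ₀ ^ (j : ℕ) • K j u = 0 → u = 0) (R : ℝ) :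
    {κ : ℂ | ‖κ‖ ≤ R ∧ ∃ u, u ≠ 0 ∧ C u + ∑ j : Fin 5, κ ^ (j : ℕ) • K j u = 0}.Finite := by
  set S : X →L[ℂ] X := ∑ j : Fin 5, κ₀ ^ (j : ℕ) • K j with hS
  have hSc : IsCompactOperator S := by
    have h1 : S = K 0 + κ₀ • K 1 + κ₀ ^ 2 • K 2 + κ₀ ^ 3 • K 3 + κ₀ ^ 4 • K 4 := by
      simp [hS, Fin.sum_univ_five]
    rw [h1]
    exact ((((hK 0).add ((hK 1).smul _)).add ((hK 2).smul _)).add ((hK 3).smul _)).add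
      ((hK 4).smul _)
  have hA : IsUnit (C + S) := IsCompactOperator.isUnit_add_of_injective hC hSc
    fun u hu => hinj u (by simpa [hS, sum_apply] using hu)
  -- Coefficients of the pencil re-expanded in powers of κ - κ₀. The constant term `C + S` has
  -- become invertible.
  set L : Fin 4 → X →L[ℂ] X := ![K 1 + (2 * κ₀) • K 2 + (3 * κ₀ ^ 2) • K 3 + (4 * κ₀ ^ 3) • K 4,
    K 2 + (3 * κ₀) • K 3 + (6 * κ₀ ^ 2) • K 4, K 3 + (4 * κ₀) • K 4, K 4] with hL
  have hLc : ∀ j, IsCompactOperator (L j) := by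
    intro j
    fin_cases j
    · exact (((hK 1).add ((hK 2).smul _)).add ((hK 3).smul _)).add ((hK 4).smul _)
    · exact ((hK 2).add ((hK 3).smul _)).add ((hK 4).smul _)
    · exact (hK 3).add ((hK 4).smul _)
    · exact hK 4
  have hfin := (finite_singular_pencil hA hLc (R + ‖κ₀‖)).image (fun ζ => κ₀ + ζ)
  refine hfin.subset ?_
  rintro κ ⟨hκ, u, hu, h⟩
  refine ⟨κ - κ₀, ⟨?_, u, hu, ?_⟩, by simp⟩
  · exact (norm_sub_le _ _).trans (by linarith)
  · rw [← h]
    simp only [hS, hL, Fin.sum_univ_four, Fin.sum_univ_five, add_apply]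
    simp
    module


/-! ### Functions vanishing on the boundary of a closed set, extended by zero -/

/-- Fundamental theorem of calculus for a `C¹` function vanishing on the boundary of a closed set
`F`, extended by zero into `F`. -/
theorem integral_indicator_compl_deriv {g g' : ℝ → ℂ} {F : Set ℝ} (hF : IsClosed F)
    (hg : ∀ x, HasDerivAt g (g' x) x) (hg' : Continuous g') (h0 : ∀ x ∈ frontier F, g x = 0)
    (a b : ℝ) :
    ∫ x in a..b, Fᶜ.indicator g' x = Fᶜ.indicator g b - Fᶜ.indicator g a := by
  have hgc : Continuous g := continuous_iff_continuousAt.mpr fun x => (hg x).continuousAt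
  have hcont : Continuous (Fᶜ.indicator g) :=
    continuous_indicator (fun x hx => h0 x (by rwa [frontier_compl] at hx)) hgc.continuousOn
  -- The extension by zero can fail to be differentiable only at a frontier point where g' ≠ 0, and
  -- such a point is isolated in the zero set of g. The right-isolated points of any set of reals
  -- are countable, and the fundamental theorem of calculus tolerates a countable exceptional set.
  -- Where g and g' both vanish, the extension is dominated by g and has derivative 0.
  set Z : Set ℝ := {x ∈ {y | g y = 0} | 𝓝[{y | g y = 0} ∩ Set.Ioi x] x = ⊥} with hZ
  have hZc : Z.Countable := countable_setOfPred_isolated_right_within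
  refine integral_eq_of_hasDerivAt_off_countable _ _ hZc hcont.continuousOn ?_ ?_
  · rintro x ⟨-, hx⟩
    by_cases hxF : x ∈ F
    · rw [Set.indicator_of_notMem (by simpa using hxF)]
      by_cases hxi : x ∈ interior F
      · have : Fᶜ.indicator g =ᶠ[𝓝 x] fun _ => 0 := by
          filter_upwards [mem_interior_iff_mem_nhds.mp hxi] with y hy
          exact Set.indicator_of_notMem (by simpa using hy) _
        exact (hasDerivAt_const x (0 : ℂ)).congr_of_eventuallyEq this
      · have hgx : g x = 0 := h0 x ⟨subset_closure hxF, hxi⟩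
        have hg'x : g' x = 0 := by
          by_contra hne
          refine hx ⟨hgx, ?_⟩
          have h1 := (hg x).eventually_ne (c := 0) hne
          have h2 : ∀ᶠ z in 𝓝[>] x, g z ≠ 0 :=
            h1.filter_mono (nhdsWithin_mono _ fun z hz => ne_of_gt hz)
          rw [← Filter.empty_mem_iff_bot, Set.inter_comm, nhdsWithin_inter', mem_inf_principal]
          filter_upwards [h2] with z hz hz' using hz hz'
        have h3 := hg x
        rw [hg'x, hasDerivAt_iff_isLittleO] at h3
        rw [hasDerivAt_iff_isLittleO]
        refine Asymptotics.IsBigO.trans_isLittleO (Asymptotics.IsBigO.of_bound 1 ?_) h3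
        refine Eventually.of_forall fun y => ?_
        rw [Set.indicator_of_notMem (by simpa using hxF : x ∉ Fᶜ), hgx]
        simp only [sub_zero, smul_zero, one_mul]
        exact norm_indicator_le_norm_self _ _
    · rw [Set.indicator_of_mem (by simpa using hxF)]
      have : Fᶜ.indicator g =ᶠ[𝓝 x] g := by
        filter_upwards [hF.isOpen_compl.mem_nhds hxF] with y hy
        exact Set.indicator_of_mem hy _
      exact (hg x).congr_of_eventuallyEq this
  · rw [intervalIntegrable_iff]
    exact ((hg'.intervalIntegrable a b).def').indicator hF.isOpen_compl.measurableSet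

/-- The Cauchy-Schwarz inequality on a set of finite measure. -/
theorem lintegral_sq_le {α : Type*} [MeasurableSpace α] (μ : Measure α) {f : α → ℝ≥0∞}
    (hf : AEMeasurable f μ) : (∫⁻ x, f x ∂μ) ^ 2 ≤ μ Set.univ * ∫⁻ x, f x ^ 2 ∂μ := by
  have h := ENNReal.lintegral_mul_le_Lp_mul_Lq μ (Real.HolderConjugate.two_two)
    (aemeasurable_const (b := (1 : ℝ≥0∞))) hf
  simp only [Pi.mul_apply, one_mul, ENNReal.one_rpow, lintegral_one] at h
  calc (∫⁻ x, f x ∂μ) ^ 2 ≤ (μ Set.univ ^ (1 / (2 : ℝ))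
        * (∫⁻ x, f x ^ (2 : ℝ) ∂μ) ^ (1 / (2 : ℝ))) ^ 2 := by gcongr
    _ = _ := by
      rw [mul_pow, ← ENNReal.rpow_natCast, ← ENNReal.rpow_natCast, ← ENNReal.rpow_mul,
        ← ENNReal.rpow_mul]
      norm_num

theorem enorm_add_sq_le (x y : ℂ) : ‖x + y‖ₑ ^ 2 ≤ 2 * ‖x‖ₑ ^ 2 + 2 * ‖y‖ₑ ^ 2 := by
  calc ‖x + y‖ₑ ^ 2 ≤ (‖x‖ₑ + ‖y‖ₑ) ^ 2 := by gcongr; exact enorm_add_le x y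
    _ ≤ _ := by
      have := add_sq_le (R := ℝ) (a := ‖x‖) (b := ‖y‖)
      rw [← ofReal_norm, ← ofReal_norm, ← ENNReal.ofReal_add (by positivity)
        (by positivity), ← ENNReal.ofReal_pow (by positivity), ← ENNReal.ofReal_pow (by positivity),
        ← ENNReal.ofReal_pow (by positivity)]
      rw [show (2 : ℝ≥0∞) = ENNReal.ofReal 2 by simp, ← ENNReal.ofReal_mul (by norm_num),
        ← ENNReal.ofReal_mul (by norm_num), ← ENNReal.ofReal_add (by positivity) (by positivity)]
      exact ENNReal.ofReal_le_ofReal (by linarith)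

/-- Increment bound for a `C¹` function extended by zero. -/
theorem enorm_indicator_sub_sq_le {g g' : ℝ → ℂ} {F : Set ℝ} (hF : IsClosed F)
    (hg : ∀ x, HasDerivAt g (g' x) x) (hg' : Continuous g') (h0 : ∀ x ∈ frontier F, g x = 0)
    {a h x y : ℝ} (hx : x ∈ Set.Ioc a (a + h)) (hy : y ∈ Set.Ioc a (a + h)) :
    ‖Fᶜ.indicator g x - Fᶜ.indicator g y‖ₑ ^ 2
      ≤ ENNReal.ofReal h * ∫⁻ t in Set.Ioc a (a + h), ‖Fᶜ.indicator g' t‖ₑ ^ 2 := by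
  rw [← integral_indicator_compl_deriv hF hg hg' h0 y x]
  have hmeas : Measurable (Fᶜ.indicator g') :=
    hg'.measurable.indicator hF.isOpen_compl.measurableSet
  have h1 : ‖∫ t in y..x, Fᶜ.indicator g' t‖ₑ
      ≤ ∫⁻ t in Set.Ioc a (a + h), ‖Fᶜ.indicator g' t‖ₑ := by
    have h2 : ‖∫ t in y..x, Fᶜ.indicator g' t‖ₑ = ‖∫ t in Set.uIoc y x, Fᶜ.indicator g' t‖ₑ := by
      rw [← ofReal_norm, ← ofReal_norm,
        intervalIntegral.norm_intervalIntegral_eq]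
    rw [h2]
    refine (enorm_integral_le_lintegral_enorm _).trans (lintegral_mono_set ?_)
    intro t ht
    rcases le_total y x with h | h
    · rw [Set.uIoc_of_le h] at ht
      exact ⟨hy.1.trans ht.1, ht.2.trans hx.2⟩
    · rw [Set.uIoc_of_ge h] at ht
      exact ⟨hx.1.trans ht.1, ht.2.trans hy.2⟩
  calc _ ≤ (∫⁻ t in Set.Ioc a (a + h), ‖Fᶜ.indicator g' t‖ₑ) ^ 2 := by gcongr
    _ ≤ _ := by
      refine (lintegral_sq_le _ hmeas.enorm.aemeasurable).trans ?_
      simp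

/-! ### Poincaré inequalities on a subdivision into boxes -/

section Boxes

variable {F : Set (ℝ × ℝ)} {g : ℝ × ℝ → ℂ}

theorem hasDerivAt_slice_fst (hg : ContDiff ℝ 1 g) (y s : ℝ) :
    HasDerivAt (fun s => g (s, y)) (fderiv ℝ g (s, y) (1, 0)) s := by
  have h1 : HasFDerivAt g (fderiv ℝ g (s, y)) (s, y) :=
    (hg.differentiable one_ne_zero _).hasFDerivAt
  have h2 : HasDerivAt (fun s : ℝ => (s, y)) ((1 : ℝ), (0 : ℝ)) s :=
    (hasDerivAt_id s).prodMk (hasDerivAt_const s y)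
  exact h1.comp_hasDerivAt s h2

theorem hasDerivAt_slice_snd (hg : ContDiff ℝ 1 g) (x t : ℝ) :
    HasDerivAt (fun t => g (x, t)) (fderiv ℝ g (x, t) (0, 1)) t := by
  have h1 : HasFDerivAt g (fderiv ℝ g (x, t)) (x, t) :=
    (hg.differentiable one_ne_zero _).hasFDerivAt
  have h2 : HasDerivAt (fun t : ℝ => (x, t)) ((0 : ℝ), (1 : ℝ)) t :=
    (hasDerivAt_const t x).prodMk (hasDerivAt_id t)
  exact h1.comp_hasDerivAt t h2

theorem continuous_fderiv_apply_const (hg : ContDiff ℝ 1 g) (e : ℝ × ℝ) :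
    Continuous fun x => fderiv ℝ g x e :=
  (hg.continuous_fderiv one_ne_zero).clm_apply continuous_const

/-- Go from x to y along a horizontal and then a vertical segment, through the corner (y₁, x₂). The
one-dimensional bound applies on each, because the frontier of a slice of F lies in the frontier of
F. -/
theorem enorm_indicator_sub_sq_le_box (hF : IsClosed F) (hg : ContDiff ℝ 1 g)
    (h0 : ∀ x ∈ frontier F, g x = 0) {a c h k : ℝ} {x y : ℝ × ℝ}
    (hx : x ∈ Set.Ioc a (a + h) ×ˢ Set.Ioc c (c + k))
    (hy : y ∈ Set.Ioc a (a + h) ×ˢ Set.Ioc c (c + k)) :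
    ‖Fᶜ.indicator g x - Fᶜ.indicator g y‖ₑ ^ 2
      ≤ 2 * (ENNReal.ofReal h * ∫⁻ s in Set.Ioc a (a + h),
            ‖Fᶜ.indicator (fun z => fderiv ℝ g z (1, 0)) (s, x.2)‖ₑ ^ 2)
        + 2 * (ENNReal.ofReal k * ∫⁻ t in Set.Ioc c (c + k),
            ‖Fᶜ.indicator (fun z => fderiv ℝ g z (0, 1)) (y.1, t)‖ₑ ^ 2) := by
  have e1 : Continuous fun s : ℝ => (s, x.2) := by fun_prop
  have e2 : Continuous fun t : ℝ => (y.1, t) := by fun_prop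
  have h1 := enorm_indicator_sub_sq_le (hF.preimage e1) (hasDerivAt_slice_fst hg x.2)
    ((continuous_fderiv_apply_const hg (1, 0)).comp e1)
    (fun s hs => h0 _ (e1.frontier_preimage_subset F hs)) hx.1 hy.1
  have h2 := enorm_indicator_sub_sq_le (hF.preimage e2) (hasDerivAt_slice_snd hg y.1)
    ((continuous_fderiv_apply_const hg (0, 1)).comp e2)
    (fun s hs => h0 _ (e2.frontier_preimage_subset F hs)) hx.2 hy.2
  have h3 : Fᶜ.indicator g x - Fᶜ.indicator g y
      = (Fᶜ.indicator g (x.1, x.2) - Fᶜ.indicator g (y.1, x.2))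
        + (Fᶜ.indicator g (y.1, x.2) - Fᶜ.indicator g (y.1, y.2)) := by
    simp only [Prod.mk.eta]; ring
  rw [h3]
  refine (enorm_add_sq_le _ _).trans ?_
  gcongr
  · exact h1
  · exact h2

/-- Poincaré's inequality with mean value on a box, for a `C¹` function that vanishes on the
boundary of a closed set and is extended by zero into that set. -/
theorem lintegral_box_le (hF : IsClosed F) (hg : ContDiff ℝ 1 g)
    (h0 : ∀ x ∈ frontier F, g x = 0) {a c h k : ℝ} (hh : 0 < h) (hk : 0 < k) :
    ∫⁻ x in Set.Ioc a (a + h) ×ˢ Set.Ioc c (c + k), ‖Fᶜ.indicator g x‖ₑ ^ 2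
      ≤ 4 * (ENNReal.ofReal (h ^ 2) * (∫⁻ x in Set.Ioc a (a + h) ×ˢ Set.Ioc c (c + k),
            ‖Fᶜ.indicator (fun z => fderiv ℝ g z (1, 0)) x‖ₑ ^ 2)
          + ENNReal.ofReal (k ^ 2) * ∫⁻ x in Set.Ioc a (a + h) ×ˢ Set.Ioc c (c + k),
            ‖Fᶜ.indicator (fun z => fderiv ℝ g z (0, 1)) x‖ₑ ^ 2)
        + 2 * (ENNReal.ofReal (h * k))⁻¹
          * ‖∫ x in Set.Ioc a (a + h) ×ˢ Set.Ioc c (c + k), Fᶜ.indicator g x‖ₑ ^ 2 := by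
  set I := Set.Ioc a (a + h) with hI
  set J := Set.Ioc c (c + k) with hJ
  set w := Fᶜ.indicator g with hw
  set f₁ : ℝ × ℝ → ℝ≥0∞ := fun x => ‖Fᶜ.indicator (fun z => fderiv ℝ g z (1, 0)) x‖ₑ ^ 2 with hf₁
  set f₂ : ℝ × ℝ → ℝ≥0∞ := fun x => ‖Fᶜ.indicator (fun z => fderiv ℝ g z (0, 1)) x‖ₑ ^ 2 with hf₂
  have hFm : MeasurableSet Fᶜ := hF.isOpen_compl.measurableSet
  have hwm : Measurable w := hg.continuous.measurable.indicator hFm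
  have hf₁m : Measurable f₁ :=
    ((continuous_fderiv_apply_const hg (1, 0)).measurable.indicator hFm).enorm.pow_const 2
  have hf₂m : Measurable f₂ :=
    ((continuous_fderiv_apply_const hg (0, 1)).measurable.indicator hFm).enorm.pow_const 2
  have hQm : MeasurableSet (I ×ˢ J) := measurableSet_Ioc.prod measurableSet_Ioc
  have hvI : volume I = ENNReal.ofReal h := by simp [hI]
  have hvJ : volume J = ENNReal.ofReal k := by simp [hJ]
  have hvQ : volume (I ×ˢ J) = ENNReal.ofReal (h * k) := by
    rw [Measure.volume_eq_prod, Measure.prod_prod, hvI, hvJ, ENNReal.ofReal_mul hh.le]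
  have hrest : (volume : Measure (ℝ × ℝ)).restrict (I ×ˢ J)
      = (volume.restrict I).prod (volume.restrict J) := by
    rw [Measure.volume_eq_prod, Measure.prod_restrict]
  set V := ENNReal.ofReal (h * k) with hV
  have hV0 : V ≠ 0 := by simp [hV, hh, hk]
  have hVt : V ≠ ⊤ := ENNReal.ofReal_ne_top
  have hwint : IntegrableOn w (I ×ˢ J) := by
    have h1 : IntegrableOn g (Set.Icc a (a + h) ×ˢ Set.Icc c (c + k)) :=
      hg.continuous.continuousOn.integrableOn_compact (isCompact_Icc.prod isCompact_Icc)
    exact (h1.mono_set (Set.prod_mono Set.Ioc_subset_Icc_self Set.Ioc_subset_Icc_self)).indicator hFm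
  set A := ‖∫ x in I ×ˢ J, w x‖ₑ with hA
  -- pointwise bound
  have hpt : ∀ x, V ^ 2 * ‖w x‖ₑ ^ 2
      ≤ 2 * (V * ∫⁻ y in I ×ˢ J, ‖w x - w y‖ₑ ^ 2) + 2 * A ^ 2 := by
    intro x
    have hc : IntegrableOn (fun _ : ℝ × ℝ => w x) (I ×ˢ J) :=
      integrableOn_const (by rw [hvQ]; exact hVt)
    have h1 : (h * k : ℝ) • w x = (∫ y in I ×ˢ J, (w x - w y)) + ∫ y in I ×ˢ J, w y := by
      rw [integral_sub hc hwint]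
      simp [measureReal_def, hvQ, hV, ENNReal.toReal_ofReal (mul_pos hh hk).le]
    have h2 : V * ‖w x‖ₑ = ‖(h * k : ℝ) • w x‖ₑ := by
      rw [enorm_smul, hV, Real.enorm_of_nonneg (mul_pos hh hk).le]
    rw [← mul_pow, h2, h1]
    refine (enorm_add_sq_le _ _).trans ?_
    gcongr
    calc ‖∫ y in I ×ˢ J, (w x - w y)‖ₑ ^ 2 ≤ (∫⁻ y in I ×ˢ J, ‖w x - w y‖ₑ) ^ 2 := by
          gcongr; exact enorm_integral_le_lintegral_enorm _
      _ ≤ _ := by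
          refine (lintegral_sq_le _ (measurable_const.sub hwm).enorm.aemeasurable).trans ?_
          rw [Measure.restrict_apply_univ, hvQ]
          exact le_rfl
  -- Each one-dimensional integral in the increment bound is constant in the direction of
  -- integration; integrating it over the box therefore supplies a second factor h or k.
  have hdouble : ∫⁻ x in I ×ˢ J, ∫⁻ y in I ×ˢ J, ‖w x - w y‖ₑ ^ 2
      ≤ 2 * V * (ENNReal.ofReal (h ^ 2) * (∫⁻ x in I ×ˢ J, f₁ x)
          + ENNReal.ofReal (k ^ 2) * ∫⁻ x in I ×ˢ J, f₂ x) := by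
    have m1 : Measurable fun t : ℝ => ∫⁻ s in I, f₁ (s, t) := hf₁m.lintegral_prod_left'
    have m2 : Measurable fun s : ℝ => ∫⁻ t in J, f₂ (s, t) := hf₂m.lintegral_prod_right'
    have m1' : Measurable fun x : ℝ × ℝ => ∫⁻ s in I, f₁ (s, x.2) := m1.comp measurable_snd
    have m2' : Measurable fun x : ℝ × ℝ => ∫⁻ t in J, f₂ (x.1, t) := m2.comp measurable_fst
    have i1 : ∫⁻ x in I ×ˢ J, f₁ x = ∫⁻ t in J, ∫⁻ s in I, f₁ (s, t) := by
      rw [hrest, lintegral_prod_symm' _ hf₁m]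
    have i2 : ∫⁻ x in I ×ˢ J, f₂ x = ∫⁻ s in I, ∫⁻ t in J, f₂ (s, t) := by
      rw [hrest, lintegral_prod _ hf₂m.aemeasurable]
    calc ∫⁻ x in I ×ˢ J, ∫⁻ y in I ×ˢ J, ‖w x - w y‖ₑ ^ 2
        ≤ ∫⁻ x in I ×ˢ J, ∫⁻ y in I ×ˢ J, (2 * (ENNReal.ofReal h * ∫⁻ s in I, f₁ (s, x.2))
            + 2 * (ENNReal.ofReal k * ∫⁻ t in J, f₂ (y.1, t))) := by
          refine setLIntegral_mono' hQm fun x hx => setLIntegral_mono' hQm fun y hy => ?_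
          exact enorm_indicator_sub_sq_le_box hF hg h0 hx hy
      _ = ∫⁻ x in I ×ˢ J, (2 * (ENNReal.ofReal h * ∫⁻ s in I, f₁ (s, x.2)) * V
            + 2 * (ENNReal.ofReal k * (ENNReal.ofReal k * ∫⁻ x in I ×ˢ J, f₂ x))) := by
          congr 1; ext x
          rw [lintegral_add_left measurable_const, setLIntegral_const, hvQ,
            lintegral_const_mul _ (m2'.const_mul _),
            lintegral_const_mul _ m2']
          congr 3
          rw [hrest, lintegral_prod _ m2'.aemeasurable, ← hrest, i2]
          simp only [lintegral_const, Measure.restrict_apply_univ, hvJ]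
          rw [lintegral_mul_const _ m2, mul_comm]
      _ = 2 * (ENNReal.ofReal h * (ENNReal.ofReal h * ∫⁻ x in I ×ˢ J, f₁ x)) * V
            + 2 * (ENNReal.ofReal k * (ENNReal.ofReal k * ∫⁻ x in I ×ˢ J, f₂ x)) * V := by
          rw [lintegral_add_right _ measurable_const, setLIntegral_const, hvQ,
            lintegral_mul_const _ ((m1'.const_mul _).const_mul _),
            lintegral_const_mul _ (m1'.const_mul _),
            lintegral_const_mul _ m1']
          congr 5
          rw [hrest, lintegral_prod _ m1'.aemeasurable, ← hrest, i1]
          simp only [lintegral_const, Measure.restrict_apply_univ, hvI]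
          rw [mul_comm]
      _ = _ := by
          rw [pow_two, pow_two, ENNReal.ofReal_mul hh.le, ENNReal.ofReal_mul hk.le]
          ring
  have hmain : V ^ 2 * ∫⁻ x in I ×ˢ J, ‖w x‖ₑ ^ 2
      ≤ V ^ 2 * (4 * (ENNReal.ofReal (h ^ 2) * (∫⁻ x in I ×ˢ J, f₁ x)
          + ENNReal.ofReal (k ^ 2) * ∫⁻ x in I ×ˢ J, f₂ x) + 2 * V⁻¹ * A ^ 2) := by
    calc V ^ 2 * ∫⁻ x in I ×ˢ J, ‖w x‖ₑ ^ 2 = ∫⁻ x in I ×ˢ J, V ^ 2 * ‖w x‖ₑ ^ 2 :=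
          (lintegral_const_mul _ (hwm.enorm.pow_const 2)).symm
      _ ≤ ∫⁻ x in I ×ˢ J, (2 * (V * ∫⁻ y in I ×ˢ J, ‖w x - w y‖ₑ ^ 2) + 2 * A ^ 2) :=
          lintegral_mono hpt
      _ = 2 * (V * ∫⁻ x in I ×ˢ J, ∫⁻ y in I ×ˢ J, ‖w x - w y‖ₑ ^ 2) + 2 * A ^ 2 * V := by
          have hm : Measurable fun x => ∫⁻ y in I ×ˢ J, ‖w x - w y‖ₑ ^ 2 := by
            have : Measurable fun z : (ℝ × ℝ) × (ℝ × ℝ) => ‖w z.1 - w z.2‖ₑ ^ 2 :=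
              ((hwm.comp measurable_fst).sub (hwm.comp measurable_snd)).enorm.pow_const 2
            exact this.lintegral_prod_right'
          rw [lintegral_add_right _ measurable_const, setLIntegral_const, hvQ,
            lintegral_const_mul _ (hm.const_mul _), lintegral_const_mul _ hm]
      _ ≤ 2 * (V * (2 * V * (ENNReal.ofReal (h ^ 2) * (∫⁻ x in I ×ˢ J, f₁ x)
          + ENNReal.ofReal (k ^ 2) * ∫⁻ x in I ×ˢ J, f₂ x))) + 2 * A ^ 2 * V := by gcongr
      _ = _ := by
          have hVV : V ^ 2 * V⁻¹ = V := by
            rw [pow_two, mul_assoc, ENNReal.mul_inv_cancel hV0 hVt, mul_one]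
          rw [mul_add (V ^ 2), show V ^ 2 * (2 * V⁻¹ * A ^ 2) = (V ^ 2 * V⁻¹) * (2 * A ^ 2) by ring, hVV]
          ring
  exact (ENNReal.mul_le_mul_iff_right (pow_ne_zero 2 hV0) (ENNReal.pow_ne_top hVt)).mp hmain

/-- The `p`-th box of the subdivision of a rectangle into `n × n` boxes. -/
def subBox (a c L H : ℝ) (n : ℕ) (p : Fin n × Fin n) : Set (ℝ × ℝ) :=
  Set.Ioc (a + p.1 * (L / n)) (a + p.1 * (L / n) + L / n)
    ×ˢ Set.Ioc (c + p.2 * (H / n)) (c + p.2 * (H / n) + H / n)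

theorem measurableSet_subBox (a c L H : ℝ) (n : ℕ) (p : Fin n × Fin n) :
    MeasurableSet (subBox a c L H n p) := measurableSet_Ioc.prod measurableSet_Ioc

theorem exists_mem_Ioc_subdivision {a L x : ℝ} (hL : 0 < L) {n : ℕ} (hn : 0 < n)
    (hx : x ∈ Set.Ioc a (a + L)) :
    ∃ i : Fin n, x ∈ Set.Ioc (a + i * (L / n)) (a + i * (L / n) + L / n) := by
  have hn' : (0 : ℝ) < n := by exact_mod_cast hn
  have hd : 0 < L / n := div_pos hL hn'
  set y := (x - a) / (L / n) with hy
  have hy0 : 0 < y := div_pos (by linarith [hx.1]) hd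
  have hyn : y ≤ n := by
    rw [hy, div_le_iff₀ hd]
    have : (n : ℝ) * (L / n) = L := by field_simp
    linarith [hx.2]
  have hxy : x = a + y * (L / n) := by rw [hy]; field_simp; ring
  -- The intervals are closed on the right, so the index is ⌈y⌉ - 1 and not ⌊y⌋.
  have hc : 0 < ⌈y⌉₊ := Nat.ceil_pos.mpr hy0
  have hcn : ⌈y⌉₊ ≤ n := Nat.ceil_le.mpr hyn
  refine ⟨⟨⌈y⌉₊ - 1, by omega⟩, ?_, ?_⟩
  · have h1 : ((⌈y⌉₊ - 1 : ℕ) : ℝ) < y := by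
      rw [← Nat.lt_ceil]; omega
    simp only
    nlinarith [hxy]
  · have h1 : y ≤ ((⌈y⌉₊ - 1 : ℕ) : ℝ) + 1 := by
      have h2 := Nat.le_ceil y
      have h3 : ((⌈y⌉₊ - 1 : ℕ) : ℝ) + 1 = (⌈y⌉₊ : ℝ) := by
        rw [Nat.cast_sub hc]; simp
      linarith
    simp only
    nlinarith [hxy]

theorem Ioc_subdivision_subset {a L : ℝ} (hL : 0 < L) {n : ℕ} (i : Fin n) :
    Set.Ioc (a + i * (L / n)) (a + i * (L / n) + L / n) ⊆ Set.Ioc a (a + L) := by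
  have hn' : (0 : ℝ) < n := by exact_mod_cast i.pos
  have hd : 0 < L / n := div_pos hL hn'
  have h1 : (i : ℝ) + 1 ≤ n := by exact_mod_cast i.2
  have h2 : (n : ℝ) * (L / n) = L := by field_simp
  have h3 : (0 : ℝ) ≤ i := by positivity
  intro x hx
  exact ⟨by nlinarith [hx.1], by nlinarith [hx.2]⟩

theorem Ioc_subdivision_disjoint {a L : ℝ} (hL : 0 < L) {n : ℕ} {i j : Fin n} (hij : i ≠ j) :
    Disjoint (Set.Ioc (a + i * (L / n)) (a + i * (L / n) + L / n))
      (Set.Ioc (a + j * (L / n)) (a + j * (L / n) + L / n)) := by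
  have hn' : (0 : ℝ) < n := by exact_mod_cast i.pos
  have hd : 0 < L / n := div_pos hL hn'
  rw [Set.disjoint_left]
  intro x hx hy
  rcases lt_or_gt_of_ne hij with h | h
  · have h1 : (i : ℝ) + 1 ≤ j := by exact_mod_cast h
    nlinarith [hx.2, hy.1]
  · have h1 : (j : ℝ) + 1 ≤ i := by exact_mod_cast h
    nlinarith [hx.1, hy.2]

theorem subBox_disjoint {a c L H : ℝ} (hL : 0 < L) (hH : 0 < H) (n : ℕ) :
    Pairwise (Function.onFun Disjoint (subBox a c L H n)) := by
  intro p q hpq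
  by_cases h : p.1 = q.1
  · have h2 : p.2 ≠ q.2 := fun h2 => hpq (Prod.ext h h2)
    exact Set.disjoint_prod.mpr (Or.inr (Ioc_subdivision_disjoint hH h2))
  · exact Set.disjoint_prod.mpr (Or.inl (Ioc_subdivision_disjoint hL h))

theorem iUnion_subBox {a c L H : ℝ} (hL : 0 < L) (hH : 0 < H) {n : ℕ} (hn : 0 < n) :
    ⋃ p, subBox a c L H n p = Set.Ioc a (a + L) ×ˢ Set.Ioc c (c + H) := by
  ext x
  simp only [Set.mem_iUnion]
  constructor
  · rintro ⟨p, hp⟩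
    exact ⟨Ioc_subdivision_subset hL _ hp.1, Ioc_subdivision_subset hH _ hp.2⟩
  · rintro ⟨h1, h2⟩
    obtain ⟨i, hi⟩ := exists_mem_Ioc_subdivision hL hn h1
    obtain ⟨j, hj⟩ := exists_mem_Ioc_subdivision hH hn h2
    exact ⟨(i, j), hi, hj⟩

/-- Half-open boxes partition the half-open rectangle exactly; the passage from the open one costs
only a null set. -/
theorem restrict_rectangle_diff (hF : IsClosed F) (a b c d : ℝ) :
    (volume : Measure (ℝ × ℝ)).restrict ((Set.Ioo a b ×ˢ Set.Ioo c d) \ F)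
      = (volume.restrict (Set.Ioc a b ×ˢ Set.Ioc c d)).restrict Fᶜ := by
  rw [Measure.restrict_restrict hF.isOpen_compl.measurableSet, Set.inter_comm,
    ← Set.sdiff_eq]
  refine Measure.restrict_congr_set ?_
  refine ae_eq_set_sdiff ?_ (ae_eq_refl _)
  rw [Measure.volume_eq_prod]
  exact Measure.set_prod_ae_eq Ioo_ae_eq_Ioc Ioo_ae_eq_Ioc

/-- The `L²` norm of a `C¹` function vanishing on the boundary of `F` is controlled, up to finitely
many mean values, by a small multiple of the norm of its gradient. -/
theorem lintegral_rectangle_diff_le (hF : IsClosed F) (hg : ContDiff ℝ 1 g)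
    (h0 : ∀ x ∈ frontier F, g x = 0) {a c L H : ℝ} (hL : 0 < L) (hH : 0 < H) {n : ℕ}
    (hn : 0 < n) {D : Set (ℝ × ℝ)}
    (hD : D = (Set.Ioo a (a + L) ×ˢ Set.Ioo c (c + H)) \ F) :
    ∫⁻ x in D, ‖g x‖ₑ ^ 2
      ≤ 4 * (ENNReal.ofReal ((L / n) ^ 2) * (∫⁻ x in D, ‖fderiv ℝ g x (1, 0)‖ₑ ^ 2)
          + ENNReal.ofReal ((H / n) ^ 2) * (∫⁻ x in D, ‖fderiv ℝ g x (0, 1)‖ₑ ^ 2))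
        + 2 * (ENNReal.ofReal (L / n * (H / n)))⁻¹
          * ∑ p, ‖∫ x in D, (subBox a c L H n p).indicator g x‖ₑ ^ 2 := by
  have hn' : (0 : ℝ) < n := by exact_mod_cast hn
  have hFm : MeasurableSet Fᶜ := hF.isOpen_compl.measurableSet
  have hrD : volume.restrict D
      = (volume.restrict (Set.Ioc a (a + L) ×ˢ Set.Ioc c (c + H))).restrict Fᶜ := by
    rw [hD]; exact restrict_rectangle_diff hF _ _ _ _
  have key : ∀ f : ℝ × ℝ → ℂ, ∫⁻ x in D, ‖f x‖ₑ ^ 2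
      = ∑ p, ∫⁻ x in subBox a c L H n p, ‖Fᶜ.indicator f x‖ₑ ^ 2 := by
    intro f
    rw [hrD, ← lintegral_indicator hFm, ← iUnion_subBox hL hH hn,
      lintegral_iUnion (measurableSet_subBox a c L H n) (subBox_disjoint hL hH n), tsum_fintype]
    refine Finset.sum_congr rfl fun p _ => lintegral_congr fun x => ?_
    by_cases hx : x ∈ Fᶜ <;> simp [Set.indicator, hx]
  have key2 : ∀ p, ∫ x in D, (subBox a c L H n p).indicator g x
      = ∫ x in subBox a c L H n p, Fᶜ.indicator g x := by
    intro p
    rw [hrD, ← integral_indicator hFm]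
    have h1 : Fᶜ.indicator ((subBox a c L H n p).indicator g)
        = (subBox a c L H n p).indicator (Fᶜ.indicator g) := by
      rw [Set.indicator_indicator, Set.indicator_indicator, Set.inter_comm]
    rw [h1, integral_indicator (measurableSet_subBox a c L H n p),
      Measure.restrict_restrict (measurableSet_subBox a c L H n p), Set.inter_eq_left.mpr]
    rw [← iUnion_subBox hL hH hn]
    exact Set.subset_iUnion _ p
  rw [key g, key (fun x => fderiv ℝ g x (1, 0)), key (fun x => fderiv ℝ g x (0, 1))]
  simp_rw [key2]
  rw [Finset.mul_sum, Finset.mul_sum, ← Finset.sum_add_distrib, Finset.mul_sum, Finset.mul_sum,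
    ← Finset.sum_add_distrib]
  exact Finset.sum_le_sum fun p _ =>
    lintegral_box_le hF hg h0 (div_pos hL hn') (div_pos hH hn')

end Boxes


/-- An operator is compact if it is bounded, up to a small multiple of the norm, by finitely many
continuous linear functionals. -/
theorem isCompactOperator_of_forall_le {V X : Type*} [NormedAddCommGroup V] [NormedSpace ℂ V]
    [NormedAddCommGroup X] [NormedSpace ℂ X] [CompleteSpace X] (K : V →L[ℂ] X)
    (h : ∀ ε > 0, ∃ (ι : Type) (_ : Fintype ι) (L : V →L[ℂ] (ι → ℂ)),
      ∀ u, ‖K u‖ ≤ ε * ‖u‖ + ‖L u‖) : IsCompactOperator K := by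
  refine (isCompactOperator_iff_isCompact_closure_image_closedBall (𝕜₁ := ℂ) (K : V →ₗ[ℂ] X)
    zero_lt_one).mpr ?_
  refine isCompact_iff_totallyBounded_isComplete.mpr
    ⟨TotallyBounded.closure ?_, isClosed_closure.isComplete⟩
  rw [Metric.totallyBounded_iff]
  intro ε hε
  -- Differences in the unit ball have norm at most 2, so ε/4 accounts for one half of ε; an ε/2-net
  -- of the bounded finite-dimensional image under L accounts for the other.
  obtain ⟨ι, _, L, hL⟩ := h (ε / 4) (by positivity)
  have hLb : TotallyBounded (L '' Metric.closedBall (0 : V) 1) := by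
    have hb : Bornology.IsBounded (L '' Metric.closedBall (0 : V) 1) := by
      exact (L.lipschitz.isBounded_image Metric.isBounded_closedBall)
    exact (Metric.isCompact_of_isClosed_isBounded isClosed_closure hb.closure).totallyBounded.subset
      subset_closure
  obtain ⟨t, ht, htf, hcov⟩ := Metric.finite_approx_of_totallyBounded hLb (ε / 2) (by positivity)
  have ht' : ∀ y ∈ t, ∃ z : V, z ∈ Metric.closedBall (0 : V) 1 ∧ L z = y := fun y hy => ht hy
  choose! z hz hzt using ht'
  refine ⟨(fun y => K (z y)) '' t, htf.image _, ?_⟩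
  rintro _ ⟨x, hx, rfl⟩
  obtain ⟨y, hy, hxy⟩ := Set.mem_iUnion₂.mp (hcov ⟨x, hx, rfl⟩)
  refine Set.mem_iUnion₂.mpr ⟨_, ⟨y, hy, rfl⟩, ?_⟩
  rw [Metric.mem_ball, dist_eq_norm, ← hzt y hy, ← map_sub] at hxy
  rw [Metric.mem_ball, dist_eq_norm]
  have h3 : ‖x - z y‖ ≤ 2 := by
    have h4 : ‖x‖ ≤ 1 := by simpa using hx
    have h5 : ‖z y‖ ≤ 1 := by simpa using hz y hy
    exact (norm_sub_le _ _).trans (by linarith)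
  have h6 := hL (x - z y)
  have h7 : ‖K (x - z y)‖ < ε := by nlinarith
  simpa using h7

noncomputable section

namespace BiharmonicPML

/-! ### Square integrable functions and jets -/

/-- The space `L²(D)`. -/
abbrev L2 (D : Set (ℝ × ℝ)) := Lp ℂ 2 (volume.restrict D)

/-- Sextuples of square integrable functions, in the order `u, ∂₁u, ∂₂u, ∂₁²u, ∂₁∂₂u, ∂₂²u`. -/
abbrev Jet (D : Set (ℝ × ℝ)) := PiLp 2 (fun _ : Fin 6 => L2 D)

/-- The class in `L²(D)` of a square integrable function. -/
def toL2 (D : Set (ℝ × ℝ)) (f : ℝ × ℝ → ℂ) : L2 D :=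
  open Classical in if h : MemLp f 2 (volume.restrict D) then h.toLp f else 0

theorem coeFn_toL2 {D : Set (ℝ × ℝ)} {f : ℝ × ℝ → ℂ} (h : MemLp f 2 (volume.restrict D)) :
    toL2 D f =ᵐ[volume.restrict D] f := by
  rw [toL2, dif_pos h]; exact h.coeFn_toLp

theorem memLp_of_continuous {D : Set (ℝ × ℝ)} (hD : Bornology.IsBounded D) {f : ℝ × ℝ → ℂ}
    (hf : Continuous f) (p : ℝ≥0∞) : MemLp f p (volume.restrict D) := by
  have hK : IsCompact (closure D) := hD.isCompact_closure
  have hfin : IsFiniteMeasure ((volume : Measure (ℝ × ℝ)).restrict D) :=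
    ⟨by simpa using (measure_mono subset_closure).trans_lt hK.measure_lt_top⟩
  obtain ⟨C, hC⟩ := hK.exists_bound_of_continuousOn hf.continuousOn
  refine MemLp.of_bound hf.aestronglyMeasurable C ?_
  have h1 : ∀ᵐ x ∂(volume : Measure (ℝ × ℝ)).restrict (closure D), ‖f x‖ ≤ C := by
    rw [ae_restrict_iff' isClosed_closure.measurableSet]
    exact Eventually.of_forall hC
  exact ae_mono (Measure.restrict_mono subset_closure le_rfl) h1

theorem coeFn_toL2_of_continuous {D : Set (ℝ × ℝ)} (hD : Bornology.IsBounded D)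
    {f : ℝ × ℝ → ℂ} (hf : Continuous f) : toL2 D f =ᵐ[volume.restrict D] f :=
  coeFn_toL2 (memLp_of_continuous hD hf 2)

theorem enorm_L2_sq {D : Set (ℝ × ℝ)} (f : L2 D) : ‖f‖ₑ ^ 2 = ∫⁻ x in D, ‖f x‖ₑ ^ 2 := by
  rw [Lp.enorm_def, eLpNorm_eq_lintegral_rpow_enorm_toReal (by norm_num) (by norm_num)]
  rw [← ENNReal.rpow_natCast, ← ENNReal.rpow_mul]
  norm_num

theorem enorm_toL2_sq {D : Set (ℝ × ℝ)} {f : ℝ × ℝ → ℂ} (h : MemLp f 2 (volume.restrict D)) :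
    ‖toL2 D f‖ₑ ^ 2 = ∫⁻ x in D, ‖f x‖ₑ ^ 2 := by
  rw [enorm_L2_sq]
  refine lintegral_congr_ae ?_
  filter_upwards [coeFn_toL2 h] with x hx
  rw [hx]

/-- The jet of a smooth function. -/
def jet (D : Set (ℝ × ℝ)) (ψ : ℝ × ℝ → ℂ) : Jet D :=
  WithLp.toLp 2 ![toL2 D ψ, toL2 D (pd (1, 0) ψ), toL2 D (pd (0, 1) ψ),
    toL2 D (pd (1, 0) (pd (1, 0) ψ)), toL2 D (pd (0, 1) (pd (1, 0) ψ)),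
    toL2 D (pd (0, 1) (pd (0, 1) ψ))]

theorem contDiff_pd {ψ : ℝ × ℝ → ℂ} (hψ : ContDiff ℝ ∞ ψ) (e : ℝ × ℝ) :
    ContDiff ℝ ∞ (pd e ψ) :=
  (hψ.fderiv_right (m := ∞) (by simp)).clm_apply contDiff_const

theorem pd_comm {ψ : ℝ × ℝ → ℂ} (hψ : ContDiff ℝ ∞ ψ) (e e' : ℝ × ℝ) :
    pd e (pd e' ψ) = pd e' (pd e ψ) := by
  ext x
  have hd : DifferentiableAt ℝ (fderiv ℝ ψ) x :=
    (hψ.fderiv_right (m := ∞) (by simp)).differentiable (by simp) x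
  have h1 : ∀ v w : ℝ × ℝ, pd v (pd w ψ) x = fderiv ℝ (fderiv ℝ ψ) x v w := by
    intro v w
    have := fderiv_clm_apply hd (differentiableAt_const w)
    change fderiv ℝ (fun y => fderiv ℝ ψ y w) x v = _
    rw [this]; simp
  rw [h1, h1]
  have hs : IsSymmSndFDerivAt ℝ ψ x :=
    hψ.contDiffAt.isSymmSndFDerivAt (by simp only [minSmoothness_of_isRCLikeNormedField]; exact WithTop.coe_le_coe.mpr le_top)
  exact hs e e'

theorem norm_jet_apply_le {D : Set (ℝ × ℝ)} (u : Jet D) (i : Fin 6) : ‖u i‖ ≤ ‖u‖ :=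
  PiLp.norm_apply_le u i

set_option maxHeartbeats 400000 in
/-- Compactness of the lower order part of jets in a space whose elements are limits of jets of
smooth functions such that the relevant derivative vanishes on the boundary of `F`. -/
theorem isCompactOperator_component {F : Set (ℝ × ℝ)} (hF : IsClosed F) {a c L H : ℝ}
    (hL : 0 < L) (hH : 0 < H) {D : Set (ℝ × ℝ)}
    (hD : D = (Set.Ioo a (a + L) ×ˢ Set.Ioo c (c + H)) \ F) (V : Submodule ℂ (Jet D))
    (S : Set (ℝ × ℝ → ℂ)) (hV : (V : Set (Jet D)) ⊆ closure (jet D '' S))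
    (i i₁ i₂ : Fin 6) (G : (ℝ × ℝ → ℂ) → (ℝ × ℝ → ℂ))
    (hG : ∀ ψ ∈ S, ContDiff ℝ ∞ (G ψ) ∧ (∀ x ∈ frontier F, G ψ x = 0) ∧
      (jet D ψ) i = toL2 D (G ψ) ∧ (jet D ψ) i₁ = toL2 D (pd (1, 0) (G ψ)) ∧
      (jet D ψ) i₂ = toL2 D (pd (0, 1) (G ψ))) :
    IsCompactOperator ((PiLp.proj 2 (fun _ : Fin 6 => L2 D) i : Jet D →L[ℂ] L2 D) ∘L V.subtypeL) := by
  have hDb : Bornology.IsBounded D := by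
    rw [hD]
    exact ((Metric.isBounded_Ioo _ _).prod (Metric.isBounded_Ioo _ _)).subset Set.sdiff_subset
  have hDfin : (volume : Measure (ℝ × ℝ)) D < ⊤ := hDb.measure_lt_top
  have hfinM : IsFiniteMeasure ((volume : Measure (ℝ × ℝ)).restrict D) := ⟨by simpa using hDfin⟩
  refine isCompactOperator_of_forall_le _ fun ε hε => ?_
  -- The boxes are taken so small that the gradient term of `lintegral_rectangle_diff_le`, with its
  -- factor 4, is at most ε²‖u‖².
  obtain ⟨n, hn⟩ := exists_nat_gt (2 * (L + H) / ε)
  have hn0 : 0 < n := by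
    have : (0 : ℝ) < n := lt_of_le_of_lt (by positivity) hn
    exact_mod_cast this
  have hn' : (0 : ℝ) < n := by exact_mod_cast hn0
  have hnε : 2 * ((L + H) / n) ≤ ε := by
    rw [div_lt_iff₀ hε] at hn
    rw [← mul_div_assoc, div_le_iff₀ hn']; linarith
  set A : ℝ := 2 * (L / n * (H / n))⁻¹ with hA
  have hA0 : 0 ≤ A := by positivity
  have hqm : ∀ p, MeasurableSet (subBox a c L H n p) := measurableSet_subBox a c L H n
  set q : Fin n × Fin n → L2 D := fun p =>
    indicatorConstLp 2 (hqm p) (measure_ne_top _ _) (1 : ℂ) with hq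
  -- The functionals take values in a space with the maximum norm; the factor √(A n²) lets that norm
  -- dominate A times a sum of n² squares.
  set N : ℝ := Real.sqrt (A * (n * n)) with hN
  set ℓ : Jet D →L[ℂ] (Fin n × Fin n → ℂ) := (N : ℂ) • ContinuousLinearMap.pi fun p =>
    (innerSL ℂ (q p)) ∘L (PiLp.proj 2 (fun _ : Fin 6 => L2 D) i) with hℓ
  refine ⟨Fin n × Fin n, inferInstance, ℓ ∘L V.subtypeL, ?_⟩
  suffices hmain : ∀ u ∈ closure (jet D '' S), ‖u i‖ ≤ ε * ‖u‖ + ‖ℓ u‖ by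
    intro u
    exact hmain u.1 (hV u.2)
  have hclosed : IsClosed {u : Jet D | ‖u i‖ ≤ ε * ‖u‖ + ‖ℓ u‖} :=
    isClosed_le (PiLp.proj 2 (fun _ : Fin 6 => L2 D) i : Jet D →L[ℂ] L2 D).continuous.norm
      ((continuous_const.mul continuous_norm).add ℓ.continuous.norm)
  refine fun u hu => closure_minimal ?_ hclosed hu
  rintro _ ⟨ψ, hψ, rfl⟩
  obtain ⟨hg, hg0, hi, hi₁, hi₂⟩ := hG ψ hψ
  set g := G ψ with hgdef
  set u := jet D ψ with hu
  have hbound := lintegral_rectangle_diff_le hF (hg.of_le (by simp)) hg0 hL hH hn0 hD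
  rw [show (4 : ℝ≥0∞) = ENNReal.ofReal 4 by simp,
    show (2 : ℝ≥0∞) = ENNReal.ofReal 2 by simp] at hbound
  have hm0 := memLp_of_continuous hDb hg.continuous 2
  have hm1 := memLp_of_continuous hDb (contDiff_pd hg (1, 0)).continuous 2
  have hm2 := memLp_of_continuous hDb (contDiff_pd hg (0, 1)).continuous 2
  have e0 : ∫⁻ x in D, ‖g x‖ₑ ^ 2 = ENNReal.ofReal (‖u i‖ ^ 2) := by
    rw [← enorm_toL2_sq hm0, ← hi, ← ofReal_norm, ENNReal.ofReal_pow (norm_nonneg _)]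
  have e1 : ∫⁻ x in D, ‖fderiv ℝ g x (1, 0)‖ₑ ^ 2 = ENNReal.ofReal (‖u i₁‖ ^ 2) := by
    change ∫⁻ x in D, ‖pd (1, 0) g x‖ₑ ^ 2 = _
    rw [← enorm_toL2_sq hm1, ← hi₁, ← ofReal_norm, ENNReal.ofReal_pow (norm_nonneg _)]
  have e2 : ∫⁻ x in D, ‖fderiv ℝ g x (0, 1)‖ₑ ^ 2 = ENNReal.ofReal (‖u i₂‖ ^ 2) := by
    change ∫⁻ x in D, ‖pd (0, 1) g x‖ₑ ^ 2 = _
    rw [← enorm_toL2_sq hm2, ← hi₂, ← ofReal_norm, ENNReal.ofReal_pow (norm_nonneg _)]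
  have e3 : ∀ p, ∫ x in D, (subBox a c L H n p).indicator g x = inner ℂ (q p) (u i) := by
    intro p
    rw [hq, L2.inner_indicatorConstLp_one, integral_indicator (hqm p), hi]
    refine (setIntegral_congr_ae (hqm p) ?_)
    filter_upwards [coeFn_toL2 hm0] with x hx _ using hx.symm
  have e4 : ∀ p, ‖∫ x in D, (subBox a c L H n p).indicator g x‖ₑ ^ 2
      = ENNReal.ofReal (‖inner ℂ (q p) (u i)‖ ^ 2) := by
    intro p
    rw [e3, ← ofReal_norm, ENNReal.ofReal_pow (norm_nonneg _)]
  rw [e0, e1, e2] at hbound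
  simp_rw [e4] at hbound
  have hpos : 0 < L / n * (H / n) := by positivity
  rw [← ENNReal.ofReal_sum_of_nonneg (fun _ _ => by positivity), ← ENNReal.ofReal_inv_of_pos hpos,
    ← ENNReal.ofReal_mul (by positivity), ← ENNReal.ofReal_mul (by positivity),
    ← ENNReal.ofReal_add (by positivity) (by positivity), ← ENNReal.ofReal_mul (by positivity),
    ← ENNReal.ofReal_mul (by positivity), ← ENNReal.ofReal_mul (by positivity),
    ← ENNReal.ofReal_add (by positivity) (by positivity),
    ENNReal.ofReal_le_ofReal_iff (by positivity)] at hbound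
  have hℓp : ∀ p, N * ‖inner ℂ (q p) (u i)‖ ≤ ‖ℓ u‖ := by
    intro p
    have h1 : ℓ u p = (N : ℂ) * inner ℂ (q p) (u i) := by simp [hℓ]
    have h2 := norm_le_pi_norm (ℓ u) p
    rw [h1, norm_mul, Complex.norm_real, Real.norm_of_nonneg (Real.sqrt_nonneg _)] at h2
    exact h2
  have hN2 : N ^ 2 = A * (n * n) := Real.sq_sqrt (by positivity)
  have hsum : A * ∑ p, ‖inner ℂ (q p) (u i)‖ ^ 2 ≤ ‖ℓ u‖ ^ 2 := by
    have h1 : ∀ p, A * (n * n) * ‖inner ℂ (q p) (u i)‖ ^ 2 ≤ ‖ℓ u‖ ^ 2 := by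
      intro p
      rw [← hN2, ← mul_pow]
      exact pow_le_pow_left₀ (by positivity) (hℓp p) 2
    have h2 : ∑ p : Fin n × Fin n, A * (n * n) * ‖inner ℂ (q p) (u i)‖ ^ 2
        ≤ ∑ _p : Fin n × Fin n, ‖ℓ u‖ ^ 2 := Finset.sum_le_sum fun p _ => h1 p
    rw [← Finset.mul_sum, Finset.sum_const, Finset.card_univ, Fintype.card_prod, Fintype.card_fin,
      nsmul_eq_mul] at h2
    push_cast at h2
    have h3 : (0 : ℝ) < n * n := by positivity
    nlinarith
  have hu1 := norm_jet_apply_le u i₁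
  have hu2 := norm_jet_apply_le u i₂
  have hfin : ‖u i‖ ^ 2 ≤ (ε * ‖u‖ + ‖ℓ u‖) ^ 2 := by
    have h1 : ‖u i₁‖ ^ 2 ≤ ‖u‖ ^ 2 := pow_le_pow_left₀ (norm_nonneg _) hu1 2
    have h2 : ‖u i₂‖ ^ 2 ≤ ‖u‖ ^ 2 := pow_le_pow_left₀ (norm_nonneg _) hu2 2
    have h3 : 4 * ((L / n) ^ 2 * ‖u i₁‖ ^ 2 + (H / n) ^ 2 * ‖u i₂‖ ^ 2)
        ≤ ε ^ 2 * ‖u‖ ^ 2 := by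
      have h5 : (2 * ((L + H) / n)) ^ 2 ≤ ε ^ 2 := pow_le_pow_left₀ (by positivity) hnε 2
      have h6 : (L / n) ^ 2 + (H / n) ^ 2 ≤ ((L + H) / n) ^ 2 := by
        rw [add_div]
        have : 0 ≤ L / n * (H / n) := hpos.le
        nlinarith
      calc 4 * ((L / n) ^ 2 * ‖u i₁‖ ^ 2 + (H / n) ^ 2 * ‖u i₂‖ ^ 2)
          ≤ 4 * ((L / n) ^ 2 * ‖u‖ ^ 2 + (H / n) ^ 2 * ‖u‖ ^ 2) := by gcongr
        _ = 4 * ((L / n) ^ 2 + (H / n) ^ 2) * ‖u‖ ^ 2 := by ring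
        _ ≤ 4 * ((L + H) / n) ^ 2 * ‖u‖ ^ 2 := by gcongr
        _ = (2 * ((L + H) / n)) ^ 2 * ‖u‖ ^ 2 := by ring
        _ ≤ _ := by gcongr
    have h4 : 0 ≤ ε * ‖u‖ * ‖ℓ u‖ := by positivity
    rw [hA] at hsum
    rw [add_sq, mul_pow]
    linarith
  exact (abs_le_of_sq_le_sq' hfin (by positivity)).2

end BiharmonicPML
end


/-! ### The stretching function -/

/-- The power `x ↦ (x⁺) ^ p` of the positive part is differentiable for `p > 1`. -/
theorem hasDerivAt_max_zero_rpow {p : ℝ} (hp : 1 < p) (x : ℝ) :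
    HasDerivAt (fun x : ℝ => max x 0 ^ p) (p * max x 0 ^ (p - 1)) x := by
  rcases lt_trichotomy x 0 with h | h | h
  · have h1 : (fun x : ℝ => max x 0 ^ p) =ᶠ[𝓝 x] fun _ => 0 := by
      filter_upwards [eventually_lt_nhds h] with y hy
      rw [max_eq_right hy.le, Real.zero_rpow (by linarith)]
    rw [max_eq_right h.le, Real.zero_rpow (by linarith), mul_zero]
    exact (hasDerivAt_const x (0 : ℝ)).congr_of_eventuallyEq h1
  · subst h
    have h2 := Real.hasDerivAt_rpow_const (x := 0) (p := p) (Or.inr hp.le)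
    rw [Real.zero_rpow (by linarith), mul_zero] at h2
    rw [max_self, Real.zero_rpow (by linarith), mul_zero]
    rw [hasDerivAt_iff_isLittleO] at h2 ⊢
    refine Asymptotics.IsBigO.trans_isLittleO (Asymptotics.IsBigO.of_bound 1 ?_) h2
    refine Eventually.of_forall fun y => ?_
    rw [max_self, Real.zero_rpow (by linarith)]
    simp only [sub_zero, smul_zero, one_mul]
    rcases le_total 0 y with hy | hy
    · rw [max_eq_left hy]
    · rw [max_eq_right hy, Real.zero_rpow (by linarith), norm_zero]
      exact norm_nonneg _
  · have h1 : (fun x : ℝ => max x 0 ^ p) =ᶠ[𝓝 x] fun x => x ^ p := by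
      filter_upwards [eventually_gt_nhds h] with y hy
      rw [max_eq_left hy.le]
    rw [max_eq_left h.le]
    exact (Real.hasDerivAt_rpow_const (Or.inl h.ne')).congr_of_eventuallyEq h1

noncomputable section

namespace BiharmonicPML

namespace Setup

/-- The standing assumptions on the data. -/
structure Admissible (P : Setup) : Prop where
  hΛ : 0 < P.Λ
  hh : P.h₂ < P.h₁
  hΔ₁ : 0 < P.Δh₁
  hΔ₂ : 0 < P.Δh₂
  hcavity : IsOpen P.cavity
  hencl : closure P.cavity ⊆ P.rect
  hθ : P.θ ∈ Set.Ioo (-(Real.pi / 2)) (Real.pi / 2)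
  hμ : P.μ ∈ Set.Ioo (0 : ℝ) 1
  hm : 3 < P.m
  hσ₁ : 0 < P.σ₁
  hσ₂ : 0 < P.σ₂
  hσ : Real.sqrt ((3 + P.μ) / (1 - P.μ)) * P.σ₂ < 1 + P.σ₁

variable (P : Setup)

/-- The height of the lower outer boundary. -/
def bot : ℝ := P.h₂ - P.Δh₂

/-- The height of the upper outer boundary. -/
def top : ℝ := P.h₁ + P.Δh₁

/-- The real profile of the stretching. -/
def τ (t : ℝ) : ℝ :=
  max ((t - P.h₁) / P.Δh₁) 0 ^ P.m + max ((P.h₂ - t) / P.Δh₂) 0 ^ P.m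

/-- The derivative of the profile. -/
def τ' (t : ℝ) : ℝ :=
  P.m * max ((t - P.h₁) / P.Δh₁) 0 ^ (P.m - 1) * (1 / P.Δh₁)
    + P.m * max ((P.h₂ - t) / P.Δh₂) 0 ^ (P.m - 1) * (-1 / P.Δh₂)

/-- Real part of the stretching. -/
def sx (t : ℝ) : ℝ := 1 + P.σ₁ * P.τ t

/-- Imaginary part of the stretching. -/
def sy (t : ℝ) : ℝ := P.σ₂ * P.τ t

/-- The derivative of the stretching. -/
def σ' (t : ℝ) : ℂ := (P.σ₁ + Complex.I * P.σ₂) * P.τ' t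

variable {P}

theorem Admissible.hasDerivAt_τ (hP : P.Admissible) (t : ℝ) : HasDerivAt P.τ (P.τ' t) t := by
  have hm : 1 < P.m := by linarith [hP.hm]
  have h1 : HasDerivAt (fun t => (t - P.h₁) / P.Δh₁) (1 / P.Δh₁) t :=
    ((hasDerivAt_id t).sub_const _).div_const _
  have h2 : HasDerivAt (fun t => (P.h₂ - t) / P.Δh₂) (-1 / P.Δh₂) t :=
    ((hasDerivAt_id t).const_sub _).div_const _
  exact ((hasDerivAt_max_zero_rpow hm _).comp t h1).add ((hasDerivAt_max_zero_rpow hm _).comp t h2)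

theorem Admissible.continuous_τ' (hP : P.Admissible) : Continuous P.τ' := by
  have hm : 0 ≤ P.m - 1 := by linarith [hP.hm]
  unfold τ'
  refine Continuous.add ?_ ?_
  · refine (continuous_const.mul (Continuous.rpow_const (by fun_prop) fun _ => Or.inr hm)).mul
      continuous_const
  · refine (continuous_const.mul (Continuous.rpow_const (by fun_prop) fun _ => Or.inr hm)).mul
      continuous_const

theorem τ_nonneg (t : ℝ) : 0 ≤ P.τ t := by
  unfold τ
  have h1 : 0 ≤ max ((t - P.h₁) / P.Δh₁) 0 := le_max_right _ _
  have h2 : 0 ≤ max ((P.h₂ - t) / P.Δh₂) 0 := le_max_right _ _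
  positivity

theorem Admissible.τ_le_one (hP : P.Admissible) {t : ℝ} (ht : t ∈ Set.Icc P.bot P.top) :
    P.τ t ≤ 1 := by
  have hm : 0 < P.m := by linarith [hP.hm]
  have h1 : (t - P.h₁) / P.Δh₁ ≤ 1 := by
    rw [div_le_one hP.hΔ₁]; have := ht.2; unfold top at this; linarith
  have h2 : (P.h₂ - t) / P.Δh₂ ≤ 1 := by
    rw [div_le_one hP.hΔ₂]; have := ht.1; unfold bot at this; linarith
  unfold τ
  rcases le_total t P.h₁ with h | h
  · have h3 : (t - P.h₁) / P.Δh₁ ≤ 0 := div_nonpos_of_nonpos_of_nonneg (by linarith) hP.hΔ₁.le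
    rw [max_eq_right h3, Real.zero_rpow hm.ne', zero_add]
    exact Real.rpow_le_one (le_max_right _ _) (max_le h2 zero_le_one) hm.le
  · have h3 : (P.h₂ - t) / P.Δh₂ ≤ 0 :=
      div_nonpos_of_nonpos_of_nonneg (by linarith [hP.hh]) hP.hΔ₂.le
    rw [max_eq_right h3, Real.zero_rpow hm.ne', add_zero]
    exact Real.rpow_le_one (le_max_right _ _) (max_le h1 zero_le_one) hm.le

/-- One formula covers the three cases because the positive parts vanish off their layers and 0 to
the power m is 0. It displays σ as a C¹ function whose values lie on a half-line from 1. -/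
theorem Admissible.σ_eq (hP : P.Admissible) (t : ℝ) :
    P.σ t = 1 + (P.σ₁ + Complex.I * P.σ₂) * P.τ t := by
  have hm : 0 < P.m := by linarith [hP.hm]
  unfold σ τ
  split_ifs with h1 h2
  · have h3 : (P.h₂ - t) / P.Δh₂ ≤ 0 :=
      div_nonpos_of_nonpos_of_nonneg (by linarith [hP.hh]) hP.hΔ₂.le
    have h4 : 0 ≤ (t - P.h₁) / P.Δh₁ := div_nonneg (by linarith) hP.hΔ₁.le
    rw [max_eq_right h3, Real.zero_rpow hm.ne', add_zero, max_eq_left h4]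
    ring
  · have h3 : (t - P.h₁) / P.Δh₁ ≤ 0 :=
      div_nonpos_of_nonpos_of_nonneg (by linarith [hP.hh]) hP.hΔ₁.le
    have h4 : 0 ≤ (P.h₂ - t) / P.Δh₂ := div_nonneg (by linarith) hP.hΔ₂.le
    rw [max_eq_right h3, Real.zero_rpow hm.ne', zero_add, max_eq_left h4]
    ring
  · have h3 : (t - P.h₁) / P.Δh₁ ≤ 0 :=
      div_nonpos_of_nonpos_of_nonneg (by linarith) hP.hΔ₁.le
    have h4 : (P.h₂ - t) / P.Δh₂ ≤ 0 := div_nonpos_of_nonpos_of_nonneg (by linarith) hP.hΔ₂.le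
    rw [max_eq_right h3, max_eq_right h4, Real.zero_rpow hm.ne']
    simp

theorem Admissible.σ_re (hP : P.Admissible) (t : ℝ) : (P.σ t).re = P.sx t := by
  rw [hP.σ_eq]; simp [sx]

theorem Admissible.σ_im (hP : P.Admissible) (t : ℝ) : (P.σ t).im = P.sy t := by
  rw [hP.σ_eq]; simp [sy]

theorem Admissible.one_le_sx (hP : P.Admissible) (t : ℝ) : 1 ≤ P.sx t := by
  have := mul_nonneg hP.hσ₁.le (τ_nonneg (P := P) t)
  unfold sx; linarith

theorem Admissible.sy_nonneg (hP : P.Admissible) (t : ℝ) : 0 ≤ P.sy t :=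
  mul_nonneg hP.hσ₂.le (τ_nonneg t)

theorem Admissible.σ_ne_zero (hP : P.Admissible) (t : ℝ) : P.σ t ≠ 0 := by
  intro h
  have h1 := hP.one_le_sx t
  rw [← hP.σ_re, h] at h1
  norm_num at h1

theorem Admissible.hasDerivAt_σ (hP : P.Admissible) (t : ℝ) : HasDerivAt P.σ (P.σ' t) t := by
  have h : P.σ = fun t => 1 + (P.σ₁ + Complex.I * P.σ₂) * (P.τ t : ℂ) := funext hP.σ_eq
  rw [h]
  exact ((hP.hasDerivAt_τ t).ofReal_comp.const_mul _).const_add _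

theorem Admissible.continuous_σ (hP : P.Admissible) : Continuous P.σ :=
  continuous_iff_continuousAt.mpr fun t => (hP.hasDerivAt_σ t).continuousAt

theorem Admissible.continuous_σ' (hP : P.Admissible) : Continuous P.σ' :=
  continuous_const.mul (Complex.continuous_ofReal.comp hP.continuous_τ')

theorem Admissible.deriv_inv_σ (hP : P.Admissible) (t : ℝ) :
    deriv (fun s => (P.σ s)⁻¹) t = -P.σ' t / P.σ t ^ 2 :=
  ((hP.hasDerivAt_σ t).inv (hP.σ_ne_zero t)).deriv

/-- The quantitative form of the sector condition on the stretching. -/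
theorem Admissible.exists_sector (hP : P.Admissible) :
    ∃ c > 0, ∀ t ∈ Set.Icc P.bot P.top,
      c ≤ (1 - P.μ) * P.sx t ^ 2 - (3 + P.μ) * P.sy t ^ 2 := by
  obtain ⟨hμ0, hμ1⟩ := hP.hμ
  have h1μ : 0 < 1 - P.μ := by linarith
  set r := Real.sqrt ((3 + P.μ) / (1 - P.μ)) with hr
  have hr0 : 0 ≤ r := Real.sqrt_nonneg _
  have hr2 : (1 - P.μ) * r ^ 2 = 3 + P.μ := by
    rw [hr, Real.sq_sqrt (by positivity)]; field_simp
  -- `sx - r * sy` is affine in the profile τ ∈ [0, 1], with end values 1 and 1 + σ₁ - rσ₂, so its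
  -- minimum is at an end.
  set d := min 1 (1 + P.σ₁ - r * P.σ₂) with hd
  have hd0 : 0 < d := lt_min one_pos (by linarith [hP.hσ])
  refine ⟨(1 - P.μ) * d, by positivity, fun t ht => ?_⟩
  have hτ0 := τ_nonneg (P := P) t
  have hτ1 := hP.τ_le_one ht
  have h1 : d ≤ P.sx t - r * P.sy t := by
    have e1 : d ≤ 1 := min_le_left _ _
    have e2 : d ≤ 1 + P.σ₁ - r * P.σ₂ := min_le_right _ _
    unfold sx sy
    nlinarith
  have h2 : 1 ≤ P.sx t + r * P.sy t := by
    have := hP.one_le_sx t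
    have := mul_nonneg hr0 (hP.sy_nonneg t)
    linarith
  have h3 : (1 - P.μ) * P.sx t ^ 2 - (3 + P.μ) * P.sy t ^ 2
      = (1 - P.μ) * ((P.sx t - r * P.sy t) * (P.sx t + r * P.sy t)) := by
    rw [← hr2]; ring
  rw [h3]
  have h4 : d ≤ (P.sx t - r * P.sy t) * (P.sx t + r * P.sy t) := by nlinarith
  gcongr

/-- A bound for the stretching in the computational domain. -/
theorem Admissible.sx_sq_add_sy_sq_le (hP : P.Admissible) {t : ℝ} (ht : t ∈ Set.Icc P.bot P.top) :
    P.sx t ^ 2 + P.sy t ^ 2 ≤ (1 + P.σ₁) ^ 2 + P.σ₂ ^ 2 := by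
  have hτ0 := τ_nonneg (P := P) t
  have hτ1 := hP.τ_le_one ht
  have h1 : P.sx t ≤ 1 + P.σ₁ := by unfold sx; nlinarith [hP.hσ₁]
  have h2 : P.sy t ≤ P.σ₂ := by unfold sy; nlinarith [hP.hσ₂]
  have := hP.one_le_sx t
  have := hP.sy_nonneg t
  gcongr

/-- Since (3 + μ)/(1 - μ) ≥ 3, the sector condition confines the argument of σ to [0, π/6]. This
weaker form is what the estimate off the real axis uses. -/
theorem Admissible.sx_sq_ge (hP : P.Admissible) {t : ℝ} (ht : t ∈ Set.Icc P.bot P.top) :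
    3 * P.sy t ^ 2 ≤ P.sx t ^ 2 := by
  obtain ⟨c, hc, h⟩ := hP.exists_sector
  obtain ⟨hμ0, hμ1⟩ := hP.hμ
  have := h t ht
  nlinarith [sq_nonneg (P.sx t), sq_nonneg (P.sy t), mul_nonneg hμ0.le (sq_nonneg (P.sx t)),
    mul_nonneg hμ0.le (sq_nonneg (P.sy t))]

/-! ### The domain -/

theorem domain_eq : P.domain
    = (Set.Ioo 0 (0 + P.Λ) ×ˢ Set.Ioo P.bot (P.bot + (P.top - P.bot))) \ closure P.cavity := by
  simp [domain, bot, top]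

theorem isBounded_domain : Bornology.IsBounded P.domain :=
  ((Metric.isBounded_Ioo _ _).prod (Metric.isBounded_Ioo _ _)).subset Set.sdiff_subset

theorem isOpen_domain : IsOpen P.domain :=
  (isOpen_Ioo.prod isOpen_Ioo).sdiff isClosed_closure

theorem snd_mem_of_mem_domain {x : ℝ × ℝ} (hx : x ∈ P.domain) : x.2 ∈ Set.Icc P.bot P.top :=
  ⟨hx.1.2.1.le, hx.1.2.2.le⟩

theorem Admissible.bot_lt_top (hP : P.Admissible) : P.bot < P.top := by
  unfold bot top; linarith [hP.hh, hP.hΔ₁, hP.hΔ₂]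

theorem ae_mem_domain : ∀ᵐ x ∂(volume : Measure (ℝ × ℝ)).restrict P.domain, x ∈ P.domain :=
  ae_restrict_mem isOpen_domain.measurableSet

end Setup

/-- The pointwise ellipticity of the principal part of the form. -/
theorem principal_part_ge {μ c R : ℝ} (hμ0 : 0 < μ) (hμ1 : μ < 1) (hc : 0 < c) {s : ℂ}
    (hx : 1 ≤ s.re) (hs : c ≤ (1 - μ) * s.re ^ 2 - (3 + μ) * s.im ^ 2)
    (hR : s.re ^ 2 + s.im ^ 2 ≤ R) (A B C : ℂ) :
    min (min (1 - μ) (c / R ^ 3)) ((2 - 2 * μ) / R) * (‖A‖ ^ 2 + ‖C‖ ^ 2 + ‖B‖ ^ 2) ≤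
      (s * A * conj A + μ * (s⁻¹ * B) * conj A + (2 - 2 * μ) * s⁻¹ * C * conj C
        + s⁻¹ * (s⁻¹ * (s⁻¹ * B)) * conj B + s⁻¹ * (μ * A) * conj B).re := by
  set x := s.re with hxd
  set y := s.im with hyd
  set r := x ^ 2 + y ^ 2 with hr
  have hr1 : 1 ≤ r := by nlinarith [sq_nonneg y]
  have hR1 : 1 ≤ R := hr1.trans hR
  have hr0 : 0 < r := by linarith
  have hR0 : 0 < R := by linarith
  have hns : Complex.normSq s = r := by rw [Complex.normSq_apply, hr]; ring
  have hire : (s⁻¹).re = x / r := by rw [Complex.inv_re, hns]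
  have hiim : (s⁻¹).im = -y / r := by rw [Complex.inv_im, hns]
  -- The Poisson terms are absorbed into the square of A + B/|s|². The price is μx‖A‖² and
  -- μx‖B‖²/r²; what is left for B has the factor (1 - μ)x² - (3 + μ)y², and this is the origin of
  -- the condition on σ₁ and σ₂.
  have key : (s * A * conj A + μ * (s⁻¹ * B) * conj A + (2 - 2 * μ) * s⁻¹ * C * conj C
        + s⁻¹ * (s⁻¹ * (s⁻¹ * B)) * conj B + s⁻¹ * (μ * A) * conj B).re
      = x * ((1 - μ) * ‖A‖ ^ 2 + μ * ((A.re + B.re / r) ^ 2 + (A.im + B.im / r) ^ 2))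
        + x * (((1 - μ) * x ^ 2 - (3 + μ) * y ^ 2) / r ^ 3) * ‖B‖ ^ 2
        + (2 - 2 * μ) * (x / r) * ‖C‖ ^ 2 := by
    simp only [← Complex.normSq_eq_norm_sq, Complex.normSq_apply, Complex.add_re, Complex.mul_re,
      Complex.mul_im, Complex.conj_re, Complex.conj_im, Complex.ofReal_re, Complex.ofReal_im,
      Complex.sub_re, Complex.sub_im, Complex.re_ofNat, Complex.im_ofNat, hire, hiim, ← hxd, ← hyd]
    have hr0' : r ≠ 0 := hr0.ne'
    field_simp
    rw [hr]
    ring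
  rw [key]
  set m := min (min (1 - μ) (c / R ^ 3)) ((2 - 2 * μ) / R) with hm
  have m1 : m ≤ 1 - μ := (min_le_left _ _).trans (min_le_left _ _)
  have m2 : m ≤ c / R ^ 3 := (min_le_left _ _).trans (min_le_right _ _)
  have m3 : m ≤ (2 - 2 * μ) / R := min_le_right _ _
  have hμ' : 0 < 1 - μ := by linarith
  have a1 : m * ‖A‖ ^ 2
      ≤ x * ((1 - μ) * ‖A‖ ^ 2 + μ * ((A.re + B.re / r) ^ 2 + (A.im + B.im / r) ^ 2)) := by
    have : 0 ≤ μ * ((A.re + B.re / r) ^ 2 + (A.im + B.im / r) ^ 2) := by positivity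
    have h2 : m * ‖A‖ ^ 2 ≤ (1 - μ) * ‖A‖ ^ 2 := by gcongr
    have h3 : 0 ≤ (1 - μ) * ‖A‖ ^ 2 := by positivity
    nlinarith
  have a2 : m * ‖B‖ ^ 2 ≤ x * (((1 - μ) * x ^ 2 - (3 + μ) * y ^ 2) / r ^ 3) * ‖B‖ ^ 2 := by
    have h1 : c / R ^ 3 ≤ ((1 - μ) * x ^ 2 - (3 + μ) * y ^ 2) / r ^ 3 := by gcongr; linarith
    have h2 : 0 < c / R ^ 3 := by positivity
    have h3 : m ≤ x * (((1 - μ) * x ^ 2 - (3 + μ) * y ^ 2) / r ^ 3) := by nlinarith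
    gcongr
  have a3 : m * ‖C‖ ^ 2 ≤ (2 - 2 * μ) * (x / r) * ‖C‖ ^ 2 := by
    have h1 : (2 - 2 * μ) / R ≤ (2 - 2 * μ) * (x / r) := by
      rw [div_eq_mul_one_div]
      have : 0 ≤ 2 - 2 * μ := by linarith
      gcongr
    have h3 := m3.trans h1
    gcongr
  linarith

end BiharmonicPML
end


theorem integral_add_add {α E : Type*} [MeasurableSpace α] {μ : Measure α}
    [NormedAddCommGroup E] [NormedSpace ℝ E] {f g h : α → E} (hf : Integrable f μ)
    (hg : Integrable g μ) (hh : Integrable h μ) :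
    ∫ x, f x + g x + h x ∂μ = ∫ x, f x ∂μ + ∫ x, g x ∂μ + ∫ x, h x ∂μ := by
  rw [← integral_add hf hg]
  exact integral_add (hf.add hg) hh

noncomputable section

namespace BiharmonicPML

/-! ### Multiplication operators and operators on jets -/

section Operators

variable {D : Set (ℝ × ℝ)}

/-- Multiplication by a bounded function on `L²(D)`. -/
def mulL (D : Set (ℝ × ℝ)) (c : ℝ × ℝ → ℂ) : L2 D →L[ℂ] L2 D :=
  open Classical in
  if h : MemLp c ⊤ (volume.restrict D) then
    (ContinuousLinearMap.mul ℂ ℂ).holderL (volume.restrict D) ⊤ 2 2 (h.toLp c) else 0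

theorem coeFn_mulL {c : ℝ × ℝ → ℂ} (h : MemLp c ⊤ (volume.restrict D)) (f : L2 D) :
    mulL D c f =ᵐ[volume.restrict D] fun x => c x * f x := by
  rw [mulL, dif_pos h]
  have h1 := (ContinuousLinearMap.mul ℂ ℂ).coeFn_holder (r := 2) (h.toLp c) f
  filter_upwards [h1, h.coeFn_toLp] with x hx hx2
  rw [← hx2]
  exact hx

/-- The components of a jet. -/
def pr (D : Set (ℝ × ℝ)) (i : Fin 6) : Jet D →L[ℂ] L2 D := PiLp.proj 2 (fun _ : Fin 6 => L2 D) i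

/-- The jet with a single nonzero component. -/
def inj (D : Set (ℝ × ℝ)) (i : Fin 6) : L2 D →L[ℂ] Jet D :=
  (PiLp.continuousLinearEquiv 2 ℂ (fun _ : Fin 6 => L2 D)).symm.toContinuousLinearMap ∘L
    ContinuousLinearMap.single ℂ (fun _ : Fin 6 => L2 D) i

@[simp]
theorem pr_apply (i : Fin 6) (u : Jet D) : pr D i u = u i := rfl

theorem inj_apply (i j : Fin 6) (f : L2 D) : inj D i f j = if j = i then f else 0 := by
  change (Pi.single i f : Fin 6 → L2 D) j = _
  rw [Pi.single_apply]

theorem inner_inj (u : Jet D) (i : Fin 6) (f : L2 D) :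
    inner ℂ u (inj D i f) = inner ℂ (u i) f := by
  rw [PiLp.inner_apply, Finset.sum_eq_single i]
  · rw [inj_apply, if_pos rfl]
  · intro j _ hj
    rw [inj_apply, if_neg hj, inner_zero_right]
  · simp

theorem adjoint_pr (i : Fin 6) : ContinuousLinearMap.adjoint (pr D i) = inj D i := by
  refine (ContinuousLinearMap.ext fun f => ?_)
  refine ext_inner_left ℂ fun u => ?_
  rw [ContinuousLinearMap.adjoint_inner_right, inner_inj, pr_apply]

theorem inner_L2 (f g : L2 D) : inner ℂ f g = ∫ x in D, g x * conj (f x) := by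
  rw [L2.inner_def]
  refine integral_congr_ae (Eventually.of_forall fun x => ?_)
  simp [RCLike.inner_apply]

theorem integrable_mul_conj (f g : L2 D) :
    Integrable (fun x => g x * conj (f x)) (volume.restrict D) := by
  refine (L2.integrable_inner (𝕜 := ℂ) f g).congr (Eventually.of_forall fun x => ?_)
  simp [RCLike.inner_apply]

/-- First order part in `α` of the action on jets of the multiplication by `exp(iαx₁)`. -/
def N₁ (D : Set (ℝ × ℝ)) : Jet D →L[ℂ] Jet D :=
  inj D 1 ∘L (Complex.I • pr D 0) + inj D 3 ∘L ((2 * Complex.I) • pr D 1)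
    + inj D 4 ∘L (Complex.I • pr D 2)

/-- Second order part in `α` of the action on jets of the multiplication by `exp(iαx₁)`. -/
def N₂ (D : Set (ℝ × ℝ)) : Jet D →L[ℂ] Jet D := inj D 3 ∘L (-pr D 0)

/-- The action on jets of the conjugation of derivatives by `exp(iαx₁)`: `∂₁` becomes
`∂₁ + iα`. -/
def N (D : Set (ℝ × ℝ)) (z : ℂ) : Jet D →L[ℂ] Jet D :=
  ContinuousLinearMap.id ℂ _ + z • N₁ D + z ^ 2 • N₂ D

theorem N_apply_zero (z : ℂ) (u : Jet D) : N D z u 0 = u 0 := by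
  simp [N, N₁, N₂, inj_apply]

theorem N_apply_one (z : ℂ) (u : Jet D) : N D z u 1 = u 1 + (Complex.I * z) • u 0 := by
  simp [N, N₁, N₂, inj_apply, smul_smul, mul_comm]

theorem N_apply_two (z : ℂ) (u : Jet D) : N D z u 2 = u 2 := by
  simp [N, N₁, N₂, inj_apply]

theorem N_apply_three (z : ℂ) (u : Jet D) :
    N D z u 3 = u 3 + (2 * Complex.I * z) • u 1 - z ^ 2 • u 0 := by
  simp [N, N₁, N₂, inj_apply, smul_smul, mul_comm, sub_eq_add_neg]

theorem N_apply_four (z : ℂ) (u : Jet D) : N D z u 4 = u 4 + (Complex.I * z) • u 2 := by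
  simp [N, N₁, N₂, inj_apply, smul_smul, mul_comm]

theorem N_apply_five (z : ℂ) (u : Jet D) : N D z u 5 = u 5 := by
  simp [N, N₁, N₂, inj_apply]

end Operators

/-! ### Operators on jets that represent the sesquilinear form -/

namespace Setup

variable (P : Setup)

/-- The coefficient `σ` as a function on the plane. -/
def c₀ (x : ℝ × ℝ) : ℂ := P.σ x.2

/-- The coefficient `1/σ` as a function on the plane. -/
def c₁ (x : ℝ × ℝ) : ℂ := (P.σ x.2)⁻¹

/-- The coefficient `(1/σ)'` as a function on the plane. -/
def c₂ (x : ℝ × ℝ) : ℂ := deriv (fun s => (P.σ s)⁻¹) x.2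

/-- The operator `u ↦ ∂₂((1/σ)∂₂u)` on jets. -/
def opW : Jet P.domain →L[ℂ] L2 P.domain :=
  mulL P.domain P.c₁ ∘L pr P.domain 5 + mulL P.domain P.c₂ ∘L pr P.domain 2

/-- The operator on jets that represents the form without its term of order zero. -/
def opT : Jet P.domain →L[ℂ] Jet P.domain :=
  inj P.domain 2 ∘L mulL P.domain P.c₂ ∘L
      (mulL P.domain P.c₁ ∘L P.opW + (P.μ : ℂ) • pr P.domain 3)
    + inj P.domain 3 ∘L (mulL P.domain P.c₀ ∘L pr P.domain 3 + (P.μ : ℂ) • P.opW)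
    + inj P.domain 4 ∘L ((2 - 2 * P.μ : ℂ) • mulL P.domain P.c₁ ∘L pr P.domain 4)
    + inj P.domain 5 ∘L mulL P.domain P.c₁ ∘L
      (mulL P.domain P.c₁ ∘L P.opW + (P.μ : ℂ) • pr P.domain 3)

/-- The operator on jets that represents the term of order zero. -/
def opS : Jet P.domain →L[ℂ] Jet P.domain :=
  inj P.domain 0 ∘L mulL P.domain P.c₀ ∘L pr P.domain 0

/-- The principal part of `opT`, made coercive by lower order terms. -/
def opC : Jet P.domain →L[ℂ] Jet P.domain :=
  inj P.domain 3 ∘L (mulL P.domain P.c₀ ∘L pr P.domain 3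
      + (P.μ : ℂ) • mulL P.domain P.c₁ ∘L pr P.domain 5)
    + inj P.domain 4 ∘L ((2 - 2 * P.μ : ℂ) • mulL P.domain P.c₁ ∘L pr P.domain 4)
    + inj P.domain 5 ∘L mulL P.domain P.c₁ ∘L
      (mulL P.domain P.c₁ ∘L mulL P.domain P.c₁ ∘L pr P.domain 5 + (P.μ : ℂ) • pr P.domain 3)
    + (inj P.domain 0 ∘L pr P.domain 0 + inj P.domain 1 ∘L pr P.domain 1
      + inj P.domain 2 ∘L pr P.domain 2)

/-- The density of the form without its term of order zero. -/
def density (t : ℝ) (U V : Fin 6 → ℂ) : ℂ :=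
  P.σ t * U 3 * conj (V 3)
    + P.μ * P.D2InvSigma t (U 2) (U 5) * conj (V 3)
    + (2 - 2 * P.μ) / P.σ t * conj (V 4) * U 4
    + 1 / P.σ t * P.D2InvSigma t (U 2) (U 5) * P.D2InvSigma t (conj (V 2)) (conj (V 5))
    + P.μ * U 3 * P.D2InvSigma t (conj (V 2)) (conj (V 5))

variable {P}

theorem Admissible.memLp_c₀ (hP : P.Admissible) : MemLp P.c₀ ⊤ (volume.restrict P.domain) :=
  memLp_of_continuous isBounded_domain (hP.continuous_σ.comp continuous_snd) _

theorem Admissible.memLp_c₁ (hP : P.Admissible) : MemLp P.c₁ ⊤ (volume.restrict P.domain) :=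
  memLp_of_continuous isBounded_domain
    ((hP.continuous_σ.comp continuous_snd).inv₀ fun x => hP.σ_ne_zero x.2) _

theorem Admissible.memLp_c₂ (hP : P.Admissible) : MemLp P.c₂ ⊤ (volume.restrict P.domain) := by
  refine memLp_of_continuous isBounded_domain ?_ _
  have h : P.c₂ = fun x => -P.σ' x.2 / P.σ x.2 ^ 2 := funext fun x => hP.deriv_inv_σ x.2
  rw [h]
  exact ((hP.continuous_σ'.comp continuous_snd).neg).div₀
    ((hP.continuous_σ.comp continuous_snd).pow 2) fun x => pow_ne_zero 2 (hP.σ_ne_zero x.2)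

theorem Admissible.coeFn_opW (hP : P.Admissible) (u : Jet P.domain) :
    P.opW u =ᵐ[volume.restrict P.domain] fun x => P.D2InvSigma x.2 (u 2 x) (u 5 x) := by
  have h1 := coeFn_mulL hP.memLp_c₁ (u 5)
  have h2 := coeFn_mulL hP.memLp_c₂ (u 2)
  have h3 := Lp.coeFn_add (mulL P.domain P.c₁ (u 5)) (mulL P.domain P.c₂ (u 2))
  filter_upwards [h1, h2, h3] with x h1 h2 h3
  change (mulL P.domain P.c₁ (u 5) + mulL P.domain P.c₂ (u 2) : L2 P.domain) x = _
  rw [h3, Pi.add_apply, h1, h2]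
  rfl

/-- The operator `opT` represents the form; the density is integrable. -/
theorem Admissible.inner_opT (hP : P.Admissible) (u v : Jet P.domain) :
    Integrable (fun x => P.density x.2 (fun i => u i x) (fun i => v i x))
        (volume.restrict P.domain) ∧
      inner ℂ v (P.opT u)
        = ∫ x in P.domain, P.density x.2 (fun i => u i x) (fun i => v i x) := by
  set Y : L2 P.domain := mulL P.domain P.c₁ (P.opW u) + (P.μ : ℂ) • u 3 with hY
  set X₂ : L2 P.domain := mulL P.domain P.c₂ Y with hX₂
  set X₃ : L2 P.domain := mulL P.domain P.c₀ (u 3) + (P.μ : ℂ) • P.opW u with hX₃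
  set X₄ : L2 P.domain := (2 - 2 * P.μ : ℂ) • mulL P.domain P.c₁ (u 4) with hX₄
  set X₅ : L2 P.domain := mulL P.domain P.c₁ Y with hX₅
  have hT : P.opT u = inj P.domain 2 X₂ + inj P.domain 3 X₃ + inj P.domain 4 X₄
      + inj P.domain 5 X₅ := rfl
  have hae : (fun x => P.density x.2 (fun i => u i x) (fun i => v i x))
      =ᵐ[volume.restrict P.domain] fun x => X₂ x * conj (v 2 x) + X₃ x * conj (v 3 x)
        + X₄ x * conj (v 4 x) + X₅ x * conj (v 5 x) := by
    filter_upwards [hP.coeFn_opW u, coeFn_mulL hP.memLp_c₁ (P.opW u), coeFn_mulL hP.memLp_c₂ Y,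
      coeFn_mulL hP.memLp_c₁ Y, coeFn_mulL hP.memLp_c₀ (u 3), coeFn_mulL hP.memLp_c₁ (u 4),
      Lp.coeFn_add (mulL P.domain P.c₁ (P.opW u)) ((P.μ : ℂ) • u 3),
      Lp.coeFn_smul (P.μ : ℂ) (u 3), Lp.coeFn_smul (P.μ : ℂ) (P.opW u),
      Lp.coeFn_add (mulL P.domain P.c₀ (u 3)) ((P.μ : ℂ) • P.opW u),
      Lp.coeFn_smul (2 - 2 * P.μ : ℂ) (mulL P.domain P.c₁ (u 4))] with x e1 e2 e3 e4 e5 e6 e7 e8 e9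
      e10 e11
    simp only [hX₂, hX₃, hX₄, hX₅, e3, e4, e10, e11, Pi.add_apply, Pi.smul_apply, e5, e9, e6,
      smul_eq_mul]
    rw [hY, e7]
    simp only [Pi.add_apply, e2, e8, Pi.smul_apply, smul_eq_mul, e1]
    simp only [density, D2InvSigma, c₀, c₁, c₂]
    field_simp [hP.σ_ne_zero x.2]
    ring
  have i2 := integrable_mul_conj (v 2) X₂
  have i3 := integrable_mul_conj (v 3) X₃
  have i4 := integrable_mul_conj (v 4) X₄
  have i5 := integrable_mul_conj (v 5) X₅
  refine ⟨(((i2.add i3).add i4).add i5).congr hae.symm, ?_⟩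
  have i234 : Integrable (fun x => X₂ x * conj (v 2 x) + X₃ x * conj (v 3 x) + X₄ x * conj (v 4 x))
      (volume.restrict P.domain) := (i2.add i3).add i4
  rw [integral_congr_ae hae, integral_add i234 i5, integral_add_add i2 i3 i4, hT, inner_add_right, inner_add_right, inner_add_right, inner_inj,
    inner_inj, inner_inj, inner_inj, inner_L2, inner_L2, inner_L2, inner_L2]

theorem Admissible.inner_opS (hP : P.Admissible) (u v : Jet P.domain) :
    Integrable (fun x => P.σ x.2 * u 0 x * conj (v 0 x)) (volume.restrict P.domain) ∧
      inner ℂ v (P.opS u) = ∫ x in P.domain, P.σ x.2 * u 0 x * conj (v 0 x) := by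
  have hS : P.opS u = inj P.domain 0 (mulL P.domain P.c₀ (u 0)) := rfl
  have hae : (fun x => P.σ x.2 * u 0 x * conj (v 0 x)) =ᵐ[volume.restrict P.domain]
      fun x => mulL P.domain P.c₀ (u 0) x * conj (v 0 x) := by
    filter_upwards [coeFn_mulL hP.memLp_c₀ (u 0)] with x e1
    rw [e1]; rfl
  refine ⟨(integrable_mul_conj (v 0) _).congr hae.symm, ?_⟩
  rw [hS, inner_inj, inner_L2, integral_congr_ae hae]

/-- Coercivity of the principal part. -/
theorem Admissible.exists_coercive (hP : P.Admissible) :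
    ∃ c > 0, ∀ u : Jet P.domain, c * ‖u‖ ^ 2 ≤ (inner ℂ u (P.opC u)).re := by
  obtain ⟨c, hc, hsec⟩ := hP.exists_sector
  obtain ⟨hμ0, hμ1⟩ := hP.hμ
  set R := (1 + P.σ₁) ^ 2 + P.σ₂ ^ 2 with hR
  set m := min (min (1 - P.μ) (c / R ^ 3)) ((2 - 2 * P.μ) / R) with hm
  have hR0 : 0 < R := by have := hP.hσ₁; positivity
  have hm0 : 0 < m := by
    refine lt_min (lt_min (by linarith) (by positivity)) (div_pos (by linarith) hR0)
  -- m is the ellipticity constant for the second derivatives; the components of order at most one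
  -- enter `opC` with coefficient 1.
  refine ⟨min m 1, lt_min hm0 one_pos, fun u => ?_⟩
  set Y : L2 P.domain := mulL P.domain P.c₁ (mulL P.domain P.c₁ (u 5)) + (P.μ : ℂ) • u 3 with hY
  set X₃ : L2 P.domain := mulL P.domain P.c₀ (u 3) + (P.μ : ℂ) • mulL P.domain P.c₁ (u 5) with hX₃
  set X₄ : L2 P.domain := (2 - 2 * P.μ : ℂ) • mulL P.domain P.c₁ (u 4) with hX₄
  set X₅ : L2 P.domain := mulL P.domain P.c₁ Y with hX₅
  have hC : P.opC u = inj P.domain 3 X₃ + inj P.domain 4 X₄ + inj P.domain 5 X₅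
      + (inj P.domain 0 (u 0) + inj P.domain 1 (u 1) + inj P.domain 2 (u 2)) := rfl
  have hae : ∀ᵐ x ∂(volume : Measure (ℝ × ℝ)).restrict P.domain,
      m * (‖u 3 x‖ ^ 2 + ‖u 4 x‖ ^ 2 + ‖u 5 x‖ ^ 2)
        ≤ (X₃ x * conj (u 3 x) + X₄ x * conj (u 4 x) + X₅ x * conj (u 5 x)).re := by
    filter_upwards [ae_mem_domain (P := P), coeFn_mulL hP.memLp_c₁ (u 5),
      coeFn_mulL hP.memLp_c₁ (mulL P.domain P.c₁ (u 5)),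
      coeFn_mulL hP.memLp_c₁ Y, coeFn_mulL hP.memLp_c₀ (u 3), coeFn_mulL hP.memLp_c₁ (u 4),
      Lp.coeFn_add (mulL P.domain P.c₁ (mulL P.domain P.c₁ (u 5))) ((P.μ : ℂ) • u 3),
      Lp.coeFn_smul (P.μ : ℂ) (u 3), Lp.coeFn_smul (P.μ : ℂ) (mulL P.domain P.c₁ (u 5)),
      Lp.coeFn_add (mulL P.domain P.c₀ (u 3)) ((P.μ : ℂ) • mulL P.domain P.c₁ (u 5)),
      Lp.coeFn_smul (2 - 2 * P.μ : ℂ) (mulL P.domain P.c₁ (u 4))] with x hx e1 e2 e3 e4 e5 e6 e7 e8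
      e9 e10
    have hx2 := snd_mem_of_mem_domain hx
    have hre := hP.σ_re x.2
    have him := hP.σ_im x.2
    have key := principal_part_ge (s := P.σ x.2) (R := R) hμ0 hμ1 hc (by rw [hre]; exact hP.one_le_sx _)
      (by rw [hre, him]; exact hsec _ hx2) (by rw [hre, him]; exact hP.sx_sq_add_sy_sq_le hx2)
      (u 3 x) (u 5 x) (u 4 x)
    refine key.trans (le_of_eq ?_)
    congr 1
    simp only [hX₃, hX₄, hX₅, e3, e9, e10, Pi.add_apply, Pi.smul_apply, e4, e8, e5, smul_eq_mul,
      e1]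
    rw [hY, e6]
    simp only [Pi.add_apply, e2, e7, Pi.smul_apply, smul_eq_mul, e1, c₀, c₁]
    ring
  have i3 := integrable_mul_conj (u 3) X₃
  have i4 := integrable_mul_conj (u 4) X₄
  have i5 := integrable_mul_conj (u 5) X₅
  have hn : ∀ f : L2 P.domain, Integrable (fun x => ‖f x‖ ^ 2) (volume.restrict P.domain) ∧
      ∫ x in P.domain, ‖f x‖ ^ 2 = ‖f‖ ^ 2 := by
    intro f
    have h1 : Integrable (fun x => ‖f x‖ ^ 2) (volume.restrict P.domain) :=
      (memLp_two_iff_integrable_sq_norm (Lp.aestronglyMeasurable f)).mp (Lp.memLp f)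
    refine ⟨h1, ?_⟩
    have h2 := inner_self_eq_norm_sq (𝕜 := ℂ) f
    rw [← h2, inner_L2]
    have h3 := integral_re (𝕜 := ℂ) (integrable_mul_conj f f)
    rw [← h3]
    refine integral_congr_ae (Eventually.of_forall fun x => ?_)
    simp only [Complex.mul_conj, Complex.normSq_eq_norm_sq]
    exact (Complex.ofReal_re _).symm
  have hprinc : m * (‖u 3‖ ^ 2 + ‖u 4‖ ^ 2 + ‖u 5‖ ^ 2)
      ≤ (inner ℂ (u 3) X₃ + inner ℂ (u 4) X₄ + inner ℂ (u 5) X₅ : ℂ).re := by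
    have e1 : (inner ℂ (u 3) X₃ + inner ℂ (u 4) X₄ + inner ℂ (u 5) X₅ : ℂ)
        = ∫ x in P.domain, (X₃ x * conj (u 3 x) + X₄ x * conj (u 4 x) + X₅ x * conj (u 5 x)) := by
      rw [integral_add_add i3 i4 i5, inner_L2, inner_L2, inner_L2]
    have e2 : (∫ x in P.domain, (X₃ x * conj (u 3 x) + X₄ x * conj (u 4 x)
          + X₅ x * conj (u 5 x))).re
        = ∫ x in P.domain, (X₃ x * conj (u 3 x) + X₄ x * conj (u 4 x) + X₅ x * conj (u 5 x)).re :=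
      (integral_re (𝕜 := ℂ) ((i3.add i4).add i5)).symm
    rw [e1, e2]
    have e3 : m * (‖u 3‖ ^ 2 + ‖u 4‖ ^ 2 + ‖u 5‖ ^ 2)
        = ∫ x in P.domain, m * (‖u 3 x‖ ^ 2 + ‖u 4 x‖ ^ 2 + ‖u 5 x‖ ^ 2) := by
      rw [integral_const_mul, integral_add_add (hn (u 3)).1 (hn (u 4)).1 (hn (u 5)).1, (hn _).2,
        (hn _).2, (hn _).2]
    rw [e3]
    exact integral_mono_ae ((((hn _).1.add (hn _).1).add (hn _).1).const_mul m)
      ((i3.add i4).add i5).re hae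
  have hlow : ∀ f : L2 P.domain, (inner ℂ f f : ℂ).re = ‖f‖ ^ 2 := fun f =>
    inner_self_eq_norm_sq (𝕜 := ℂ) f
  rw [hC]
  simp only [inner_add_right, inner_inj, Complex.add_re, hlow] at hprinc ⊢
  have hsum : ‖u‖ ^ 2 = ‖u 0‖ ^ 2 + ‖u 1‖ ^ 2 + ‖u 2‖ ^ 2 + ‖u 3‖ ^ 2 + ‖u 4‖ ^ 2 + ‖u 5‖ ^ 2 := by
    rw [PiLp.norm_sq_eq_of_L2, Fin.sum_univ_six]
  rw [hsum]
  have q1 : min m 1 ≤ m := min_le_left _ _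
  have q2 : min m 1 ≤ 1 := min_le_right _ _
  have a3 : min m 1 * (‖u 3‖ ^ 2 + ‖u 4‖ ^ 2 + ‖u 5‖ ^ 2)
      ≤ m * (‖u 3‖ ^ 2 + ‖u 4‖ ^ 2 + ‖u 5‖ ^ 2) := by gcongr
  have a0 : min m 1 * (‖u 0‖ ^ 2 + ‖u 1‖ ^ 2 + ‖u 2‖ ^ 2)
      ≤ 1 * (‖u 0‖ ^ 2 + ‖u 1‖ ^ 2 + ‖u 2‖ ^ 2) := by gcongr
  linarith

end Setup

end BiharmonicPML
end


/-! ### Compact remainders and the expansion in powers of the wavenumber -/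

noncomputable section

namespace BiharmonicPML

/-- Terms of a form in which one of the factors is of lower order are compact. -/
theorem exists_isCompactOperator_remainder {H E F : Type*} [NormedAddCommGroup H]
    [InnerProductSpace ℂ H] [CompleteSpace H] [NormedAddCommGroup E] [InnerProductSpace ℂ E]
    [CompleteSpace E] [NormedAddCommGroup F] [InnerProductSpace ℂ F] [CompleteSpace F]
    {ι : H →L[ℂ] E} {T C : E →L[ℂ] E} {p₀ p₁ p₂ R : E →L[ℂ] F} {j₀ j₁ Y : F →L[ℂ] E}
    (h₀ : IsCompactOperator (p₀ ∘L ι)) (h₁ : IsCompactOperator (p₁ ∘L ι))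
    (h₂ : IsCompactOperator (p₂ ∘L ι))
    (hT : T = C + ContinuousLinearMap.adjoint p₂ ∘L R + Y ∘L p₂ - j₀ ∘L p₀ - j₁ ∘L p₁) :
    ∃ K : H →L[ℂ] H, IsCompactOperator K ∧
      ContinuousLinearMap.adjoint ι ∘L T ∘L ι = ContinuousLinearMap.adjoint ι ∘L C ∘L ι + K := by
  set ι' := ContinuousLinearMap.adjoint ι with hι'
  -- A lower order factor on the side of the test function appears as the adjoint of a compact
  -- operator, which is again compact.
  refine ⟨ContinuousLinearMap.adjoint (p₂ ∘L ι) ∘L (R ∘L ι) + (ι' ∘L Y) ∘L (p₂ ∘L ι)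
    - (ι' ∘L j₀) ∘L (p₀ ∘L ι) - (ι' ∘L j₁) ∘L (p₁ ∘L ι), ?_, ?_⟩
  · exact (((h₂.adjoint.comp_clm (R ∘L ι)).add (h₂.clm_comp (ι' ∘L Y))).sub
      (h₀.clm_comp (ι' ∘L j₀))).sub (h₁.clm_comp (ι' ∘L j₁))
  · rw [ContinuousLinearMap.adjoint_comp, hT]
    refine ContinuousLinearMap.ext fun u => ?_
    simp only [add_apply, sub_apply, ContinuousLinearMap.comp_apply, map_add, map_sub]
    abel

/-- Expansion in powers of `κ` of a form with derivatives conjugated by an exponential. -/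
theorem exists_pencil_expansion {H E : Type*} [NormedAddCommGroup H] [InnerProductSpace ℂ H]
    [CompleteSpace H] [NormedAddCommGroup E] [InnerProductSpace ℂ E] [CompleteSpace E]
    (ι : H →L[ℂ] E) (M₁ M₂ T S : E →L[ℂ] E) {s : ℂ} (hs : conj s = s) {C K₀ : H →L[ℂ] H}
    (hTK : ContinuousLinearMap.adjoint ι ∘L T ∘L ι = C + K₀) (hK₀ : IsCompactOperator K₀)
    (h₁ : IsCompactOperator (M₁ ∘L ι)) (h₂ : IsCompactOperator (M₂ ∘L ι))
    (hS : IsCompactOperator (S ∘L ι)) :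
    ∃ K : Fin 5 → H →L[ℂ] H, (∀ j, IsCompactOperator (K j)) ∧ ∀ (κ : ℂ) (u : H),
      (ContinuousLinearMap.adjoint ι ∘L
        (ContinuousLinearMap.adjoint (ContinuousLinearMap.id ℂ E + conj (κ * s) • M₁
            + conj (κ * s) ^ 2 • M₂) ∘L T ∘L
          (ContinuousLinearMap.id ℂ E + (κ * s) • M₁ + (κ * s) ^ 2 • M₂) - κ ^ 4 • S) ∘L ι) u
        = C u + ∑ j : Fin 5, κ ^ (j : ℕ) • K j u := by
  set ι' := ContinuousLinearMap.adjoint ι with hι'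
  set A₁ : H →L[ℂ] E := s • (M₁ ∘L ι) with hA₁
  set A₂ : H →L[ℂ] E := s ^ 2 • (M₂ ∘L ι) with hA₂
  set A₁' := ContinuousLinearMap.adjoint A₁ with hA₁'
  set A₂' := ContinuousLinearMap.adjoint A₂ with hA₂'
  have c1 : IsCompactOperator A₁ := h₁.smul s
  have c2 : IsCompactOperator A₂ := h₂.smul (s ^ 2)
  have c1' : IsCompactOperator A₁' := c1.adjoint
  have c2' : IsCompactOperator A₂' := c2.adjoint
  -- Coefficients sorted by total degree in κ. Only the term of degree zero without `A₁`, `A₂` is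
  -- not compact, and it is C + K₀ by assumption.
  refine ⟨![K₀, A₁' ∘L (T ∘L ι) + (ι' ∘L T) ∘L A₁,
    A₂' ∘L (T ∘L ι) + A₁' ∘L (T ∘L A₁) + (ι' ∘L T) ∘L A₂,
    A₂' ∘L (T ∘L A₁) + A₁' ∘L (T ∘L A₂),
    A₂' ∘L (T ∘L A₂) - ι' ∘L (S ∘L ι)], ?_, ?_⟩
  · intro j
    fin_cases j
    · exact hK₀
    · exact (c1'.comp_clm _).add (c1.clm_comp (ι' ∘L T))
    · exact ((c2'.comp_clm _).add (c1'.comp_clm _)).add (c2.clm_comp (ι' ∘L T))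
    · exact (c2'.comp_clm _).add (c1'.comp_clm _)
    · exact (c2'.comp_clm _).sub (hS.clm_comp ι')
  · intro κ u
    have hN : (ContinuousLinearMap.id ℂ E + (κ * s) • M₁ + (κ * s) ^ 2 • M₂) ∘L ι
        = ι + κ • A₁ + κ ^ 2 • A₂ := by
      refine ContinuousLinearMap.ext fun u => ?_
      simp only [hA₁, hA₂, add_apply, smul_apply, ContinuousLinearMap.comp_apply,
        ContinuousLinearMap.id_apply, smul_smul, mul_pow]
    -- Taking the adjoint undoes the conjugation of κ, and s is self-conjugate; hence powers of κ
    -- appear, and none of its conjugate.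
    have hN' : ι' ∘L ContinuousLinearMap.adjoint (ContinuousLinearMap.id ℂ E
        + conj (κ * s) • M₁ + conj (κ * s) ^ 2 • M₂) = ι' + κ • A₁' + κ ^ 2 • A₂' := by
      have e1 : (ContinuousLinearMap.id ℂ E + conj (κ * s) • M₁ + conj (κ * s) ^ 2 • M₂) ∘L ι
          = ι + conj κ • A₁ + (conj κ) ^ 2 • A₂ := by
        refine ContinuousLinearMap.ext fun u => ?_
        simp only [hA₁, hA₂, add_apply, smul_apply, ContinuousLinearMap.comp_apply,
          ContinuousLinearMap.id_apply, smul_smul, mul_pow, map_mul, hs]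
      rw [hι', ← ContinuousLinearMap.adjoint_comp, e1]
      simp [hA₁', hA₂', map_smulₛₗ]
    have hTu : ι' (T (ι u)) = C u + K₀ u := congrArg (fun L : H →L[ℂ] H => L u) hTK
    have hNu := congrArg (fun L : H →L[ℂ] E => L u) hN
    have hN'v := fun v : E => congrArg (fun L : E →L[ℂ] H => L v) hN'
    simp only [ContinuousLinearMap.comp_apply] at hNu hN'v
    simp only [ContinuousLinearMap.comp_apply, sub_apply, map_sub, smul_apply, map_smul]
    rw [hNu, hN'v, Fin.sum_univ_five]
    simp only [sub_apply, add_apply, smul_apply, ContinuousLinearMap.comp_apply, map_add, map_smul,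
      hTu, Matrix.cons_val, Fin.val_zero, Fin.val_one, pow_zero, pow_one, one_smul, Fin.val_two]
    simp only [smul_add, smul_sub, smul_smul, show ((3 : Fin 5) : ℕ) = 3 from rfl,
      show ((4 : Fin 5) : ℕ) = 4 from rfl]
    module


/-! ### Jets of smooth functions -/

theorem pd_add {f g : ℝ × ℝ → ℂ} (hf : ContDiff ℝ ∞ f) (hg : ContDiff ℝ ∞ g) (e : ℝ × ℝ) :
    pd e (f + g) = pd e f + pd e g := by
  ext x
  simp only [pd, Pi.add_apply]
  rw [fderiv_add (hf.differentiable (by simp) x) (hg.differentiable (by simp) x)]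
  rfl

theorem pd_smul {f : ℝ × ℝ → ℂ} (hf : ContDiff ℝ ∞ f) (c : ℂ) (e : ℝ × ℝ) :
    pd e (c • f) = c • pd e f := by
  ext x
  simp only [pd, Pi.smul_apply]
  rw [fderiv_const_smul (hf.differentiable (by simp) x)]
  rfl

theorem toL2_add {D : Set (ℝ × ℝ)} {f g : ℝ × ℝ → ℂ} (hf : MemLp f 2 (volume.restrict D))
    (hg : MemLp g 2 (volume.restrict D)) : toL2 D (f + g) = toL2 D f + toL2 D g := by
  rw [toL2, toL2, toL2, dif_pos hf, dif_pos hg, dif_pos (hf.add hg), MemLp.toLp_add]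

theorem toL2_smul {D : Set (ℝ × ℝ)} {f : ℝ × ℝ → ℂ} (hf : MemLp f 2 (volume.restrict D)) (c : ℂ) :
    toL2 D (c • f) = c • toL2 D f := by
  rw [toL2, toL2, dif_pos hf, dif_pos (hf.const_smul c), MemLp.toLp_const_smul]

theorem jet_add {D : Set (ℝ × ℝ)} (hD : Bornology.IsBounded D) {f g : ℝ × ℝ → ℂ}
    (hf : ContDiff ℝ ∞ f) (hg : ContDiff ℝ ∞ g) : jet D (f + g) = jet D f + jet D g := by
  have hm : ∀ {h : ℝ × ℝ → ℂ}, ContDiff ℝ ∞ h → MemLp h 2 (volume.restrict D) :=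
    fun hh => memLp_of_continuous hD hh.continuous 2
  ext i : 1
  fin_cases i
  · exact toL2_add (hm hf) (hm hg)
  · change toL2 D (pd _ (f + g)) = toL2 D (pd _ f) + toL2 D (pd _ g)
    rw [pd_add hf hg, toL2_add (hm (contDiff_pd hf _)) (hm (contDiff_pd hg _))]
  · change toL2 D (pd _ (f + g)) = toL2 D (pd _ f) + toL2 D (pd _ g)
    rw [pd_add hf hg, toL2_add (hm (contDiff_pd hf _)) (hm (contDiff_pd hg _))]
  all_goals
    change toL2 D (pd _ (pd _ (f + g))) = toL2 D (pd _ (pd _ f)) + toL2 D (pd _ (pd _ g))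
    rw [pd_add hf hg, pd_add (contDiff_pd hf _) (contDiff_pd hg _),
      toL2_add (hm (contDiff_pd (contDiff_pd hf _) _)) (hm (contDiff_pd (contDiff_pd hg _) _))]

theorem jet_smul {D : Set (ℝ × ℝ)} (hD : Bornology.IsBounded D) {f : ℝ × ℝ → ℂ}
    (hf : ContDiff ℝ ∞ f) (c : ℂ) : jet D (c • f) = c • jet D f := by
  have hm : ∀ {h : ℝ × ℝ → ℂ}, ContDiff ℝ ∞ h → MemLp h 2 (volume.restrict D) :=
    fun hh => memLp_of_continuous hD hh.continuous 2
  ext i : 1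
  fin_cases i
  · exact toL2_smul (hm hf) c
  · change toL2 D (pd _ (c • f)) = c • toL2 D (pd _ f)
    rw [pd_smul hf, toL2_smul (hm (contDiff_pd hf _))]
  · change toL2 D (pd _ (c • f)) = c • toL2 D (pd _ f)
    rw [pd_smul hf, toL2_smul (hm (contDiff_pd hf _))]
  all_goals
    change toL2 D (pd _ (pd _ (c • f))) = c • toL2 D (pd _ (pd _ f))
    rw [pd_smul hf, pd_smul (contDiff_pd hf _), toL2_smul (hm (contDiff_pd (contDiff_pd hf _) _))]

theorem quasiPeriodic_add {Λ α : ℝ} {f g : ℝ × ℝ → ℂ} (hf : QuasiPeriodic Λ α f)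
    (hg : QuasiPeriodic Λ α g) : QuasiPeriodic Λ α (f + g) := fun x => by
  simp only [Pi.add_apply, hf x, hg x]; ring

theorem quasiPeriodic_smul {Λ α : ℝ} {f : ℝ × ℝ → ℂ} (hf : QuasiPeriodic Λ α f) (c : ℂ) :
    QuasiPeriodic Λ α (c • f) := fun x => by
  simp only [Pi.smul_apply, hf x, smul_eq_mul]; ring

/-! ### The Hilbert space of clamped periodic jets and the operator pencil -/

namespace Setup

variable (P : Setup)

/-- Smooth quasi-periodic functions that vanish to first order on the cavity and on both outer
boundaries. -/
def clamped (α : ℝ) : Submodule ℂ (ℝ × ℝ → ℂ) where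
  carrier := {ψ | ContDiff ℝ ∞ ψ ∧ QuasiPeriodic P.Λ α ψ ∧
    ∀ x ∈ P.Γc ∪ P.Γ₁ ∪ P.Γ₂, ψ x = 0 ∧ fderiv ℝ ψ x = 0}
  zero_mem' := ⟨contDiff_const, fun x => by simp, fun x _ => ⟨rfl, by simp⟩⟩
  add_mem' := by
    rintro f g ⟨hf, hfq, hf0⟩ ⟨hg, hgq, hg0⟩
    refine ⟨hf.add hg, quasiPeriodic_add hfq hgq, fun x hx => ⟨?_, ?_⟩⟩
    · simp [(hf0 x hx).1, (hg0 x hx).1]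
    · rw [fderiv_add (hf.differentiable (by simp) x) (hg.differentiable (by simp) x),
        (hf0 x hx).2, (hg0 x hx).2, add_zero]
  smul_mem' := by
    rintro c f ⟨hf, hfq, hf0⟩
    refine ⟨hf.const_smul c, quasiPeriodic_smul hfq c, fun x hx => ⟨?_, ?_⟩⟩
    · simp [(hf0 x hx).1]
    · rw [fderiv_const_smul (hf.differentiable (by simp) x), (hf0 x hx).2, smul_zero]

/-- The jets of clamped smooth functions. -/
def clampedJets (α : ℝ) : Submodule ℂ (Jet P.domain) where
  carrier := jet P.domain '' P.clamped α
  zero_mem' := ⟨0, (P.clamped α).zero_mem, by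
    have := jet_smul (isBounded_domain (P := P)) (f := 0) contDiff_const 0
    simpa using this⟩
  add_mem' := by
    rintro _ _ ⟨f, hf, rfl⟩ ⟨g, hg, rfl⟩
    exact ⟨f + g, (P.clamped α).add_mem hf hg, jet_add isBounded_domain hf.1 hg.1⟩
  smul_mem' := by
    rintro c _ ⟨f, hf, rfl⟩
    exact ⟨c • f, (P.clamped α).smul_mem c hf, jet_smul isBounded_domain hf.1 c⟩

/-- The Hilbert space of jets of clamped periodic functions. -/
abbrev V₀ : Submodule ℂ (Jet P.domain) := (P.clampedJets 0).topologicalClosure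

instance : CompleteSpace P.V₀ :=
  (P.clampedJets 0).isClosed_topologicalClosure.completeSpace_coe

/-- The inclusion of the space of clamped periodic functions into the space of jets. -/
def incl : P.V₀ →L[ℂ] Jet P.domain := P.V₀.subtypeL

@[simp]
theorem incl_apply (u : P.V₀) : P.incl u = (u : Jet P.domain) := rfl

/-- The operator of the truncated problem in the space of clamped periodic functions, for a complex
wavenumber. -/
def opB (κ : ℂ) : P.V₀ →L[ℂ] P.V₀ :=
  ContinuousLinearMap.adjoint P.incl ∘L
    (ContinuousLinearMap.adjoint (N P.domain (conj (κ * Real.sin P.θ))) ∘L P.opT ∘L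
      N P.domain (κ * Real.sin P.θ) - κ ^ 4 • P.opS) ∘L P.incl

/-- The conjugate wavenumber on the test side compensates the antilinearity of the inner product
there; this keeps `opB` polynomial in κ, and for real κ it changes nothing. -/
theorem inner_opB (κ : ℂ) (u v : P.V₀) :
    inner ℂ v (P.opB κ u)
      = inner ℂ (N P.domain (conj (κ * Real.sin P.θ)) (v : Jet P.domain))
          (P.opT (N P.domain (κ * Real.sin P.θ) (u : Jet P.domain)))
        - κ ^ 4 * inner ℂ (v : Jet P.domain) (P.opS (u : Jet P.domain)) := by
  simp only [opB, ContinuousLinearMap.comp_apply]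
  rw [ContinuousLinearMap.adjoint_inner_right]
  simp only [incl_apply, sub_apply, ContinuousLinearMap.comp_apply, smul_apply,
    inner_sub_right, inner_smul_right]
  rw [ContinuousLinearMap.adjoint_inner_right]

variable {P}

/-- Clamping makes ψ, ∂₁ψ and ∂₂ψ vanish on the boundary of the cavity, so that the box criterion
applies to each of them, with gradients that are again components of the jet. -/
theorem Admissible.isCompactOperator_pr (hP : P.Admissible) :
    IsCompactOperator (pr P.domain 0 ∘L P.incl) ∧ IsCompactOperator (pr P.domain 1 ∘L P.incl) ∧
      IsCompactOperator (pr P.domain 2 ∘L P.incl) := by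
  have hV : (P.V₀ : Set (Jet P.domain)) ⊆ closure (jet P.domain '' (P.clamped 0)) := subset_rfl
  have hH : 0 < P.top - P.bot := sub_pos.mpr hP.bot_lt_top
  have hfr : ∀ x ∈ frontier (closure P.cavity), x ∈ P.Γc ∪ P.Γ₁ ∪ P.Γ₂ := fun x hx =>
    Or.inl (Or.inl (frontier_closure_subset hx))
  refine ⟨?_, ?_, ?_⟩
  · refine isCompactOperator_component isClosed_closure hP.hΛ hH domain_eq P.V₀
      (P.clamped 0) hV 0 1 2 id ?_
    rintro ψ ⟨hψ, -, h0⟩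
    exact ⟨hψ, fun x hx => (h0 x (hfr x hx)).1, rfl, rfl, rfl⟩
  · refine isCompactOperator_component isClosed_closure hP.hΛ hH domain_eq P.V₀
      (P.clamped 0) hV 1 3 4 (pd (1, 0)) ?_
    rintro ψ ⟨hψ, -, h0⟩
    refine ⟨contDiff_pd hψ _, fun x hx => ?_, rfl, rfl, rfl⟩
    simp [pd, (h0 x (hfr x hx)).2]
  · refine isCompactOperator_component isClosed_closure hP.hΛ hH domain_eq P.V₀
      (P.clamped 0) hV 2 4 5 (pd (0, 1)) ?_
    rintro ψ ⟨hψ, -, h0⟩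
    refine ⟨contDiff_pd hψ _, fun x hx => ?_, rfl, ?_, rfl⟩
    · simp [pd, (h0 x (hfr x hx)).2]
    · rw [pd_comm hψ]; rfl

/-- Lax-Milgram: coercivity of `opC` on all jets passes to its compression to `V₀`. -/
theorem Admissible.isUnit_opC (hP : P.Admissible) :
    IsUnit (ContinuousLinearMap.adjoint P.incl ∘L P.opC ∘L P.incl) := by
  obtain ⟨c, hc, hcoer⟩ := hP.exists_coercive
  refine ContinuousLinearMap.isUnit_of_forall_le_norm_inner_map _ (c := ⟨c, hc.le⟩) hc
    fun x => ?_
  rw [← inner_conj_symm, RCLike.norm_conj, ContinuousLinearMap.comp_apply,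
    ContinuousLinearMap.adjoint_inner_right]
  exact (mul_comm _ _).trans_le ((hcoer (x : Jet P.domain)).trans (Complex.re_le_norm _))

theorem Admissible.isCompactOperator_N₁ (hP : P.Admissible) :
    IsCompactOperator (N₁ P.domain ∘L P.incl) := by
  obtain ⟨h0, h1, h2⟩ := hP.isCompactOperator_pr
  have q0 : IsCompactOperator (Complex.I • (pr P.domain 0 ∘L P.incl)) := h0.smul Complex.I
  have q1 : IsCompactOperator ((2 * Complex.I) • (pr P.domain 1 ∘L P.incl)) :=
    h1.smul (2 * Complex.I)
  have q2 : IsCompactOperator (Complex.I • (pr P.domain 2 ∘L P.incl)) := h2.smul Complex.I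
  exact ((q0.clm_comp (inj P.domain 1)).add (q1.clm_comp (inj P.domain 3))).add
    (q2.clm_comp (inj P.domain 4))

theorem Admissible.isCompactOperator_N₂ (hP : P.Admissible) :
    IsCompactOperator (N₂ P.domain ∘L P.incl) := by
  have q0 : IsCompactOperator (-(pr P.domain 0 ∘L P.incl)) := hP.isCompactOperator_pr.1.neg
  exact q0.clm_comp (inj P.domain 3)

theorem Admissible.isCompactOperator_opS (hP : P.Admissible) :
    IsCompactOperator (P.opS ∘L P.incl) :=
  hP.isCompactOperator_pr.1.clm_comp (inj P.domain 0 ∘L mulL P.domain P.c₀)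

/-- Every term besides `opC` contains a component of order at most one, either of the trial function
(`pr` 0, 1, 2 on the right) or of the test function (`inj` 2 on the left). This is the shape treated
by `exists_isCompactOperator_remainder`. -/
theorem opT_eq : P.opT = P.opC + inj P.domain 2 ∘L (mulL P.domain P.c₂ ∘L
        (mulL P.domain P.c₁ ∘L P.opW + (P.μ : ℂ) • pr P.domain 3))
      + (inj P.domain 3 ∘L ((P.μ : ℂ) • mulL P.domain P.c₂)
        + inj P.domain 5 ∘L mulL P.domain P.c₁ ∘L mulL P.domain P.c₁ ∘L mulL P.domain P.c₂
        - inj P.domain 2) ∘L pr P.domain 2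
      - inj P.domain 0 ∘L pr P.domain 0 - inj P.domain 1 ∘L pr P.domain 1 := by
  refine ContinuousLinearMap.ext fun u => ?_
  simp only [opT, opC, opW, add_apply, sub_apply, ContinuousLinearMap.comp_apply,
    smul_apply, map_add, map_smul, smul_add]
  abel

/-- The form is coercive up to a compact operator. -/
theorem Admissible.exists_compact_remainder (hP : P.Admissible) :
    ∃ K₀ : P.V₀ →L[ℂ] P.V₀, IsCompactOperator K₀ ∧
      ContinuousLinearMap.adjoint P.incl ∘L P.opT ∘L P.incl
        = ContinuousLinearMap.adjoint P.incl ∘L P.opC ∘L P.incl + K₀ := by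
  obtain ⟨h0, h1, h2⟩ := hP.isCompactOperator_pr
  have hT := opT_eq (P := P)
  rw [← adjoint_pr 2] at hT
  exact exists_isCompactOperator_remainder h0 h1 h2 hT

/-- The operators `opB κ` form a polynomial pencil, invertible up to compact operators. -/
theorem Admissible.exists_pencil (hP : P.Admissible) :
    ∃ (C : P.V₀ →L[ℂ] P.V₀) (K : Fin 5 → P.V₀ →L[ℂ] P.V₀), IsUnit C ∧
      (∀ j, IsCompactOperator (K j)) ∧
      ∀ κ u, P.opB κ u = C u + ∑ j : Fin 5, κ ^ (j : ℕ) • K j u := by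
  obtain ⟨K₀, hK₀, hTK⟩ := hP.exists_compact_remainder
  obtain ⟨K, hK, hexp⟩ := exists_pencil_expansion P.incl (N₁ P.domain) (N₂ P.domain) P.opT P.opS
    (s := ((Real.sin P.θ : ℝ) : ℂ)) (Complex.conj_ofReal _) hTK hK₀ hP.isCompactOperator_N₁
    hP.isCompactOperator_N₂ hP.isCompactOperator_opS
  exact ⟨_, K, hP.isUnit_opC, hK, fun κ u => hexp κ u⟩

end Setup

end BiharmonicPML
end


noncomputable section

namespace BiharmonicPML

/-! ### Integration by parts in the domain -/

theorem pd_mul {f g : ℝ × ℝ → ℂ} {x : ℝ × ℝ} (hf : DifferentiableAt ℝ f x)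
    (hg : DifferentiableAt ℝ g x) (e : ℝ × ℝ) :
    pd e (fun y => f y * g y) x = pd e f x * g x + f x * pd e g x := by
  simp only [pd]
  rw [fderiv_fun_mul hf hg]
  simp only [add_apply, smul_apply, smul_eq_mul]
  ring

theorem pd_conj {f : ℝ × ℝ → ℂ} {x : ℝ × ℝ} (hf : DifferentiableAt ℝ f x) (e : ℝ × ℝ) :
    pd e (fun y => conj (f y)) x = conj (pd e f x) := by
  simp only [pd]
  have h : HasFDerivAt (fun y => conj (f y)) (Complex.conjCLE.toContinuousLinearMap ∘L
      fderiv ℝ f x) x := Complex.conjCLE.toContinuousLinearMap.hasFDerivAt.comp x hf.hasFDerivAt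
  rw [h.fderiv]
  rfl

theorem pd_snd {w : ℝ → ℂ} {x : ℝ × ℝ} (hw : DifferentiableAt ℝ w x.2) (e : ℝ × ℝ) :
    pd e (fun y => w y.2) x = e.2 * deriv w x.2 := by
  simp only [pd]
  have h : HasFDerivAt (fun y : ℝ × ℝ => w y.2) ((fderiv ℝ w x.2) ∘L
      ContinuousLinearMap.snd ℝ ℝ ℝ) x := by
    exact HasFDerivAt.comp x hw.hasFDerivAt hasFDerivAt_snd
  rw [h.fderiv, ContinuousLinearMap.comp_apply, ContinuousLinearMap.coe_snd']
  have h2 : fderiv ℝ w x.2 e.2 = e.2 • deriv w x.2 := by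
    rw [← fderiv_apply_one_eq_deriv, ← map_smul, smul_eq_mul, mul_one]
  rw [h2, Complex.real_smul]

theorem contDiff_conj {n : WithTop ℕ∞} {f : ℝ × ℝ → ℂ} (hf : ContDiff ℝ n f) :
    ContDiff ℝ n fun x => conj (f x) :=
  Complex.conjCLE.toContinuousLinearMap.contDiff.comp hf

/-- The derivative `-i∂₁ + r`. -/
def Dr (r : ℝ) (f : ℝ × ℝ → ℂ) : ℝ × ℝ → ℂ := fun x => -Complex.I * pd (1, 0) f x + r * f x

theorem contDiff_Dr {f : ℝ × ℝ → ℂ} (hf : ContDiff ℝ ∞ f) (r : ℝ) : ContDiff ℝ ∞ (Dr r f) :=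
  (contDiff_const.mul (contDiff_pd hf _)).add (contDiff_const.mul hf)

theorem pd_Dr {f : ℝ × ℝ → ℂ} (hf : ContDiff ℝ ∞ f) (r : ℝ) (e : ℝ × ℝ) :
    pd e (Dr r f) = Dr r (pd e f) := by
  have h1 : Dr r f = (-Complex.I) • pd (1, 0) f + (r : ℂ) • f := rfl
  have h2 : ContDiff ℝ ∞ ((r : ℂ) • f) := contDiff_const.smul hf
  have h3 : ContDiff ℝ ∞ ((-Complex.I) • pd (1, 0) f) := contDiff_const.smul (contDiff_pd hf _)
  rw [h1, pd_add h3 h2, pd_smul hf, pd_smul (contDiff_pd hf _), pd_comm hf]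
  rfl

theorem quasiPeriodic_zero_iff {Λ : ℝ} {f : ℝ × ℝ → ℂ} :
    QuasiPeriodic Λ 0 f ↔ ∀ x : ℝ × ℝ, f (x.1 + Λ, x.2) = f x := by
  simp [QuasiPeriodic]

theorem QuasiPeriodic.pd {Λ α : ℝ} {f : ℝ × ℝ → ℂ} (hf : QuasiPeriodic Λ α f)
    (hd : ContDiff ℝ ∞ f) (e : ℝ × ℝ) : QuasiPeriodic Λ α (pd e f) := by
  intro x
  have h : (fun y : ℝ × ℝ => f (y + (Λ, 0)))
      = fun y => Complex.exp (Complex.I * (α * Λ : ℝ)) * f y := by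
    ext y
    have := hf y
    rw [← this]
    congr 1
    ext <;> simp
  have h1 : fderiv ℝ (fun y : ℝ × ℝ => f (y + (Λ, 0))) x = fderiv ℝ f (x + (Λ, 0)) :=
    fderiv_comp_add_right (Λ, 0)
  have h2 : x + (Λ, 0) = (x.1 + Λ, x.2) := by ext <;> simp
  simp only [BiharmonicPML.pd]
  rw [← h2, ← h1, h, fderiv_const_mul (hd.differentiable (by simp) x)]
  rfl

theorem QuasiPeriodic.Dr {Λ α : ℝ} {f : ℝ × ℝ → ℂ} (hf : QuasiPeriodic Λ α f)
    (hd : ContDiff ℝ ∞ f) (r : ℝ) : QuasiPeriodic Λ α (Dr r f) := by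
  intro x
  simp only [BiharmonicPML.Dr]
  rw [hf.pd hd (1, 0) x, hf x]
  ring

theorem integrableOn_of_isBounded {E : Type*} [NormedAddCommGroup E] {f : ℝ × ℝ → E}
    {D : Set (ℝ × ℝ)} (hD : Bornology.IsBounded D) (hf : Continuous f) : IntegrableOn f D :=
  (hf.continuousOn.integrableOn_compact hD.isCompact_closure).mono_set subset_closure

namespace Setup

variable {P : Setup}

theorem integrable_of_continuous {E : Type*} [NormedAddCommGroup E] {f : ℝ × ℝ → E}
    (hf : Continuous f) : Integrable f (volume.restrict P.domain) :=
  integrableOn_of_isBounded isBounded_domain hf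

theorem integral_domain_eq (f : ℝ × ℝ → ℂ) :
    ∫ x in P.domain, f x = ∫ x in Set.Ioo 0 P.Λ ×ˢ Set.Ioo P.bot P.top,
      (closure P.cavity)ᶜ.indicator f x := by
  rw [setIntegral_indicator isClosed_closure.isOpen_compl.measurableSet]
  rfl

theorem integrableOn_indicator {f : ℝ × ℝ → ℂ} (hf : Continuous f) :
    IntegrableOn ((closure P.cavity)ᶜ.indicator f) (Set.Ioo 0 P.Λ ×ˢ Set.Ioo P.bot P.top) := by
  refine IntegrableOn.indicator ?_ isClosed_closure.isOpen_compl.measurableSet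
  exact integrableOn_of_isBounded
    ((Metric.isBounded_Ioo _ _).prod (Metric.isBounded_Ioo _ _)) hf

/-- By Fubini, the fundamental theorem of calculus for extensions by zero is applied on each
horizontal line. The cavity stays away from the lateral sides, and the two end values cancel by
periodicity. -/
theorem Admissible.integral_pd_fst (hP : P.Admissible) {f : ℝ × ℝ → ℂ} (hf : ContDiff ℝ 1 f)
    (h0 : ∀ x ∈ P.Γc, f x = 0) (hper : ∀ x : ℝ × ℝ, f (x.1 + P.Λ, x.2) = f x) :
    ∫ x in P.domain, pd (1, 0) f x = 0 := by
  have hc : Continuous (pd (1, 0) f) := continuous_fderiv_apply_const hf _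
  have hI := integrableOn_indicator (P := P) hc
  rw [Measure.volume_eq_prod, IntegrableOn, ← Measure.prod_restrict] at hI
  rw [integral_domain_eq, Measure.volume_eq_prod, ← Measure.prod_restrict, integral_prod_symm _ hI]
  refine integral_eq_zero_of_ae (Eventually.of_forall fun t => ?_)
  have e1 : Continuous fun s : ℝ => (s, t) := by fun_prop
  have h1 := integral_indicator_compl_deriv ((isClosed_closure (s := P.cavity)).preimage e1)
    (hasDerivAt_slice_fst hf t) ((continuous_fderiv_apply_const hf (1, 0)).comp e1)
    (fun s hs => h0 _ (frontier_closure_subset (e1.frontier_preimage_subset _ hs))) 0 P.Λ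
  have hout : ∀ s : ℝ, s ∉ Set.Ioo 0 P.Λ → s ∈ ((fun s : ℝ => (s, t)) ⁻¹' closure P.cavity)ᶜ :=
    fun s hs hs' => hs (hP.hencl hs').1
  rw [Set.indicator_of_mem (hout _ (by simp)), Set.indicator_of_mem (hout _ (by simp)),
    intervalIntegral.integral_of_le hP.hΛ.le, integral_Ioc_eq_integral_Ioo] at h1
  have h2 := hper (0, t)
  simp only [zero_add] at h2
  rw [h2, sub_self] at h1
  exact h1

theorem Admissible.integral_pd_snd (hP : P.Admissible) {f : ℝ × ℝ → ℂ} (hf : ContDiff ℝ 1 f)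
    (h0 : ∀ x ∈ P.Γc ∪ P.Γ₁ ∪ P.Γ₂, f x = 0) : ∫ x in P.domain, pd (0, 1) f x = 0 := by
  have hc : Continuous (pd (0, 1) f) := continuous_fderiv_apply_const hf _
  rw [integral_domain_eq, Measure.volume_eq_prod, setIntegral_prod _ (by
    rw [← Measure.volume_eq_prod]; exact integrableOn_indicator hc)]
  refine setIntegral_eq_zero_of_forall_eq_zero fun s hs => ?_
  have e1 : Continuous fun t : ℝ => (s, t) := by fun_prop
  have h1 := integral_indicator_compl_deriv ((isClosed_closure (s := P.cavity)).preimage e1)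
    (hasDerivAt_slice_snd hf s) ((continuous_fderiv_apply_const hf (0, 1)).comp e1)
    (fun t ht => h0 _ (Or.inl (Or.inl
      (frontier_closure_subset (e1.frontier_preimage_subset _ ht))))) P.bot P.top
  have hb : f (s, P.bot) = 0 := h0 _ (Or.inr ⟨hs, rfl⟩)
  have ht : f (s, P.top) = 0 := h0 _ (Or.inl (Or.inr ⟨hs, rfl⟩))
  have hb' : ((fun t : ℝ => (s, t)) ⁻¹' closure P.cavity)ᶜ.indicator (fun t => f (s, t)) P.bot = 0 :=
    Set.indicator_apply_eq_zero.mpr fun _ => hb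
  have ht' : ((fun t : ℝ => (s, t)) ⁻¹' closure P.cavity)ᶜ.indicator (fun t => f (s, t)) P.top = 0 :=
    Set.indicator_apply_eq_zero.mpr fun _ => ht
  rw [hb', ht', intervalIntegral.integral_of_le hP.bot_lt_top.le, integral_Ioc_eq_integral_Ioo, sub_self] at h1
  exact h1

theorem pd_eq_zero_of_mem_clamped {α : ℝ} {ψ : ℝ × ℝ → ℂ} (hψ : ψ ∈ P.clamped α) {x : ℝ × ℝ}
    (hx : x ∈ P.Γc ∪ P.Γ₁ ∪ P.Γ₂) (e : ℝ × ℝ) : pd e ψ x = 0 := by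
  simp [pd, (hψ.2.2 x hx).2]

theorem contDiff_comp_snd {w w' : ℝ → ℂ} (hw : ∀ t, HasDerivAt w (w' t) t) (hw' : Continuous w') :
    ContDiff ℝ 1 fun x : ℝ × ℝ => w x.2 := by
  refine ContDiff.comp (g := w) (f := Prod.snd) ?_ contDiff_snd
  rw [contDiff_one_iff_deriv]
  refine ⟨fun t => (hw t).differentiableAt, ?_⟩
  rwa [show deriv w = w' from funext fun t => (hw t).deriv]

/-- Integration by parts in `x₂` against the derivative of a clamped function. -/
theorem Admissible.integral_parts_snd (hP : P.Admissible) {ψ χ : ℝ × ℝ → ℂ}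
    (hψ : ψ ∈ P.clamped 0) (hχ : ContDiff ℝ ∞ χ) {w w' : ℝ → ℂ}
    (hw : ∀ t, HasDerivAt w (w' t) t) (hw' : Continuous w') :
    ∫ x in P.domain, w x.2 * (pd (0, 1) (pd (0, 1) ψ) x * conj (χ x)
        + pd (0, 1) ψ x * conj (pd (0, 1) χ x))
      = -∫ x in P.domain, w' x.2 * (pd (0, 1) ψ x * conj (χ x)) := by
  have hb := contDiff_pd hψ.1 (0, 1)
  have hc := contDiff_pd hb (0, 1)
  have hχ2 := contDiff_pd hχ (0, 1)
  have h1 := contDiff_comp_snd hw hw'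
  have h2 : ContDiff ℝ ∞ fun x => pd (0, 1) ψ x * conj (χ x) := hb.mul (contDiff_conj hχ)
  have hwc : Continuous w := continuous_iff_continuousAt.mpr fun t => (hw t).continuousAt
  -- The factor ∂₂ψ alone makes the boundary terms vanish. So χ need not be clamped, which matters
  -- because χ will be a second derivative of ψ.
  have key := hP.integral_pd_snd (f := fun x => w x.2 * (pd (0, 1) ψ x * conj (χ x)))
    (h1.mul (h2.of_le (by simp))) (fun x hx => by simp [pd_eq_zero_of_mem_clamped hψ hx])
  have hpt : ∀ x, pd (0, 1) (fun x => w x.2 * (pd (0, 1) ψ x * conj (χ x))) x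
      = w x.2 * (pd (0, 1) (pd (0, 1) ψ) x * conj (χ x) + pd (0, 1) ψ x * conj (pd (0, 1) χ x))
        + w' x.2 * (pd (0, 1) ψ x * conj (χ x)) := by
    intro x
    rw [pd_mul (f := fun x => w x.2) (h1.differentiable (by simp) x)
        (h2.differentiable (by simp) x),
      pd_snd (hw _).differentiableAt, (hw _).deriv,
      pd_mul (f := pd (0, 1) ψ) (hb.differentiable (by simp) x)
        ((contDiff_conj hχ).differentiable (by simp) x),
      pd_conj (hχ.differentiable (by simp) x)]
    push_cast
    ring
  simp only [hpt] at key
  have c1 := hb.continuous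
  have c2 := hc.continuous
  have c3 := hχ2.continuous
  have c4 := hχ.continuous
  rw [integral_add (integrable_of_continuous (by fun_prop))
    (integrable_of_continuous (by fun_prop))] at key
  exact eq_neg_of_add_eq_zero_left key

/-- The derivative `-i∂₁ + r` is symmetric on periodic functions that vanish on the cavity. -/
theorem Admissible.integral_Dr_symm (hP : P.Admissible) {f χ : ℝ × ℝ → ℂ}
    (hf : ContDiff ℝ ∞ f) (hfp : QuasiPeriodic P.Λ 0 f) (hf0 : ∀ x ∈ P.Γc, f x = 0)
    (hχ : ContDiff ℝ ∞ χ) (hχp : QuasiPeriodic P.Λ 0 χ) (r : ℝ) {w w' : ℝ → ℂ}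
    (hw : ∀ t, HasDerivAt w (w' t) t) (hw' : Continuous w') :
    ∫ x in P.domain, w x.2 * (Dr r f x * conj (χ x))
      = ∫ x in P.domain, w x.2 * (f x * conj (Dr r χ x)) := by
  have h1 := contDiff_comp_snd hw hw'
  have h2 : ContDiff ℝ ∞ fun x => f x * conj (χ x) := hf.mul (contDiff_conj hχ)
  have hwc : Continuous w := continuous_iff_continuousAt.mpr fun t => (hw t).continuousAt
  rw [quasiPeriodic_zero_iff] at hfp hχp
  have key := hP.integral_pd_fst (f := fun x => w x.2 * (f x * conj (χ x)))
    (h1.mul (h2.of_le (by simp))) (fun x hx => by simp [hf0 x hx])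
    (fun x => by simp only [hfp x, hχp x])
  have hpt : ∀ x, pd (1, 0) (fun x => w x.2 * (f x * conj (χ x))) x
      = Complex.I * (w x.2 * (Dr r f x * conj (χ x)) - w x.2 * (f x * conj (Dr r χ x))) := by
    intro x
    rw [pd_mul (f := fun x => w x.2) (h1.differentiable (by simp) x)
        (h2.differentiable (by simp) x),
      pd_snd (hw _).differentiableAt, (hw _).deriv,
      pd_mul (f := f) (hf.differentiable (by simp) x)
        ((contDiff_conj hχ).differentiable (by simp) x),
      pd_conj (hχ.differentiable (by simp) x)]
    simp only [Dr, map_add, map_mul, map_neg, Complex.conj_I, Complex.conj_ofReal]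
    push_cast
    linear_combination (w x.2 * (pd (1, 0) f x * conj (χ x) + f x * conj (pd (1, 0) χ x)))
      * Complex.I_sq
  simp only [hpt] at key
  have c1 := hf.continuous
  have c2 := hχ.continuous
  have c3 := (contDiff_Dr hf r).continuous
  have c4 := (contDiff_Dr hχ r).continuous
  rw [integral_const_mul, integral_sub (integrable_of_continuous (by fun_prop))
    (integrable_of_continuous (by fun_prop))] at key
  exact sub_eq_zero.mp ((mul_eq_zero.mp key).resolve_left Complex.I_ne_zero)

end Setup

end BiharmonicPML
end


noncomputable section

namespace BiharmonicPML

/-! ### Pointwise estimates for the form at a wavenumber off the real axis -/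

/-- The square of the weighted size of the values of a function and its derivatives. -/
def weight (k : ℝ) (a₀ a₁ a₂ b₀ b₁ c₀ : ℂ) : ℝ :=
  ‖a₂‖ ^ 2 + ‖b₁‖ ^ 2 + ‖c₀‖ ^ 2 + k ^ 2 * (‖a₁‖ ^ 2 + ‖b₀‖ ^ 2) + k ^ 4 * ‖a₀‖ ^ 2

/-- The part of the form, divided by the multiplier, that does not involve derivatives of the
coefficients. -/
def mainForm (μ a : ℝ) (z s a₀ a₁ a₂ b₀ b₁ c₀ : ℂ) : ℂ :=
  (a₂ - a ^ 2 * a₀ + 2 * Complex.I * a * a₁)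
      * (conj a₂ - a ^ 2 * conj a₀ + 2 * Complex.I * a * conj a₁)
    - μ * s ^ 2 * (c₀ * (conj a₂ - a ^ 2 * conj a₀ + 2 * Complex.I * a * conj a₁)
      + (a₂ - a ^ 2 * a₀ + 2 * Complex.I * a * a₁) * conj c₀)
    + (2 - 2 * μ) * s ^ 2 * ((b₁ + Complex.I * a * b₀) * (conj b₁ + Complex.I * a * conj b₀))
    + s ^ 4 * (c₀ * conj c₀) - z * (a₀ * conj a₀)

/-- The form `mainForm` after an integration by parts. -/
def reducedForm (a : ℝ) (z s a₀ a₁ a₂ b₀ b₁ c₀ : ℂ) : ℂ :=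
  (a₂ - a ^ 2 * a₀ + 2 * Complex.I * a * a₁)
      * (conj a₂ - a ^ 2 * conj a₀ + 2 * Complex.I * a * conj a₁)
    + 2 * s ^ 2 * ((b₁ + Complex.I * a * b₀) * (conj b₁ + Complex.I * a * conj b₀))
    + s ^ 4 * (c₀ * conj c₀) - z * (a₀ * conj a₀)

/-- The Poisson terms form a null Lagrangian. Each sum such as c₀ conj a₂ + b₁ conj b₁ becomes,
after integration by parts, a term with a derivative on the weight (`null_zero`, `null_one`,
`null_two`); only the form with μ = 0 has to be shown positive. -/
theorem mainForm_eq (μ a : ℝ) (z s a₀ a₁ a₂ b₀ b₁ c₀ : ℂ) :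
    mainForm μ a z s a₀ a₁ a₂ b₀ b₁ c₀ = reducedForm a z s a₀ a₁ a₂ b₀ b₁ c₀
      - μ * s ^ 2 * (((c₀ * conj a₂ + b₁ * conj b₁) + conj (c₀ * conj a₂ + b₁ * conj b₁))
        - a ^ 2 * ((c₀ * conj a₀ + b₀ * conj b₀) + conj (c₀ * conj a₀ + b₀ * conj b₀))
        + 2 * Complex.I * a *
          ((c₀ * conj a₁ + b₀ * conj b₁) + conj (c₀ * conj a₁ + b₀ * conj b₁))) := by
  simp only [mainForm, reducedForm, map_add, map_mul, Complex.conj_conj]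
  linear_combination (-2 * a ^ 2 * μ * s ^ 2 * b₀ * conj b₀) * Complex.I_sq

section Bounds

variable {k : ℝ} {a₀ a₁ a₂ b₀ b₁ c₀ : ℂ}

theorem weight_nonneg : 0 ≤ weight k a₀ a₁ a₂ b₀ b₁ c₀ := by unfold weight; positivity

/-- A derivative of order j is paired with k to the power 2 - j. All products of two such quantities
are then controlled by the weight, and each missing derivative is worth a factor 1/k. -/
theorem norms_le_sqrt_weight :
    ‖a₂‖ ≤ √(weight k a₀ a₁ a₂ b₀ b₁ c₀) ∧ ‖b₁‖ ≤ √(weight k a₀ a₁ a₂ b₀ b₁ c₀) ∧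
    ‖c₀‖ ≤ √(weight k a₀ a₁ a₂ b₀ b₁ c₀) ∧ k * ‖a₁‖ ≤ √(weight k a₀ a₁ a₂ b₀ b₁ c₀) ∧
    k * ‖b₀‖ ≤ √(weight k a₀ a₁ a₂ b₀ b₁ c₀) ∧ k ^ 2 * ‖a₀‖ ≤ √(weight k a₀ a₁ a₂ b₀ b₁ c₀) := by
  have h1 := sq_nonneg ‖a₂‖
  have h2 := sq_nonneg ‖b₁‖
  have h3 := sq_nonneg ‖c₀‖
  have h4 := sq_nonneg (k * ‖a₁‖)
  have h5 := sq_nonneg (k * ‖b₀‖)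
  have h6 := sq_nonneg (k ^ 2 * ‖a₀‖)
  have e : weight k a₀ a₁ a₂ b₀ b₁ c₀ = ‖a₂‖ ^ 2 + ‖b₁‖ ^ 2 + ‖c₀‖ ^ 2 + (k * ‖a₁‖) ^ 2
    + (k * ‖b₀‖) ^ 2 + (k ^ 2 * ‖a₀‖) ^ 2 := by unfold weight; ring
  rw [e]
  refine ⟨?_, ?_, ?_, ?_, ?_, ?_⟩ <;> apply Real.le_sqrt_of_sq_le <;> linarith

theorem norm_shift_le (hk : 0 < k) {a : ℝ} (ha : |a| ≤ k) :
    ‖a₂ - a ^ 2 * a₀ + 2 * Complex.I * a * a₁‖ ≤ 4 * √(weight k a₀ a₁ a₂ b₀ b₁ c₀) ∧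
    ‖conj a₂ - a ^ 2 * conj a₀ + 2 * Complex.I * a * conj a₁‖
      ≤ 4 * √(weight k a₀ a₁ a₂ b₀ b₁ c₀) ∧
    ‖b₁ + Complex.I * a * b₀‖ ≤ 2 * √(weight k a₀ a₁ a₂ b₀ b₁ c₀) ∧
    ‖conj b₁ + Complex.I * a * conj b₀‖ ≤ 2 * √(weight k a₀ a₁ a₂ b₀ b₁ c₀) ∧
    k * ‖conj a₁ + Complex.I * a * conj a₀‖ ≤ 2 * √(weight k a₀ a₁ a₂ b₀ b₁ c₀) := by
  obtain ⟨h1, h2, h3, h4, h5, h6⟩ := norms_le_sqrt_weight (a₀ := a₀) (a₁ := a₁) (a₂ := a₂)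
    (b₀ := b₀) (b₁ := b₁) (c₀ := c₀) (k := k)
  set Q := √(weight k a₀ a₁ a₂ b₀ b₁ c₀)
  have ha2 : |a| ^ 2 * ‖a₀‖ ≤ k ^ 2 * ‖a₀‖ := by gcongr
  have ha1 : |a| * ‖a₁‖ ≤ k * ‖a₁‖ := by gcongr
  have hb0 : |a| * ‖b₀‖ ≤ k * ‖b₀‖ := by gcongr
  have ha0 : k * (|a| * ‖a₀‖) ≤ k * (k * ‖a₀‖) := by gcongr
  have key : ∀ x₀ x₁ x₂ : ℂ, ‖x₀‖ = ‖a₀‖ → ‖x₁‖ = ‖a₁‖ → ‖x₂‖ = ‖a₂‖ →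
      ‖x₂ - a ^ 2 * x₀ + 2 * Complex.I * a * x₁‖ ≤ 4 * Q := by
    intro x₀ x₁ x₂ e0 e1 e2
    have n1 := norm_add_le (x₂ - a ^ 2 * x₀) (2 * Complex.I * a * x₁)
    have n2 := norm_sub_le x₂ (a ^ 2 * x₀)
    simp only [norm_mul, norm_pow, Complex.norm_real, Complex.norm_I, Complex.norm_ofNat,
      Real.norm_eq_abs, e0, e1, e2] at n1 n2
    linarith
  have key2 : ∀ x y : ℂ, ‖x‖ = ‖b₀‖ → ‖y‖ = ‖b₁‖ → ‖y + Complex.I * a * x‖ ≤ 2 * Q := by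
    intro x y e0 e1
    have n1 := norm_add_le y (Complex.I * a * x)
    simp only [norm_mul, Complex.norm_real, Complex.norm_I, Real.norm_eq_abs, e0, e1] at n1
    linarith
  refine ⟨key _ _ _ rfl rfl rfl, key _ _ _ (by simp) (by simp) (by simp), key2 _ _ rfl rfl,
    key2 _ _ (by simp) (by simp), ?_⟩
  have n1 := norm_add_le (conj a₁) (Complex.I * a * conj a₀)
  simp only [norm_mul, Complex.norm_real, Complex.norm_I, Real.norm_eq_abs, RCLike.norm_conj] at n1
  have := mul_le_mul_of_nonneg_left n1 hk.le
  nlinarith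

theorem norm_mul_le_mul_sq {x y : ℂ} {A B Q : ℝ} (hx : ‖x‖ ≤ A * Q) (hy : ‖y‖ ≤ B * Q) :
    ‖x * y‖ ≤ A * B * Q ^ 2 := by
  rw [norm_mul]
  calc ‖x‖ * ‖y‖ ≤ (A * Q) * (B * Q) := mul_le_mul hx hy (norm_nonneg _)
        ((norm_nonneg _).trans hx)
    _ = _ := by ring

/-- A crude bound suffices, because it is only used with a small factor in front. The five groups of
terms contribute 16 + 8 + 8 + 1 + 16. -/
theorem norm_mainForm_le (hk : 0 < k) {a μ : ℝ} (ha : |a| ≤ k) (hμ0 : 0 < μ) (hμ1 : μ < 1)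
    {z s : ℂ} (hs : ‖s‖ ≤ 1) (hz : ‖z‖ ≤ 16 * k ^ 4) :
    ‖mainForm μ a z s a₀ a₁ a₂ b₀ b₁ c₀‖ ≤ 50 * weight k a₀ a₁ a₂ b₀ b₁ c₀ := by
  obtain ⟨h1, h2, h3, h4, h5, h6⟩ := norms_le_sqrt_weight (a₀ := a₀) (a₁ := a₁) (a₂ := a₂)
    (b₀ := b₀) (b₁ := b₁) (c₀ := c₀) (k := k)
  obtain ⟨hA, hA', hB, hB', -⟩ := norm_shift_le (a₀ := a₀) (a₁ := a₁) (a₂ := a₂)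
    (b₀ := b₀) (b₁ := b₁) (c₀ := c₀) hk ha
  have hQ := Real.sq_sqrt (weight_nonneg (k := k) (a₀ := a₀) (a₁ := a₁) (a₂ := a₂)
    (b₀ := b₀) (b₁ := b₁) (c₀ := c₀))
  set Q := √(weight k a₀ a₁ a₂ b₀ b₁ c₀)
  rw [← hQ]
  have hc1 : ‖c₀‖ ≤ 1 * Q := by linarith
  have hc2 : ‖conj c₀‖ ≤ 1 * Q := by rw [RCLike.norm_conj]; exact hc1
  have t1 := norm_mul_le_mul_sq hA hA'
  have t2 := norm_mul_le_mul_sq hc1 hA'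
  have t3 := norm_mul_le_mul_sq hA hc2
  have t4 := norm_mul_le_mul_sq hB hB'
  have t5 := norm_mul_le_mul_sq hc1 hc2
  have t6 : ‖z * (a₀ * conj a₀)‖ ≤ 16 * Q ^ 2 := by
    rw [norm_mul, norm_mul, RCLike.norm_conj]
    calc ‖z‖ * (‖a₀‖ * ‖a₀‖) ≤ 16 * k ^ 4 * (‖a₀‖ * ‖a₀‖) := by gcongr
      _ = 16 * (k ^ 2 * ‖a₀‖) ^ 2 := by ring
      _ ≤ _ := by gcongr
  have hs2 : ‖s ^ 2‖ ≤ 1 := by rw [norm_pow]; exact pow_le_one₀ (norm_nonneg _) hs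
  have hs4 : ‖s ^ 4‖ ≤ 1 := by rw [norm_pow]; exact pow_le_one₀ (norm_nonneg _) hs
  have hms : ‖(μ : ℂ) * s ^ 2‖ ≤ 1 := by
    rw [norm_mul, Complex.norm_real, Real.norm_of_nonneg hμ0.le]
    exact mul_le_one₀ hμ1.le (norm_nonneg _) hs2
  have hms2 : ‖(2 - 2 * (μ : ℂ)) * s ^ 2‖ ≤ 2 := by
    have : (2 - 2 * (μ : ℂ)) = ((2 - 2 * μ : ℝ) : ℂ) := by push_cast; ring
    rw [norm_mul, this, Complex.norm_real, Real.norm_of_nonneg (by linarith)]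
    nlinarith [norm_nonneg (s ^ 2)]
  unfold mainForm
  refine (norm_sub_le _ _).trans ?_
  refine (add_le_add (norm_add_le _ _) le_rfl).trans ?_
  refine (add_le_add (add_le_add (norm_add_le _ _) le_rfl) le_rfl).trans ?_
  refine (add_le_add (add_le_add (add_le_add (norm_sub_le _ _) le_rfl) le_rfl) le_rfl).trans ?_
  rw [norm_mul ((μ : ℂ) * s ^ 2), norm_mul ((2 - 2 * (μ : ℂ)) * s ^ 2), norm_mul (s ^ 4)]
  have u1 := mul_le_mul hms ((norm_add_le _ _).trans (add_le_add t2 t3)) (norm_nonneg _) zero_le_one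
  have u2 := mul_le_mul hms2 t4 (norm_nonneg _) zero_le_two
  have u3 := mul_le_mul hs4 t5 (norm_nonneg _) zero_le_one
  linarith [sq_nonneg Q]

theorem re_rotated_shift (δ a : ℝ) :
    ((3 * δ + Complex.I) * ((a₂ - a ^ 2 * a₀ + 2 * Complex.I * a * a₁)
      * (conj a₂ - a ^ 2 * conj a₀ + 2 * Complex.I * a * conj a₁))).re
      = 3 * δ * (‖a₂‖ ^ 2 - 2 * a ^ 2 * (a₂ * conj a₀).re + a ^ 4 * ‖a₀‖ ^ 2
        - 4 * a ^ 2 * ‖a₁‖ ^ 2) - 4 * a * (a₂ * conj a₁).re + 4 * a ^ 3 * (a₀ * conj a₁).re := by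
  simp only [Complex.sq_norm, Complex.normSq_apply]
  simp [pow_two, Complex.mul_re, Complex.mul_im]
  ring

theorem re_mul_shift (g : ℂ) (a : ℝ) :
    (g * ((b₁ + Complex.I * a * b₀) * (conj b₁ + Complex.I * a * conj b₀))).re
      = g.re * (‖b₁‖ ^ 2 - a ^ 2 * ‖b₀‖ ^ 2) - 2 * a * g.im * (b₁ * conj b₀).re := by
  simp only [Complex.sq_norm, Complex.normSq_apply]
  simp [pow_two, Complex.mul_re, Complex.mul_im]
  ring

theorem abs_re_mul_conj_le (x y : ℂ) : |(x * conj y).re| ≤ ‖x‖ * ‖y‖ := by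
  have := Complex.abs_re_le_norm (x * conj y)
  rwa [norm_mul, RCLike.norm_conj] at this

/-- The real part of the rotated reduced form, to first order in `δ`. -/
theorem re_reducedForm_ge (hk : 0 < k) {s δ η ξ ρ : ℝ} (hs : |s| ≤ 1) (hδ0 : 0 < δ)
    (hδ1 : δ ≤ 1 / 6) {z w : ℂ} (hz : ((3 * δ + Complex.I) * z).re ≤ -(δ * k ^ 4))
    (hξ : ((3 * δ + Complex.I) * w ^ 2).re = ξ) (hη : ((3 * δ + Complex.I) * w ^ 2).im = η)
    (hξ1 : 3 * δ * ρ ^ 2 ≤ ξ) (hξ2 : ξ ≤ 2)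
    (hw4 : 3 * δ * ρ ^ 4 ≤ ((3 * δ + Complex.I) * w ^ 4).re) :
    δ * (3 * ‖a₂‖ ^ 2 - 4 * (s * k) * (a₂ * conj a₁).re + k ^ 4 * ‖a₀‖ ^ 2 + 6 * ρ ^ 2 * ‖b₁‖ ^ 2
        - 4 * (s * k) * η * (b₁ * conj b₀).re + 3 * ρ ^ 4 * ‖c₀‖ ^ 2)
      - 8 * δ ^ 2 * weight k a₀ a₁ a₂ b₀ b₁ c₀
    ≤ ((3 * δ + Complex.I) * reducedForm (s * k * δ) z w a₀ a₁ a₂ b₀ b₁ c₀).re := by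
  have e : (3 * δ + Complex.I) * reducedForm (s * k * δ) z w a₀ a₁ a₂ b₀ b₁ c₀
      = (3 * δ + Complex.I) * ((a₂ - ((s * k * δ : ℝ) : ℂ) ^ 2 * a₀
            + 2 * Complex.I * ((s * k * δ : ℝ) : ℂ) * a₁)
          * (conj a₂ - ((s * k * δ : ℝ) : ℂ) ^ 2 * conj a₀
            + 2 * Complex.I * ((s * k * δ : ℝ) : ℂ) * conj a₁))
        + (2 : ℝ) * (((3 * δ + Complex.I) * w ^ 2) * ((b₁ + Complex.I * ((s * k * δ : ℝ) : ℂ) * b₀)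
            * (conj b₁ + Complex.I * ((s * k * δ : ℝ) : ℂ) * conj b₀)))
        + ((‖c₀‖ ^ 2 : ℝ) : ℂ) * ((3 * δ + Complex.I) * w ^ 4)
        - ((‖a₀‖ ^ 2 : ℝ) : ℂ) * ((3 * δ + Complex.I) * z) := by
    have n0 : a₀ * conj a₀ = ((‖a₀‖ ^ 2 : ℝ) : ℂ) := by push_cast; exact Complex.mul_conj' _
    have n1 : c₀ * conj c₀ = ((‖c₀‖ ^ 2 : ℝ) : ℂ) := by push_cast; exact Complex.mul_conj' _
    simp only [reducedForm, n0, n1]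
    push_cast
    ring
  rw [e, Complex.sub_re, Complex.add_re, Complex.add_re, Complex.re_ofReal_mul,
    Complex.re_ofReal_mul, Complex.re_ofReal_mul, re_rotated_shift, re_mul_shift, hξ, hη]
  obtain ⟨h1, h2, h3, h4, h5, h6⟩ := norms_le_sqrt_weight (a₀ := a₀) (a₁ := a₁) (a₂ := a₂)
    (b₀ := b₀) (b₁ := b₁) (c₀ := c₀) (k := k)
  have hQ := Real.sq_sqrt (weight_nonneg (k := k) (a₀ := a₀) (a₁ := a₁) (a₂ := a₂)
    (b₀ := b₀) (b₁ := b₁) (c₀ := c₀))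
  set Q := √(weight k a₀ a₁ a₂ b₀ b₁ c₀)
  have hQ0 : 0 ≤ Q := Real.sqrt_nonneg _
  rw [← hQ]
  have hs2 : s ^ 2 ≤ 1 := (sq_le_one_iff_abs_le_one s).mpr hs
  have m1 : k ^ 2 * |(a₂ * conj a₀).re| ≤ Q ^ 2 := by
    calc k ^ 2 * |(a₂ * conj a₀).re| ≤ k ^ 2 * (‖a₂‖ * ‖a₀‖) := by
          gcongr; exact abs_re_mul_conj_le _ _
      _ = ‖a₂‖ * (k ^ 2 * ‖a₀‖) := by ring
      _ ≤ Q * Q := by gcongr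
      _ = _ := by ring
  have m2 : k ^ 3 * |(a₀ * conj a₁).re| ≤ Q ^ 2 := by
    calc k ^ 3 * |(a₀ * conj a₁).re| ≤ k ^ 3 * (‖a₀‖ * ‖a₁‖) := by
          gcongr; exact abs_re_mul_conj_le _ _
      _ = (k ^ 2 * ‖a₀‖) * (k * ‖a₁‖) := by ring
      _ ≤ Q * Q := by gcongr
      _ = _ := by ring
  have m3 : k ^ 2 * ‖a₁‖ ^ 2 ≤ Q ^ 2 := by rw [← mul_pow]; gcongr
  have m4 : k ^ 2 * ‖b₀‖ ^ 2 ≤ Q ^ 2 := by rw [← mul_pow]; gcongr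
  -- Terms of third order in δ are reduced to second order. The errors `r1` to `r4` contribute 1 + 2
  -- + 1 + 4, which is the constant 8; `r5` has a favourable sign and is dropped.
  have hδ3 : δ ^ 3 ≤ δ ^ 2 * (1 / 6) := by
    rw [pow_succ]; gcongr
  -- error terms
  have r1 : 3 * δ * (2 * (s * k * δ) ^ 2 * (a₂ * conj a₀).re) ≤ δ ^ 2 * Q ^ 2 := by
    calc 3 * δ * (2 * (s * k * δ) ^ 2 * (a₂ * conj a₀).re)
        = 6 * δ ^ 3 * (s ^ 2 * (k ^ 2 * (a₂ * conj a₀).re)) := by ring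
      _ ≤ 6 * δ ^ 3 * (1 * (k ^ 2 * |(a₂ * conj a₀).re|)) := by
          gcongr ?_ * ?_
          refine (mul_le_mul_of_nonneg_left (mul_le_mul_of_nonneg_left (le_abs_self _)
            (sq_nonneg k)) (sq_nonneg s)).trans ?_
          gcongr
      _ ≤ 6 * (δ ^ 2 * (1 / 6)) * (1 * Q ^ 2) := by gcongr
      _ = _ := by ring
  have r2 : 3 * δ * (4 * (s * k * δ) ^ 2 * ‖a₁‖ ^ 2) ≤ 2 * δ ^ 2 * Q ^ 2 := by
    calc 3 * δ * (4 * (s * k * δ) ^ 2 * ‖a₁‖ ^ 2)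
        = 12 * δ ^ 3 * (s ^ 2 * (k ^ 2 * ‖a₁‖ ^ 2)) := by ring
      _ ≤ 12 * (δ ^ 2 * (1 / 6)) * (1 * Q ^ 2) := by gcongr
      _ = _ := by ring
  have r3 : -(δ ^ 2 * Q ^ 2) ≤ 4 * (s * k * δ) ^ 3 * (a₀ * conj a₁).re := by
    have h : |4 * (s * k * δ) ^ 3 * (a₀ * conj a₁).re| ≤ δ ^ 2 * Q ^ 2 := by
      calc |4 * (s * k * δ) ^ 3 * (a₀ * conj a₁).re|
          = 4 * δ ^ 3 * (|s| ^ 3 * (k ^ 3 * |(a₀ * conj a₁).re|)) := by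
            rw [abs_mul, abs_mul, abs_pow, abs_mul, abs_mul, abs_of_pos hk, abs_of_pos hδ0]
            norm_num; ring
        _ ≤ 4 * (δ ^ 2 * (1 / 6)) * (1 * Q ^ 2) := by
            gcongr
            exact pow_le_one₀ (abs_nonneg _) hs
        _ ≤ _ := by nlinarith [mul_nonneg (sq_nonneg δ) (sq_nonneg Q)]
    exact (abs_le.mp h).1
  have r4 : 2 * (ξ * ((s * k * δ) ^ 2 * ‖b₀‖ ^ 2)) ≤ 4 * δ ^ 2 * Q ^ 2 := by
    calc 2 * (ξ * ((s * k * δ) ^ 2 * ‖b₀‖ ^ 2))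
        = 2 * (ξ * (δ ^ 2 * (s ^ 2 * (k ^ 2 * ‖b₀‖ ^ 2)))) := by ring
      _ ≤ 2 * (2 * (δ ^ 2 * (1 * Q ^ 2))) := by gcongr
      _ = _ := by ring
  have r5 : 0 ≤ 3 * δ * ((s * k * δ) ^ 4 * ‖a₀‖ ^ 2) := by
    have : 0 ≤ (s * k * δ) ^ 4 := by positivity
    positivity
  have r6 : 3 * δ * ρ ^ 2 * ‖b₁‖ ^ 2 ≤ ξ * ‖b₁‖ ^ 2 := by gcongr
  have r7 : ‖c₀‖ ^ 2 * (3 * δ * ρ ^ 4) ≤ ‖c₀‖ ^ 2 * ((3 * δ + Complex.I) * w ^ 4).re := by gcongr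
  have r8 : ‖a₀‖ ^ 2 * ((3 * δ + Complex.I) * z).re ≤ ‖a₀‖ ^ 2 * (-(δ * k ^ 4)) := by gcongr
  linarith

/-- The first order part of the rotated reduced form is positive up to terms that integrate to lower
order ones. -/
theorem firstOrder_ge {s η ρ : ℝ} (hs : |s| ≤ 1) (hη0 : 0 ≤ η) (hη1 : η ≤ ρ ^ 2) (hρ : ρ ^ 2 ≤ 1) :
    (1 - |s|) * ρ ^ 4 * (‖a₂‖ ^ 2 + ‖b₁‖ ^ 2 + ‖c₀‖ ^ 2 + k ^ 4 * ‖a₀‖ ^ 2)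
      + |s| * (2 * η * (c₀ * conj a₂ + b₁ * conj b₁).re
        + 2 * k ^ 2 * ((a₂ * conj a₀).re - ‖a₁‖ ^ 2)
        - 2 * k ^ 2 * η * (c₀ * conj a₀ + b₀ * conj b₀).re)
    ≤ 3 * ‖a₂‖ ^ 2 - 4 * (s * k) * (a₂ * conj a₁).re + k ^ 4 * ‖a₀‖ ^ 2 + 6 * ρ ^ 2 * ‖b₁‖ ^ 2
        - 4 * (s * k) * η * (b₁ * conj b₀).re + 3 * ρ ^ 4 * ‖c₀‖ ^ 2 := by
  -- With s k written as |s| l, l = ±k, both sides are affine in |s|. The claim is therefore a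
  -- convex combination of the case |s| = 1, which is `q1`, and the case s = 0, which is `q2`.
  obtain ⟨l, hl, hls⟩ : ∃ l : ℝ, l ^ 2 = k ^ 2 ∧ s * k = |s| * l := by
    rcases le_total 0 s with h | h
    · exact ⟨k, rfl, by rw [abs_of_nonneg h]⟩
    · exact ⟨-k, by ring, by rw [abs_of_nonpos h]; ring⟩
  -- Where η = 1 the first square is that of the Helmholtz operator, since a₂ stands for minus the
  -- second derivative in x₁, conjugated by exp(irx₁). The last bracket collects the null terms.
  have hid : 3 * ‖a₂‖ ^ 2 - 4 * l * (a₂ * conj a₁).re + k ^ 4 * ‖a₀‖ ^ 2 + 6 * ρ ^ 2 * ‖b₁‖ ^ 2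
        - 4 * l * η * (b₁ * conj b₀).re + 3 * ρ ^ 4 * ‖c₀‖ ^ 2
      = ‖a₂ - η * c₀ - (k ^ 2 : ℝ) * a₀‖ ^ 2 + 2 * ‖a₂ - l * a₁‖ ^ 2 + 2 * η * ‖b₁ - l * b₀‖ ^ 2
        + (6 * ρ ^ 2 - 4 * η) * ‖b₁‖ ^ 2 + (3 * ρ ^ 4 - η ^ 2) * ‖c₀‖ ^ 2
        + (2 * η * (c₀ * conj a₂ + b₁ * conj b₁).re
        + 2 * k ^ 2 * ((a₂ * conj a₀).re - ‖a₁‖ ^ 2)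
        - 2 * k ^ 2 * η * (c₀ * conj a₀ + b₀ * conj b₀).re) := by
    simp only [Complex.sq_norm, Complex.normSq_apply]
    simp only [Complex.mul_re, Complex.mul_im, Complex.add_re, Complex.sub_re, Complex.sub_im,
      Complex.ofReal_re, Complex.ofReal_im, Complex.conj_re, Complex.conj_im]
    linear_combination (-2 * (a₁.re * a₁.re + a₁.im * a₁.im)
      - 2 * η * (b₀.re * b₀.re + b₀.im * b₀.im)) * hl
  have hη2 : η ^ 2 ≤ ρ ^ 4 := by
    rw [show ρ ^ 4 = (ρ ^ 2) ^ 2 by ring]; gcongr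
  have p1 : 0 ≤ (6 * ρ ^ 2 - 4 * η) * ‖b₁‖ ^ 2 := mul_nonneg (by nlinarith) (sq_nonneg _)
  have p2 : 0 ≤ (3 * ρ ^ 4 - η ^ 2) * ‖c₀‖ ^ 2 := mul_nonneg (by nlinarith) (sq_nonneg _)
  have p3 : 0 ≤ 2 * η * ‖b₁ - l * b₀‖ ^ 2 := by positivity
  have q1 := mul_le_mul_of_nonneg_left (show
      2 * η * (c₀ * conj a₂ + b₁ * conj b₁).re + 2 * k ^ 2 * ((a₂ * conj a₀).re - ‖a₁‖ ^ 2)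
        - 2 * k ^ 2 * η * (c₀ * conj a₀ + b₀ * conj b₀).re
      ≤ 3 * ‖a₂‖ ^ 2 - 4 * l * (a₂ * conj a₁).re + k ^ 4 * ‖a₀‖ ^ 2 + 6 * ρ ^ 2 * ‖b₁‖ ^ 2
        - 4 * l * η * (b₁ * conj b₀).re + 3 * ρ ^ 4 * ‖c₀‖ ^ 2 by
    rw [hid]
    have := sq_nonneg ‖a₂ - η * c₀ - (k ^ 2 : ℝ) * a₀‖
    have := sq_nonneg ‖a₂ - l * a₁‖
    linarith) (abs_nonneg s)
  have hρ4 : ρ ^ 4 ≤ ρ ^ 2 := by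
    rw [show ρ ^ 4 = ρ ^ 2 * ρ ^ 2 by ring]; nlinarith [sq_nonneg ρ]
  have hρ0 : 0 ≤ ρ ^ 4 := by positivity
  have q2 := mul_le_mul_of_nonneg_left (show
      ρ ^ 4 * (‖a₂‖ ^ 2 + ‖b₁‖ ^ 2 + ‖c₀‖ ^ 2 + k ^ 4 * ‖a₀‖ ^ 2)
      ≤ 3 * ‖a₂‖ ^ 2 + k ^ 4 * ‖a₀‖ ^ 2 + 6 * ρ ^ 2 * ‖b₁‖ ^ 2 + 3 * ρ ^ 4 * ‖c₀‖ ^ 2 by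
    have u1 : ρ ^ 4 * ‖a₂‖ ^ 2 ≤ 1 * ‖a₂‖ ^ 2 := by gcongr; linarith
    have u2 : ρ ^ 4 * ‖b₁‖ ^ 2 ≤ ρ ^ 2 * ‖b₁‖ ^ 2 := by gcongr
    have u3 : ρ ^ 4 * (k ^ 4 * ‖a₀‖ ^ 2) ≤ 1 * (k ^ 4 * ‖a₀‖ ^ 2) := by gcongr; linarith
    have : 0 ≤ ρ ^ 4 * ‖c₀‖ ^ 2 := by positivity
    have : 0 ≤ ρ ^ 2 * ‖b₁‖ ^ 2 := by positivity
    linarith [sq_nonneg ‖a₂‖]) (sub_nonneg.mpr hs)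
  rw [hls]
  linarith

/-- The part of the form that involves derivatives of the coefficients. -/
def lowerForm (μ a : ℝ) (s s' G G' G'' a₀ a₁ a₂ b₀ b₁ c₀ : ℂ) : ℂ :=
  -μ * s' * b₀ * (G * (conj a₂ - a ^ 2 * conj a₀ + 2 * Complex.I * a * conj a₁))
    + (2 - 2 * μ) * s * ((b₁ + Complex.I * a * b₀) * (G' * (conj a₁ + Complex.I * a * conj a₀)))
    + s * (s * c₀ + s' * b₀) * (s * (2 * G' * conj b₀ + G'' * conj a₀)
      + s' * (G * conj b₀ + G' * conj a₀))
    + s * s' * b₀ * (s * (G * conj c₀))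
    - μ * (a₂ - a ^ 2 * a₀ + 2 * Complex.I * a * a₁) * (s * (2 * G' * conj b₀ + G'' * conj a₀)
      + s' * (G * conj b₀ + G' * conj a₀))

/-- In every term a derivative falls on H or on 1/σ instead of ψ, so at least one factor is of order
at most one; this pays for the additional factor k. -/
theorem norm_lowerForm_le (hk : 1 ≤ k) {a μ M : ℝ} (ha : |a| ≤ k) (hμ0 : 0 < μ) (hμ1 : μ < 1)
    {s s' G G' G'' : ℂ} (hs : ‖s‖ ≤ 1) (hM : 1 ≤ M) (hs' : ‖s'‖ ≤ M) (hG : ‖G‖ ≤ M)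
    (hG' : ‖G'‖ ≤ M) (hG'' : ‖G''‖ ≤ M) :
    k * ‖lowerForm μ a s s' G G' G'' a₀ a₁ a₂ b₀ b₁ c₀‖
      ≤ 43 * M ^ 3 * weight k a₀ a₁ a₂ b₀ b₁ c₀ := by
  have hk0 : 0 < k := by linarith
  obtain ⟨h1, h2, h3, h4, h5, h6⟩ := norms_le_sqrt_weight (a₀ := a₀) (a₁ := a₁) (a₂ := a₂)
    (b₀ := b₀) (b₁ := b₁) (c₀ := c₀) (k := k)
  obtain ⟨hA, hA', hB, hB', hE⟩ := norm_shift_le (a₀ := a₀) (a₁ := a₁) (a₂ := a₂)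
    (b₀ := b₀) (b₁ := b₁) (c₀ := c₀) hk0 ha
  have hQ := Real.sq_sqrt (weight_nonneg (k := k) (a₀ := a₀) (a₁ := a₁) (a₂ := a₂)
    (b₀ := b₀) (b₁ := b₁) (c₀ := c₀))
  set Q := √(weight k a₀ a₁ a₂ b₀ b₁ c₀)
  have hQ0 : 0 ≤ Q := Real.sqrt_nonneg _
  rw [← hQ]
  have hnk : ‖(k : ℂ)‖ = k := by rw [Complex.norm_real, Real.norm_of_nonneg hk0.le]
  have h0 : k * ‖a₀‖ ≤ Q := by
    refine le_trans ?_ h6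
    gcongr
    nlinarith
  have hb0 : ‖b₀‖ ≤ Q := by nlinarith [norm_nonneg b₀]
  have hnb : ‖(k : ℂ) * b₀‖ ≤ Q := by rw [norm_mul, hnk]; exact h5
  have hnE : ‖(k : ℂ) * (conj a₁ + Complex.I * a * conj a₀)‖ ≤ 2 * Q := by
    rw [norm_mul, hnk]; exact hE
  set Ac := conj a₂ - a ^ 2 * conj a₀ + 2 * Complex.I * a * conj a₁
  set Ap := a₂ - a ^ 2 * a₀ + 2 * Complex.I * a * a₁
  set B := b₁ + Complex.I * a * b₀
  set E := conj a₁ + Complex.I * a * conj a₀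
  set L := s * (2 * G' * conj b₀ + G'' * conj a₀) + s' * (G * conj b₀ + G' * conj a₀) with hL
  have hM0 : 0 ≤ M := by linarith
  have hM2 : M ≤ M ^ 2 := by nlinarith
  have hM3 : M ^ 2 ≤ M ^ 3 := by nlinarith [sq_nonneg M]
  have hnL : ‖(k : ℂ) * L‖ ≤ 5 * M ^ 2 * Q := by
    have e : (k : ℂ) * L = s * (2 * G' * (k * conj b₀) + G'' * (k * conj a₀))
        + s' * (G * (k * conj b₀) + G' * (k * conj a₀)) := by rw [hL]; ring
    have hcb : ‖(k : ℂ) * conj b₀‖ ≤ Q := by rw [norm_mul, hnk, RCLike.norm_conj]; exact h5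
    have hca : ‖(k : ℂ) * conj a₀‖ ≤ Q := by rw [norm_mul, hnk, RCLike.norm_conj]; exact h0
    rw [e]
    calc _ ≤ ‖s‖ * (2 * ‖G'‖ * ‖(k : ℂ) * conj b₀‖ + ‖G''‖ * ‖(k : ℂ) * conj a₀‖)
          + ‖s'‖ * (‖G‖ * ‖(k : ℂ) * conj b₀‖ + ‖G'‖ * ‖(k : ℂ) * conj a₀‖) := by
          refine (norm_add_le _ _).trans (add_le_add ?_ ?_)
          · rw [norm_mul s]
            gcongr
            refine (norm_add_le _ _).trans_eq ?_
            simp only [norm_mul, Complex.norm_ofNat]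
          · rw [norm_mul s']
            gcongr
            refine (norm_add_le _ _).trans_eq ?_
            simp only [norm_mul]
      _ ≤ 1 * (2 * M * Q + M * Q) + M * (M * Q + M * Q) := by gcongr
      _ = (3 * M + 2 * M ^ 2) * Q := by ring
      _ ≤ _ := by gcongr; linarith
  have e : (k : ℂ) * lowerForm μ a s s' G G' G'' a₀ a₁ a₂ b₀ b₁ c₀
      = -μ * s' * G * (k * b₀ * Ac) + (2 - 2 * μ) * s * G' * (B * (k * E))
        + s * (s * c₀ + s' * b₀) * (k * L) + s * s' * s * G * (k * b₀ * conj c₀)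
        - μ * (Ap * (k * L)) := by
    simp only [lowerForm]; ring
  have n2 : ‖(2 - 2 * (μ : ℂ))‖ ≤ 2 := by
    have : (2 - 2 * (μ : ℂ)) = ((2 - 2 * μ : ℝ) : ℂ) := by push_cast; ring
    rw [this, Complex.norm_real, Real.norm_of_nonneg (by linarith)]
    linarith
  have nμ : ‖(μ : ℂ)‖ ≤ 1 := by
    rw [Complex.norm_real, Real.norm_of_nonneg hμ0.le]; exact hμ1.le
  have t1 : ‖-(μ : ℂ) * s' * G * (k * b₀ * Ac)‖ ≤ 1 * M * M * (Q * (4 * Q)) := by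
    rw [norm_mul, norm_mul, norm_mul, norm_mul (k * b₀ : ℂ), norm_neg]
    gcongr
  have t2 : ‖(2 - 2 * (μ : ℂ)) * s * G' * (B * (k * E))‖ ≤ 2 * 1 * M * ((2 * Q) * (2 * Q)) := by
    rw [norm_mul, norm_mul, norm_mul, norm_mul B]
    gcongr
  have t3 : ‖s * (s * c₀ + s' * b₀) * (k * L)‖ ≤ 1 * (1 * Q + M * Q) * (5 * M ^ 2 * Q) := by
    rw [norm_mul, norm_mul s]
    gcongr
    refine (norm_add_le _ _).trans ?_
    rw [norm_mul, norm_mul]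
    gcongr
  have t4 : ‖s * s' * s * G * (k * b₀ * conj c₀)‖ ≤ 1 * M * 1 * M * (Q * Q) := by
    rw [norm_mul, norm_mul, norm_mul, norm_mul, norm_mul (k * b₀ : ℂ), RCLike.norm_conj]
    gcongr
  have t5 : ‖(μ : ℂ) * (Ap * (k * L))‖ ≤ 1 * ((4 * Q) * (5 * M ^ 2 * Q)) := by
    rw [norm_mul, norm_mul Ap]
    gcongr
  have hfin : k * ‖lowerForm μ a s s' G G' G'' a₀ a₁ a₂ b₀ b₁ c₀‖
      ≤ 1 * M * M * (Q * (4 * Q)) + 2 * 1 * M * ((2 * Q) * (2 * Q))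
        + 1 * (1 * Q + M * Q) * (5 * M ^ 2 * Q) + 1 * M * 1 * M * (Q * Q)
        + 1 * ((4 * Q) * (5 * M ^ 2 * Q)) := by
    calc _ = ‖(k : ℂ) * lowerForm μ a s s' G G' G'' a₀ a₁ a₂ b₀ b₁ c₀‖ := by rw [norm_mul, hnk]
      _ ≤ _ := by
        rw [e]
        refine (norm_sub_le _ _).trans (add_le_add ?_ t5)
        refine (norm_add_le _ _).trans (add_le_add ?_ t4)
        refine (norm_add_le _ _).trans (add_le_add ?_ t3)
        exact (norm_add_le _ _).trans (add_le_add t1 t2)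
  refine hfin.trans ?_
  have : 1 * M * M * (Q * (4 * Q)) + 2 * 1 * M * ((2 * Q) * (2 * Q))
        + 1 * (1 * Q + M * Q) * (5 * M ^ 2 * Q) + 1 * M * 1 * M * (Q * Q)
        + 1 * ((4 * Q) * (5 * M ^ 2 * Q))
      = (30 * M ^ 2 + 8 * M + 5 * M ^ 3) * Q ^ 2 := by ring
  rw [this]
  gcongr
  linarith

/-- These are the expressions left over when the null Lagrangian is integrated by parts. Each has
b₀, of order one, in place of a second derivative, which gains the factor k. -/
theorem norm_boundaryForm_le (hk : 0 < k) {a W : ℝ} (ha : |a| ≤ k) {w : ℂ} (hw : ‖w‖ ≤ W) :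
    k * ‖w * ((b₀ * conj a₂ + conj (b₀ * conj a₂))
        - a ^ 2 * (b₀ * conj a₀ + conj (b₀ * conj a₀))
        + 2 * Complex.I * a * (b₀ * conj a₁ + conj (b₀ * conj a₁)))‖
      ≤ 8 * W * weight k a₀ a₁ a₂ b₀ b₁ c₀ := by
  obtain ⟨h1, h2, h3, h4, h5, h6⟩ := norms_le_sqrt_weight (a₀ := a₀) (a₁ := a₁) (a₂ := a₂)
    (b₀ := b₀) (b₁ := b₁) (c₀ := c₀) (k := k)
  obtain ⟨hA, hA', -, -, -⟩ := norm_shift_le (a₀ := a₀) (a₁ := a₁) (a₂ := a₂)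
    (b₀ := b₀) (b₁ := b₁) (c₀ := c₀) hk ha
  have hQ := Real.sq_sqrt (weight_nonneg (k := k) (a₀ := a₀) (a₁ := a₁) (a₂ := a₂)
    (b₀ := b₀) (b₁ := b₁) (c₀ := c₀))
  set Q := √(weight k a₀ a₁ a₂ b₀ b₁ c₀)
  have hQ0 : 0 ≤ Q := Real.sqrt_nonneg _
  have hW0 : 0 ≤ W := (norm_nonneg _).trans hw
  rw [← hQ]
  have e : (b₀ * conj a₂ + conj (b₀ * conj a₂))
        - a ^ 2 * (b₀ * conj a₀ + conj (b₀ * conj a₀))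
        + 2 * Complex.I * a * (b₀ * conj a₁ + conj (b₀ * conj a₁))
      = b₀ * (conj a₂ - a ^ 2 * conj a₀ + 2 * Complex.I * a * conj a₁)
        + conj b₀ * (a₂ - a ^ 2 * a₀ + 2 * Complex.I * a * a₁) := by
    simp only [map_mul, Complex.conj_conj]; ring
  rw [e, norm_mul]
  set Ac := conj a₂ - a ^ 2 * conj a₀ + 2 * Complex.I * a * conj a₁
  set Ap := a₂ - a ^ 2 * a₀ + 2 * Complex.I * a * a₁
  calc k * (‖w‖ * ‖b₀ * Ac + conj b₀ * Ap‖) ≤ k * (W * (‖b₀‖ * ‖Ac‖ + ‖b₀‖ * ‖Ap‖)) := by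
        gcongr
        refine (norm_add_le _ _).trans_eq ?_
        rw [norm_mul, norm_mul, RCLike.norm_conj]
    _ = W * ((k * ‖b₀‖) * ‖Ac‖ + (k * ‖b₀‖) * ‖Ap‖) := by ring
    _ ≤ W * (Q * (4 * Q) + Q * (4 * Q)) := by gcongr
    _ = _ := by ring

end Bounds

/-- If φ ∈ [0, π/6] is the argument of σ, the powers σ⁻² and σ⁻⁴ turn i clockwise by at most π/3 and
2π/3, so that its real part stays nonnegative. Quantitatively, xy ≤ x² - y² and 6δ ≤ 1 let this
contribution compensate what the factor 3δ loses by the same rotation. -/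
theorem stretch_rotation_bounds {σ : ℂ} {δ : ℝ} (hδ0 : 0 < δ) (hδ1 : δ ≤ 1 / 6) (hx : 1 ≤ σ.re)
    (hy : 0 ≤ σ.im) (hxy : 3 * σ.im ^ 2 ≤ σ.re ^ 2) :
    3 * δ * (‖σ‖⁻¹) ^ 2 ≤ ((3 * δ + Complex.I) * σ⁻¹ ^ 2).re ∧
    ((3 * δ + Complex.I) * σ⁻¹ ^ 2).re ≤ 2 ∧
    0 ≤ ((3 * δ + Complex.I) * σ⁻¹ ^ 2).im ∧
    ((3 * δ + Complex.I) * σ⁻¹ ^ 2).im ≤ (‖σ‖⁻¹) ^ 2 ∧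
    3 * δ * (‖σ‖⁻¹) ^ 4 ≤ ((3 * δ + Complex.I) * σ⁻¹ ^ 4).re := by
  set x := σ.re
  set y := σ.im
  set r : ℝ := (Complex.normSq σ)⁻¹ with hr
  have hN : Complex.normSq σ = x ^ 2 + y ^ 2 := by rw [Complex.normSq_apply]; ring
  have hNpos : 0 < x ^ 2 + y ^ 2 := by positivity
  have hr1 : r * (x ^ 2 + y ^ 2) = 1 := by
    rw [hr, hN]; exact inv_mul_cancel₀ hNpos.ne'
  have hr0 : 0 < r := by rw [hr, hN]; positivity
  have hrn : (‖σ‖⁻¹) ^ 2 = r := by rw [inv_pow, Complex.sq_norm]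
  have hrn4 : (‖σ‖⁻¹) ^ 4 = r ^ 2 := by rw [← hrn]; ring
  have hσ : σ⁻¹ = conj σ * r := by rw [Complex.inv_def]
  have e1 : ((3 * δ + Complex.I) * σ⁻¹ ^ 2).re
      = r ^ 2 * (3 * δ * (x ^ 2 - y ^ 2) + 2 * (x * y)) := by
    rw [hσ]; simp [pow_two, Complex.mul_re, Complex.mul_im]; ring
  have e2 : ((3 * δ + Complex.I) * σ⁻¹ ^ 2).im
      = r ^ 2 * ((x ^ 2 - y ^ 2) - 6 * δ * (x * y)) := by
    rw [hσ]; simp [pow_two, Complex.mul_re, Complex.mul_im]; ring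
  have e3 : ((3 * δ + Complex.I) * σ⁻¹ ^ 4).re
      = r ^ 4 * (3 * δ * ((x ^ 2 - y ^ 2) ^ 2 - 4 * (x * y) ^ 2)
        + 4 * (x * y) * (x ^ 2 - y ^ 2)) := by
    rw [hσ, show (conj σ * (r : ℂ)) ^ 4 = ((conj σ * r) * (conj σ * r))
      * ((conj σ * r) * (conj σ * r)) by ring]
    simp [Complex.mul_re, Complex.mul_im]; ring
  have hrr : r = r ^ 2 * (x ^ 2 + y ^ 2) := by linear_combination (-r) * hr1
  have hrr4 : r ^ 2 = r ^ 4 * (x ^ 2 + y ^ 2) ^ 2 := by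
    linear_combination (-r ^ 2 * (1 + r * (x ^ 2 + y ^ 2))) * hr1
  have hxy0 : 0 ≤ x * y := by positivity
  have hyx : y ≤ x := by nlinarith
  have hd : 6 * δ * (x * y) ≤ x ^ 2 - y ^ 2 := by
    have : 6 * δ * (x * y) ≤ 1 * (x * y) := by gcongr; linarith
    nlinarith [sq_nonneg (x - 2 * y), sq_nonneg (5 * x - 9 * y)]
  rw [hrn, hrn4, e1, e2, e3]
  refine ⟨?_, ?_, ?_, ?_, ?_⟩
  · rw [show 3 * δ * r = r ^ 2 * (3 * δ * (x ^ 2 + y ^ 2)) by linear_combination 3 * δ * hrr]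
    gcongr
    nlinarith [mul_nonneg hy (sub_nonneg.mpr hyx), mul_nonneg (sub_nonneg.mpr hδ1) (sq_nonneg y)]
  · have h2 : r ≤ 1 := by nlinarith
    have h3 : 3 * δ * (x ^ 2 - y ^ 2) + 2 * (x * y) ≤ 2 * (x ^ 2 + y ^ 2) := by
      nlinarith [sq_nonneg (x - y), mul_nonneg (sub_nonneg.mpr hδ1) (sq_nonneg x),
        mul_nonneg hδ0.le (sq_nonneg y)]
    calc _ ≤ r ^ 2 * (2 * (x ^ 2 + y ^ 2)) := by gcongr
      _ = 2 * r := by linear_combination (-2) * hrr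
      _ ≤ 2 := by linarith
  · exact mul_nonneg (sq_nonneg _) (sub_nonneg.mpr hd)
  · calc _ ≤ r ^ 2 * (x ^ 2 + y ^ 2) := by
          gcongr
          nlinarith [mul_nonneg hδ0.le hxy0]
      _ = r := hrr.symm
  · rw [show 3 * δ * r ^ 2 = r ^ 4 * (3 * δ * (x ^ 2 + y ^ 2) ^ 2) by
      linear_combination 3 * δ * hrr4]
    refine mul_le_mul_of_nonneg_left ?_ (by positivity)
    linear_combination 4 * mul_nonneg hxy0 (sub_nonneg.mpr hd)

/-- To first order in δ the coefficient is 3δ - 4δ. The rotation 3δ has to stay below the 4δ gained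
by the fourth power of the wavenumber, for then the term of order zero acquires the good sign. -/
theorem re_rotation_pow_le {k δ : ℝ} (hδ0 : 0 < δ) (hδ1 : δ ≤ 1 / 6) :
    ((3 * δ + Complex.I) * (k * (1 + Complex.I * δ)) ^ 4).re ≤ -(δ * k ^ 4) := by
  have e : (3 * δ + Complex.I) * (k * (1 + Complex.I * δ)) ^ 4
      = ((k ^ 4 * (-δ - 14 * δ ^ 3 + 3 * δ ^ 5) : ℝ) : ℂ)
        + ((k ^ 4 * (1 + 6 * δ ^ 2 - 11 * δ ^ 4) : ℝ) : ℂ) * Complex.I := by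
    have h3 : Complex.I ^ 3 = -Complex.I := by rw [pow_succ, Complex.I_sq]; ring
    have h4 : Complex.I ^ 4 = 1 := Complex.I_pow_four
    have h5 : Complex.I ^ 5 = Complex.I := by rw [pow_succ, h4, one_mul]
    push_cast
    ring_nf
    rw [h3, h4, h5, Complex.I_sq]
    ring
  rw [e, Complex.add_re, Complex.re_ofReal_mul, Complex.I_re, mul_zero, add_zero, Complex.ofReal_re]
  have h : 3 * δ ^ 5 ≤ 14 * δ ^ 3 := by
    have : δ ^ 2 ≤ 1 := by nlinarith
    have h3 : 0 ≤ δ ^ 3 := by positivity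
    nlinarith
  have hk : 0 ≤ k ^ 4 := by positivity
  nlinarith

theorem norm_rotation_pow_le {k δ : ℝ} (hk : 0 ≤ k) (hδ0 : 0 < δ) (hδ1 : δ ≤ 1 / 6) :
    ‖((k : ℂ) * (1 + Complex.I * δ)) ^ 4‖ ≤ 16 * k ^ 4 := by
  have h : ‖(1 + Complex.I * (δ : ℂ))‖ ≤ 2 := by
    refine (norm_add_le _ _).trans ?_
    rw [norm_mul, Complex.norm_I, Complex.norm_real, Real.norm_of_nonneg hδ0.le, norm_one]
    linarith
  rw [norm_pow, norm_mul, Complex.norm_real, Real.norm_of_nonneg hk, mul_pow, mul_comm]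
  gcongr
  calc _ ≤ (2 : ℝ) ^ 4 := by gcongr
    _ = 16 := by norm_num

end BiharmonicPML
end


noncomputable section

namespace BiharmonicPML

/-! ### Integrated estimates for clamped functions -/

theorem continuous_derivs {ψ : ℝ × ℝ → ℂ} (hψ : ContDiff ℝ ∞ ψ) (r : ℝ) :
    Continuous ψ ∧ Continuous (Dr r ψ) ∧ Continuous (Dr r (Dr r ψ)) ∧ Continuous (pd (0, 1) ψ) ∧
      Continuous (Dr r (pd (0, 1) ψ)) ∧ Continuous (pd (0, 1) (pd (0, 1) ψ)) :=
  ⟨hψ.continuous, (contDiff_Dr hψ r).continuous, (contDiff_Dr (contDiff_Dr hψ r) r).continuous,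
    (contDiff_pd hψ _).continuous, (contDiff_Dr (contDiff_pd hψ _) r).continuous,
    (contDiff_pd (contDiff_pd hψ _) _).continuous⟩

/-- The weighted size of the derivatives of a function at a point. -/
def weightAt (k r : ℝ) (ψ : ℝ × ℝ → ℂ) (x : ℝ × ℝ) : ℝ :=
  weight k (ψ x) (Dr r ψ x) (Dr r (Dr r ψ) x) (pd (0, 1) ψ x) (Dr r (pd (0, 1) ψ) x)
    (pd (0, 1) (pd (0, 1) ψ) x)

theorem continuous_weightAt {ψ : ℝ × ℝ → ℂ} (hψ : ContDiff ℝ ∞ ψ) (k r : ℝ) :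
    Continuous (weightAt k r ψ) := by
  obtain ⟨h0, h1, h2, h3, h4, h5⟩ := continuous_derivs hψ r
  unfold weightAt weight
  fun_prop

section Estimates

attribute [local irreducible] Dr pd

namespace Setup

variable {P : Setup}

/-- The conjugate half follows by conjugating the identity for the weight conj w; this is why `H` is
required for all complex weights. -/
theorem integral_add_conj {f h : ℝ × ℝ → ℂ} (hf : Continuous f) (hh : Continuous h)
    (H : ∀ w w' : ℝ → ℂ, (∀ t, HasDerivAt w (w' t) t) → Continuous w' →
      ∫ x in P.domain, w x.2 * f x = -∫ x in P.domain, w' x.2 * h x)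
    {w w' : ℝ → ℂ} (hw : ∀ t, HasDerivAt w (w' t) t) (hw' : Continuous w') :
    ∫ x in P.domain, w x.2 * (f x + conj (f x))
      = -∫ x in P.domain, w' x.2 * (h x + conj (h x)) := by
  have hwc : Continuous w := continuous_iff_continuousAt.mpr fun t => (hw t).continuousAt
  have hcd : ∀ t, HasDerivAt (fun t => conj (w t)) (conj (w' t)) t := fun t =>
    (Complex.conjCLE.toContinuousLinearMap.hasFDerivAt.comp_hasDerivAt t (hw t))
  have h1 := H w w' hw hw'
  have h2 := congrArg conj (H _ _ hcd (by fun_prop))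
  rw [map_neg, ← integral_conj, ← integral_conj] at h2
  simp only [map_mul, Complex.conj_conj] at h2
  simp only [mul_add]
  rw [integral_add (integrable_of_continuous (by fun_prop)) (integrable_of_continuous (by fun_prop)),
    integral_add (integrable_of_continuous (by fun_prop)) (integrable_of_continuous (by fun_prop)),
    h1, h2]
  ring

theorem integral_mul_re {f h : ℝ × ℝ → ℂ} (hf : Continuous f) (hh : Continuous h)
    (H : ∀ w w' : ℝ → ℂ, (∀ t, HasDerivAt w (w' t) t) → Continuous w' →
      ∫ x in P.domain, w x.2 * f x = -∫ x in P.domain, w' x.2 * h x)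
    {η η' : ℝ → ℝ} (hη : ∀ t, HasDerivAt η (η' t) t) (hη' : Continuous η') :
    ∫ x in P.domain, η x.2 * (f x).re = -∫ x in P.domain, η' x.2 * (h x).re := by
  have hηc : Continuous η := continuous_iff_continuousAt.mpr fun t => (hη t).continuousAt
  have h1 := congrArg Complex.re (H (fun t => (η t : ℂ)) (fun t => (η' t : ℂ))
    (fun t => (hη t).ofReal_comp) (by fun_prop))
  have h2 : ∀ {f : ℝ × ℝ → ℂ} {η : ℝ → ℝ}, Continuous f → Continuous η →
      (∫ x in P.domain, (η x.2 : ℂ) * f x).re = ∫ x in P.domain, η x.2 * (f x).re := by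
    intro f η hf hη
    have := Complex.reCLM.integral_comp_comm (μ := volume.restrict P.domain)
      (φ := fun x => (η x.2 : ℂ) * f x) (integrable_of_continuous (by fun_prop))
    rw [← Complex.reCLM_apply, ← this]
    simp
  rw [Complex.neg_re, h2 hf hηc, h2 hh hη'] at h1
  exact h1

theorem Admissible.null_zero (hP : P.Admissible) {ψ : ℝ × ℝ → ℂ} (hψ : ψ ∈ P.clamped 0)
    (w w' : ℝ → ℂ) (hw : ∀ t, HasDerivAt w (w' t) t) (hw' : Continuous w') :
    ∫ x in P.domain, w x.2 * (pd (0, 1) (pd (0, 1) ψ) x * conj (ψ x)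
        + pd (0, 1) ψ x * conj (pd (0, 1) ψ x))
      = -∫ x in P.domain, w' x.2 * (pd (0, 1) ψ x * conj (ψ x)) :=
  hP.integral_parts_snd hψ hψ.1 hw hw'

theorem Admissible.null_one (hP : P.Admissible) {ψ : ℝ × ℝ → ℂ} (hψ : ψ ∈ P.clamped 0) (r : ℝ)
    (w w' : ℝ → ℂ) (hw : ∀ t, HasDerivAt w (w' t) t) (hw' : Continuous w') :
    ∫ x in P.domain, w x.2 * (pd (0, 1) (pd (0, 1) ψ) x * conj (Dr r ψ x)
        + pd (0, 1) ψ x * conj (Dr r (pd (0, 1) ψ) x))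
      = -∫ x in P.domain, w' x.2 * (pd (0, 1) ψ x * conj (Dr r ψ x)) := by
  have := hP.integral_parts_snd hψ (contDiff_Dr hψ.1 r) hw hw'
  rwa [pd_Dr hψ.1] at this

/-- Integrate by parts in x₂ against the second `Dr` derivative of ψ, then move one `Dr` back. It is
symmetric, and it commutes with ∂₂ and with weights that depend on x₂ only. -/
theorem Admissible.null_two (hP : P.Admissible) {ψ : ℝ × ℝ → ℂ} (hψ : ψ ∈ P.clamped 0) (r : ℝ)
    (w w' : ℝ → ℂ) (hw : ∀ t, HasDerivAt w (w' t) t) (hw' : Continuous w') :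
    ∫ x in P.domain, w x.2 * (pd (0, 1) (pd (0, 1) ψ) x * conj (Dr r (Dr r ψ) x)
        + Dr r (pd (0, 1) ψ) x * conj (Dr r (pd (0, 1) ψ) x))
      = -∫ x in P.domain, w' x.2 * (pd (0, 1) ψ x * conj (Dr r (Dr r ψ) x)) := by
  have h1 := hP.integral_parts_snd hψ (contDiff_Dr (contDiff_Dr hψ.1 r) r) hw hw'
  rw [pd_Dr (contDiff_Dr hψ.1 r), pd_Dr hψ.1] at h1
  have hb := contDiff_pd hψ.1 (0, 1)
  have hbp := hψ.2.1.pd hψ.1 (0, 1)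
  have h2 := hP.integral_Dr_symm hb hbp
    (fun x hx => pd_eq_zero_of_mem_clamped hψ (Or.inl (Or.inl hx)) _)
    (contDiff_Dr hb r) (hbp.Dr hb r) r hw hw'
  rw [← h1]
  have hwc : Continuous w := continuous_iff_continuousAt.mpr fun t => (hw t).continuousAt
  obtain ⟨q0, q1, q2, q3, q4, q5⟩ := continuous_derivs hψ.1 r
  have q6 := (contDiff_Dr (contDiff_Dr hb r) r).continuous
  simp only [mul_add]
  rw [integral_add (integrable_of_continuous (by fun_prop)) (integrable_of_continuous (by fun_prop)),
    integral_add (integrable_of_continuous (by fun_prop)) (integrable_of_continuous (by fun_prop)),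
    h2]

theorem Admissible.integral_norm_Dr_sq (hP : P.Admissible) {ψ : ℝ × ℝ → ℂ}
    (hψ : ψ ∈ P.clamped 0) (r : ℝ) :
    ∫ x in P.domain, ((Dr r (Dr r ψ) x * conj (ψ x)).re - ‖Dr r ψ x‖ ^ 2) = 0 := by
  have h := hP.integral_Dr_symm hψ.1 hψ.2.1 (fun x hx => (hψ.2.2 x (Or.inl (Or.inl hx))).1)
    (contDiff_Dr hψ.1 r) (hψ.2.1.Dr hψ.1 r) r (w := fun _ => 1) (w' := fun _ => 0)
    (fun t => hasDerivAt_const _ _) continuous_const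
  simp only [one_mul] at h
  obtain ⟨q0, q1, q2, -, -, -⟩ := continuous_derivs hψ.1 r
  have h2 : ∀ {f : ℝ × ℝ → ℂ}, Continuous f →
      (∫ x in P.domain, f x).re = ∫ x in P.domain, (f x).re := fun hf =>
    (Complex.reCLM.integral_comp_comm (integrable_of_continuous hf)).symm
  have h3 := congrArg Complex.re h
  rw [h2 (by fun_prop), h2 (by fun_prop)] at h3
  rw [integral_sub (integrable_of_continuous (by fun_prop)) (integrable_of_continuous (by fun_prop)),
    sub_eq_zero]
  have e1 : ∀ x, (Dr r ψ x * conj (Dr r ψ x)).re = ‖Dr r ψ x‖ ^ 2 := fun x => by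
    rw [Complex.mul_conj']; norm_cast
  have e2 : ∀ x, (ψ x * conj (Dr r (Dr r ψ) x)).re = (Dr r (Dr r ψ) x * conj (ψ x)).re := fun x => by
    rw [← Complex.conj_re, map_mul, Complex.conj_conj, mul_comm]
  simp only [e1, e2] at h3
  exact h3.symm

/-- Interpolation: the integrals of ‖Dr ψ‖² and ‖∂₂ψ‖² equal those of products of a second
derivative with ψ, up to sign. Adding these vanishing expressions removes the first derivatives, and
k²|a||b| ≤ (|a|² + k⁴|b|²)/2 does the rest. -/
theorem Admissible.integral_weightAt_le (hP : P.Admissible) {ψ : ℝ × ℝ → ℂ}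
    (hψ : ψ ∈ P.clamped 0) (k r : ℝ) :
    ∫ x in P.domain, weightAt k r ψ x ≤ 2 * ∫ x in P.domain, (‖Dr r (Dr r ψ) x‖ ^ 2
      + ‖Dr r (pd (0, 1) ψ) x‖ ^ 2 + ‖pd (0, 1) (pd (0, 1) ψ) x‖ ^ 2 + k ^ 4 * ‖ψ x‖ ^ 2) := by
  obtain ⟨q0, q1, q2, q3, q4, q5⟩ := continuous_derivs hψ.1 r
  have h1 := hP.integral_norm_Dr_sq hψ r
  have h2 := integral_mul_re (f := fun x => pd (0, 1) (pd (0, 1) ψ) x * conj (ψ x)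
        + pd (0, 1) ψ x * conj (pd (0, 1) ψ x)) (h := fun x => pd (0, 1) ψ x * conj (ψ x))
    (by fun_prop) (by fun_prop) (fun w w' hw hw' => hP.null_zero hψ w w' hw hw')
    (η := fun _ => 1) (η' := fun _ => 0) (fun t => hasDerivAt_const _ _) continuous_const
  simp only [one_mul, zero_mul, integral_zero, neg_zero] at h2
  have h3 : ∫ x in P.domain, (weightAt k r ψ x
      + k ^ 2 * ((Dr r (Dr r ψ) x * conj (ψ x)).re - ‖Dr r ψ x‖ ^ 2)
      - k ^ 2 * (pd (0, 1) (pd (0, 1) ψ) x * conj (ψ x)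
        + pd (0, 1) ψ x * conj (pd (0, 1) ψ x)).re) = ∫ x in P.domain, weightAt k r ψ x := by
    have q6 := continuous_weightAt hψ.1 k r
    rw [integral_sub (integrable_of_continuous (by fun_prop))
      (integrable_of_continuous (by fun_prop)), integral_add (integrable_of_continuous (by fun_prop))
      (integrable_of_continuous (by fun_prop)), integral_const_mul, integral_const_mul, h1, h2]
    ring
  rw [← h3, ← integral_const_mul]
  have q6 := continuous_weightAt hψ.1 k r
  refine integral_mono (integrable_of_continuous (by fun_prop))
    (integrable_of_continuous (by fun_prop)) fun x => ?_
  simp only [weightAt, weight]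
  have e1 := (le_abs_self _).trans (abs_re_mul_conj_le (Dr r (Dr r ψ) x) (ψ x))
  have e2 := (abs_le.mp (abs_re_mul_conj_le (pd (0, 1) (pd (0, 1) ψ) x) (ψ x))).1
  have e3 : (pd (0, 1) ψ x * conj (pd (0, 1) ψ x)).re = ‖pd (0, 1) ψ x‖ ^ 2 := by
    rw [Complex.mul_conj']; norm_cast
  rw [Complex.add_re, e3]
  have f1 := mul_le_mul_of_nonneg_left e1 (sq_nonneg k)
  have f2 := mul_le_mul_of_nonneg_left e2 (sq_nonneg k)
  nlinarith [sq_nonneg (‖Dr r (Dr r ψ) x‖ - k ^ 2 * ‖ψ x‖),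
    sq_nonneg (‖pd (0, 1) (pd (0, 1) ψ) x‖ - k ^ 2 * ‖ψ x‖), sq_nonneg ‖Dr r (pd (0, 1) ψ) x‖,
    sq_nonneg ‖pd (0, 1) (pd (0, 1) ψ) x‖]

theorem setIntegral_mono_domain {f g : ℝ × ℝ → ℝ} (hf : Continuous f) (hg : Continuous g)
    (h : ∀ x ∈ P.domain, f x ≤ g x) : ∫ x in P.domain, f x ≤ ∫ x in P.domain, g x :=
  setIntegral_mono_on (integrable_of_continuous hf) (integrable_of_continuous hg)
    isOpen_domain.measurableSet h

theorem norm_integral_domain_le {f : ℝ × ℝ → ℂ} {g : ℝ × ℝ → ℝ} (hg : Continuous g)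
    (h : ∀ x ∈ P.domain, ‖f x‖ ≤ g x) : ‖∫ x in P.domain, f x‖ ≤ ∫ x in P.domain, g x :=
  norm_integral_le_of_norm_le (integrable_of_continuous hg)
    ((ae_mem_domain (P := P)).mono h)

/-- The terms that vanish up to derivatives of the coefficient are of lower order. -/
theorem Admissible.norm_integral_null_le (hP : P.Admissible) {ψ : ℝ × ℝ → ℂ}
    (hψ : ψ ∈ P.clamped 0) {k r a W : ℝ} (hk : 0 < k) (ha : |a| ≤ k) {w w' : ℝ → ℂ}
    (hw : ∀ t, HasDerivAt w (w' t) t) (hw' : Continuous w')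
    (hW : ∀ t ∈ Set.Icc P.bot P.top, ‖w' t‖ ≤ W) :
    ‖∫ x in P.domain, w x.2 *
        (((pd (0, 1) (pd (0, 1) ψ) x * conj (Dr r (Dr r ψ) x)
            + Dr r (pd (0, 1) ψ) x * conj (Dr r (pd (0, 1) ψ) x))
          + conj (pd (0, 1) (pd (0, 1) ψ) x * conj (Dr r (Dr r ψ) x)
            + Dr r (pd (0, 1) ψ) x * conj (Dr r (pd (0, 1) ψ) x)))
        - a ^ 2 * ((pd (0, 1) (pd (0, 1) ψ) x * conj (ψ x)
            + pd (0, 1) ψ x * conj (pd (0, 1) ψ x))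
          + conj (pd (0, 1) (pd (0, 1) ψ) x * conj (ψ x)
            + pd (0, 1) ψ x * conj (pd (0, 1) ψ x)))
        + 2 * Complex.I * a *
          ((pd (0, 1) (pd (0, 1) ψ) x * conj (Dr r ψ x)
            + pd (0, 1) ψ x * conj (Dr r (pd (0, 1) ψ) x))
          + conj (pd (0, 1) (pd (0, 1) ψ) x * conj (Dr r ψ x)
            + pd (0, 1) ψ x * conj (Dr r (pd (0, 1) ψ) x))))‖
      ≤ 8 * W / k * ∫ x in P.domain, weightAt k r ψ x := by
  obtain ⟨q0, q1, q2, q3, q4, q5⟩ := continuous_derivs hψ.1 r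
  have hwc : Continuous w := continuous_iff_continuousAt.mpr fun t => (hw t).continuousAt
  have h0 := integral_add_conj (f := fun x => pd (0, 1) (pd (0, 1) ψ) x * conj (ψ x)
        + pd (0, 1) ψ x * conj (pd (0, 1) ψ x)) (h := fun x => pd (0, 1) ψ x * conj (ψ x))
    (by fun_prop) (by fun_prop) (fun w w' hw hw' => hP.null_zero hψ w w' hw hw') hw hw'
  have h1 := integral_add_conj (f := fun x => pd (0, 1) (pd (0, 1) ψ) x * conj (Dr r ψ x)
            + pd (0, 1) ψ x * conj (Dr r (pd (0, 1) ψ) x))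
    (h := fun x => pd (0, 1) ψ x * conj (Dr r ψ x))
    (by fun_prop) (by fun_prop) (fun w w' hw hw' => hP.null_one hψ r w w' hw hw') hw hw'
  have h2 := integral_add_conj (f := fun x => pd (0, 1) (pd (0, 1) ψ) x * conj (Dr r (Dr r ψ) x)
            + Dr r (pd (0, 1) ψ) x * conj (Dr r (pd (0, 1) ψ) x))
    (h := fun x => pd (0, 1) ψ x * conj (Dr r (Dr r ψ) x))
    (by fun_prop) (by fun_prop) (fun w w' hw hw' => hP.null_two hψ r w w' hw hw') hw hw'
  have comb : ∀ {f₀ f₁ f₂ : ℝ × ℝ → ℂ} {v : ℝ → ℂ}, Continuous f₀ → Continuous f₁ → Continuous f₂ →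
      Continuous v → ∫ x in P.domain, v x.2 * (f₂ x - a ^ 2 * f₀ x + 2 * Complex.I * a * f₁ x)
        = (∫ x in P.domain, v x.2 * f₂ x) - a ^ 2 * (∫ x in P.domain, v x.2 * f₀ x)
          + 2 * Complex.I * a * ∫ x in P.domain, v x.2 * f₁ x := by
    intro f₀ f₁ f₂ v hf₀ hf₁ hf₂ hv
    rw [← integral_const_mul, ← integral_const_mul, ← integral_sub
      (integrable_of_continuous (by fun_prop)) (integrable_of_continuous (by fun_prop)),
      ← integral_add (integrable_of_continuous (by fun_prop))
        (integrable_of_continuous (by fun_prop))]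
    congr 1
    ext x
    ring
  rw [comb (by fun_prop) (by fun_prop) (by fun_prop) hwc, h0, h1, h2]
  have e := comb (f₀ := fun x => pd (0, 1) ψ x * conj (ψ x) + conj (pd (0, 1) ψ x * conj (ψ x)))
    (f₁ := fun x => pd (0, 1) ψ x * conj (Dr r ψ x) + conj (pd (0, 1) ψ x * conj (Dr r ψ x)))
    (f₂ := fun x => pd (0, 1) ψ x * conj (Dr r (Dr r ψ) x)
      + conj (pd (0, 1) ψ x * conj (Dr r (Dr r ψ) x))) (v := w')
    (by fun_prop) (by fun_prop) (by fun_prop) hw'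
  have hneg : ∀ A B C D E : ℂ, -A - B * -C + D * -E = -(A - B * C + D * E) :=
    fun A B C D E => by ring
  rw [hneg, ← e, norm_neg, ← integral_const_mul]
  have q6 := continuous_weightAt hψ.1 k r
  refine norm_integral_domain_le (by fun_prop) fun x hx => ?_
  rw [div_mul_eq_mul_div, le_div_iff₀ hk, mul_comm _ k]
  exact norm_boundaryForm_le hk ha (hW _ (snd_mem_of_mem_domain hx))

/-- The real terms that vanish up to derivatives of the coefficient are of lower order. -/
theorem Admissible.integral_null_ge (hP : P.Admissible) {ψ : ℝ × ℝ → ℂ}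
    (hψ : ψ ∈ P.clamped 0) {k r W : ℝ} (hk : 1 ≤ k) {η η' : ℝ → ℝ}
    (hη : ∀ t, HasDerivAt η (η' t) t) (hη' : Continuous η')
    (hW : ∀ t ∈ Set.Icc P.bot P.top, |η' t| ≤ W) :
    -(4 * W / k * ∫ x in P.domain, weightAt k r ψ x) ≤
      ∫ x in P.domain, (2 * η x.2 * (pd (0, 1) (pd (0, 1) ψ) x * conj (Dr r (Dr r ψ) x)
            + Dr r (pd (0, 1) ψ) x * conj (Dr r (pd (0, 1) ψ) x)).re
        + 2 * k ^ 2 * ((Dr r (Dr r ψ) x * conj (ψ x)).re - ‖Dr r ψ x‖ ^ 2)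
        - 2 * k ^ 2 * η x.2 * (pd (0, 1) (pd (0, 1) ψ) x * conj (ψ x)
            + pd (0, 1) ψ x * conj (pd (0, 1) ψ x)).re) := by
  obtain ⟨q0, q1, q2, q3, q4, q5⟩ := continuous_derivs hψ.1 r
  have hηc : Continuous η := continuous_iff_continuousAt.mpr fun t => (hη t).continuousAt
  have hk0 : 0 < k := by linarith
  have h0 := integral_mul_re (f := fun x => pd (0, 1) (pd (0, 1) ψ) x * conj (ψ x)
        + pd (0, 1) ψ x * conj (pd (0, 1) ψ x)) (h := fun x => pd (0, 1) ψ x * conj (ψ x))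
    (by fun_prop) (by fun_prop) (fun w w' hw hw' => hP.null_zero hψ w w' hw hw') hη hη'
  have h1 := hP.integral_norm_Dr_sq hψ r
  have h2 := integral_mul_re (f := fun x => pd (0, 1) (pd (0, 1) ψ) x * conj (Dr r (Dr r ψ) x)
            + Dr r (pd (0, 1) ψ) x * conj (Dr r (pd (0, 1) ψ) x))
    (h := fun x => pd (0, 1) ψ x * conj (Dr r (Dr r ψ) x))
    (by fun_prop) (by fun_prop) (fun w w' hw hw' => hP.null_two hψ r w w' hw hw') hη hη'
  have q6 := continuous_weightAt hψ.1 k r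
  have e : ∫ x in P.domain, (2 * η x.2 * (pd (0, 1) (pd (0, 1) ψ) x * conj (Dr r (Dr r ψ) x)
            + Dr r (pd (0, 1) ψ) x * conj (Dr r (pd (0, 1) ψ) x)).re
        + 2 * k ^ 2 * ((Dr r (Dr r ψ) x * conj (ψ x)).re - ‖Dr r ψ x‖ ^ 2)
        - 2 * k ^ 2 * η x.2 * (pd (0, 1) (pd (0, 1) ψ) x * conj (ψ x)
            + pd (0, 1) ψ x * conj (pd (0, 1) ψ x)).re)
      = ∫ x in P.domain, (2 * k ^ 2 * (η' x.2 * (pd (0, 1) ψ x * conj (ψ x)).re)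
        - 2 * (η' x.2 * (pd (0, 1) ψ x * conj (Dr r (Dr r ψ) x)).re)) := by
    simp only [mul_assoc]
    rw [integral_sub (integrable_of_continuous (by fun_prop))
      (integrable_of_continuous (by fun_prop)), integral_add (integrable_of_continuous (by fun_prop))
      (integrable_of_continuous (by fun_prop)), integral_sub (integrable_of_continuous (by fun_prop))
      (integrable_of_continuous (by fun_prop))]
    simp only [integral_const_mul]
    rw [h0, h1, h2]
    ring
  rw [e, ← integral_const_mul, ← integral_neg]
  refine setIntegral_mono_domain (by fun_prop) (by fun_prop) fun x hx => ?_
  obtain ⟨n1, n2, n3, n4, n5, n6⟩ := norms_le_sqrt_weight (k := k) (a₀ := ψ x) (a₁ := Dr r ψ x)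
    (a₂ := Dr r (Dr r ψ) x) (b₀ := pd (0, 1) ψ x) (b₁ := Dr r (pd (0, 1) ψ) x)
    (c₀ := pd (0, 1) (pd (0, 1) ψ) x)
  have hQ := Real.sq_sqrt (weight_nonneg (k := k) (a₀ := ψ x) (a₁ := Dr r ψ x)
    (a₂ := Dr r (Dr r ψ) x) (b₀ := pd (0, 1) ψ x) (b₁ := Dr r (pd (0, 1) ψ) x)
    (c₀ := pd (0, 1) (pd (0, 1) ψ) x))
  unfold weightAt
  set Q := √(weight k (ψ x) (Dr r ψ x) (Dr r (Dr r ψ) x) (pd (0, 1) ψ x) (Dr r (pd (0, 1) ψ) x)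
    (pd (0, 1) (pd (0, 1) ψ) x))
  have hW' := hW _ (snd_mem_of_mem_domain hx)
  have hW0 : 0 ≤ W := (abs_nonneg _).trans hW'
  have hQ0 : 0 ≤ Q := Real.sqrt_nonneg _
  rw [← hQ]
  have m1 : |k ^ 2 * (η' x.2 * (pd (0, 1) ψ x * conj (ψ x)).re)| * k ≤ W * Q ^ 2 := by
    rw [abs_mul, abs_mul, abs_of_nonneg (sq_nonneg k)]
    calc k ^ 2 * (|η' x.2| * |(pd (0, 1) ψ x * conj (ψ x)).re|) * k
        ≤ k ^ 2 * (W * (‖pd (0, 1) ψ x‖ * ‖ψ x‖)) * k := by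
          gcongr; exact abs_re_mul_conj_le _ _
      _ = W * ((k * ‖pd (0, 1) ψ x‖) * (k ^ 2 * ‖ψ x‖)) := by ring
      _ ≤ W * (Q * Q) := by gcongr
      _ = _ := by ring
  have m2 : |η' x.2 * (pd (0, 1) ψ x * conj (Dr r (Dr r ψ) x)).re| * k ≤ W * Q ^ 2 := by
    rw [abs_mul]
    calc |η' x.2| * |(pd (0, 1) ψ x * conj (Dr r (Dr r ψ) x)).re| * k
        ≤ W * (‖pd (0, 1) ψ x‖ * ‖Dr r (Dr r ψ) x‖) * k := by
          gcongr; exact abs_re_mul_conj_le _ _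
      _ = W * ((k * ‖pd (0, 1) ψ x‖) * ‖Dr r (Dr r ψ) x‖) := by ring
      _ ≤ W * (Q * Q) := by gcongr
      _ = _ := by ring
  rw [← le_div_iff₀ hk0] at m1 m2
  have m1' := (abs_le.mp m1).1
  have m2' := (abs_le.mp m2).2
  have : 4 * W / k * Q ^ 2 = 4 * (W * Q ^ 2 / k) := by ring
  linarith

end Setup

end Estimates

end BiharmonicPML
end


noncomputable section

namespace BiharmonicPML

/-! ### Multiplication by functions of the height, and jets -/

/-- The product with a function of the height. -/
def mulSnd (H : ℝ → ℂ) (ψ : ℝ × ℝ → ℂ) : ℝ × ℝ → ℂ := fun x => H x.2 * ψ x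

theorem contDiff_mulSnd {H : ℝ → ℂ} {ψ : ℝ × ℝ → ℂ} (hH : ContDiff ℝ ∞ H)
    (hψ : ContDiff ℝ ∞ ψ) : ContDiff ℝ ∞ (mulSnd H ψ) :=
  (hH.comp contDiff_snd).mul hψ

theorem contDiff_deriv_top {H : ℝ → ℂ} (hH : ContDiff ℝ ∞ H) : ContDiff ℝ ∞ (deriv H) := by
  have h : ContDiff ℝ (((⊤ : ℕ∞) : WithTop ℕ∞) + 1) H := hH
  rw [contDiff_succ_iff_deriv] at h
  exact h.2.2

theorem pd_mulSnd {H : ℝ → ℂ} {ψ : ℝ × ℝ → ℂ} (hH : ContDiff ℝ ∞ H) (hψ : ContDiff ℝ ∞ ψ)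
    (e : ℝ × ℝ) : pd e (mulSnd H ψ) = mulSnd H (pd e ψ) + (e.2 : ℂ) • mulSnd (deriv H) ψ := by
  ext x
  have h1 : DifferentiableAt ℝ (fun y : ℝ × ℝ => H y.2) x :=
    (hH.comp contDiff_snd).differentiable (by simp) x
  have := pd_mul h1 (hψ.differentiable (by simp) x) e
  rw [pd_snd (hH.differentiable (by simp) _)] at this
  change pd e (fun y => H y.2 * ψ y) x = H x.2 * pd e ψ x + e.2 * (deriv H x.2 * ψ x)
  rw [this]
  ring

theorem pd_fst_mulSnd {H : ℝ → ℂ} {ψ : ℝ × ℝ → ℂ} (hH : ContDiff ℝ ∞ H) (hψ : ContDiff ℝ ∞ ψ) :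
    pd (1, 0) (mulSnd H ψ) = mulSnd H (pd (1, 0) ψ) := by
  rw [pd_mulSnd hH hψ]; simp

theorem pd_snd_mulSnd {H : ℝ → ℂ} {ψ : ℝ × ℝ → ℂ} (hH : ContDiff ℝ ∞ H) (hψ : ContDiff ℝ ∞ ψ) :
    pd (0, 1) (mulSnd H ψ) = mulSnd H (pd (0, 1) ψ) + mulSnd (deriv H) ψ := by
  rw [pd_mulSnd hH hψ]; simp

theorem pd_snd_snd_mulSnd {H : ℝ → ℂ} {ψ : ℝ × ℝ → ℂ} (hH : ContDiff ℝ ∞ H)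
    (hψ : ContDiff ℝ ∞ ψ) (x : ℝ × ℝ) :
    pd (0, 1) (pd (0, 1) (mulSnd H ψ)) x = H x.2 * pd (0, 1) (pd (0, 1) ψ) x
      + 2 * deriv H x.2 * pd (0, 1) ψ x + deriv (deriv H) x.2 * ψ x := by
  have hH' := contDiff_deriv_top hH
  rw [pd_snd_mulSnd hH hψ, pd_add (contDiff_mulSnd hH (contDiff_pd hψ _)) (contDiff_mulSnd hH' hψ),
    pd_snd_mulSnd hH (contDiff_pd hψ _), pd_snd_mulSnd hH' hψ]
  simp only [mulSnd, Pi.add_apply]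
  ring

theorem quasiPeriodic_mulSnd {Λ α : ℝ} {H : ℝ → ℂ} {ψ : ℝ × ℝ → ℂ} (hψ : QuasiPeriodic Λ α ψ) :
    QuasiPeriodic Λ α (mulSnd H ψ) := fun x => by
  simp only [mulSnd, hψ x]; ring

theorem fderiv_mulSnd {H : ℝ → ℂ} {ψ : ℝ × ℝ → ℂ} (hH : ContDiff ℝ ∞ H) (hψ : ContDiff ℝ ∞ ψ)
    (x : ℝ × ℝ) : fderiv ℝ (mulSnd H ψ) x
      = H x.2 • fderiv ℝ ψ x + ψ x • fderiv ℝ (fun y : ℝ × ℝ => H y.2) x :=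
  fderiv_fun_mul ((hH.comp contDiff_snd).differentiable (by simp) x)
    (hψ.differentiable (by simp) x)

theorem Setup.mulSnd_mem_clamped {P : Setup} {α : ℝ} {H : ℝ → ℂ} {ψ : ℝ × ℝ → ℂ}
    (hH : ContDiff ℝ ∞ H) (hψ : ψ ∈ P.clamped α) : mulSnd H ψ ∈ P.clamped α := by
  refine ⟨contDiff_mulSnd hH hψ.1, quasiPeriodic_mulSnd hψ.2.1, fun x hx => ⟨?_, ?_⟩⟩
  · simp [mulSnd, (hψ.2.2 x hx).1]
  · refine ContinuousLinearMap.ext fun v => ?_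
    rw [fderiv_mulSnd hH hψ.1, (hψ.2.2 x hx).1, (hψ.2.2 x hx).2]
    change H x.2 * 0 + 0 * _ = (0 : ℂ)
    ring

/-- The values of a smooth function and its derivatives, with `∂₁` replaced by `∂₁ + iz`. -/
def jetAt (z : ℂ) (ψ : ℝ × ℝ → ℂ) (x : ℝ × ℝ) : Fin 6 → ℂ :=
  ![ψ x, pd (1, 0) ψ x + Complex.I * z * ψ x, pd (0, 1) ψ x,
    pd (1, 0) (pd (1, 0) ψ) x + 2 * Complex.I * z * pd (1, 0) ψ x - z ^ 2 * ψ x,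
    pd (0, 1) (pd (1, 0) ψ) x + Complex.I * z * pd (0, 1) ψ x, pd (0, 1) (pd (0, 1) ψ) x]

theorem coeFn_jet {D : Set (ℝ × ℝ)} (hD : Bornology.IsBounded D) {ψ : ℝ × ℝ → ℂ}
    (hψ : ContDiff ℝ ∞ ψ) : ∀ᵐ x ∂volume.restrict D,
      jet D ψ 0 x = ψ x ∧ jet D ψ 1 x = pd (1, 0) ψ x ∧ jet D ψ 2 x = pd (0, 1) ψ x ∧
      jet D ψ 3 x = pd (1, 0) (pd (1, 0) ψ) x ∧ jet D ψ 4 x = pd (0, 1) (pd (1, 0) ψ) x ∧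
      jet D ψ 5 x = pd (0, 1) (pd (0, 1) ψ) x := by
  have h1 := contDiff_pd hψ (1, 0)
  have h2 := contDiff_pd hψ (0, 1)
  filter_upwards [coeFn_toL2_of_continuous hD hψ.continuous,
    coeFn_toL2_of_continuous hD h1.continuous, coeFn_toL2_of_continuous hD h2.continuous,
    coeFn_toL2_of_continuous hD (contDiff_pd h1 (1, 0)).continuous,
    coeFn_toL2_of_continuous hD (contDiff_pd h1 (0, 1)).continuous,
    coeFn_toL2_of_continuous hD (contDiff_pd h2 (0, 1)).continuous] with x e0 e1 e2 e3 e4 e5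
  exact ⟨e0, e1, e2, e3, e4, e5⟩

theorem coeFn_N {D : Set (ℝ × ℝ)} (z : ℂ) (u : Jet D) : ∀ᵐ x ∂volume.restrict D,
    (fun i => N D z u i x) = ![u 0 x, u 1 x + Complex.I * z * u 0 x, u 2 x,
      u 3 x + 2 * Complex.I * z * u 1 x - z ^ 2 * u 0 x, u 4 x + Complex.I * z * u 2 x, u 5 x] := by
  filter_upwards [Lp.coeFn_add (u 1) ((Complex.I * z) • u 0), Lp.coeFn_smul (Complex.I * z) (u 0),
    Lp.coeFn_sub (u 3 + (2 * Complex.I * z) • u 1) (z ^ 2 • u 0),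
    Lp.coeFn_add (u 3) ((2 * Complex.I * z) • u 1), Lp.coeFn_smul (2 * Complex.I * z) (u 1),
    Lp.coeFn_smul (z ^ 2) (u 0), Lp.coeFn_add (u 4) ((Complex.I * z) • u 2),
    Lp.coeFn_smul (Complex.I * z) (u 2)] with x e1 e2 e3 e4 e5 e6 e7 e8
  ext i
  fin_cases i
  · simp [N_apply_zero]
  · exact (congrArg (fun f : L2 D => f x) (N_apply_one z u)).trans
      (e1.trans (congrArg (u 1 x + ·) e2))
  · simp [N_apply_two]
  · refine (congrArg (fun f : L2 D => f x) (N_apply_three z u)).trans (e3.trans ?_)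
    exact congrArg₂ (· - ·) (e4.trans (congrArg (u 3 x + ·) e5)) e6
  · exact (congrArg (fun f : L2 D => f x) (N_apply_four z u)).trans
      (e7.trans (congrArg (u 4 x + ·) e8))
  · simp [N_apply_five]

theorem coeFn_N_jet {D : Set (ℝ × ℝ)} (hD : Bornology.IsBounded D) {ψ : ℝ × ℝ → ℂ}
    (hψ : ContDiff ℝ ∞ ψ) (z : ℂ) :
    ∀ᵐ x ∂volume.restrict D, (fun i => N D z (jet D ψ) i x) = jetAt z ψ x := by
  filter_upwards [coeFn_N z (jet D ψ), coeFn_jet hD hψ] with x e1 ⟨h0, h1, h2, h3, h4, h5⟩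
  rw [e1, h0, h1, h2, h3, h4, h5]
  rfl

/-- The sum of the squares of a function and its derivatives at a point. -/
def jetSq (ψ : ℝ × ℝ → ℂ) (x : ℝ × ℝ) : ℝ :=
  ‖ψ x‖ ^ 2 + ‖pd (1, 0) ψ x‖ ^ 2 + ‖pd (0, 1) ψ x‖ ^ 2 + ‖pd (1, 0) (pd (1, 0) ψ) x‖ ^ 2
    + ‖pd (0, 1) (pd (1, 0) ψ) x‖ ^ 2 + ‖pd (0, 1) (pd (0, 1) ψ) x‖ ^ 2

theorem norm_L2_sq {D : Set (ℝ × ℝ)} (f : L2 D) : ‖f‖ ^ 2 = ∫ x in D, ‖f x‖ ^ 2 := by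
  have h : inner ℂ f f = ∫ x in D, ((‖f x‖ ^ 2 : ℝ) : ℂ) := by
    rw [inner_L2]
    congr 1
    ext x
    rw [Complex.mul_conj']
    push_cast
    rfl
  rw [← inner_self_eq_norm_sq (𝕜 := ℂ) f, h, integral_complex_ofReal]
  rfl

theorem integrable_norm_sq {D : Set (ℝ × ℝ)} (f : L2 D) :
    Integrable (fun x => ‖f x‖ ^ 2) (volume.restrict D) :=
  (Lp.memLp f).integrable_norm_pow (by simp)

theorem continuous_jetSq {ψ : ℝ × ℝ → ℂ} (hψ : ContDiff ℝ ∞ ψ) : Continuous (jetSq ψ) := by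
  have h1 := contDiff_pd hψ (1, 0)
  have h2 := contDiff_pd hψ (0, 1)
  have c0 := hψ.continuous
  have c1 := h1.continuous
  have c2 := h2.continuous
  have c3 := (contDiff_pd h1 (1, 0)).continuous
  have c4 := (contDiff_pd h1 (0, 1)).continuous
  have c5 := (contDiff_pd h2 (0, 1)).continuous
  unfold jetSq
  fun_prop

theorem norm_jet_sq {D : Set (ℝ × ℝ)} (hD : Bornology.IsBounded D) {ψ : ℝ × ℝ → ℂ}
    (hψ : ContDiff ℝ ∞ ψ) : ‖jet D ψ‖ ^ 2 = ∫ x in D, jetSq ψ x := by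
  rw [PiLp.norm_sq_eq_of_L2]
  simp only [norm_L2_sq]
  rw [← integral_finsetSum _ fun i _ => integrable_norm_sq (jet D ψ i)]
  refine integral_congr_ae ?_
  filter_upwards [coeFn_jet hD hψ] with x ⟨h0, h1, h2, h3, h4, h5⟩
  simp only [Fin.sum_univ_six, h0, h1, h2, h3, h4, h5, jetSq]

theorem jetSq_mulSnd_le {H : ℝ → ℂ} {ψ : ℝ × ℝ → ℂ} (hH : ContDiff ℝ ∞ H) (hψ : ContDiff ℝ ∞ ψ)
    {M : ℝ} {x : ℝ × ℝ} (h0 : ‖H x.2‖ ≤ M) (h1 : ‖deriv H x.2‖ ≤ M)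
    (h2 : ‖deriv (deriv H) x.2‖ ≤ M) : jetSq (mulSnd H ψ) x ≤ 20 * M ^ 2 * jetSq ψ x := by
  have hM : 0 ≤ M := (norm_nonneg _).trans h0
  have e1 : pd (1, 0) (mulSnd H ψ) x = H x.2 * pd (1, 0) ψ x := by
    rw [pd_fst_mulSnd hH hψ]; rfl
  have e2 : pd (0, 1) (mulSnd H ψ) x = H x.2 * pd (0, 1) ψ x + deriv H x.2 * ψ x := by
    rw [pd_snd_mulSnd hH hψ]; rfl
  have e3 : pd (1, 0) (pd (1, 0) (mulSnd H ψ)) x = H x.2 * pd (1, 0) (pd (1, 0) ψ) x := by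
    rw [pd_fst_mulSnd hH hψ, pd_fst_mulSnd hH (contDiff_pd hψ _)]; rfl
  have e4 : pd (0, 1) (pd (1, 0) (mulSnd H ψ)) x
      = H x.2 * pd (0, 1) (pd (1, 0) ψ) x + deriv H x.2 * pd (1, 0) ψ x := by
    rw [pd_fst_mulSnd hH hψ, pd_snd_mulSnd hH (contDiff_pd hψ _)]; rfl
  have e5 := pd_snd_snd_mulSnd hH hψ x
  have b : ∀ {c : ℂ} (y : ℂ), ‖c‖ ≤ M → ‖c * y‖ ≤ M * ‖y‖ := fun y hc => by
    rw [norm_mul]; gcongr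
  have n0 : ‖mulSnd H ψ x‖ ≤ M * ‖ψ x‖ := b _ h0
  have n1 := b (pd (1, 0) ψ x) h0
  have n2 := (norm_add_le _ _).trans (add_le_add (b (pd (0, 1) ψ x) h0) (b (ψ x) h1))
  have n3 := b (pd (1, 0) (pd (1, 0) ψ) x) h0
  have n4 := (norm_add_le _ _).trans
    (add_le_add (b (pd (0, 1) (pd (1, 0) ψ) x) h0) (b (pd (1, 0) ψ x) h1))
  have n5 : ‖H x.2 * pd (0, 1) (pd (0, 1) ψ) x + 2 * deriv H x.2 * pd (0, 1) ψ x
      + deriv (deriv H) x.2 * ψ x‖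
      ≤ M * ‖pd (0, 1) (pd (0, 1) ψ) x‖ + 2 * (M * ‖pd (0, 1) ψ x‖) + M * ‖ψ x‖ := by
    refine (norm_add_le _ _).trans (add_le_add ((norm_add_le _ _).trans
      (add_le_add (b _ h0) ?_)) (b _ h2))
    rw [mul_assoc, norm_mul, Complex.norm_ofNat]
    exact mul_le_mul_of_nonneg_left (b _ h1) zero_le_two
  rw [← e1] at n1
  rw [← e2] at n2
  rw [← e3] at n3
  rw [← e4] at n4
  rw [← e5] at n5
  have p0 := pow_le_pow_left₀ (norm_nonneg _) n0 2
  have p1 := pow_le_pow_left₀ (norm_nonneg _) n1 2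
  have p2 := pow_le_pow_left₀ (norm_nonneg _) n2 2
  have p3 := pow_le_pow_left₀ (norm_nonneg _) n3 2
  have p4 := pow_le_pow_left₀ (norm_nonneg _) n4 2
  have p5 := pow_le_pow_left₀ (norm_nonneg _) n5 2
  have r2 := mul_nonneg (sq_nonneg M) (sq_nonneg (‖pd (0, 1) ψ x‖ - ‖ψ x‖))
  have r4 := mul_nonneg (sq_nonneg M) (sq_nonneg (‖pd (0, 1) (pd (1, 0) ψ) x‖ - ‖pd (1, 0) ψ x‖))
  have r5 := mul_nonneg (sq_nonneg M)
    (sq_nonneg (‖pd (0, 1) (pd (0, 1) ψ) x‖ - ‖pd (0, 1) ψ x‖))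
  have r6 := mul_nonneg (sq_nonneg M) (sq_nonneg (‖pd (0, 1) (pd (0, 1) ψ) x‖ - ‖ψ x‖))
  have s0 := mul_nonneg (sq_nonneg M) (sq_nonneg ‖ψ x‖)
  have s1 := mul_nonneg (sq_nonneg M) (sq_nonneg ‖pd (1, 0) ψ x‖)
  have s2 := mul_nonneg (sq_nonneg M) (sq_nonneg ‖pd (0, 1) ψ x‖)
  have s3 := mul_nonneg (sq_nonneg M) (sq_nonneg ‖pd (1, 0) (pd (1, 0) ψ) x‖)
  have s4 := mul_nonneg (sq_nonneg M) (sq_nonneg ‖pd (0, 1) (pd (1, 0) ψ) x‖)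
  have s5 := mul_nonneg (sq_nonneg M) (sq_nonneg ‖pd (0, 1) (pd (0, 1) ψ) x‖)
  simp only [jetSq]
  linarith

theorem exists_norm_jet_mulSnd_le {P : Setup} {H : ℝ → ℂ} (hH : ContDiff ℝ ∞ H) :
    ∃ C, ∀ ψ, ContDiff ℝ ∞ ψ → ‖jet P.domain (mulSnd H ψ)‖ ≤ C * ‖jet P.domain ψ‖ := by
  have hH1 := contDiff_deriv_top hH
  have hH2 := contDiff_deriv_top hH1
  obtain ⟨M₀, hM₀⟩ := isCompact_Icc.exists_bound_of_continuousOn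
    (hH.continuous.continuousOn (s := Set.Icc P.bot P.top))
  obtain ⟨M₁, hM₁⟩ := isCompact_Icc.exists_bound_of_continuousOn
    (hH1.continuous.continuousOn (s := Set.Icc P.bot P.top))
  obtain ⟨M₂, hM₂⟩ := isCompact_Icc.exists_bound_of_continuousOn
    (hH2.continuous.continuousOn (s := Set.Icc P.bot P.top))
  set M := max M₀ (max M₁ M₂)
  refine ⟨√(20 * M ^ 2), fun ψ hψ => ?_⟩
  refine (abs_le_of_sq_le_sq' ?_ (by positivity)).2
  rw [mul_pow, Real.sq_sqrt (by positivity), norm_jet_sq Setup.isBounded_domain hψ,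
    norm_jet_sq Setup.isBounded_domain (contDiff_mulSnd hH hψ), ← integral_const_mul]
  have c1 := continuous_jetSq hψ
  refine Setup.setIntegral_mono_domain (continuous_jetSq (contDiff_mulSnd hH hψ)) (by fun_prop)
    fun x hx => ?_
  have hx' := Setup.snd_mem_of_mem_domain hx
  exact jetSq_mulSnd_le hH hψ ((hM₀ _ hx').trans (le_max_left _ _))
    ((hM₁ _ hx').trans ((le_max_left _ _).trans (le_max_right _ _)))
    ((hM₂ _ hx').trans ((le_max_right _ _).trans (le_max_right _ _)))

/-! ### The form with a multiplier -/

theorem Dr_Dr_apply {ψ : ℝ × ℝ → ℂ} (hψ : ContDiff ℝ ∞ ψ) (r : ℝ) (x : ℝ × ℝ) :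
    Dr r (Dr r ψ) x
      = -pd (1, 0) (pd (1, 0) ψ) x - 2 * Complex.I * r * pd (1, 0) ψ x + r ^ 2 * ψ x := by
  have h : Dr r (Dr r ψ) x = -Complex.I * pd (1, 0) (Dr r ψ) x + r * Dr r ψ x := rfl
  rw [h, pd_Dr hψ]
  simp only [Dr]
  linear_combination pd (1, 0) (pd (1, 0) ψ) x * Complex.I_sq

theorem Dr_pd_apply {ψ : ℝ × ℝ → ℂ} (hψ : ContDiff ℝ ∞ ψ) (r : ℝ) (x : ℝ × ℝ) :
    Dr r (pd (0, 1) ψ) x = -Complex.I * pd (0, 1) (pd (1, 0) ψ) x + r * pd (0, 1) ψ x := by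
  rw [pd_comm hψ]; rfl

/-- Recovering ∂₁ from `Dr` costs |r| ≤ k times a derivative of lower order, which the weights
absorb. The six components are bounded by 1, 2, 1, 6, 2, 1 times the root of the weight, and the
squares add up to 47. -/
theorem jetSq_le_weightAt {ψ : ℝ × ℝ → ℂ} (hψ : ContDiff ℝ ∞ ψ) {k r : ℝ} (hk : 1 ≤ k)
    (hr : |r| ≤ k) (x : ℝ × ℝ) : jetSq ψ x ≤ 47 * weightAt k r ψ x := by
  obtain ⟨n1, n2, n3, n4, n5, n6⟩ := norms_le_sqrt_weight (k := k) (a₀ := ψ x) (a₁ := Dr r ψ x)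
    (a₂ := Dr r (Dr r ψ) x) (b₀ := pd (0, 1) ψ x) (b₁ := Dr r (pd (0, 1) ψ) x)
    (c₀ := pd (0, 1) (pd (0, 1) ψ) x)
  have hQ := Real.sq_sqrt (weight_nonneg (k := k) (a₀ := ψ x) (a₁ := Dr r ψ x)
    (a₂ := Dr r (Dr r ψ) x) (b₀ := pd (0, 1) ψ x) (b₁ := Dr r (pd (0, 1) ψ) x)
    (c₀ := pd (0, 1) (pd (0, 1) ψ) x))
  have e1 : pd (1, 0) ψ x = Complex.I * (Dr r ψ x - r * ψ x) := by
    simp only [Dr]; linear_combination (pd (1, 0) ψ x) * Complex.I_sq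
  have e3 : pd (1, 0) (pd (1, 0) ψ) x
      = -Dr r (Dr r ψ) x - 2 * Complex.I * r * pd (1, 0) ψ x + r ^ 2 * ψ x := by
    rw [Dr_Dr_apply hψ]; ring
  have e4 : pd (0, 1) (pd (1, 0) ψ) x
      = Complex.I * (Dr r (pd (0, 1) ψ) x - r * pd (0, 1) ψ x) := by
    rw [Dr_pd_apply hψ]; linear_combination (pd (0, 1) (pd (1, 0) ψ) x) * Complex.I_sq
  unfold weightAt
  set Q := √(weight k (ψ x) (Dr r ψ x) (Dr r (Dr r ψ) x) (pd (0, 1) ψ x) (Dr r (pd (0, 1) ψ) x)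
    (pd (0, 1) (pd (0, 1) ψ) x))
  have hk0 : 0 ≤ k := by linarith
  have hQ0 : 0 ≤ Q := Real.sqrt_nonneg _
  have nr : ‖(r : ℂ)‖ = |r| := by rw [Complex.norm_real, Real.norm_eq_abs]
  have b0 : ‖pd (0, 1) ψ x‖ ≤ Q := by nlinarith [norm_nonneg (pd (0, 1) ψ x)]
  have a0 : ‖ψ x‖ ≤ Q := by
    have : 1 ≤ k ^ 2 := one_le_pow₀ hk
    nlinarith [norm_nonneg (ψ x)]
  have rb0 : |r| * ‖pd (0, 1) ψ x‖ ≤ Q :=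
    (mul_le_mul_of_nonneg_right hr (norm_nonneg _)).trans n5
  have rra0 : |r| ^ 2 * ‖ψ x‖ ≤ Q := by
    refine le_trans ?_ n6
    gcongr
  have kp1 : k * ‖pd (1, 0) ψ x‖ ≤ 2 * Q := by
    rw [e1, norm_mul, Complex.norm_I, one_mul]
    have h := norm_sub_le (Dr r ψ x) (r * ψ x)
    rw [norm_mul, nr] at h
    have h2 : k * (|r| * ‖ψ x‖) ≤ Q := by
      calc k * (|r| * ‖ψ x‖) ≤ k * (k * ‖ψ x‖) := by gcongr
        _ = k ^ 2 * ‖ψ x‖ := by ring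
        _ ≤ Q := n6
    nlinarith
  have p1 : ‖pd (1, 0) ψ x‖ ≤ 2 * Q := by nlinarith [norm_nonneg (pd (1, 0) ψ x)]
  have p3 : ‖pd (1, 0) (pd (1, 0) ψ) x‖ ≤ 6 * Q := by
    have h := (norm_add_le (-Dr r (Dr r ψ) x - 2 * Complex.I * r * pd (1, 0) ψ x)
      (r ^ 2 * ψ x)).trans (add_le_add (norm_sub_le _ _) le_rfl)
    rw [← e3] at h
    simp only [norm_mul, norm_neg, norm_pow, nr, Complex.norm_I, Complex.norm_ofNat] at h
    have : |r| * ‖pd (1, 0) ψ x‖ ≤ 2 * Q :=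
      (mul_le_mul_of_nonneg_right hr (norm_nonneg _)).trans kp1
    linarith
  have p4 : ‖pd (0, 1) (pd (1, 0) ψ) x‖ ≤ 2 * Q := by
    rw [e4, norm_mul, Complex.norm_I, one_mul]
    have h := norm_sub_le (Dr r (pd (0, 1) ψ) x) (r * pd (0, 1) ψ x)
    rw [norm_mul, nr] at h
    linarith
  rw [← hQ]
  have s0 := pow_le_pow_left₀ (norm_nonneg _) a0 2
  have s1 := pow_le_pow_left₀ (norm_nonneg _) p1 2
  have s2 := pow_le_pow_left₀ (norm_nonneg _) b0 2
  have s3 := pow_le_pow_left₀ (norm_nonneg _) p3 2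
  have s4 := pow_le_pow_left₀ (norm_nonneg _) p4 2
  have s5 := pow_le_pow_left₀ (norm_nonneg _) n3 2
  simp only [jetSq]
  linarith

/-- On the trial side ∂₁ + i(r + ia) is i(Dr + ia). On the test side it is i(Dr - ia), whose
conjugate again has +ia: the conjugations conspire to make the form holomorphic in the wavenumber.
Terms with no derivative on H or 1/σ make up `mainForm`, all others `lowerForm`. -/
theorem Setup.density_jetAt_mulSnd (P : Setup) {ψ : ℝ × ℝ → ℂ} {H : ℝ → ℂ}
    (hψ : ContDiff ℝ ∞ ψ) (hH : ContDiff ℝ ∞ H) (r a : ℝ) (z : ℂ) {x : ℝ × ℝ}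
    (hσ : P.σ x.2 ≠ 0) :
    P.density x.2 (jetAt (r + Complex.I * a) ψ x)
        (jetAt (conj (r + Complex.I * a : ℂ)) (mulSnd H ψ) x)
      - z * (P.σ x.2 * ψ x * conj (mulSnd H ψ x))
    = P.σ x.2 * conj (H x.2) * mainForm P.μ a z (P.σ x.2)⁻¹ (ψ x) (Dr r ψ x) (Dr r (Dr r ψ) x)
        (pd (0, 1) ψ x) (Dr r (pd (0, 1) ψ) x) (pd (0, 1) (pd (0, 1) ψ) x)
      + lowerForm P.μ a (P.σ x.2)⁻¹ (deriv (fun s => (P.σ s)⁻¹) x.2) (conj (H x.2))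
        (conj (deriv H x.2)) (conj (deriv (deriv H) x.2)) (ψ x) (Dr r ψ x) (Dr r (Dr r ψ) x)
        (pd (0, 1) ψ x) (Dr r (pd (0, 1) ψ) x) (pd (0, 1) (pd (0, 1) ψ) x) := by
  have hI := Complex.I_sq
  have U3 : jetAt (r + Complex.I * a) ψ x 3
      = -(Dr r (Dr r ψ) x - a ^ 2 * ψ x + 2 * Complex.I * a * Dr r ψ x) := by
    rw [Dr_Dr_apply hψ]
    simp only [jetAt, Dr, Matrix.cons_val]
    linear_combination (-(a : ℂ) ^ 2 * ψ x) * hI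
  have U4 : jetAt (r + Complex.I * a) ψ x 4
      = Complex.I * (Dr r (pd (0, 1) ψ) x + Complex.I * a * pd (0, 1) ψ x) := by
    rw [Dr_pd_apply hψ]
    simp only [jetAt, Matrix.cons_val]
    linear_combination (pd (0, 1) (pd (1, 0) ψ) x) * hI
  have hz : conj (r + Complex.I * a : ℂ) = r - Complex.I * a := by
    simp only [map_add, map_mul, Complex.conj_ofReal, Complex.conj_I]; ring
  have V3 : conj (jetAt (conj (r + Complex.I * a : ℂ)) (mulSnd H ψ) x 3)
      = -(conj (H x.2) * (conj (Dr r (Dr r ψ) x) - a ^ 2 * conj (ψ x)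
        + 2 * Complex.I * a * conj (Dr r ψ x))) := by
    have h : jetAt (conj (r + Complex.I * a : ℂ)) (mulSnd H ψ) x 3
        = -(H x.2 * (Dr r (Dr r ψ) x - a ^ 2 * ψ x - 2 * Complex.I * a * Dr r ψ x)) := by
      rw [Dr_Dr_apply hψ, hz]
      simp only [jetAt, Dr, Matrix.cons_val]
      rw [pd_fst_mulSnd hH hψ, pd_fst_mulSnd hH (contDiff_pd hψ _)]
      simp only [mulSnd]
      linear_combination (-(a : ℂ) ^ 2 * H x.2 * ψ x) * hI
    rw [h]
    simp only [map_neg, map_mul, map_sub, map_pow, Complex.conj_ofReal, Complex.conj_I,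
      Complex.conj_ofNat]
    ring
  have V4 : conj (jetAt (conj (r + Complex.I * a : ℂ)) (mulSnd H ψ) x 4)
      = -Complex.I * (conj (H x.2) * (conj (Dr r (pd (0, 1) ψ) x) + Complex.I * a
          * conj (pd (0, 1) ψ x))
        + conj (deriv H x.2) * (conj (Dr r ψ x) + Complex.I * a * conj (ψ x))) := by
    have h : jetAt (conj (r + Complex.I * a : ℂ)) (mulSnd H ψ) x 4
        = Complex.I * (H x.2 * (Dr r (pd (0, 1) ψ) x - Complex.I * a * pd (0, 1) ψ x)
          + deriv H x.2 * (Dr r ψ x - Complex.I * a * ψ x)) := by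
      rw [Dr_pd_apply hψ, hz]
      simp only [jetAt, Dr, Matrix.cons_val]
      rw [pd_fst_mulSnd hH hψ, pd_snd_mulSnd hH (contDiff_pd hψ _), pd_snd_mulSnd hH hψ]
      simp only [mulSnd, Pi.add_apply]
      linear_combination (H x.2 * pd (0, 1) (pd (1, 0) ψ) x + deriv H x.2 * pd (1, 0) ψ x) * hI
    rw [h]
    simp only [map_mul, map_sub, map_add, Complex.conj_ofReal, Complex.conj_I]
    ring
  have V2 : conj (jetAt (conj (r + Complex.I * a : ℂ)) (mulSnd H ψ) x 2)
      = conj (H x.2) * conj (pd (0, 1) ψ x) + conj (deriv H x.2) * conj (ψ x) := by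
    simp only [jetAt, Matrix.cons_val]
    rw [pd_snd_mulSnd hH hψ]
    simp only [mulSnd, Pi.add_apply, map_add, map_mul]
  have V5 : conj (jetAt (conj (r + Complex.I * a : ℂ)) (mulSnd H ψ) x 5)
      = conj (H x.2) * conj (pd (0, 1) (pd (0, 1) ψ) x)
        + 2 * conj (deriv H x.2) * conj (pd (0, 1) ψ x)
        + conj (deriv (deriv H) x.2) * conj (ψ x) := by
    simp only [jetAt, Matrix.cons_val]
    rw [pd_snd_snd_mulSnd hH hψ]
    simp only [map_add, map_mul, Complex.conj_ofNat]
  have U2 : jetAt (r + Complex.I * a) ψ x 2 = pd (0, 1) ψ x := rfl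
  have U5 : jetAt (r + Complex.I * a) ψ x 5 = pd (0, 1) (pd (0, 1) ψ) x := rfl
  simp only [Setup.density, D2InvSigma, U3, U4, V3, V4, V2, V5, U2, U5]
  have hs : P.σ x.2 * (P.σ x.2)⁻¹ = 1 := mul_inv_cancel₀ hσ
  simp only [div_eq_mul_inv, one_mul, mulSnd, map_mul]
  set s := (P.σ x.2)⁻¹
  set σ := P.σ x.2
  -- Writing conj H as s γ makes the identity polynomial modulo σ s = 1 and I² = -1.
  obtain ⟨γ, hγ⟩ : ∃ γ, conj (H x.2) = s * γ :=
    ⟨σ * conj (H x.2), by rw [← mul_assoc, mul_comm s, hs, one_mul]⟩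
  rw [hγ]
  simp only [mainForm, lowerForm]
  generalize conj (Dr r (Dr r ψ) x) = a₂c
  generalize Dr r (Dr r ψ) x = a₂
  generalize conj (Dr r ψ x) = a₁c
  generalize Dr r ψ x = a₁
  generalize conj (Dr r (pd (0, 1) ψ) x) = b₁c
  generalize Dr r (pd (0, 1) ψ) x = b₁
  generalize conj (pd (0, 1) (pd (0, 1) ψ) x) = c₀c
  generalize pd (0, 1) (pd (0, 1) ψ) x = c₀
  generalize conj (pd (0, 1) ψ x) = b₀c
  generalize pd (0, 1) ψ x = b₀
  generalize conj (ψ x) = a₀c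
  generalize ψ x = a₀
  linear_combination (-γ * (-P.μ * s ^ 2 * (c₀ * (a₂c - a ^ 2 * a₀c + 2 * Complex.I * a * a₁c)
      + (a₂ - a ^ 2 * a₀ + 2 * Complex.I * a * a₁) * c₀c)
    + (2 - 2 * P.μ) * s ^ 2 * ((b₁ + Complex.I * a * b₀) * (b₁c + Complex.I * a * b₀c))
    + s ^ 4 * (c₀ * c₀c))) * hs
    - ((2 - 2 * P.μ) * s * (b₁ + Complex.I * a * b₀) * (s * γ * (b₁c + Complex.I * a * b₀c)
      + conj (deriv H x.2) * (a₁c + Complex.I * a * a₀c))) * hI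

end BiharmonicPML
end


noncomputable section

namespace BiharmonicPML

/-! ### Injectivity at a wavenumber off the real axis -/

/-- Weierstrass approximation of real and imaginary part. The ideal multiplier conj((3δ + i)/σ)
inherits only the finite regularity of σ in general, whereas test functions are limits of smooth
ones. -/
theorem exists_contDiff_near {f : ℝ → ℂ} (hf : Continuous f) (a b : ℝ) {ε : ℝ} (hε : 0 < ε) :
    ∃ H : ℝ → ℂ, ContDiff ℝ ∞ H ∧ ∀ t ∈ Set.Icc a b, ‖H t - f t‖ ≤ ε := by
  obtain ⟨p, hp⟩ := exists_polynomial_near_of_continuousOn a b (fun t => (f t).re)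
    (Complex.continuous_re.comp hf).continuousOn (ε / 2) (by positivity)
  obtain ⟨q, hq⟩ := exists_polynomial_near_of_continuousOn a b (fun t => (f t).im)
    (Complex.continuous_im.comp hf).continuousOn (ε / 2) (by positivity)
  refine ⟨fun t => ((p.eval t : ℝ) : ℂ) + ((q.eval t : ℝ) : ℂ) * Complex.I, ?_, fun t ht => ?_⟩
  · have h : ∀ p : Polynomial ℝ, ContDiff ℝ ∞ fun t => ((p.eval t : ℝ) : ℂ) := fun p =>
      Complex.ofRealCLM.contDiff.comp (Polynomial.contDiff_aeval p _)
    exact (h p).add ((h q).mul contDiff_const)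
  · have e : ((p.eval t : ℝ) : ℂ) + ((q.eval t : ℝ) : ℂ) * Complex.I - f t
        = ((p.eval t - (f t).re : ℝ) : ℂ) + ((q.eval t - (f t).im : ℝ) : ℂ) * Complex.I := by
      conv_lhs => rw [← Complex.re_add_im (f t)]
      push_cast; ring
    rw [e]
    refine (norm_add_le _ _).trans ?_
    rw [norm_mul, Complex.norm_I, mul_one, Complex.norm_real, Complex.norm_real, Real.norm_eq_abs,
      Real.norm_eq_abs]
    linarith [hp t ht, hq t ht]

section Estimate

attribute [local irreducible] Dr pd

namespace Setup

variable {P : Setup}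

theorem Admissible.one_le_norm_σ (hP : P.Admissible) (t : ℝ) : 1 ≤ ‖P.σ t‖ :=
  (hP.one_le_sx t).trans ((hP.σ_re t).symm.trans_le (Complex.re_le_norm _))

theorem Admissible.norm_inv_σ_le (hP : P.Admissible) (t : ℝ) : ‖(P.σ t)⁻¹‖ ≤ 1 := by
  rw [norm_inv]; exact inv_le_one_of_one_le₀ (hP.one_le_norm_σ t)

theorem Admissible.norm_σ_sq_le (hP : P.Admissible) {t : ℝ} (ht : t ∈ Set.Icc P.bot P.top) :
    ‖P.σ t‖ ^ 2 ≤ (1 + P.σ₁) ^ 2 + P.σ₂ ^ 2 := by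
  have h := hP.sx_sq_add_sy_sq_le ht
  rw [Complex.sq_norm, Complex.normSq_apply, hP.σ_re, hP.σ_im]
  linarith

theorem Admissible.hasDerivAt_inv_σ_sq (hP : P.Admissible) (g : ℂ) (t : ℝ) :
    HasDerivAt (fun t => g * (P.σ t)⁻¹ ^ 2) (g * (2 * (P.σ t)⁻¹ * (-P.σ' t / P.σ t ^ 2))) t := by
  have h := (((hP.hasDerivAt_σ t).inv (hP.σ_ne_zero t)).pow 2).const_mul g
  simpa [pow_one] using h

/-- The form splits as `red - nul + low`. The real part of `red` is bounded below to first order in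
δ; `nul` is the null Lagrangian, of size W/k; `low` gathers the error of the multiplier, of size ε,
and the derivatives of coefficients, of size M³/k. The weight integral on the left is recovered from
second derivatives and ψ alone at the cost of a factor 2. -/
theorem Admissible.core_estimate (hP : P.Admissible) {δ k ε M W : ℝ} (hδ0 : 0 < δ)
    (hδ1 : δ ≤ 1 / 6) (hk : 1 ≤ k) (hM : 1 ≤ M) {H : ℝ → ℂ} (hH : ContDiff ℝ ∞ H)
    (hε : ∀ t ∈ Set.Icc P.bot P.top, ‖P.σ t * conj (H t) - (3 * δ + Complex.I)‖ ≤ ε)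
    (hM0 : ∀ t ∈ Set.Icc P.bot P.top, ‖H t‖ ≤ M)
    (hM1 : ∀ t ∈ Set.Icc P.bot P.top, ‖deriv H t‖ ≤ M)
    (hM2 : ∀ t ∈ Set.Icc P.bot P.top, ‖deriv (deriv H) t‖ ≤ M)
    (hM3 : ∀ t ∈ Set.Icc P.bot P.top, ‖deriv (fun s => (P.σ s)⁻¹) t‖ ≤ M)
    (hW : ∀ t ∈ Set.Icc P.bot P.top,
      ‖(3 * δ + Complex.I) * (2 * (P.σ t)⁻¹ * (-P.σ' t / P.σ t ^ 2))‖ ≤ W)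
    {ψ : ℝ × ℝ → ℂ} (hψ : ψ ∈ P.clamped 0) :
    (δ * ((1 - |Real.sin P.θ|) * (((1 + P.σ₁) ^ 2 + P.σ₂ ^ 2)⁻¹) ^ 2) / 2 - 8 * δ ^ 2
        - 4 * δ * W / k - 8 * W / k - 50 * ε - 43 * M ^ 3 / k)
      * ∫ x in P.domain, weightAt k (Real.sin P.θ * k) ψ x
    ≤ ‖∫ x in P.domain, (P.density x.2
          (jetAt ((Real.sin P.θ * k : ℝ) + Complex.I * (Real.sin P.θ * k * δ : ℝ)) ψ x)
          (jetAt (conj ((Real.sin P.θ * k : ℝ) + Complex.I * (Real.sin P.θ * k * δ : ℝ) : ℂ))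
            (mulSnd H ψ) x)
        - ((k : ℂ) * (1 + Complex.I * δ)) ^ 4 * (P.σ x.2 * ψ x * conj (mulSnd H ψ x)))‖ := by
  set s := Real.sin P.θ with hs
  have hs1 : |s| ≤ 1 := Real.abs_sin_le_one _
  set r := s * k with hr
  set a := s * k * δ with ha
  set z := ((k : ℂ) * (1 + Complex.I * δ)) ^ 4 with hz
  set g : ℂ := 3 * δ + Complex.I with hg
  set R := (1 + P.σ₁) ^ 2 + P.σ₂ ^ 2 with hR
  have hk0 : 0 < k := by linarith
  have hak : |a| ≤ k := by
    rw [ha, abs_mul, abs_mul, abs_of_pos hk0, abs_of_pos hδ0]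
    calc |s| * k * δ ≤ 1 * k * 1 := by gcongr; linarith
      _ = k := by ring
  obtain ⟨q0, q1, q2, q3, q4, q5⟩ := continuous_derivs hψ.1 r
  have q6 := continuous_weightAt hψ.1 k r
  have cσ := hP.continuous_σ
  have cσi : Continuous fun t => (P.σ t)⁻¹ := cσ.inv₀ hP.σ_ne_zero
  have cσ' := hP.continuous_σ'
  have cσd : Continuous (deriv fun s => (P.σ s)⁻¹) := by
    rw [funext hP.deriv_inv_σ]
    exact cσ'.neg.div (cσ.pow 2) fun t => pow_ne_zero 2 (hP.σ_ne_zero t)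
  have cH := hH.continuous
  have cH1 := (contDiff_deriv_top hH).continuous
  have cH2 := (contDiff_deriv_top (contDiff_deriv_top hH)).continuous
  set ζ' : ℝ → ℂ := fun t => g * (2 * (P.σ t)⁻¹ * (-P.σ' t / P.σ t ^ 2)) with hζ'
  have cζ' : Continuous ζ' := by
    have : Continuous fun t => -P.σ' t / P.σ t ^ 2 :=
      cσ'.neg.div (cσ.pow 2) fun t => pow_ne_zero 2 (hP.σ_ne_zero t)
    exact continuous_const.mul ((continuous_const.mul cσi).mul this)
  have hζ := hP.hasDerivAt_inv_σ_sq g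
  -- the three parts of the form
  set red : ℝ × ℝ → ℂ := fun x => g * reducedForm a z (P.σ x.2)⁻¹ (ψ x) (Dr r ψ x)
    (Dr r (Dr r ψ) x) (pd (0, 1) ψ x) (Dr r (pd (0, 1) ψ) x) (pd (0, 1) (pd (0, 1) ψ) x) with hred
  set nul : ℝ × ℝ → ℂ := fun x => P.μ * (g * (P.σ x.2)⁻¹ ^ 2) *
        (((pd (0, 1) (pd (0, 1) ψ) x * conj (Dr r (Dr r ψ) x)
            + Dr r (pd (0, 1) ψ) x * conj (Dr r (pd (0, 1) ψ) x))
          + conj (pd (0, 1) (pd (0, 1) ψ) x * conj (Dr r (Dr r ψ) x)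
            + Dr r (pd (0, 1) ψ) x * conj (Dr r (pd (0, 1) ψ) x)))
        - a ^ 2 * ((pd (0, 1) (pd (0, 1) ψ) x * conj (ψ x)
            + pd (0, 1) ψ x * conj (pd (0, 1) ψ x))
          + conj (pd (0, 1) (pd (0, 1) ψ) x * conj (ψ x)
            + pd (0, 1) ψ x * conj (pd (0, 1) ψ x)))
        + 2 * Complex.I * a *
          ((pd (0, 1) (pd (0, 1) ψ) x * conj (Dr r ψ x)
            + pd (0, 1) ψ x * conj (Dr r (pd (0, 1) ψ) x))
          + conj (pd (0, 1) (pd (0, 1) ψ) x * conj (Dr r ψ x)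
            + pd (0, 1) ψ x * conj (Dr r (pd (0, 1) ψ) x)))) with hnul
  set low : ℝ × ℝ → ℂ := fun x => (P.σ x.2 * conj (H x.2) - g) * mainForm P.μ a z (P.σ x.2)⁻¹ (ψ x)
        (Dr r ψ x) (Dr r (Dr r ψ) x) (pd (0, 1) ψ x) (Dr r (pd (0, 1) ψ) x)
        (pd (0, 1) (pd (0, 1) ψ) x)
      + lowerForm P.μ a (P.σ x.2)⁻¹ (deriv (fun s => (P.σ s)⁻¹) x.2) (conj (H x.2))
        (conj (deriv H x.2)) (conj (deriv (deriv H) x.2)) (ψ x) (Dr r ψ x) (Dr r (Dr r ψ) x)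
        (pd (0, 1) ψ x) (Dr r (pd (0, 1) ψ) x) (pd (0, 1) (pd (0, 1) ψ) x) with hlow
  have cred : Continuous red := by
    simp only [hred, reducedForm]; fun_prop (disch := exact fun _ => hP.σ_ne_zero _)
  have cnul : Continuous nul := by
    simp only [hnul]; fun_prop (disch := exact fun _ => hP.σ_ne_zero _)
  have clow : Continuous low := by
    simp only [hlow, mainForm, lowerForm]
    generalize (deriv fun s => (P.σ s)⁻¹) = S at cσd
    fun_prop (disch := exact fun _ => hP.σ_ne_zero _)
  have hsplit : ∫ x in P.domain, (P.density x.2 (jetAt ((r : ℝ) + Complex.I * (a : ℝ)) ψ x)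
          (jetAt (conj ((r : ℝ) + Complex.I * (a : ℝ) : ℂ)) (mulSnd H ψ) x)
        - z * (P.σ x.2 * ψ x * conj (mulSnd H ψ x)))
      = (∫ x in P.domain, red x) - (∫ x in P.domain, nul x) + ∫ x in P.domain, low x := by
    rw [← integral_sub (integrable_of_continuous cred) (integrable_of_continuous cnul),
      ← integral_add (integrable_of_continuous
        (f := fun x => red x - nul x) (cred.sub cnul)) (integrable_of_continuous clow)]
    congr 1
    ext x
    rw [P.density_jetAt_mulSnd hψ.1 hH r a z (hP.σ_ne_zero _)]
    simp only [hred, hnul, hlow]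
    rw [mainForm_eq]
    ring
  set I := ∫ x in P.domain, weightAt k r ψ x with hI
  have hI0 : 0 ≤ I := integral_nonneg fun x => weight_nonneg
  -- the reduced form
  have h1 : (δ * ((1 - |s|) * (R⁻¹) ^ 2) / 2 - 8 * δ ^ 2 - 4 * δ * W / k) * I
      ≤ (∫ x in P.domain, red x).re := by
    set η : ℝ → ℝ := fun t => (g * (P.σ t)⁻¹ ^ 2).im with hη
    have hηd : ∀ t, HasDerivAt η ((ζ' t).im) t := fun t =>
      Complex.imCLM.hasFDerivAt.comp_hasDerivAt t (hζ t)
    have cη : Continuous η := continuous_iff_continuousAt.mpr fun t => (hηd t).continuousAt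
    have cη' : Continuous fun t => (ζ' t).im := Complex.continuous_im.comp cζ'
    have hZ := hP.integral_null_ge hψ hk hηd cη' (r := r)
      (fun t ht => (Complex.abs_im_le_norm _).trans (hW t ht))
    have hL := hP.integral_weightAt_le hψ k r
    have e0 : (∫ x in P.domain, red x).re = ∫ x in P.domain, (red x).re :=
      (Complex.reCLM.integral_comp_comm (integrable_of_continuous cred)).symm
    set L : ℝ × ℝ → ℝ := fun x => ‖Dr r (Dr r ψ) x‖ ^ 2
      + ‖Dr r (pd (0, 1) ψ) x‖ ^ 2 + ‖pd (0, 1) (pd (0, 1) ψ) x‖ ^ 2 + k ^ 4 * ‖ψ x‖ ^ 2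
    set Z : ℝ × ℝ → ℝ := fun x => 2 * η x.2 * (pd (0, 1) (pd (0, 1) ψ) x * conj (Dr r (Dr r ψ) x)
            + Dr r (pd (0, 1) ψ) x * conj (Dr r (pd (0, 1) ψ) x)).re
        + 2 * k ^ 2 * ((Dr r (Dr r ψ) x * conj (ψ x)).re - ‖Dr r ψ x‖ ^ 2)
        - 2 * k ^ 2 * η x.2 * (pd (0, 1) (pd (0, 1) ψ) x * conj (ψ x)
            + pd (0, 1) ψ x * conj (pd (0, 1) ψ x)).re
    have cL : Continuous L := by fun_prop
    have cZ : Continuous Z := by fun_prop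
    have hle : ∫ x in P.domain, (δ * ((1 - |s|) * (R⁻¹) ^ 2) * L x + δ * |s| * Z x
        - 8 * δ ^ 2 * weightAt k r ψ x) ≤ ∫ x in P.domain, (red x).re := by
      refine setIntegral_mono_domain (by fun_prop) (Complex.continuous_re.comp cred) fun x hx => ?_
      have ht := snd_mem_of_mem_domain hx
      have hx1 : 1 ≤ (P.σ x.2).re := (hP.one_le_sx _).trans_eq (hP.σ_re _).symm
      have hy0 : 0 ≤ (P.σ x.2).im := (hP.sy_nonneg _).trans_eq (hP.σ_im _).symm
      have hxy : 3 * (P.σ x.2).im ^ 2 ≤ (P.σ x.2).re ^ 2 := by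
        rw [hP.σ_re, hP.σ_im]; exact hP.sx_sq_ge ht
      obtain ⟨b1, b2, b3, b4, b5⟩ := stretch_rotation_bounds hδ0 hδ1 hx1 hy0 hxy
      have m1 := re_reducedForm_ge (a₀ := ψ x) (a₁ := Dr r ψ x) (a₂ := Dr r (Dr r ψ) x)
        (b₀ := pd (0, 1) ψ x) (b₁ := Dr r (pd (0, 1) ψ) x) (c₀ := pd (0, 1) (pd (0, 1) ψ) x)
        hk0 hs1 hδ0 hδ1 (re_rotation_pow_le hδ0 hδ1) rfl rfl b1 b2 b5
      have hρ : ‖P.σ x.2‖⁻¹ ^ 2 ≤ 1 :=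
        pow_le_one₀ (by positivity) (inv_le_one_of_one_le₀ (hP.one_le_norm_σ _))
      have m2 := firstOrder_ge (k := k) (a₀ := ψ x) (a₁ := Dr r ψ x) (a₂ := Dr r (Dr r ψ) x)
        (b₀ := pd (0, 1) ψ x) (b₁ := Dr r (pd (0, 1) ψ) x) (c₀ := pd (0, 1) (pd (0, 1) ψ) x)
        hs1 b3 b4 hρ
      have hL0 : 0 ≤ L x := by positivity
      have hR4 : (R⁻¹) ^ 2 ≤ ‖P.σ x.2‖⁻¹ ^ 4 := by
        have h0 : 0 < ‖P.σ x.2‖ ^ 2 := by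
          have := hP.one_le_norm_σ x.2
          positivity
        rw [show ‖P.σ x.2‖⁻¹ ^ 4 = ((‖P.σ x.2‖ ^ 2)⁻¹) ^ 2 by rw [← inv_pow]; ring]
        have hRpos : 0 < R := h0.trans_le (hP.norm_σ_sq_le ht)
        gcongr
        exact hP.norm_σ_sq_le ht
      have m3 : (1 - |s|) * (R⁻¹) ^ 2 * L x ≤ (1 - |s|) * ‖P.σ x.2‖⁻¹ ^ 4 * L x := by
        have : 0 ≤ 1 - |s| := sub_nonneg.mpr hs1
        gcongr
      have m4 := mul_le_mul_of_nonneg_left ((add_le_add m3 le_rfl).trans m2) hδ0.le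
      refine le_trans ?_ m1
      rw [mul_add] at m4
      simp only [weightAt]
      refine sub_le_sub_right (le_trans (le_of_eq ?_) m4) _
      ring
    rw [e0]
    refine le_trans ?_ hle
    rw [integral_sub (integrable_of_continuous (by fun_prop))
      (integrable_of_continuous (by fun_prop)), integral_add (integrable_of_continuous (by fun_prop))
      (integrable_of_continuous (by fun_prop)), integral_const_mul, integral_const_mul,
      integral_const_mul, ← hI]
    have hc2 : 0 ≤ δ * ((1 - |s|) * (R⁻¹) ^ 2) := by
      have : 0 ≤ 1 - |s| := sub_nonneg.mpr hs1
      positivity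
    have f1 := mul_le_mul_of_nonneg_left hL hc2
    have hδs : 0 ≤ δ * |s| := by positivity
    have f2 := mul_le_mul_of_nonneg_left hZ hδs
    have hW0 : 0 ≤ W := (norm_nonneg _).trans (hW P.bot ⟨le_rfl, hP.bot_lt_top.le⟩)
    have f3 : δ * |s| * (4 * W / k * I) ≤ δ * 1 * (4 * W / k * I) := by gcongr
    have f4 : 4 * δ * W / k * I = δ * 1 * (4 * W / k * I) := by ring
    rw [mul_neg] at f2
    linarith
  have h2 : ‖∫ x in P.domain, nul x‖ ≤ 8 * W / k * I := by
    refine hP.norm_integral_null_le hψ hk0 hak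
      (w := fun t => P.μ * (g * (P.σ t)⁻¹ ^ 2)) (w' := fun t => P.μ * ζ' t)
      (fun t => (hζ t).const_mul _) (by fun_prop) fun t ht => ?_
    rw [norm_mul, Complex.norm_real, Real.norm_of_nonneg hP.hμ.1.le]
    exact (mul_le_of_le_one_left (norm_nonneg _) hP.hμ.2.le).trans (hW t ht)
  have h3 : ‖∫ x in P.domain, low x‖ ≤ (50 * ε + 43 * M ^ 3 / k) * I := by
    rw [hI, ← integral_const_mul]
    refine norm_integral_domain_le (by fun_prop) fun x hx => ?_
    have ht := snd_mem_of_mem_domain hx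
    have n1 := norm_mainForm_le (a₀ := ψ x) (a₁ := Dr r ψ x) (a₂ := Dr r (Dr r ψ) x)
      (b₀ := pd (0, 1) ψ x) (b₁ := Dr r (pd (0, 1) ψ) x) (c₀ := pd (0, 1) (pd (0, 1) ψ) x) hk0 hak
      hP.hμ.1 hP.hμ.2 (hP.norm_inv_σ_le x.2) (norm_rotation_pow_le hk0.le hδ0 hδ1)
    have n2 := norm_lowerForm_le (a₀ := ψ x) (a₁ := Dr r ψ x) (a₂ := Dr r (Dr r ψ) x)
      (b₀ := pd (0, 1) ψ x) (b₁ := Dr r (pd (0, 1) ψ) x) (c₀ := pd (0, 1) (pd (0, 1) ψ) x) hk hak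
      hP.hμ.1 hP.hμ.2 (hP.norm_inv_σ_le x.2) hM (hM3 _ ht) (G := conj (H x.2))
      (G' := conj (deriv H x.2)) (G'' := conj (deriv (deriv H) x.2))
      ((RCLike.norm_conj _).trans_le (hM0 _ ht)) ((RCLike.norm_conj _).trans_le (hM1 _ ht))
      ((RCLike.norm_conj _).trans_le (hM2 _ ht))
    rw [mul_comm k, ← le_div_iff₀ hk0] at n2
    refine (norm_add_le _ _).trans ?_
    rw [norm_mul]
    have n3 := mul_le_mul (hε _ ht) n1 (norm_nonneg _) ((norm_nonneg _).trans (hε _ ht))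
    refine (add_le_add n3 n2).trans_eq ?_
    simp only [weightAt]
    ring
  have e1 : (∫ x in P.domain, red x).re ≤ ‖(∫ x in P.domain, red x) - (∫ x in P.domain, nul x)
      + ∫ x in P.domain, low x‖ + ‖∫ x in P.domain, nul x‖ + ‖∫ x in P.domain, low x‖ := by
    refine (Complex.re_le_norm _).trans ?_
    have := norm_add_le (((∫ x in P.domain, red x) - (∫ x in P.domain, nul x)
      + ∫ x in P.domain, low x) + ∫ x in P.domain, nul x) (-∫ x in P.domain, low x)
    rw [norm_neg] at this
    have t2 := norm_add_le ((∫ x in P.domain, red x) - (∫ x in P.domain, nul x)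
      + ∫ x in P.domain, low x) (∫ x in P.domain, nul x)
    have e : (∫ x in P.domain, red x) - (∫ x in P.domain, nul x)
      + (∫ x in P.domain, low x) + (∫ x in P.domain, nul x) + (-∫ x in P.domain, low x)
      = ∫ x in P.domain, red x := by ring
    rw [e] at this
    linarith
  rw [hsplit]
  linarith

/-- A wavenumber at which a multiplier makes the form coercive on clamped functions. -/
theorem Admissible.exists_multiplier (hP : P.Admissible) :
    ∃ (κ : ℂ) (H : ℝ → ℂ) (c : ℝ), ContDiff ℝ ∞ H ∧ 0 < c ∧ ∀ ψ ∈ P.clamped 0,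
      c * ‖jet P.domain ψ‖ ^ 2 ≤ ‖∫ x in P.domain, (P.density x.2
          (jetAt (κ * Real.sin P.θ) ψ x) (jetAt (conj (κ * Real.sin P.θ)) (mulSnd H ψ) x)
        - κ ^ 4 * (P.σ x.2 * ψ x * conj (mulSnd H ψ x)))‖ := by
  set s := Real.sin P.θ with hs
  have hs1 : |s| < 1 := by
    have hc := Real.cos_pos_of_mem_Ioo hP.hθ
    have := Real.sin_sq_add_cos_sq P.θ
    rw [← sq_lt_one_iff_abs_lt_one]
    nlinarith
  set R := (1 + P.σ₁) ^ 2 + P.σ₂ ^ 2 with hR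
  have hR1 : 1 ≤ R := by
    have := hP.hσ₁
    nlinarith [sq_nonneg P.σ₂]
  set c₂ := (1 - |s|) * (R⁻¹) ^ 2 with hc₂
  have hc₂0 : 0 < c₂ := by
    have : 0 < 1 - |s| := by linarith
    positivity
  -- Budget in units of δc₂: of the available 1/2, the terms 8δ², 50ε and those with 1/k take at
  -- most 1/8, 1/16 and 1/16, so that 1/8 certainly remains. Only k depends on H.
  set δ := min (1 / 6) (c₂ / 64) with hδ
  have hδ0 : 0 < δ := by positivity
  have hδ1 : δ ≤ 1 / 6 := min_le_left _ _
  have hδ2 : 64 * δ ≤ c₂ := by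
    have : δ ≤ c₂ / 64 := min_le_right _ _
    linarith
  set g : ℂ := 3 * δ + Complex.I with hg
  set ε := δ * c₂ / 800 with hε
  have hε0 : 0 < ε := by positivity
  have cσ := hP.continuous_σ
  have cσi : Continuous fun t => (P.σ t)⁻¹ := cσ.inv₀ hP.σ_ne_zero
  have cσd : Continuous (deriv fun s => (P.σ s)⁻¹) := by
    rw [funext hP.deriv_inv_σ]
    exact hP.continuous_σ'.neg.div (cσ.pow 2) fun t => pow_ne_zero 2 (hP.σ_ne_zero t)
  -- Accuracy ε/R, because the error is later multiplied by σ, which is bounded by R.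
  obtain ⟨H, hH, hHε⟩ := exists_contDiff_near (f := fun t => conj (g * (P.σ t)⁻¹)) (by fun_prop)
    P.bot P.top (ε := ε / R) (by positivity)
  have hH1 := contDiff_deriv_top hH
  have hH2 := contDiff_deriv_top hH1
  obtain ⟨M₀, hM₀⟩ := isCompact_Icc.exists_bound_of_continuousOn
    (hH.continuous.continuousOn (s := Set.Icc P.bot P.top))
  obtain ⟨M₁, hM₁⟩ := isCompact_Icc.exists_bound_of_continuousOn
    (hH1.continuous.continuousOn (s := Set.Icc P.bot P.top))
  obtain ⟨M₂, hM₂⟩ := isCompact_Icc.exists_bound_of_continuousOn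
    (hH2.continuous.continuousOn (s := Set.Icc P.bot P.top))
  obtain ⟨M₃, hM₃⟩ := isCompact_Icc.exists_bound_of_continuousOn
    (cσd.continuousOn (s := Set.Icc P.bot P.top))
  have cW : Continuous fun t => g * (2 * (P.σ t)⁻¹ * (-P.σ' t / P.σ t ^ 2)) :=
    continuous_const.mul ((continuous_const.mul cσi).mul
      (hP.continuous_σ'.neg.div (cσ.pow 2) fun t => pow_ne_zero 2 (hP.σ_ne_zero t)))
  obtain ⟨W, hW⟩ := isCompact_Icc.exists_bound_of_continuousOn
    (cW.continuousOn (s := Set.Icc P.bot P.top))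
  have hW0 : 0 ≤ W := (norm_nonneg _).trans (hW P.bot ⟨le_rfl, hP.bot_lt_top.le⟩)
  set M := max (max 1 M₀) (max M₁ (max M₂ M₃)) with hM
  have hM1 : 1 ≤ M := (le_max_left _ _).trans (le_max_left _ _)
  -- 12W covers 8W + 4δW, as δ ≤ 1. The bounds M and W do not involve k, so it may be chosen last.
  set k := max 1 ((12 * W + 43 * M ^ 3) * 16 / (δ * c₂)) with hk
  have hk1 : 1 ≤ k := le_max_left _ _
  have hk0 : 0 < k := by linarith
  have hk2 : (12 * W + 43 * M ^ 3) / k ≤ δ * c₂ / 16 := by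
    have h : (12 * W + 43 * M ^ 3) * 16 / (δ * c₂) ≤ k := le_max_right _ _
    rw [div_le_iff₀ (by positivity)] at h
    rw [div_le_iff₀ hk0]
    linarith
  have hσR : ∀ t ∈ Set.Icc P.bot P.top, ‖P.σ t‖ ≤ R := fun t ht => by
    have h1 := hP.norm_σ_sq_le ht
    have h2 := hP.one_le_norm_σ t
    nlinarith
  have hcoef : δ * c₂ / 8 ≤ δ * c₂ / 2 - 8 * δ ^ 2 - 4 * δ * W / k - 8 * W / k - 50 * ε
      - 43 * M ^ 3 / k := by
    have h1 : 4 * δ * W / k ≤ 4 * W / k := by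
      gcongr
      linarith
    have h2 : (12 * W + 43 * M ^ 3) / k = 4 * W / k + 8 * W / k + 43 * M ^ 3 / k := by ring
    have h3 : 8 * δ ^ 2 ≤ δ * c₂ / 8 := by nlinarith
    rw [hε]
    linarith [mul_pos hδ0 hc₂0]
  refine ⟨(k : ℂ) * (1 + Complex.I * δ), H, δ * c₂ / 8 / 47, hH, by positivity, fun ψ hψ => ?_⟩
  have hz : (k : ℂ) * (1 + Complex.I * δ) * (s : ℂ)
      = (s * k : ℝ) + Complex.I * (s * k * δ : ℝ) := by push_cast; ring
  have core := hP.core_estimate hδ0 hδ1 hk1 hM1 hH (ε := ε) (M := M) (W := W) (fun t ht => ?_)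
    (fun t ht => (hM₀ t ht).trans ((le_max_right _ _).trans (le_max_left _ _)))
    (fun t ht => (hM₁ t ht).trans ((le_max_left _ _).trans (le_max_right _ _)))
    (fun t ht => (hM₂ t ht).trans
      ((le_max_left _ _).trans ((le_max_right _ _).trans (le_max_right _ _))))
    (fun t ht => (hM₃ t ht).trans
      ((le_max_right _ _).trans ((le_max_right _ _).trans (le_max_right _ _)))) hW hψ
  · rw [hz]
    refine le_trans ?_ core
    have c1 := continuous_jetSq hψ.1
    have c2 := continuous_weightAt hψ.1 k (s * k)
    have h1 : ‖jet P.domain ψ‖ ^ 2 ≤ 47 * ∫ x in P.domain, weightAt k (s * k) ψ x := by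
      rw [norm_jet_sq isBounded_domain hψ.1, ← integral_const_mul]
      refine setIntegral_mono_domain c1 (by fun_prop) fun x _ =>
        jetSq_le_weightAt hψ.1 hk1 ?_ x
      rw [abs_mul, abs_of_pos hk0]
      exact mul_le_of_le_one_left hk0.le hs1.le
    have h0 : 0 ≤ ∫ x in P.domain, weightAt k (s * k) ψ x :=
      integral_nonneg fun x => weight_nonneg
    calc δ * c₂ / 8 / 47 * ‖jet P.domain ψ‖ ^ 2
        ≤ δ * c₂ / 8 / 47 * (47 * ∫ x in P.domain, weightAt k (s * k) ψ x) := by gcongr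
      _ = δ * c₂ / 8 * ∫ x in P.domain, weightAt k (s * k) ψ x := by ring
      _ ≤ _ := mul_le_mul_of_nonneg_right hcoef h0
  · have e : P.σ t * conj (H t) - g = P.σ t * conj (H t - conj (g * (P.σ t)⁻¹)) := by
      rw [map_sub, Complex.conj_conj, mul_sub, mul_left_comm, mul_inv_cancel₀ (hP.σ_ne_zero t),
        mul_one]
    rw [e, norm_mul, RCLike.norm_conj]
    calc ‖P.σ t‖ * ‖H t - conj (g * (P.σ t)⁻¹)‖ ≤ R * (ε / R) := by
          gcongr
          · exact hσR t ht
          · exact hHε t ht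
      _ = ε := by field_simp

/-- The operator of the truncated problem is injective at some complex wavenumber. -/
theorem Admissible.exists_injective_opB (hP : P.Admissible) :
    ∃ κ : ℂ, ∀ u, P.opB κ u = 0 → u = 0 := by
  obtain ⟨κ, H, c, hH, hc, hcoer⟩ := hP.exists_multiplier
  obtain ⟨C, hC⟩ := exists_norm_jet_mulSnd_le (P := P) hH
  refine ⟨κ, fun u hu => ?_⟩
  -- Testing `opB κ` of a clamped smooth function with its product by H bounds the norm from below.
  -- The inequality is closed, hence extends by density to all of `V₀`, and injectivity follows.
  have hmain : ∀ v : P.V₀, c * ‖v‖ ≤ C * ‖P.opB κ v‖ := by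
    have hdense : ∀ v : P.V₀, (v : Jet P.domain) ∈ closure (jet P.domain '' (P.clamped 0)) :=
      fun v => v.2
    have hcl : IsClosed {v : P.V₀ | c * ‖v‖ ≤ C * ‖P.opB κ v‖} :=
      isClosed_le (by fun_prop) (by fun_prop)
    intro v
    have hv : v ∈ closure {w : P.V₀ | ∃ ψ ∈ P.clamped 0, (w : Jet P.domain) = jet P.domain ψ} := by
      rw [Topology.IsEmbedding.subtypeVal.closure_eq_preimage_closure_image]
      refine closure_mono ?_ (hdense v)
      rintro _ ⟨ψ, hψ, rfl⟩
      exact ⟨⟨jet P.domain ψ, subset_closure ⟨ψ, hψ, rfl⟩⟩, ⟨ψ, hψ, rfl⟩, rfl⟩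
    refine closure_minimal ?_ hcl hv
    rintro w ⟨ψ, hψ, hw⟩
    have hχ := mulSnd_mem_clamped hH hψ
    set y : P.V₀ := ⟨jet P.domain (mulSnd H ψ), subset_closure ⟨_, hχ, rfl⟩⟩ with hy
    have hwn : ‖w‖ = ‖jet P.domain ψ‖ := by rw [← hw]; rfl
    have h1 := hcoer ψ hψ
    have h2 : inner ℂ y (P.opB κ w) = ∫ x in P.domain, (P.density x.2
          (jetAt (κ * Real.sin P.θ) ψ x) (jetAt (conj (κ * Real.sin P.θ)) (mulSnd H ψ) x)
        - κ ^ 4 * (P.σ x.2 * ψ x * conj (mulSnd H ψ x))) := by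
      have hT := hP.inner_opT (N P.domain (κ * Real.sin P.θ) (jet P.domain ψ))
        (N P.domain (conj (κ * Real.sin P.θ)) (jet P.domain (mulSnd H ψ)))
      have hS := hP.inner_opS (jet P.domain ψ) (jet P.domain (mulSnd H ψ))
      rw [inner_opB, hw, hT.2, hS.2, ← integral_const_mul,
        ← integral_sub hT.1 (hS.1.const_mul _)]
      refine integral_congr_ae ?_
      filter_upwards [coeFn_N_jet isBounded_domain hψ.1 (κ * Real.sin P.θ),
        coeFn_N_jet isBounded_domain hχ.1 (conj (κ * Real.sin P.θ)),
        coeFn_jet isBounded_domain hψ.1, coeFn_jet isBounded_domain hχ.1] with x e1 e2 e3 e4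
      simp only [e1, e2, e3.1, e4.1]
    have h3 : ‖inner ℂ y (P.opB κ w)‖ ≤ ‖y‖ * ‖P.opB κ w‖ :=
      norm_inner_le_norm (𝕜 := ℂ) y (P.opB κ w)
    have h4 : ‖y‖ ≤ C * ‖jet P.domain ψ‖ := hC ψ hψ.1
    rw [← h2] at h1
    change c * ‖w‖ ≤ C * ‖P.opB κ w‖
    rw [hwn]
    rcases (norm_nonneg (jet P.domain ψ)).eq_or_lt with h0 | h0
    · have hy0 : ‖w‖ = 0 := by rw [hwn, ← h0]
      have hw0 : w = 0 := norm_eq_zero.mp hy0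
      rw [← h0, hw0]
      simp
    · have h5 : c * ‖jet P.domain ψ‖ ^ 2 ≤ C * ‖jet P.domain ψ‖ * ‖P.opB κ w‖ :=
        h1.trans (h3.trans (mul_le_mul_of_nonneg_right h4 (norm_nonneg _)))
      refine le_of_mul_le_mul_right ?_ h0
      linarith
  have h := hmain u
  rw [hu, norm_zero, mul_zero] at h
  have h0 : ‖u‖ ≤ 0 := by
    by_contra hlt
    push Not at hlt
    have := mul_pos hc hlt
    linarith
  exact norm_le_zero_iff.mp h0

/-- The wavenumbers at which the operator is not invertible have no finite accumulation point. -/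
theorem Admissible.finite_singular (hP : P.Admissible) (R : ℝ) :
    {κ : ℂ | ‖κ‖ ≤ R ∧ ∃ u, u ≠ 0 ∧ P.opB κ u = 0}.Finite := by
  obtain ⟨C, K, hC, hK, hexp⟩ := hP.exists_pencil
  obtain ⟨κ₀, hκ₀⟩ := hP.exists_injective_opB
  have := finite_singular_of_injective hC hK (κ₀ := κ₀) (fun u hu => hκ₀ u (by rw [hexp, hu])) R
  simpa only [hexp] using this

/-- The operator is invertible if it is injective. -/
theorem Admissible.isUnit_opB (hP : P.Admissible) {κ : ℂ} (hκ : ∀ u, P.opB κ u = 0 → u = 0) :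
    IsUnit (P.opB κ) := by
  obtain ⟨C, K, hC, hK, hexp⟩ := hP.exists_pencil
  have e : P.opB κ = C + ∑ j : Fin 5, κ ^ (j : ℕ) • K j := by
    ext1 u
    rw [hexp]
    simp
  rw [e]
  refine IsCompactOperator.isUnit_add_of_injective hC ?_ fun x hx => hκ x ?_
  · have : ∀ s : Finset (Fin 5), IsCompactOperator (∑ j ∈ s, κ ^ (j : ℕ) • K j) := by
      intro s
      induction s using Finset.induction_on with
      | empty => simpa using isCompactOperator_zero
      | insert a s ha ih =>
        rw [Finset.sum_insert ha]
        exact ((hK a).smul (κ ^ (a : ℕ))).add ih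
    exact this Finset.univ
  · rw [e]
    exact hx

end Setup

end Estimate

end BiharmonicPML
end


noncomputable section

namespace BiharmonicPML

/-! ### The Sobolev space and jets -/

/-- The components of an element of `H²(D)` as a jet. -/
def H2.toJet {D : Set (ℝ × ℝ)} (u : H2 D) : Jet D :=
  WithLp.toLp 2 ![u.val, u.d1, u.d2, u.d11, u.d12, u.d22]

theorem H2.toJet_injective {D : Set (ℝ × ℝ)} : Function.Injective (H2.toJet (D := D)) := by
  intro u v h
  have h' : ∀ i, u.toJet i = v.toJet i := fun i => by rw [h]
  exact H2.ext (h' 0) (h' 1) (h' 2) (h' 3) (h' 4) (h' 5)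

theorem eLpNorm_sub_eq {D : Set (ℝ × ℝ)} {f : ℝ × ℝ → ℂ} (hf : MemLp f 2 (volume.restrict D))
    (g : L2 D) : eLpNorm (fun x => f x - g x) 2 (volume.restrict D) = edist (toL2 D f) g := by
  rw [Lp.edist_def]
  refine eLpNorm_congr_ae ?_
  filter_upwards [coeFn_toL2 hf] with x hx
  simp [hx]

theorem H2.distSmooth_eq {D : Set (ℝ × ℝ)} (hD : Bornology.IsBounded D) {ψ : ℝ × ℝ → ℂ}
    (hψ : ContDiff ℝ ∞ ψ) (u : H2 D) :
    u.distSmooth ψ = ∑ i, edist (jet D ψ i) (u.toJet i) := by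
  have h1 := contDiff_pd hψ (1, 0)
  have h2 := contDiff_pd hψ (0, 1)
  have hm : ∀ {h : ℝ × ℝ → ℂ}, ContDiff ℝ ∞ h → MemLp h 2 (volume.restrict D) :=
    fun hh => memLp_of_continuous hD hh.continuous 2
  rw [Fin.sum_univ_six, H2.distSmooth, eLpNorm_sub_eq (hm hψ), eLpNorm_sub_eq (hm h1),
    eLpNorm_sub_eq (hm h2), eLpNorm_sub_eq (hm (contDiff_pd h1 _)),
    eLpNorm_sub_eq (hm (contDiff_pd h1 _)), eLpNorm_sub_eq (hm (contDiff_pd h2 _))]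
  rfl

theorem H2.tendsto_distSmooth_iff {D : Set (ℝ × ℝ)} (hD : Bornology.IsBounded D)
    {ψ : ℕ → ℝ × ℝ → ℂ} (hψ : ∀ n, ContDiff ℝ ∞ (ψ n)) (u : H2 D) :
    Tendsto (fun n => u.distSmooth (ψ n)) atTop (𝓝 0)
      ↔ Tendsto (fun n => jet D (ψ n)) atTop (𝓝 u.toJet) := by
  simp only [fun n => u.distSmooth_eq hD (hψ n)]
  constructor
  · intro h
    have hi : ∀ i, Tendsto (fun n => jet D (ψ n) i) atTop (𝓝 (u.toJet i)) := by
      intro i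
      rw [tendsto_iff_edist_tendsto_0]
      refine tendsto_of_tendsto_of_tendsto_of_le_of_le tendsto_const_nhds h (fun _ => zero_le)
        fun n => Finset.single_le_sum (f := fun i => edist (jet D (ψ n) i) (u.toJet i))
          (fun _ _ => zero_le) (Finset.mem_univ i)
    exact ((PiLp.continuous_toLp 2 (fun _ : Fin 6 => L2 D)).tendsto _).comp
      (tendsto_pi_nhds.mpr hi)
  · intro h
    have hi : ∀ i, Tendsto (fun n => edist (jet D (ψ n) i) (u.toJet i)) atTop (𝓝 0) := fun i =>
      tendsto_iff_edist_tendsto_0.mp (((pr D i).continuous.tendsto _).comp h)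
    simpa using tendsto_finsetSum Finset.univ fun i _ => hi i

/-- A property of smooth functions, and limits in `H²(D)` of functions with that property. -/
theorem H2.exists_seq_iff {D : Set (ℝ × ℝ)} (hD : Bornology.IsBounded D)
    {p : (ℝ × ℝ → ℂ) → Prop} (hp : ∀ ψ, p ψ → ContDiff ℝ ∞ ψ) (u : H2 D) :
    (∃ ψ : ℕ → ℝ × ℝ → ℂ, (∀ n, p (ψ n)) ∧ Tendsto (fun n => u.distSmooth (ψ n)) atTop (𝓝 0))
      ↔ u.toJet ∈ closure (jet D '' {ψ | p ψ}) := by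
  constructor
  · rintro ⟨ψ, hψ, h⟩
    rw [H2.tendsto_distSmooth_iff hD fun n => hp _ (hψ n)] at h
    exact mem_closure_of_tendsto h (Eventually.of_forall fun n => ⟨ψ n, hψ n, rfl⟩)
  · intro h
    obtain ⟨x, hx, hlim⟩ := mem_closure_iff_seq_limit.mp h
    choose ψ hψ hψx using hx
    refine ⟨ψ, hψ, (H2.tendsto_distSmooth_iff hD (fun n => hp _ (hψ n)) u).mpr ?_⟩
    simpa only [hψx] using hlim

theorem integral_mul_pd_eq {D : Set (ℝ × ℝ)} {ψ φ : ℝ × ℝ → ℂ} (hψ : ContDiff ℝ ∞ ψ)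
    (hφ : ContDiff ℝ ∞ φ) (hc : HasCompactSupport φ) (hs : tsupport φ ⊆ D) (e : ℝ × ℝ) :
    ∫ x in D, ψ x * fderiv ℝ φ x e = -∫ x in D, pd e ψ x * φ x := by
  have h0 : ∀ x, x ∉ D → φ x = 0 := fun x hx => image_eq_zero_of_notMem_tsupport fun h => hx (hs h)
  have h1 : ∀ x, x ∉ D → fderiv ℝ φ x e = 0 := fun x hx => by
    have : fderiv ℝ φ x = 0 := by
      refine image_eq_zero_of_notMem_tsupport fun h => hx (hs ?_)
      exact tsupport_fderiv_subset ℝ h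
    rw [this]; rfl
  rw [setIntegral_eq_integral_of_forall_compl_eq_zero fun x hx => by rw [h1 x hx, mul_zero],
    setIntegral_eq_integral_of_forall_compl_eq_zero fun x hx => by rw [h0 x hx, mul_zero]]
  have cψ := hψ.continuous
  have cφ := hφ.continuous
  have cpψ := (contDiff_pd hψ e).continuous
  have cpφ : Continuous fun x => fderiv ℝ φ x e := (contDiff_pd hφ e).continuous
  have hcφ : HasCompactSupport fun x => fderiv ℝ φ x e := hc.fderiv_apply (𝕜 := ℝ) e
  refine integral_mul_fderiv_eq_neg_fderiv_mul_of_integrable ?_ ?_ ?_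
    (fun x _ => hψ.differentiable (by simp) x) (fun x _ => hφ.differentiable (by simp) x)
  · exact (cpψ.mul cφ).integrable_of_hasCompactSupport hc.mul_left
  · exact (cψ.mul cpφ).integrable_of_hasCompactSupport hcφ.mul_left
  · exact (cψ.mul cφ).integrable_of_hasCompactSupport hc.mul_left

/-- Weak derivatives are preserved by limits of jets. -/
theorem isWeakDeriv_of_mem_closure {D : Set (ℝ × ℝ)} (hD : Bornology.IsBounded D) {U : Jet D}
    (hU : U ∈ closure (jet D '' {ψ | ContDiff ℝ ∞ ψ})) (e : ℝ × ℝ) (i j : Fin 6)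
    (h : ∀ ψ, ContDiff ℝ ∞ ψ → ∃ η, ContDiff ℝ ∞ η ∧ jet D ψ i = toL2 D η
      ∧ jet D ψ j = toL2 D (pd e η)) : IsWeakDeriv D e (U i) (U j) := by
  intro φ hφ hc hs
  have key : ∀ {g : ℝ × ℝ → ℂ}, Continuous g → ∀ f : L2 D,
      ∫ x in D, f x * g x = inner ℂ (toL2 D fun x => conj (g x)) f := by
    intro g hg f
    rw [inner_L2]
    refine integral_congr_ae ?_
    filter_upwards [coeFn_toL2_of_continuous hD (f := fun x => conj (g x)) (by fun_prop)] with x hx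
    rw [hx, Complex.conj_conj]
  have c1 : Continuous fun x => fderiv ℝ φ x e := (contDiff_pd hφ e).continuous
  have c2 := hφ.continuous
  rw [key c1, key c2]
  -- For a fixed test function the defining identity of a weak derivative is a closed condition on
  -- the jet, so smooth functions are enough.
  have hcl : IsClosed {U : Jet D | inner ℂ (toL2 D fun x => conj (fderiv ℝ φ x e)) (U i)
      = -inner ℂ (toL2 D fun x => conj (φ x)) (U j)} := by
    refine isClosed_eq ?_ ?_
    · exact (innerSL ℂ (toL2 D fun x => conj (fderiv ℝ φ x e))).continuous.comp (pr D i).continuous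
    · exact ((innerSL ℂ (toL2 D fun x => conj (φ x))).continuous.comp (pr D j).continuous).neg
  refine closure_minimal ?_ hcl hU
  rintro _ ⟨ψ, hψ, rfl⟩
  obtain ⟨η, hη, e1, e2⟩ := h ψ hψ
  change inner ℂ _ (jet D ψ i) = -inner ℂ _ (jet D ψ j)
  rw [← key c1, ← key c2, e1, e2]
  have hp := integral_mul_pd_eq hη hφ hc hs e
  rw [integral_congr_ae (g := fun x => η x * fderiv ℝ φ x e), hp, integral_congr_ae]
  · filter_upwards [coeFn_toL2_of_continuous hD (contDiff_pd hη e).continuous] with x hx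
    rw [hx]
  · filter_upwards [coeFn_toL2_of_continuous hD hη.continuous] with x hx
    rw [hx]

/-- Limits of jets of smooth functions are jets of elements of `H²(D)`. -/
theorem exists_toJet_eq {D : Set (ℝ × ℝ)} (hD : Bornology.IsBounded D) {U : Jet D}
    (hU : U ∈ closure (jet D '' {ψ | ContDiff ℝ ∞ ψ})) : ∃ u : H2 D, u.toJet = U := by
  refine ⟨⟨U 0, U 1, U 2, U 3, U 4, U 5, ?_, ?_, ?_, ?_, ?_⟩, ?_⟩
  · exact isWeakDeriv_of_mem_closure hD hU _ 0 1 fun ψ hψ => ⟨ψ, hψ, rfl, rfl⟩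
  · exact isWeakDeriv_of_mem_closure hD hU _ 0 2 fun ψ hψ => ⟨ψ, hψ, rfl, rfl⟩
  · exact isWeakDeriv_of_mem_closure hD hU _ 1 3 fun ψ hψ =>
      ⟨_, contDiff_pd hψ _, rfl, rfl⟩
  · exact isWeakDeriv_of_mem_closure hD hU _ 1 4 fun ψ hψ =>
      ⟨_, contDiff_pd hψ _, rfl, rfl⟩
  · exact isWeakDeriv_of_mem_closure hD hU _ 2 5 fun ψ hψ =>
      ⟨_, contDiff_pd hψ _, rfl, rfl⟩
  · ext i : 1
    fin_cases i <;> rfl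

/-! ### Multiplication by exponentials -/

/-- The function `exp(iβx₁)`. -/
def expFst (β : ℝ) (x : ℝ × ℝ) : ℂ := Complex.exp (Complex.I * β * x.1)

theorem contDiff_expFst (β : ℝ) : ContDiff ℝ ∞ (expFst β) :=
  (contDiff_const.mul (Complex.ofRealCLM.contDiff.comp contDiff_fst)).cexp

theorem norm_expFst (β : ℝ) (x : ℝ × ℝ) : ‖expFst β x‖ = 1 := by
  rw [expFst, show Complex.I * β * x.1 = ((β * x.1 : ℝ) : ℂ) * Complex.I by push_cast; ring,
    Complex.norm_exp_ofReal_mul_I]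

theorem expFst_mul (β γ : ℝ) (x : ℝ × ℝ) : expFst β x * expFst γ x = expFst (β + γ) x := by
  rw [expFst, expFst, expFst, ← Complex.exp_add]
  congr 1
  push_cast
  ring

theorem expFst_zero (x : ℝ × ℝ) : expFst 0 x = 1 := by simp [expFst]

theorem expFst_mul_conj (β : ℝ) (x : ℝ × ℝ) : expFst β x * conj (expFst β x) = 1 := by
  rw [Complex.mul_conj', norm_expFst]; norm_num

theorem pd_expFst (β : ℝ) (e x : ℝ × ℝ) :
    pd e (expFst β) x = e.1 * (Complex.I * β * expFst β x) := by
  have h1 : HasFDerivAt (fun y : ℝ × ℝ => (y.1 : ℂ)) (Complex.ofRealCLM ∘L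
      ContinuousLinearMap.fst ℝ ℝ ℝ) x :=
    Complex.ofRealCLM.hasFDerivAt.comp x hasFDerivAt_fst
  have h2 : HasFDerivAt (expFst β) _ x := (h1.const_mul (Complex.I * β)).cexp
  simp only [pd]
  rw [h2.fderiv]
  simp only [smul_apply, ContinuousLinearMap.comp_apply, ContinuousLinearMap.coe_fst',
    Complex.ofRealCLM_apply, smul_eq_mul]
  change expFst β x * _ = _
  ring

/-- The product with `exp(iβx₁)`. -/
def mulExp (β : ℝ) (ψ : ℝ × ℝ → ℂ) : ℝ × ℝ → ℂ := fun x => expFst β x * ψ x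

theorem contDiff_mulExp {ψ : ℝ × ℝ → ℂ} (hψ : ContDiff ℝ ∞ ψ) (β : ℝ) :
    ContDiff ℝ ∞ (mulExp β ψ) := (contDiff_expFst β).mul hψ

theorem pd_mulExp {ψ : ℝ × ℝ → ℂ} (hψ : ContDiff ℝ ∞ ψ) (β : ℝ) (e : ℝ × ℝ) :
    pd e (mulExp β ψ) = mulExp β (pd e ψ + (e.1 * (Complex.I * β)) • ψ) := by
  ext x
  have := pd_mul ((contDiff_expFst β).differentiable (by simp) x) (hψ.differentiable (by simp) x) e
  change pd e (fun y => expFst β y * ψ y) x = _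
  rw [this, pd_expFst]
  simp only [mulExp, Pi.add_apply, Pi.smul_apply, smul_eq_mul]
  ring

theorem quasiPeriodic_mulExp {Λ α : ℝ} {ψ : ℝ × ℝ → ℂ} (hψ : QuasiPeriodic Λ α ψ) (β : ℝ) :
    QuasiPeriodic Λ (α + β) (mulExp β ψ) := by
  intro x
  simp only [mulExp, expFst, hψ x]
  rw [← mul_assoc, ← mul_assoc, ← Complex.exp_add, ← Complex.exp_add]
  congr 2
  push_cast
  ring

theorem Setup.mulExp_mem_clamped {P : Setup} {α : ℝ} {ψ : ℝ × ℝ → ℂ} (hψ : ψ ∈ P.clamped α)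
    (β : ℝ) : mulExp β ψ ∈ P.clamped (α + β) := by
  refine ⟨contDiff_mulExp hψ.1 β, quasiPeriodic_mulExp hψ.2.1 β, fun x hx => ⟨?_, ?_⟩⟩
  · simp [mulExp, (hψ.2.2 x hx).1]
  · refine ContinuousLinearMap.ext fun v => ?_
    have := congrFun (pd_mulExp hψ.1 β v) x
    simp only [pd, mulExp, Pi.add_apply, Pi.smul_apply, (hψ.2.2 x hx).1, (hψ.2.2 x hx).2] at this
    simpa using this

/-- Multiplication of all components of a jet by `exp(iβx₁)`. -/
def mulJet (D : Set (ℝ × ℝ)) (β : ℝ) : Jet D →L[ℂ] Jet D :=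
  ∑ i, inj D i ∘L mulL D (expFst β) ∘L pr D i

/-- The action on jets of the multiplication by `exp(iβx₁)`. -/
def twist (D : Set (ℝ × ℝ)) (β : ℝ) : Jet D →L[ℂ] Jet D := mulJet D β ∘L N D β

theorem mulJet_apply (D : Set (ℝ × ℝ)) (β : ℝ) (u : Jet D) (i : Fin 6) :
    mulJet D β u i = mulL D (expFst β) (u i) := by
  simp only [mulJet, sum_apply, ContinuousLinearMap.comp_apply, pr_apply]
  rw [WithLp.ofLp_sum, Finset.sum_apply]
  simp [inj_apply]

theorem coeFn_mulJet {D : Set (ℝ × ℝ)} (hD : Bornology.IsBounded D) (β : ℝ) (u : Jet D) :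
    ∀ᵐ x ∂volume.restrict D, ∀ i, mulJet D β u i x = expFst β x * u i x := by
  rw [ae_all_iff]
  intro i
  rw [mulJet_apply]
  exact coeFn_mulL (memLp_of_continuous hD (contDiff_expFst β).continuous _) _

theorem jet_ext {D : Set (ℝ × ℝ)} {u v : Jet D}
    (h : ∀ᵐ x ∂volume.restrict D, ∀ i, u i x = v i x) : u = v := by
  ext i : 1
  exact Lp.ext (h.mono fun x hx => hx i)

theorem twist_jet {D : Set (ℝ × ℝ)} (hD : Bornology.IsBounded D) {ψ : ℝ × ℝ → ℂ}
    (hψ : ContDiff ℝ ∞ ψ) (β : ℝ) : twist D β (jet D ψ) = jet D (mulExp β ψ) := by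
  refine jet_ext ?_
  have h1 := contDiff_pd hψ (1, 0)
  have h2 := contDiff_pd hψ (0, 1)
  filter_upwards [coeFn_mulJet hD β (N D β (jet D ψ)), coeFn_N_jet hD hψ β,
    coeFn_jet hD (contDiff_mulExp hψ β)] with x e1 e2 ⟨g0, g1, g2, g3, g4, g5⟩ i
  have e3 : twist D β (jet D ψ) i x = expFst β x * jetAt β ψ x i := by
    rw [← e2]; exact e1 i
  rw [e3]
  have hs : ContDiff ℝ ∞ ((Complex.I * (β : ℂ)) • ψ) := contDiff_const.smul hψ
  have hadd : ContDiff ℝ ∞ (pd (1, 0) ψ + (Complex.I * (β : ℂ)) • ψ) := h1.add hs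
  have p1 : pd (1, 0) (mulExp β ψ) = mulExp β (pd (1, 0) ψ + (Complex.I * (β : ℂ)) • ψ) := by
    rw [pd_mulExp hψ]; simp
  have p2 : pd (0, 1) (mulExp β ψ) = mulExp β (pd (0, 1) ψ) := by
    rw [pd_mulExp hψ]; simp
  have p3 : pd (1, 0) (pd (1, 0) (mulExp β ψ)) = mulExp β (pd (1, 0) (pd (1, 0) ψ)
      + (Complex.I * (β : ℂ)) • pd (1, 0) ψ + (Complex.I * (β : ℂ)) •
        (pd (1, 0) ψ + (Complex.I * (β : ℂ)) • ψ)) := by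
    rw [p1, pd_mulExp hadd, pd_add h1 hs, pd_smul hψ]; simp
  have p4 : pd (0, 1) (pd (1, 0) (mulExp β ψ)) = mulExp β (pd (0, 1) (pd (1, 0) ψ)
      + (Complex.I * (β : ℂ)) • pd (0, 1) ψ) := by
    rw [p1, pd_mulExp hadd, pd_add h1 hs, pd_smul hψ]; simp
  have p5 : pd (0, 1) (pd (0, 1) (mulExp β ψ)) = mulExp β (pd (0, 1) (pd (0, 1) ψ)) := by
    rw [p2, pd_mulExp h2]; simp
  fin_cases i
  · exact g0.symm
  · refine Eq.trans ?_ g1.symm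
    rw [p1]
    simp [jetAt, mulExp]
  · refine Eq.trans ?_ g2.symm
    rw [p2]
    rfl
  · refine Eq.trans ?_ g3.symm
    rw [p3]
    simp only [jetAt, mulExp, Pi.add_apply, Pi.smul_apply, smul_eq_mul]
    change expFst β x * (_ + _ - _) = _
    linear_combination (-expFst β x * (β : ℂ) ^ 2 * ψ x) * Complex.I_sq
  · refine Eq.trans ?_ g4.symm
    rw [p4]
    simp [jetAt, mulExp]
  · refine Eq.trans ?_ g5.symm
    rw [p5]
    rfl

/-- The shifts of ∂₁ by iβ and -iβ cancel on arbitrary jets, so twisting identifies the clamped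
spaces for all quasi-periods with the one for period zero phase. -/
theorem twist_twist {D : Set (ℝ × ℝ)} (hD : Bornology.IsBounded D) (β : ℝ) (u : Jet D) :
    twist D β (twist D (-β) u) = u := by
  refine jet_ext ?_
  filter_upwards [coeFn_mulJet hD β (N D β (twist D (-β) u)), coeFn_N β (twist D (-β) u),
    coeFn_mulJet hD (-β) (N D ((-β : ℝ) : ℂ) u), coeFn_N ((-β : ℝ) : ℂ) u] with x e1 e2 e3 e4 i
  have e5 : ∀ i, twist D (-β) u i x = expFst (-β) x * _ := fun i => by
    have := e3 i
    rw [congrFun e4 i] at this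
    exact this
  have e6 := e1 i
  rw [congrFun e2 i] at e6
  have hE : expFst β x * expFst (-β) x = 1 := by rw [expFst_mul, add_neg_cancel, expFst_zero]
  refine Eq.trans e6 ?_
  simp only [e5]
  fin_cases i <;> simp only [Matrix.cons_val] <;> push_cast
  · linear_combination u 0 x * hE
  · linear_combination u 1 x * hE
  · linear_combination u 2 x * hE
  · linear_combination u 3 x * hE
      - (2 * expFst β x * expFst (-β) x * (β : ℂ) ^ 2 * u 0 x) * Complex.I_sq
  · linear_combination u 4 x * hE
  · linear_combination u 5 x * hE

end BiharmonicPML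
end


noncomputable section

namespace BiharmonicPML

/-! ### Simultaneous boundary conditions -/

theorem jet_sub {D : Set (ℝ × ℝ)} (hD : Bornology.IsBounded D) {f g : ℝ × ℝ → ℂ}
    (hf : ContDiff ℝ ∞ f) (hg : ContDiff ℝ ∞ g) : jet D (f - g) = jet D f - jet D g := by
  have hg' : ContDiff ℝ ∞ ((-1 : ℂ) • g) := contDiff_const.smul hg
  have e : f - g = f + (-1 : ℂ) • g := by rw [neg_one_smul, sub_eq_add_neg]
  rw [e, jet_add hD hf hg', jet_smul hD hg, neg_one_smul, sub_eq_add_neg]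

namespace Setup

variable (P : Setup)

/-- A cutoff function equal to one near the upper outer boundary and to zero below the upper
interface. -/
def cutTop (t : ℝ) : ℂ := (Real.smoothTransition ((t - P.h₁) / (P.Δh₁ / 2)) : ℝ)

/-- A cutoff function equal to one near the lower outer boundary and to zero above the lower
interface. -/
def cutBot (t : ℝ) : ℂ := (Real.smoothTransition ((P.h₂ - t) / (P.Δh₂ / 2)) : ℝ)

theorem contDiff_cutTop : ContDiff ℝ ∞ P.cutTop :=
  Complex.ofRealCLM.contDiff.comp (Real.smoothTransition.contDiff.comp
    ((contDiff_id.sub contDiff_const).div_const _))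

theorem contDiff_cutBot : ContDiff ℝ ∞ P.cutBot :=
  Complex.ofRealCLM.contDiff.comp (Real.smoothTransition.contDiff.comp
    ((contDiff_const.sub contDiff_id).div_const _))

variable {P}

theorem Admissible.cutTop_eq_zero (hP : P.Admissible) {t : ℝ} (ht : t ≤ P.h₁) :
    P.cutTop t = 0 := by
  have := hP.hΔ₁
  rw [cutTop, Real.smoothTransition.zero_of_nonpos, Complex.ofReal_zero]
  exact div_nonpos_of_nonpos_of_nonneg (by linarith) (by positivity)

theorem Admissible.cutBot_eq_zero (hP : P.Admissible) {t : ℝ} (ht : P.h₂ ≤ t) :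
    P.cutBot t = 0 := by
  have := hP.hΔ₂
  rw [cutBot, Real.smoothTransition.zero_of_nonpos, Complex.ofReal_zero]
  exact div_nonpos_of_nonpos_of_nonneg (by linarith) (by positivity)

theorem Admissible.cutTop_eq_one (hP : P.Admissible) {t : ℝ} (ht : P.h₁ + P.Δh₁ / 2 ≤ t) :
    P.cutTop t = 1 := by
  have := hP.hΔ₁
  rw [cutTop, Real.smoothTransition.one_of_one_le, Complex.ofReal_one]
  rw [one_le_div (by positivity)]
  linarith

theorem Admissible.cutBot_eq_one (hP : P.Admissible) {t : ℝ} (ht : t ≤ P.h₂ - P.Δh₂ / 2) :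
    P.cutBot t = 1 := by
  have := hP.hΔ₂
  rw [cutBot, Real.smoothTransition.one_of_one_le, Complex.ofReal_one]
  rw [one_le_div (by positivity)]
  linarith

theorem eventually_snd_lt {x : ℝ × ℝ} {t : ℝ} (h : x.2 < t) : ∀ᶠ y : ℝ × ℝ in 𝓝 x, y.2 < t :=
  (continuous_snd.tendsto x).eventually (eventually_lt_nhds h)

theorem eventually_lt_snd {x : ℝ × ℝ} {t : ℝ} (h : t < x.2) : ∀ᶠ y : ℝ × ℝ in 𝓝 x, t < y.2 :=
  (continuous_snd.tendsto x).eventually (eventually_gt_nhds h)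

theorem Admissible.cut_near_Γc (hP : P.Admissible) {x : ℝ × ℝ} (hx : x ∈ P.Γc) :
    ∀ᶠ y : ℝ × ℝ in 𝓝 x, P.cutTop y.2 = 0 ∧ P.cutBot y.2 = 0 := by
  have h := (hP.hencl (frontier_subset_closure hx)).2
  filter_upwards [eventually_snd_lt h.2, eventually_lt_snd h.1] with y h1 h2
  exact ⟨hP.cutTop_eq_zero h1.le, hP.cutBot_eq_zero h2.le⟩

theorem Admissible.cut_near_Γ₁ (hP : P.Admissible) {x : ℝ × ℝ} (hx : x ∈ P.Γ₁) :
    ∀ᶠ y : ℝ × ℝ in 𝓝 x, P.cutTop y.2 = 1 ∧ P.cutBot y.2 = 0 := by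
  have h : x.2 = P.h₁ + P.Δh₁ := hx.2
  have := hP.hΔ₁
  have := hP.hh
  filter_upwards [eventually_lt_snd (t := P.h₁ + P.Δh₁ / 2) (x := x) (by linarith)] with y h1
  exact ⟨hP.cutTop_eq_one h1.le, hP.cutBot_eq_zero (by linarith)⟩

theorem Admissible.cut_near_Γ₂ (hP : P.Admissible) {x : ℝ × ℝ} (hx : x ∈ P.Γ₂) :
    ∀ᶠ y : ℝ × ℝ in 𝓝 x, P.cutTop y.2 = 0 ∧ P.cutBot y.2 = 1 := by
  have h : x.2 = P.h₂ - P.Δh₂ := hx.2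
  have := hP.hΔ₂
  have := hP.hh
  filter_upwards [eventually_snd_lt (t := P.h₂ - P.Δh₂ / 2) (x := x) (by linarith)] with y h1
  exact ⟨hP.cutTop_eq_zero (by linarith), hP.cutBot_eq_one h1.le⟩

/-- Boundary data as a closure of a set of jets. -/
theorem hasCauchyData_iff {α : ℝ} {u : H2 P.domain} {S : Set (ℝ × ℝ)} {g : ℝ × ℝ → ℂ} :
    HasCauchyData P.Λ α u S g ↔ u.toJet ∈ closure (jet P.domain '' {ψ | ContDiff ℝ ∞ ψ ∧
      QuasiPeriodic P.Λ α ψ ∧ ∀ x ∈ S, ψ x = g x ∧ fderiv ℝ ψ x = fderiv ℝ g x}) :=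
  H2.exists_seq_iff (p := fun ψ => ContDiff ℝ ∞ ψ ∧ QuasiPeriodic P.Λ α ψ ∧
    ∀ x ∈ S, ψ x = g x ∧ fderiv ℝ ψ x = fderiv ℝ g x) isBounded_domain (fun _ h => h.1) u

theorem HasCauchyData.mem_H2qp {α : ℝ} {u : H2 P.domain} {S : Set (ℝ × ℝ)} {g : ℝ × ℝ → ℂ}
    (h : HasCauchyData P.Λ α u S g) : u ∈ H2qp P.domain P.Λ α := by
  obtain ⟨ψ, hψ, hlim⟩ := h
  exact ⟨ψ, fun n => ⟨(hψ n).1, (hψ n).2.1⟩, hlim⟩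

theorem quasiPeriodic_sub {Λ α : ℝ} {f g : ℝ × ℝ → ℂ} (hf : QuasiPeriodic Λ α f)
    (hg : QuasiPeriodic Λ α g) : QuasiPeriodic Λ α (f - g) := fun x => by
  simp only [Pi.sub_apply, hf x, hg x]; ring

/-- The three boundary conditions can be satisfied simultaneously by the approximating functions. -/
theorem Admissible.cauchyData_iff (hP : P.Admissible) {α : ℝ} {g : ℝ × ℝ → ℂ}
    (hg : ContDiff ℝ ∞ g) (hgq : QuasiPeriodic P.Λ α g) (u : H2 P.domain) :
    (HasCauchyData P.Λ α u P.Γc 0 ∧ HasCauchyData P.Λ α u P.Γ₂ 0 ∧ HasCauchyData P.Λ α u P.Γ₁ g)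
      ↔ u.toJet - jet P.domain (mulSnd P.cutTop g)
        ∈ closure (jet P.domain '' (P.clamped α : Set (ℝ × ℝ → ℂ))) := by
  have hD := isBounded_domain (P := P)
  have hL : ContDiff ℝ ∞ (mulSnd P.cutTop g) := contDiff_mulSnd P.contDiff_cutTop hg
  have hz : ∀ x : ℝ × ℝ, fderiv ℝ (0 : ℝ × ℝ → ℂ) x = 0 := fun x => by
    rw [Pi.zero_def]; exact fderiv_const_apply _
  constructor
  · rintro ⟨⟨c, hc, hcl⟩, ⟨b, hb, hbl⟩, ⟨a, ha, hal⟩⟩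
    rw [H2.tendsto_distSmooth_iff hD fun n => (hc n).1] at hcl
    rw [H2.tendsto_distSmooth_iff hD fun n => (hb n).1] at hbl
    rw [H2.tendsto_distSmooth_iff hD fun n => (ha n).1] at hal
    have hac : ∀ n, ContDiff ℝ ∞ (a n - c n) := fun n => (ha n).1.sub (hc n).1
    have hbc : ∀ n, ContDiff ℝ ∞ (b n - c n) := fun n => (hb n).1.sub (hc n).1
    have m1 : ∀ n, ContDiff ℝ ∞ (mulSnd P.cutTop (a n - c n)) := fun n =>
      contDiff_mulSnd P.contDiff_cutTop (hac n)
    have m2 : ∀ n, ContDiff ℝ ∞ (mulSnd P.cutBot (b n - c n)) := fun n =>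
      contDiff_mulSnd P.contDiff_cutBot (hbc n)
    have m3 : ∀ n, ContDiff ℝ ∞ (c n + mulSnd P.cutTop (a n - c n)) := fun n =>
      (hc n).1.add (m1 n)
    have m4 : ∀ n, ContDiff ℝ ∞ (c n + mulSnd P.cutTop (a n - c n)
      + mulSnd P.cutBot (b n - c n)) := fun n => (m3 n).add (m2 n)
    -- Gluing: the cutoffs select the sequence adapted to the outer boundaries near them and leave
    -- `c n` near the cavity; subtracting the lifting makes the result clamped. The three sequences
    -- have the same limit, so the corrections tend to zero.
    set w : ℕ → ℝ × ℝ → ℂ := fun n => c n + mulSnd P.cutTop (a n - c n)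
      + mulSnd P.cutBot (b n - c n) - mulSnd P.cutTop g with hw
    have hval : ∀ n y, w n y = c n y + P.cutTop y.2 * (a n y - c n y)
      + P.cutBot y.2 * (b n y - c n y) - P.cutTop y.2 * g y := fun n y => rfl
    have hmem : ∀ n, w n ∈ P.clamped α := by
      intro n
      refine ⟨(m4 n).sub hL, ?_, ?_⟩
      · exact quasiPeriodic_sub (quasiPeriodic_add (quasiPeriodic_add (hc n).2.1
          (quasiPeriodic_mulSnd (quasiPeriodic_sub (ha n).2.1 (hc n).2.1)))
          (quasiPeriodic_mulSnd (quasiPeriodic_sub (hb n).2.1 (hc n).2.1)))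
          (quasiPeriodic_mulSnd hgq)
      · rintro x ((hx | hx) | hx)
        · have h : w n =ᶠ[𝓝 x] c n := by
            filter_upwards [hP.cut_near_Γc hx] with y hy
            rw [hval, hy.1, hy.2]; ring
          rw [h.eq_of_nhds, h.fderiv_eq, ((hc n).2.2 x hx).1, ((hc n).2.2 x hx).2]
          exact ⟨rfl, hz x⟩
        · have h : w n =ᶠ[𝓝 x] fun y => a n y - g y := by
            filter_upwards [hP.cut_near_Γ₁ hx] with y hy
            rw [hval, hy.1, hy.2]; ring
          rw [h.eq_of_nhds, h.fderiv_eq, fderiv_fun_sub ((ha n).1.differentiable (by simp) x)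
            (hg.differentiable (by simp) x), ((ha n).2.2 x hx).1, ((ha n).2.2 x hx).2]
          exact ⟨sub_self _, sub_self _⟩
        · have h : w n =ᶠ[𝓝 x] b n := by
            filter_upwards [hP.cut_near_Γ₂ hx] with y hy
            rw [hval, hy.1, hy.2]; ring
          rw [h.eq_of_nhds, h.fderiv_eq, ((hb n).2.2 x hx).1, ((hb n).2.2 x hx).2]
          exact ⟨rfl, hz x⟩
    have hjet : ∀ n, jet P.domain (w n) = jet P.domain (c n)
        + jet P.domain (mulSnd P.cutTop (a n - c n)) + jet P.domain (mulSnd P.cutBot (b n - c n))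
        - jet P.domain (mulSnd P.cutTop g) := by
      intro n
      rw [hw, jet_sub hD (m4 n) hL, jet_add hD (m3 n) (m2 n), jet_add hD (hc n).1 (m1 n)]
    have hsmall : ∀ {χ : ℝ → ℂ} {a : ℕ → ℝ × ℝ → ℂ}, ContDiff ℝ ∞ χ → (∀ n, ContDiff ℝ ∞ (a n)) →
        Tendsto (fun n => jet P.domain (a n)) atTop (𝓝 u.toJet) →
        Tendsto (fun n => jet P.domain (mulSnd χ (a n - c n))) atTop (𝓝 0) := by
      intro χ a hχ ha hal
      obtain ⟨C, hC⟩ := exists_norm_jet_mulSnd_le (P := P) hχ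
      have h0 : Tendsto (fun n => C * ‖jet P.domain (a n) - jet P.domain (c n)‖) atTop (𝓝 0) := by
        have := ((hal.sub hcl).norm).const_mul C
        simpa using this
      refine squeeze_zero_norm (fun n => ?_) h0
      have hs : ContDiff ℝ ∞ (a n - c n) := (ha n).sub (hc n).1
      rw [← jet_sub hD (ha n) (hc n).1]
      exact hC _ hs
    have hlim : Tendsto (fun n => jet P.domain (w n)) atTop
        (𝓝 (u.toJet - jet P.domain (mulSnd P.cutTop g))) := by
      simp only [hjet]
      have := ((hcl.add (hsmall P.contDiff_cutTop (fun n => (ha n).1) hal)).add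
        (hsmall P.contDiff_cutBot (fun n => (hb n).1) hbl)).sub_const
          (jet P.domain (mulSnd P.cutTop g))
      simpa using this
    exact mem_closure_of_tendsto hlim (Eventually.of_forall fun n => ⟨w n, hmem n, rfl⟩)
  · intro h
    have key : ∀ {S : Set (ℝ × ℝ)} {f : ℝ × ℝ → ℂ},
        (∀ ψ ∈ P.clamped α, ∀ x ∈ S, (ψ + mulSnd P.cutTop g) x = f x
          ∧ fderiv ℝ (ψ + mulSnd P.cutTop g) x = fderiv ℝ f x) → HasCauchyData P.Λ α u S f := by
      intro S f hS
      rw [hasCauchyData_iff]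
      have h2 := map_mem_closure (f := fun U => U + jet P.domain (mulSnd P.cutTop g))
        (by fun_prop) h (t := jet P.domain '' {ψ | ContDiff ℝ ∞ ψ ∧ QuasiPeriodic P.Λ α ψ ∧
          ∀ x ∈ S, ψ x = f x ∧ fderiv ℝ ψ x = fderiv ℝ f x}) ?_
      · simpa using h2
      · rintro _ ⟨ψ, hψ, rfl⟩
        exact ⟨ψ + mulSnd P.cutTop g, ⟨hψ.1.add hL,
          quasiPeriodic_add hψ.2.1 (quasiPeriodic_mulSnd hgq), hS ψ hψ⟩, jet_add hD hψ.1 hL⟩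
    have hval : ∀ (ψ : ℝ × ℝ → ℂ) y, (ψ + mulSnd P.cutTop g) y = ψ y + P.cutTop y.2 * g y :=
      fun ψ y => rfl
    refine ⟨key fun ψ hψ x hx => ?_, key fun ψ hψ x hx => ?_, key fun ψ hψ x hx => ?_⟩
    · have h : (ψ + mulSnd P.cutTop g) =ᶠ[𝓝 x] ψ := by
        filter_upwards [hP.cut_near_Γc hx] with y hy
        rw [hval, hy.1]; ring
      rw [h.eq_of_nhds, h.fderiv_eq, hz]
      exact hψ.2.2 x (Or.inl (Or.inl hx))
    · have h : (ψ + mulSnd P.cutTop g) =ᶠ[𝓝 x] ψ := by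
        filter_upwards [hP.cut_near_Γ₂ hx] with y hy
        rw [hval, hy.1]; ring
      rw [h.eq_of_nhds, h.fderiv_eq, hz]
      exact hψ.2.2 x (Or.inr hx)
    · have h : (ψ + mulSnd P.cutTop g) =ᶠ[𝓝 x] fun y => ψ y + g y := by
        filter_upwards [hP.cut_near_Γ₁ hx] with y hy
        rw [hval, hy.1]; ring
      have hx' := hψ.2.2 x (Or.inl (Or.inr hx))
      rw [h.eq_of_nhds, h.fderiv_eq, fderiv_fun_add (hψ.1.differentiable (by simp) x)
        (hg.differentiable (by simp) x), hx'.1, hx'.2]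
      exact ⟨zero_add _, zero_add _⟩

/-- Limits of clamped quasi-periodic functions are twisted limits of clamped periodic ones. -/
theorem mem_closure_clamped_iff (α : ℝ) (U : Jet P.domain) :
    U ∈ closure (jet P.domain '' (P.clamped α : Set (ℝ × ℝ → ℂ)))
      ↔ ∃ w : P.V₀, U = twist P.domain α (w : Jet P.domain) := by
  have hD := isBounded_domain (P := P)
  have key : ∀ (β γ : ℝ) {U : Jet P.domain},
      U ∈ closure (jet P.domain '' (P.clamped γ : Set (ℝ × ℝ → ℂ))) →
      twist P.domain β U ∈ closure (jet P.domain '' (P.clamped (γ + β) : Set (ℝ × ℝ → ℂ))) := by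
    intro β γ U hU
    refine map_mem_closure (twist P.domain β).continuous hU ?_
    rintro _ ⟨ψ, hψ, rfl⟩
    exact ⟨_, mulExp_mem_clamped hψ β, (twist_jet hD hψ.1 β).symm⟩
  constructor
  · intro h
    have h1 := key (-α) α h
    rw [add_neg_cancel] at h1
    exact ⟨⟨_, h1⟩, (twist_twist hD α U).symm⟩
  · rintro ⟨w, rfl⟩
    have h1 := key α 0 w.2
    rwa [zero_add] at h1

end Setup

end BiharmonicPML
end



/-! ### Square integrability of the source term -/

noncomputable section

namespace BiharmonicPML

/-- The action of the stretched Laplacian with stretching `s` on the profile `v` of the function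
`exp(iαx₁) v(x₂)`. -/
def profileLaplacian (s : ℝ → ℂ) (α : ℝ) (v : ℝ → ℂ) (t : ℝ) : ℂ :=
  -(α : ℂ) ^ 2 * v t + (s t)⁻¹ * deriv (fun r => (s r)⁻¹ * deriv v r) t

theorem profileLaplacian_congr {s s' : ℝ → ℂ} {v v' : ℝ → ℂ} {t : ℝ} (α : ℝ)
    (hs : s =ᶠ[𝓝 t] s') (hv : v =ᶠ[𝓝 t] v') :
    profileLaplacian s α v =ᶠ[𝓝 t] profileLaplacian s' α v' := by
  have h : (fun r => (s r)⁻¹ * deriv v r) =ᶠ[𝓝 t] fun r => (s' r)⁻¹ * deriv v' r := by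
    filter_upwards [hs, hv.deriv] with r h1 h2
    rw [h1, h2]
  filter_upwards [hs, hv, h.deriv] with r h1 h2 h3
  simp only [profileLaplacian, h1, h2, h3]

theorem contDiffAt_deriv {n m : WithTop ℕ∞} {f : ℝ → ℂ} {t : ℝ} (hf : ContDiffAt ℝ n f t)
    (h : m + 1 ≤ n) : ContDiffAt ℝ m (deriv f) t :=
  (hf.fderiv_right h).clm_apply contDiffAt_const

/-- Each application costs two derivatives of the profile but only one of the stretching. The source
applies it twice, so three derivatives of the stretching suffice for continuity. -/
theorem contDiffAt_profileLaplacian {s v : ℝ → ℂ} {t : ℝ} (n : ℕ) (α : ℝ)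
    (hs : ContDiffAt ℝ (n + 1 : ℕ) s t) (h0 : s t ≠ 0) (hv : ContDiffAt ℝ (n + 2 : ℕ) v t) :
    ContDiffAt ℝ n (profileLaplacian s α v) t := by
  have hi : ContDiffAt ℝ (n + 1 : ℕ) (fun r => (s r)⁻¹) t := hs.inv h0
  have h1 : ContDiffAt ℝ (n + 1 : ℕ) (deriv v) t := contDiffAt_deriv hv (by norm_cast)
  have h2 : ContDiffAt ℝ n (deriv fun r => (s r)⁻¹ * deriv v r) t :=
    contDiffAt_deriv (hi.mul h1) (by norm_cast)
  have hle : ((n : ℕ) : WithTop ℕ∞) ≤ (n + 1 : ℕ) := by exact_mod_cast Nat.le_succ n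
  have hle' : ((n : ℕ) : WithTop ℕ∞) ≤ (n + 2 : ℕ) := by exact_mod_cast Nat.le_add_right n 2
  exact (contDiffAt_const.mul (hv.of_le hle')).add ((hi.of_le hle).mul h2)

namespace Setup

variable {P : Setup}

theorem stretchedLaplacian_mul (α : ℝ) (v : ℝ → ℂ) :
    P.stretchedLaplacian (fun x => expFst α x * v x.2)
      = fun x => expFst α x * profileLaplacian P.σ α v x.2 := by
  ext x
  have h0 : ∀ s : ℝ, HasDerivAt (fun s : ℝ => Complex.exp (Complex.I * α * s))
      (Complex.exp (Complex.I * α * s) * (Complex.I * α)) s := fun s => by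
    have h : HasDerivAt (fun s : ℝ => Complex.I * α * (s : ℂ)) (Complex.I * α) s := by
      simpa using (Complex.ofRealCLM.hasDerivAt (x := s)).const_mul (Complex.I * α)
    exact h.cexp
  have h1 : deriv (fun s => expFst α (s, x.2) * v x.2)
      = fun s : ℝ => Complex.exp (Complex.I * α * s) * (Complex.I * α * v x.2) := by
    ext s
    have := (h0 s).mul_const (v x.2)
    rw [show (fun s : ℝ => expFst α (s, x.2) * v x.2)
      = fun s : ℝ => Complex.exp (Complex.I * α * s) * v x.2 from rfl, this.deriv]
    ring
  have h2 : deriv (deriv fun s => expFst α (s, x.2) * v x.2) x.1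
      = expFst α x * (-(α : ℂ) ^ 2 * v x.2) := by
    rw [h1, ((h0 x.1).mul_const _).deriv, expFst]
    linear_combination Complex.exp (Complex.I * α * x.1) * α ^ 2 * v x.2 * Complex.I_sq
  have h3 : P.stretchedD2 (fun x => expFst α x * v x.2)
      = fun x => expFst α x * ((P.σ x.2)⁻¹ * deriv v x.2) := by
    ext y
    have : deriv (fun t => expFst α (y.1, t) * v t) y.2 = expFst α y * deriv v y.2 :=
      deriv_const_mul_field (u := expFst α y) (v := v)
    simp only [stretchedD2, this]
    ring
  have h4 : deriv (fun t => expFst α (x.1, t) * ((P.σ t)⁻¹ * deriv v t)) x.2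
      = expFst α x * deriv (fun t => (P.σ t)⁻¹ * deriv v t) x.2 :=
    deriv_const_mul_field (u := expFst α x) (v := fun t => (P.σ t)⁻¹ * deriv v t)
  simp only [stretchedLaplacian]
  rw [h2, h3]
  simp only [stretchedD2, h4, profileLaplacian]
  ring

/-- The vertical profile of the incident wave. -/
def winc (P : Setup) (κ : ℝ) (t : ℝ) : ℂ := Complex.exp (-Complex.I * P.β κ * t)

theorem uinc_eq (κ : ℝ) : P.uinc κ = fun x => expFst (P.α κ) x * P.winc κ x.2 := by
  ext x
  simp only [uinc, expFst, winc, ← Complex.exp_add]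
  congr 1
  push_cast
  ring

theorem contDiff_winc (κ : ℝ) : ContDiff ℝ ∞ (P.winc κ) :=
  (contDiff_const.mul Complex.ofRealCLM.contDiff).cexp

theorem contDiff_uinc (κ : ℝ) : ContDiff ℝ ∞ (P.uinc κ) := by
  rw [uinc_eq]
  exact (contDiff_expFst _).mul ((contDiff_winc κ).comp contDiff_snd)

theorem quasiPeriodic_uinc (κ : ℝ) : QuasiPeriodic P.Λ (P.α κ) (P.uinc κ) := by
  intro x
  simp only [uinc, ← Complex.exp_add]
  congr 1
  push_cast
  ring

/-- The stretching of the upper layer. -/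
def σUp (P : Setup) (t : ℝ) : ℂ :=
  1 + P.σ₁ * (((t - P.h₁) / P.Δh₁) ^ P.m : ℝ) + Complex.I * P.σ₂ * (((t - P.h₁) / P.Δh₁) ^ P.m : ℝ)

theorem σ_eventuallyEq_σUp {t : ℝ} (ht : P.h₁ < t) : P.σ =ᶠ[𝓝 t] P.σUp := by
  filter_upwards [lt_mem_nhds ht] with r hr
  simp only [σ, σUp, if_pos hr]

/-- This is where m > 3 enters: the power of order m is C³ across the interface. -/
theorem Admissible.contDiff_σUp (hP : P.Admissible) : ContDiff ℝ (3 : ℕ) P.σUp := by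
  have h1 : ContDiff ℝ (3 : ℕ) fun t : ℝ => ((t - P.h₁) / P.Δh₁) ^ P.m :=
    (Real.contDiff_rpow_const_of_le (by exact_mod_cast hP.hm.le)).comp
      ((contDiff_id.sub contDiff_const).div_const _)
  have h2 : ContDiff ℝ (3 : ℕ) fun t : ℝ => ((((t - P.h₁) / P.Δh₁) ^ P.m : ℝ) : ℂ) :=
    Complex.ofRealCLM.contDiff.comp h1
  exact (contDiff_const.add (contDiff_const.mul h2)).add (contDiff_const.mul h2)

theorem Admissible.σUp_ne_zero (hP : P.Admissible) {t : ℝ} (ht : P.h₁ ≤ t) : P.σUp t ≠ 0 := by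
  intro h
  have hτ : 0 ≤ ((t - P.h₁) / P.Δh₁) ^ P.m :=
    Real.rpow_nonneg (div_nonneg (sub_nonneg.mpr ht) hP.hΔ₁.le) _
  have hre := congrArg Complex.re h
  simp [σUp] at hre
  nlinarith [mul_nonneg hP.hσ₁.le hτ]

/-- In the upper layer σ may be replaced by `σUp`, which is regular up to and across h₁. The
resulting profile is continuous on [h₁, ∞); evaluated at max(h₁, x₂) it is continuous on the plane,
and the source is its restriction to x₂ > h₁ after the incident term is subtracted. -/
theorem Admissible.memLp_source (hP : P.Admissible) (κ : ℝ) :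
    MemLp (fun x => P.σ x.2 * P.source κ x) 2 (volume.restrict P.domain) := by
  set H : ℝ → ℂ := profileLaplacian P.σUp (P.α κ) (profileLaplacian P.σUp (P.α κ) (P.winc κ))
  have hH : ∀ t, P.h₁ ≤ t → ContinuousAt H t := by
    intro t ht
    have hs := (hP.contDiff_σUp).contDiffAt (x := t)
    have h1 : ContDiffAt ℝ (2 : ℕ) (profileLaplacian P.σUp (P.α κ) (P.winc κ)) t :=
      contDiffAt_profileLaplacian 2 _ hs (hP.σUp_ne_zero ht)
        (contDiff_infty.mp (contDiff_winc κ) 4).contDiffAt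
    exact (contDiffAt_profileLaplacian 0 _ (hs.of_le (by norm_cast)) (hP.σUp_ne_zero ht)
      h1).continuousAt
  have hHc : Continuous fun x : ℝ × ℝ => H (max P.h₁ x.2) :=
    continuous_iff_continuousAt.mpr fun x =>
      ContinuousAt.comp (f := fun x : ℝ × ℝ => max P.h₁ x.2) (hH _ (le_max_left _ _))
        (by fun_prop)
  have hFc : Continuous fun x : ℝ × ℝ => P.σ x.2 * (expFst (P.α κ) x * H (max P.h₁ x.2)
      - κ ^ 4 * P.uinc κ x) :=
    (hP.continuous_σ.comp continuous_snd).mul (((contDiff_expFst _).continuous.mul hHc).sub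
      (continuous_const.mul (contDiff_uinc κ).continuous))
  have heq : (fun x => P.σ x.2 * P.source κ x) = {x : ℝ × ℝ | P.h₁ < x.2}.indicator
      fun x => P.σ x.2 * (expFst (P.α κ) x * H (max P.h₁ x.2) - κ ^ 4 * P.uinc κ x) := by
    ext x
    by_cases hx : P.h₁ < x.2
    · have hloc := σ_eventuallyEq_σUp hx
      have := (profileLaplacian_congr (P.α κ) hloc (profileLaplacian_congr (P.α κ) hloc
        (EventuallyEq.refl _ (P.winc κ)))).eq_of_nhds
      rw [Set.indicator_of_mem (by exact hx), source, if_pos hx, max_eq_right hx.le,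
        show P.stretchedLaplacian (P.stretchedLaplacian (P.uinc κ)) x = expFst (P.α κ) x * H x.2 by
          rw [uinc_eq, stretchedLaplacian_mul, stretchedLaplacian_mul]; exact congrArg _ this]
    · rw [Set.indicator_of_notMem (by exact hx), source, if_neg hx, mul_zero]
  rw [heq]
  exact (memLp_of_continuous isBounded_domain hFc 2).indicator
    (measurableSet_lt measurable_const measurable_snd)

end Setup

end BiharmonicPML
end



/-! ### Reduction of the weak problem to an operator equation -/

noncomputable section

namespace BiharmonicPML

namespace Setup

variable {P : Setup}

/-- The density is linear in the jet of u and antilinear in that of v, so multiplying both by the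
same function of modulus one leaves it unchanged at each point. -/
theorem Admissible.inner_opT_mulJet (hP : P.Admissible) (β : ℝ) (u v : Jet P.domain) :
    inner ℂ (mulJet P.domain β v) (P.opT (mulJet P.domain β u)) = inner ℂ v (P.opT u) := by
  rw [(hP.inner_opT _ _).2, (hP.inner_opT _ _).2]
  refine integral_congr_ae ?_
  filter_upwards [coeFn_mulJet isBounded_domain β u, coeFn_mulJet isBounded_domain β v]
    with x hu hv
  have h := expFst_mul_conj β x
  simp only [density, D2InvSigma, hu, hv, map_mul]
  set e := expFst β x
  set d := deriv (fun s => (P.σ s)⁻¹) x.2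
  set r := (P.σ x.2)⁻¹
  linear_combination (P.σ x.2 * u 3 x * conj (v 3 x)
    + P.μ * (r * u 5 x + d * u 2 x) * conj (v 3 x)
    + (2 - 2 * P.μ) / P.σ x.2 * conj (v 4 x) * u 4 x
    + 1 / P.σ x.2 * (r * u 5 x + d * u 2 x) * (r * conj (v 5 x) + d * conj (v 2 x))
    + P.μ * u 3 x * (r * conj (v 5 x) + d * conj (v 2 x))) * h

theorem Admissible.inner_opS_mulJet (hP : P.Admissible) (β : ℝ) (u v : Jet P.domain) :
    inner ℂ (mulJet P.domain β v) (P.opS (mulJet P.domain β u)) = inner ℂ v (P.opS u) := by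
  rw [(hP.inner_opS _ _).2, (hP.inner_opS _ _).2]
  refine integral_congr_ae ?_
  filter_upwards [coeFn_mulJet isBounded_domain β u, coeFn_mulJet isBounded_domain β v]
    with x hu hv
  simp only [hu, hv, map_mul]
  linear_combination P.σ x.2 * u 0 x * conj (v 0 x) * expFst_mul_conj β x

/-- The operator of the form on jets. -/
def opA (P : Setup) (κ : ℝ) : Jet P.domain →L[ℂ] Jet P.domain := P.opT - (κ : ℂ) ^ 4 • P.opS

theorem inner_opA (κ : ℝ) (u v : Jet P.domain) :
    inner ℂ v (P.opA κ u) = inner ℂ v (P.opT u) - (κ : ℂ) ^ 4 * inner ℂ v (P.opS u) := by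
  simp only [opA, sub_apply, smul_apply, inner_sub_right, inner_smul_right]

theorem Admissible.form_eq (hP : P.Admissible) (κ : ℝ) (u v : H2 P.domain) :
    P.form κ u v = inner ℂ v.toJet (P.opA κ u.toJet) := by
  obtain ⟨iT, eT⟩ := hP.inner_opT u.toJet v.toJet
  obtain ⟨iS, eS⟩ := hP.inner_opS u.toJet v.toJet
  rw [inner_opA, eT, eS, ← integral_const_mul, ← integral_sub iT (iS.const_mul _)]
  refine integral_congr_ae (Eventually.of_forall fun x => ?_)
  change _ = P.σ x.2 * u.d11 x * conj (v.d11 x)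
      + P.μ * P.D2InvSigma x.2 (u.d2 x) (u.d22 x) * conj (v.d11 x)
      + (2 - 2 * P.μ) / P.σ x.2 * conj (v.d12 x) * u.d12 x
      + 1 / P.σ x.2 * P.D2InvSigma x.2 (u.d2 x) (u.d22 x)
          * P.D2InvSigma x.2 (conj (v.d2 x)) (conj (v.d22 x))
      + P.μ * u.d11 x * P.D2InvSigma x.2 (conj (v.d2 x)) (conj (v.d22 x))
      - κ ^ 4 * (P.σ x.2 * u.val x * conj (v.val x))
  ring

/-- Twisting is the shift `N` followed by a unimodular factor, which drops out. The term of order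
zero sees only the component that `N` leaves alone. -/
theorem Admissible.inner_twist_opA (hP : P.Admissible) (κ : ℝ) (u v : P.V₀) :
    inner ℂ (twist P.domain (P.α κ) (v : Jet P.domain))
        (P.opA κ (twist P.domain (P.α κ) (u : Jet P.domain)))
      = inner ℂ v (P.opB κ u) := by
  have hα : ((κ : ℂ) * (Real.sin P.θ : ℂ)) = ((P.α κ : ℝ) : ℂ) := by simp [α]
  rw [inner_opB, inner_opA, hα, Complex.conj_ofReal]
  simp only [twist, ContinuousLinearMap.comp_apply]
  rw [hP.inner_opT_mulJet, hP.inner_opS_mulJet]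
  congr 2
  rw [(hP.inner_opS _ _).2, (hP.inner_opS _ _).2]
  simp only [N_apply_zero]

/-- The jet of the lifting of the incident wave into the upper layer. -/
def jetLift (P : Setup) (κ : ℝ) : Jet P.domain := jet P.domain (mulSnd P.cutTop (P.uinc κ))

theorem Admissible.mem_H2qp00_iff (hP : P.Admissible) (κ : ℝ) (v : H2 P.domain) :
    v ∈ P.H2qp00 κ ↔ ∃ w : P.V₀, v.toJet = twist P.domain (P.α κ) (w : Jet P.domain) := by
  have hq : QuasiPeriodic P.Λ (P.α κ) 0 := fun x => by simp
  have h0 : ContDiff ℝ ∞ (0 : ℝ × ℝ → ℂ) := contDiff_zero_fun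
  have h := hP.cauchyData_iff h0 hq v
  rw [mem_closure_clamped_iff, show mulSnd P.cutTop 0 = (0 : ℝ × ℝ → ℂ) from ?_,
    show jet P.domain 0 = 0 from ?_, sub_zero] at h
  · rw [← h]
    exact ⟨fun hv => ⟨hv.1.2, hv.2.1, hv.2.2⟩,
      fun hv => ⟨⟨HasCauchyData.mem_H2qp hv.1, hv.1⟩, hv.2.1, hv.2.2⟩⟩
  · simpa using jet_sub (D := P.domain) isBounded_domain h0 h0
  · ext x
    simp [mulSnd]

theorem Admissible.mem_H2qp0_iff (hP : P.Admissible) (κ : ℝ) (u : H2 P.domain) :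
    (u ∈ P.H2qp0 κ ∧ HasCauchyData P.Λ (P.α κ) u P.Γ₁ (P.uinc κ))
      ↔ ∃ w : P.V₀, u.toJet = P.jetLift κ + twist P.domain (P.α κ) (w : Jet P.domain) := by
  have h := hP.cauchyData_iff (contDiff_uinc κ) (quasiPeriodic_uinc κ) u
  rw [mem_closure_clamped_iff] at h
  simp only [sub_eq_iff_eq_add'] at h
  rw [jetLift, ← h]
  exact ⟨fun hv => ⟨hv.1.1.2, hv.1.2, hv.2⟩,
    fun hv => ⟨⟨⟨HasCauchyData.mem_H2qp hv.1, hv.1⟩, hv.2.1⟩, hv.2.2⟩⟩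

theorem exists_toJet_eq_twist (α : ℝ) (w : P.V₀) :
    ∃ u : H2 P.domain, u.toJet = twist P.domain α (w : Jet P.domain) := by
  refine exists_toJet_eq isBounded_domain ?_
  refine closure_mono (Set.image_mono ?_) ((mem_closure_clamped_iff α _).mpr ⟨w, rfl⟩)
  exact fun ψ hψ => hψ.1

theorem exists_toJet_eq_add_twist (κ α : ℝ) (w : P.V₀) :
    ∃ u : H2 P.domain, u.toJet = P.jetLift κ + twist P.domain α (w : Jet P.domain) := by
  refine exists_toJet_eq isBounded_domain ?_
  have hL : ContDiff ℝ ∞ (mulSnd P.cutTop (P.uinc κ)) :=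
    contDiff_mulSnd P.contDiff_cutTop (contDiff_uinc κ)
  refine map_mem_closure (f := fun U => P.jetLift κ + U) (by fun_prop)
    ((mem_closure_clamped_iff α _).mpr ⟨w, rfl⟩) ?_
  rintro _ ⟨ψ, hψ, rfl⟩
  exact ⟨mulSnd P.cutTop (P.uinc κ) + ψ, hL.add hψ.1, jet_add isBounded_domain hL hψ.1⟩

/-- The right-hand side of the truncated problem, as an element of the space of clamped periodic
functions. -/
def rhs (P : Setup) (κ : ℝ) : P.V₀ :=
  ContinuousLinearMap.adjoint (twist P.domain (P.α κ) ∘L P.incl)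
    (inj P.domain 0 (toL2 P.domain fun x => P.σ x.2 * P.source κ x) - P.opA κ (P.jetLift κ))

theorem Admissible.integral_source (hP : P.Admissible) (κ : ℝ) (v : H2 P.domain) :
    ∫ x in P.domain, P.σ x.2 * P.source κ x * conj (v.val x)
      = inner ℂ v.toJet (inj P.domain 0 (toL2 P.domain fun x => P.σ x.2 * P.source κ x)) := by
  rw [inner_inj, inner_L2]
  refine integral_congr_ae ?_
  filter_upwards [coeFn_toL2 (hP.memLp_source κ)] with x hx
  rw [hx]
  rfl

/-- Admissible u are the lifting plus a twisted element of `V₀`, and the test functions are all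
twisted elements. Moving the lifting to the right and taking the adjoint of the twist gives an
equation tested against every element of `V₀`. -/
theorem Admissible.isWeakSolution_iff (hP : P.Admissible) (κ : ℝ) (u : H2 P.domain) :
    P.IsWeakSolution κ u ↔ ∃ w : P.V₀,
      u.toJet = P.jetLift κ + twist P.domain (P.α κ) (w : Jet P.domain)
        ∧ P.opB κ w = P.rhs κ := by
  have key : ∀ w v' : P.V₀, ∀ v : H2 P.domain,
      u.toJet = P.jetLift κ + twist P.domain (P.α κ) (w : Jet P.domain) →
      v.toJet = twist P.domain (P.α κ) (v' : Jet P.domain) →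
      (P.form κ u v = ∫ x in P.domain, P.σ x.2 * P.source κ x * conj (v.val x)
        ↔ inner ℂ v' (P.opB κ w) = inner ℂ v' (P.rhs κ)) := by
    intro w v' v hu hv
    rw [hP.form_eq, hP.integral_source, hu, hv, map_add, inner_add_right, hP.inner_twist_opA, rhs,
      ContinuousLinearMap.adjoint_inner_right, inner_sub_right, ContinuousLinearMap.comp_apply,
      incl_apply, eq_sub_iff_add_eq']
  rw [IsWeakSolution, ← and_assoc, hP.mem_H2qp0_iff]
  constructor
  · rintro ⟨⟨w, hw⟩, h⟩
    refine ⟨w, hw, ext_inner_left ℂ fun v' => ?_⟩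
    obtain ⟨v, hv⟩ := exists_toJet_eq_twist (P.α κ) v'
    exact (key w v' v hw hv).mp (h v ((hP.mem_H2qp00_iff κ v).mpr ⟨v', hv⟩))
  · rintro ⟨w, hw, h⟩
    refine ⟨⟨w, hw⟩, fun v hv => ?_⟩
    obtain ⟨v', hv'⟩ := (hP.mem_H2qp00_iff κ v).mp hv
    exact (key w v' v hw hv').mpr (by rw [h])

theorem Admissible.existsUnique_isWeakSolution (hP : P.Admissible) {κ : ℝ}
    (hκ : ∀ u, P.opB κ u = 0 → u = 0) : ∃! u : H2 P.domain, P.IsWeakSolution κ u := by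
  obtain ⟨w, hw⟩ := (ContinuousLinearMap.isUnit_iff_bijective.mp (hP.isUnit_opB hκ)).2 (P.rhs κ)
  obtain ⟨u, hu⟩ := exists_toJet_eq_add_twist κ (P.α κ) w
  refine ⟨u, (hP.isWeakSolution_iff κ u).mpr ⟨w, hu, hw⟩, fun u' hu' => ?_⟩
  obtain ⟨w', hw', hB⟩ := (hP.isWeakSolution_iff κ u').mp hu'
  have : w' = w := sub_eq_zero.mp (hκ _ (by rw [map_sub, hB, hw, sub_self]))
  exact H2.toJet_injective (by rw [hw', hu, this])

/-- The positive wavenumbers for which the truncated problem with zero data has a nonzero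
solution. -/
def exceptional (P : Setup) : Set ℝ := {κ | 0 < κ ∧ ∃ u, u ≠ 0 ∧ P.opB κ u = 0}

theorem Admissible.finite_exceptional_inter (hP : P.Admissible) (R : ℝ) :
    (P.exceptional ∩ Metric.closedBall 0 R).Finite := by
  refine ((hP.finite_singular R).preimage Complex.ofReal_injective.injOn).subset ?_
  rintro κ ⟨⟨_, hκ⟩, hR⟩
  refine ⟨?_, hκ⟩
  rw [mem_closedBall_zero_iff] at hR
  rwa [Complex.norm_real]

end Setup

/-- A set that meets every ball in a finite set is closed. -/
theorem isClosed_of_finite_inter_closedBall {E : Set ℝ}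
    (hE : ∀ R : ℝ, (E ∩ Metric.closedBall 0 R).Finite) : IsClosed E := by
  refine isClosed_of_closure_subset fun x hx => ?_
  have h : x ∈ closure (E ∩ Metric.ball 0 (‖x‖ + 1)) :=
    mem_closure_iff_nhds.mpr fun t ht => by
      obtain ⟨y, hy, hyE⟩ := mem_closure_iff_nhds.mp hx (t ∩ Metric.ball 0 (‖x‖ + 1))
        (inter_mem ht (Metric.isOpen_ball.mem_nhds (by simp)))
      exact ⟨y, hy.1, hyE, hy.2⟩
  have h' := closure_mono (Set.inter_subset_inter_right E Metric.ball_subset_closedBall) h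
  rw [(hE _).isClosed.closure_eq] at h'
  exact h'.1

/-- A set that meets every ball in a finite set is discrete. -/
theorem isDiscrete_of_finite_inter_closedBall {E : Set ℝ}
    (hE : ∀ R : ℝ, (E ∩ Metric.closedBall 0 R).Finite) : IsDiscrete E := by
  refine isDiscrete_iff_forall_mem_exists_isOpen.mpr fun y hy => ?_
  refine ⟨Metric.ball 0 (‖y‖ + 1) ∩ ((E ∩ Metric.closedBall 0 (‖y‖ + 1)) \ {y})ᶜ,
    Metric.isOpen_ball.inter ((hE _).subset Set.sdiff_subset).isClosed.isOpen_compl, ?_⟩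
  ext z
  constructor
  · rintro ⟨⟨hz, hz'⟩, hzE⟩
    by_contra hne
    exact hz' ⟨⟨hzE, Metric.ball_subset_closedBall hz⟩, hne⟩
  · rintro rfl
    exact ⟨⟨by simp, fun h => h.2 rfl⟩, hy⟩

end BiharmonicPML
end

theorem theorem4p1 (P : BiharmonicPML.Setup)
    (hΛ : 0 < P.Λ) (hh : P.h₂ < P.h₁) (hΔ₁ : 0 < P.Δh₁) (hΔ₂ : 0 < P.Δh₂)
    (hcavity : IsOpen P.cavity) (hLip : BiharmonicPML.HasLipschitzBoundary P.cavity)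
    (hencl : closure P.cavity ⊆ P.rect)
    (hθ : P.θ ∈ Set.Ioo (-(Real.pi / 2)) (Real.pi / 2))
    (hμ : P.μ ∈ Set.Ioo (0 : ℝ) 1)
    (hm : 3 < P.m) (hσ₁ : 0 < P.σ₁) (hσ₂ : 0 < P.σ₂)
    (hσ : Real.sqrt ((3 + P.μ) / (1 - P.μ)) * P.σ₂ < 1 + P.σ₁) :
    ∃ E : Set ℝ, E ⊆ Set.Ioi 0 ∧ IsClosed E ∧ IsDiscrete E ∧
      ∀ κ : ℝ, 0 < κ → κ ∉ E → ∃! u : BiharmonicPML.H2 P.domain, P.IsWeakSolution κ u := by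
  have hP : P.Admissible := ⟨hΛ, hh, hΔ₁, hΔ₂, hcavity, hencl, hθ, hμ, hm, hσ₁, hσ₂, hσ⟩
  refine ⟨P.exceptional, fun κ hκ => hκ.1,
    BiharmonicPML.isClosed_of_finite_inter_closedBall hP.finite_exceptional_inter,
    BiharmonicPML.isDiscrete_of_finite_inter_closedBall hP.finite_exceptional_inter,
    fun κ hκ hE => hP.existsUnique_isWeakSolution fun u hu => ?_⟩
  by_contra hne
  exact hE ⟨hκ, u, hne, hu⟩
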